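/- **Setting.** Let $\Gamma$ be a group, $A$ an abelian group, and $\alpha:\Gamma^3\to A$ a 3-cocycle, i.e. $\alpha(x,y,z)-\alpha(xy,z,w)+\alpha(x,yz,w)-\alpha(x,y,zw)+\alpha(y,z,w)=0$, that is strongly normalized: $\alpha(x,y,z)=0$ whenever $1\in\{x,y,z,xy,yz\}$. For a space $X$, a representation is a functor $\rho:\Pi_1(X)\to\Gamma$ from the fundamental groupoid, a concatenation of paths going to the product of the values in the same order. For a singular chain $\zeta=\sum_j n_j\sigma^j\in C_3(X)$ put $\alpha(\zeta\langle\rho\rangle)=\sum_j n_j\,\alpha\big(\rho(\sigma^j_{01}),\rho(\sigma^j_{12}),\rho(\sigma^j_{23})\big)$, where $\sigma_{ij}$ is the restriction of $\sigma$ to the edge $[v_i,v_j]$. For a compact oriented 3-manifold $X$ let $[X]\subset C_3(X)$ be the set of singular chains that represent the fundamental class $[X,\partial X]$. For $\xi\in C_2(\partial X)$ representing the fundamental class of $\partial X$ (with $\xi=0$ if $X$ is closed), $F(X,\rho)(\xi)\in A$ denotes the value $\alpha(\zeta\langle\rho\rangle)$ for any $\zeta\in[X]$ with $\partial\zeta=\xi$;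 for closed $X$ write $F(X,\rho)=F(X,\rho)(0)$. Let $\mathbb T^2=S^1\times S^1=\mathbb R^2/\mathbb Z^2$, and $\xi^{\rm st}_{\mathbb T^2}=[OW_1W_3]-[OW_2W_3]$ with $O=(0,0)$, $W_1=(1,0)$, $W_2=(0,1)$, $W_3=(1,1)$, where $[A_0A_1A_2]$ is the image in $\mathbb T^2$ of the affine simplex of $\mathbb R^2$ with these vertices. Let $L\subset S^3$ be a link with $n\ge 0$ components, whose components have disjoint tubular neighborhoods $\mathcal N(L_i)$ parametrized by orientation-preserving embeddings of $D^2\times S^1$ that extend to embeddings, still disjoint, of solid tori with a larger disk factor. Let $\mathbb T^2_i=\partial\mathcal N(L_i)$, identified with $\mathbb T^2$ by the parametrization, with meridian $\mathfrak m_i=S^1\times 1$ and longitude $\mathfrak l_i=1\times S^1$ based at $(1,1)$ (any framing is allowed; the preferred longitude gives the usual surgery coefficients). Let $E_L=S^3\setminus\bigsqcup_i{\rm int}\,\mathcal N(L_i)$, so that $\partial E_L=\bigsqcup_i-\mathbb T^2_i$. Let $\mathbf a_i=\begin{pmatrix}p_i&p_i'\\q_i&q_i'\end{pmatrix}\in{\rm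 SL}(2,\mathbb Z)$, let $[p_i/q_i]:\mathbb T^2\to\mathbb T^2$ be the homeomorphism induced by left multiplication by $\mathbf a_i$, and let $$M=M(L;p_1/q_1,\ldots,p_n/q_n)=E_L\cup_{\sqcup_i[p_i/q_i]}\bigsqcup_{i=1}^n D^2\times S^1$$ be the closed oriented 3-manifold in which $x\in\partial(D^2\times S^1)=\mathbb T^2$ in the $i$-th solid torus is identified with $[p_i/q_i](x)\in\mathbb T^2_i$ (so that $S^1\times1$ is glued to $p_i\mathfrak m_i+q_i\mathfrak l_i$). **Statement.** Let $\rho:\Pi_1(M)\to\Gamma$ be a functor and $\rho_L$ its restriction to $E_L$. Then $F(M,\rho)$ and $F(E_L,\rho_L)\big(\bigsqcup_i-\xi^{\rm st}_{\mathbb T^2_i}\big)$ are well defined (a chain $\zeta$ as above exists, and the value does not depend on it). For each $i$ there is a unique $z_i\in\Gamma$ with $z_i^{p_i}=\rho(\mathfrak l_i)$ and $z_i^{-q_i}=\rho(\mathfrak m_i)$. For each $z\in\Gamma$ there is $f_z:\mathbb Z^2\to A$ with $$\alpha(z^a,z^b,z^c)=f_z(b,c)-f_z(a+b,c)+f_z(a,b+c)-f_z(a,b)\qquad(a,b,c\in\mathbb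 Z).$$ For every choice of such functions $f_{z_i}$, with $\epsilon(z_i;a,b)=f_{z_i}(a,b)-f_{z_i}(b,a)$, $$F(M,\rho)=F(E_L,\rho_L)\Big(\bigsqcup_{i=1}^n-\xi^{\rm st}_{\mathbb T^2_i}\Big)+\sum_{i=1}^n\epsilon(z_i;-q_i,p_i).$$ -/

import Mathlib

open CategoryTheory

noncomputable section

namespace SurgeryFormula

/-! ### Singular chains -/

/-- The standard simplex `[v₀, …, v_k]`. -/
abbrev Simplex (k : ℕ) : Type := stdSimplex ℝ (Fin (k + 1))

/-- Singular `k`-simplices of `X`. -/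
abbrev SingularSimplex (k : ℕ) (X : Type*) [TopologicalSpace X] := C(Simplex k, X)

/-- Singular `k`-chains of `X` with integer coefficients. -/
abbrev Chain (k : ℕ) (X : Type*) [TopologicalSpace X] := SingularSimplex k X →₀ ℤ

section Chains

variable {X Y : Type*} [TopologicalSpace X] [TopologicalSpace Y] {k : ℕ}

/-- The `i`-th face (opposite to `v_i`) of a singular simplex. -/
def face (i : Fin (k + 2)) (σ : SingularSimplex (k + 1) X) : SingularSimplex k X :=
  σ.comp ⟨stdSimplex.map i.succAbove, stdSimplex.continuous_map _⟩

/-- The singular boundary operator. -/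
def boundary : Chain (k + 1) X →+ Chain k X :=
  Finsupp.liftAddHom fun σ =>
    zmultiplesHom (Chain k X)
      (∑ i : Fin (k + 2), Finsupp.single (face i σ) ((-1 : ℤ) ^ (i : ℕ)))

/-- The map `f_#` induced by a continuous map on singular chains. -/
def push (f : C(X, Y)) : Chain k X →+ Chain k Y :=
  Finsupp.mapDomain.addMonoidHom fun σ => f.comp σ

/-- A chain all of whose simplices lie in `S`, that is, an element of `C_k(S) ⊆ C_k(X)`. -/
def SupportedIn (S : Set X) (c : Chain k X) : Prop :=
  ∀ σ ∈ c.support, Set.range σ ⊆ S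

/-- `c` and `c'` agree in the local homology `H_k(X, X ∖ {x})`: they differ by a boundary and a
chain in `X ∖ {x}`. -/
def LocallyHomologous (x : X) (c c' : Chain k X) : Prop :=
  ∃ e : Chain (k + 1) X, SupportedIn {x}ᶜ (c - c' - boundary e)

end Chains

/-! ### Orientations and s-triangulations

An orientation of a 3-manifold is given through a set `P` of positively oriented embedded singular
3-simplices whose interiors cover the interior of the manifold: the preferred generator of
`H_3(X, X ∖ {x})` is the class of any `σ ∈ P` whose interior contains `x`. -/

/-- The interior of the standard simplex. -/
def simplexInterior (k : ℕ) : Set (Simplex k) := {t | ∀ i, 0 < t i}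

section Orientations

variable {X Y : Type*} [TopologicalSpace X] [TopologicalSpace Y]

/-- `f` carries the orientation given by `P` to the one given by `Q`, where defined. -/
def OrientationPreserving (P : Set (SingularSimplex 3 X)) (Q : Set (SingularSimplex 3 Y))
    (f : C(X, Y)) : Prop :=
  ∀ σ ∈ P, ∀ τ ∈ Q, ∀ s ∈ simplexInterior 3, ∀ t ∈ simplexInterior 3, f (σ s) = τ t →
    LocallyHomologous (τ t) (push f (Finsupp.single σ 1)) (Finsupp.single τ 1)

/-- The orientation of `X` that extends an orientation `P` given on a dense open subset:
it consists of all embedded 3-simplices that are positive wherever they meet that subset. -/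
def extendOrientation (P : Set (SingularSimplex 3 X)) : Set (SingularSimplex 3 X) :=
  {σ | Topology.IsEmbedding σ ∧ IsOpen (σ '' simplexInterior 3) ∧
    ∀ τ ∈ P, ∀ s ∈ simplexInterior 3, ∀ t ∈ simplexInterior 3, σ s = τ t →
      LocallyHomologous (τ t) (Finsupp.single σ 1) (Finsupp.single τ 1)}

/-- `[X]`: the s-triangulations of a compact 3-manifold `X` with orientation `P` and boundary `B`,
that is, the singular 3-chains that represent the fundamental class `[X, ∂X]`: relative cycles
that restrict to the preferred generator of `H_3(X, X ∖ {x})` for each interior point `x`. -/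
def sTriangulations (P : Set (SingularSimplex 3 X)) (B : Set X) : Set (Chain 3 X) :=
  {ζ | SupportedIn B (boundary ζ) ∧
    ∀ σ ∈ P, ∀ t ∈ simplexInterior 3, LocallyHomologous (σ t) ζ (Finsupp.single σ 1)}

end Orientations

/-! ### Cocycles and the invariant `F` -/

section Invariant

variable {X Y : Type*} [TopologicalSpace X] [TopologicalSpace Y]
variable {Γ : Type*} [Group Γ] {A : Type*} [AddCommGroup A]

/-- The cocycle identity for `α ∈ Z³(Γ; A)`. -/
def IsThreeCocycle (α : Γ → Γ → Γ → A) : Prop :=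
  ∀ x y z w, α x y z - α (x * y) z w + α x (y * z) w - α x y (z * w) + α y z w = 0

/-- `α(x, y, z) = 0` whenever `1 ∈ {x, y, z, xy, yz}`. -/
def IsStronglyNormalized (α : Γ → Γ → Γ → A) : Prop :=
  ∀ x y z, (x = 1 ∨ y = 1 ∨ z = 1 ∨ x * y = 1 ∨ y * z = 1) → α x y z = 0

/-- Functors `Π₁(X) → Γ`. The opposite group appears because Mathlib composes morphisms of
`SingleObj G` by `f ≫ g = g * f`: here a concatenation `p · q` is sent to `ρ(p) ρ(q)`. -/
abbrev GroupoidRep (X : Type*) [TopologicalSpace X] (Γ : Type*) [Group Γ] :=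
  FundamentalGroupoid X ⥤ SingleObj Γᵐᵒᵖ

/-- The value of `ρ` on (the homotopy class of) a path. -/
def GroupoidRep.val (ρ : GroupoidRep X Γ) {x y : X} (p : Path x y) : Γ :=
  MulOpposite.unop
    (show Γᵐᵒᵖ from ρ.map (FundamentalGroupoid.fromPath (Path.Homotopic.Quotient.mk p)))

/-- The pull-back of `ρ` along a continuous map; the restriction when `f` is an inclusion. -/
def GroupoidRep.pull (ρ : GroupoidRep Y Γ) (f : C(X, Y)) : GroupoidRep X Γ := FundamentalGroupoid.map f ⋙ ρ

/-- The edge `[v_i, v_j]` of the standard simplex as a path. -/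
def stdEdge {k : ℕ} (i j : Fin (k + 1)) :
    Path (stdSimplex.vertex i : Simplex k) (stdSimplex.vertex j) where
  toFun s := stdSimplex.map ![i, j] (stdSimplexHomeomorphUnitInterval.symm s)
  continuous_toFun :=
    (stdSimplex.continuous_map _).comp stdSimplexHomeomorphUnitInterval.symm.continuous
  source' := by
    rw [← stdSimplexHomeomorphUnitInterval_zero, Homeomorph.symm_apply_apply]
    exact stdSimplex.map_vertex ![i, j] 0
  target' := by
    rw [← stdSimplexHomeomorphUnitInterval_one, Homeomorph.symm_apply_apply]
    exact stdSimplex.map_vertex ![i, j] 1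

/-- The path `σ_{ij} = σ|_{[v_i, v_j]}`. -/
def edge {k : ℕ} (σ : SingularSimplex k X) (i j : Fin (k + 1)) :
    Path (σ (stdSimplex.vertex i)) (σ (stdSimplex.vertex j)) :=
  (stdEdge i j).map σ.continuous

/-- `α(ζ⟨ρ⟩)`, where `σ⟨ρ⟩ = [ρ(σ₀₁) | ρ(σ₁₂) | ρ(σ₂₃)]`. -/
def evalChain (α : Γ → Γ → Γ → A) (ρ : GroupoidRep X Γ) (ζ : Chain 3 X) : A :=
  ζ.sum fun σ m => m • α (ρ.val (edge σ 0 1)) (ρ.val (edge σ 1 2)) (ρ.val (edge σ 2 3))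

open Classical in
/-- `F(X, ρ)(ξ) = α(ζ⟨ρ⟩)` for any s-triangulation `ζ ∈ T = [X]` with `∂ζ = ξ`. It is meaningful
when `FWellDefined` holds. For closed `X` one takes `ξ = 0`. -/
def F (α : Γ → Γ → Γ → A) (T : Set (Chain 3 X)) (ρ : GroupoidRep X Γ) (ξ : Chain 2 X) : A :=
  if h : ∃ ζ ∈ T, boundary ζ = ξ then evalChain α ρ h.choose else 0

/-- There is an s-triangulation bounded by `ξ`, and all of them give the same value. -/
def FWellDefined (α : Γ → Γ → Γ → A) (T : Set (Chain 3 X)) (ρ : GroupoidRep X Γ) (ξ : Chain 2 X) : Prop :=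
  (∃ ζ ∈ T, boundary ζ = ξ) ∧ ∀ ζ ∈ T, boundary ζ = ξ → evalChain α ρ ζ = F α T ρ ξ

/-- `f = f_z` is a 2-cochain on `ℤ` whose coboundary is `(a, b, c) ↦ α(z^a, z^b, z^c)`. -/
def Trivializes (α : Γ → Γ → Γ → A) (z : Γ) (f : ℤ → ℤ → A) : Prop :=
  ∀ a b c : ℤ, α (z ^ a) (z ^ b) (z ^ c) = f b c - f (a + b) c + f a (b + c) - f a b

/-- The antisymmetrization; `ε(z; a, b)` is its value for `f = f_z`. -/
def antisymmetrize (f : ℤ → ℤ → A) (a b : ℤ) : A := f a b - f b a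

end Invariant

/-! ### The torus, the solid torus and the 3-sphere -/

/-- `T² = S¹ × S¹`. -/
abbrev Torus : Type := Circle × Circle

/-- The singular 2-simplex `[A₀A₁A₂]` of the torus: the image under `ℝ² → T²` of the affine
simplex with vertices `A₀, A₁, A₂`. -/
def torusSimplex (V : Fin 3 → ℝ × ℝ) : SingularSimplex 2 Torus where
  toFun t := (Circle.exp (2 * Real.pi * ∑ i, t i * (V i).1),
    Circle.exp (2 * Real.pi * ∑ i, t i * (V i).2))
  continuous_toFun := by
    have h : ∀ i, Continuous fun t : Simplex 2 => t i := fun i =>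
      (continuous_apply i).comp continuous_subtype_val
    have hs : ∀ c : Fin 3 → ℝ, Continuous fun t : Simplex 2 =>
        Circle.exp (2 * Real.pi * ∑ i, t i * c i) := fun c =>
      Circle.exp.continuous.comp (continuous_const.mul
        (continuous_finsetSum _ fun i _ => (h i).mul continuous_const))
    exact (hs _).prodMk (hs _)

/-- `ξ^st = [O W₁ W₃] - [O W₂ W₃]`. -/
def xiSt : Chain 2 Torus :=
  Finsupp.single (torusSimplex ![(0, 0), (1, 0), (1, 1)]) 1 -
    Finsupp.single (torusSimplex ![(0, 0), (0, 1), (1, 1)]) 1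

/-- The homeomorphism of `T²` induced by left multiplication of column vectors by `a`. -/
def torusMap (a : Matrix.SpecialLinearGroup (Fin 2) ℤ) : C(Torus, Torus) where
  toFun x := (x.1 ^ (a 0 0) * x.2 ^ (a 0 1), x.1 ^ (a 1 0) * x.2 ^ (a 1 1))
  continuous_toFun := by fun_prop

/-- The loop `S¹ × 1`. -/
def meridian : Path ((1, 1) : Torus) (1, 1) where
  toFun s := (Circle.exp (2 * Real.pi * s), 1)
  continuous_toFun := by fun_prop
  source' := by simp
  target' := by simp

/-- The loop `1 × S¹`. -/
def longitude : Path ((1, 1) : Torus) (1, 1) where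
  toFun s := (1, Circle.exp (2 * Real.pi * s))
  continuous_toFun := by fun_prop
  source' := by simp
  target' := by simp

/-- The solid torus `D²(r) × S¹`, with `D²(r) ⊆ ℂ` the closed disk of radius `r`. -/
abbrev SolidTorus (r : ℝ) : Type := Metric.closedBall (0 : ℂ) r × Circle

/-- The inclusion of `T² = S¹ × S¹` in `D²(r) × S¹`. -/
def torusInSolid (r : ℝ) (hr : 1 ≤ r) : C(Torus, SolidTorus r) where
  toFun x := (⟨(x.1 : ℂ), by simpa [Circle.norm_coe] using hr⟩, x.2)
  continuous_toFun := by fun_prop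

/-- The product orientation of the solid torus, given by the images of the positively oriented
affine 3-simplices in the universal cover `D²(r) × ℝ` that embed in `D²(r) × S¹`. -/
def solidTorusOrientation (r : ℝ) : Set (SingularSimplex 3 (SolidTorus r)) :=
  {σ | ∃ v : Fin 4 → Fin 3 → ℝ,
    0 < (Matrix.of fun i j : Fin 3 => v i.succ j - v 0 j).det ∧
    (∀ i j, |v i 2 - v j 2| < 1) ∧
    ∀ t, ((σ t).1 : ℂ) = ⟨∑ k, t k * v k 0, ∑ k, t k * v k 1⟩ ∧
      (σ t).2 = Circle.exp (2 * Real.pi * ∑ k, t k * v k 2)}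

/-- `S³`, as the unit sphere of `ℝ⁴`. -/
abbrev Sphere3 : Type := Metric.sphere (0 : EuclideanSpace ℝ (Fin 4)) 1

/-- The orientation of `S³` as the boundary of the unit ball: its positive simplices are the
radial projections of the affine simplices whose vertices form a positive basis of `ℝ⁴`. -/
def sphereOrientation : Set (SingularSimplex 3 Sphere3) :=
  {σ | ∃ v : Fin 4 → EuclideanSpace ℝ (Fin 4),
    0 < (Matrix.of fun i j : Fin 4 => v i j).det ∧
    ∀ t, (σ t : EuclideanSpace ℝ (Fin 4)) = ‖∑ k, t k • v k‖⁻¹ • ∑ k, t k • v k}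

/-! ### Links, their exteriors and Dehn surgery -/

/-- A link in `S³` with components `L_i = nbhd i (0 × S¹)`, together with tubular neighbourhoods
`N(L_i) = nbhd i (D²(1) × S¹)` parametrized by orientation-preserving embeddings. The
parametrizations extend to the larger solid tori `D²(2) × S¹`, so that the tori `∂N(L_i)` are
bicollared. The meridian and the longitude of `L_i` are `nbhd i (S¹ × 1)` and `nbhd i (1 × S¹)`. -/
structure TubularLink (n : ℕ) where
  nbhd : Fin n → C(SolidTorus 2, Sphere3)
  injective : Function.Injective fun x : Fin n × SolidTorus 2 => nbhd x.1 x.2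
  positive : ∀ i, OrientationPreserving (solidTorusOrientation 2) sphereOrientation (nbhd i)

namespace TubularLink

variable {n : ℕ} (L : TubularLink n)

/-- The exterior `E_L`: the complement of the interiors of the neighbourhoods `N(L_i)`. -/
def exterior : Set Sphere3 := {x | ∀ i, ∀ w : SolidTorus 2, ‖(w.1 : ℂ)‖ < 1 → L.nbhd i w ≠ x}

/-- The inclusion `E_L → S³`. -/
def exteriorIncl : C(L.exterior, Sphere3) := ⟨Subtype.val, continuous_subtype_val⟩

/-- The identification of `T²` with `T²_i = ∂N(L_i) ⊆ E_L`. -/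
def torus (i : Fin n) : C(Torus, L.exterior) where
  toFun x := ⟨L.nbhd i (torusInSolid 2 one_le_two x), by
    intro j w hw h
    have h' := @L.injective (j, w) (i, torusInSolid 2 one_le_two x) h
    have hw' : w = torusInSolid 2 one_le_two x := congrArg Prod.snd h'
    rw [hw'] at hw
    exact absurd hw (by simp [torusInSolid, Circle.norm_coe])⟩
  continuous_toFun := by fun_prop

/-- `∂E_L`. -/
def exteriorBoundary : Set L.exterior := ⋃ i, Set.range (L.torus i)

/-- The orientation of `E_L` induced from `S³`. -/
def exteriorOrientation : Set (SingularSimplex 3 L.exterior) :=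
  {σ | L.exteriorIncl.comp σ ∈ sphereOrientation}

/-- The boundary s-triangulation `⊔_i -ξ^st_{T²_i}` of `∂E_L = ⊔_i -T²_i`. -/
def xiBoundary : Chain 2 L.exterior := ∑ i, -push (L.torus i) xiSt

/-- The gluing: a point `x` of `T² = ∂(D² × S¹)` in the `i`-th solid torus is identified with the
point `[p_i/q_i](x)` of `T²_i ⊆ ∂E_L`, where `[p_i/q_i]` is the homeomorphism induced by `a i`. -/
inductive SurgeryRel (a : Fin n → Matrix.SpecialLinearGroup (Fin 2) ℤ) :
    L.exterior ⊕ (Fin n × SolidTorus 1) → L.exterior ⊕ (Fin n × SolidTorus 1) → Prop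
  | glue (i : Fin n) (x : Torus) :
      SurgeryRel a (Sum.inl (L.torus i (torusMap (a i) x)))
        (Sum.inr (i, torusInSolid 1 le_rfl x))

/-- The closed 3-manifold `M = E_L ∪ (⊔_i D² × S¹)` obtained by Dehn surgery; if `(p_i, q_i)` is
the first column of `a i`, it is `M(L; p_1/q_1, …, p_n/q_n)`. -/
def Surgery (a : Fin n → Matrix.SpecialLinearGroup (Fin 2) ℤ) : Type :=
  Quot (L.SurgeryRel a)

instance (a : Fin n → Matrix.SpecialLinearGroup (Fin 2) ℤ) : TopologicalSpace (L.Surgery a) :=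
  inferInstanceAs (TopologicalSpace (Quot (L.SurgeryRel a)))

variable (a : Fin n → Matrix.SpecialLinearGroup (Fin 2) ℤ)

/-- The inclusion `E_L → M`. -/
def inExterior : C(L.exterior, L.Surgery a) :=
  ⟨fun x => Quot.mk _ (Sum.inl x), continuous_quot_mk.comp continuous_inl⟩

/-- The inclusion of the `i`-th solid torus in `M`. -/
def inSolid (i : Fin n) : C(SolidTorus 1, L.Surgery a) :=
  ⟨fun x => Quot.mk _ (Sum.inr (i, x)),
    continuous_quot_mk.comp (continuous_inr.comp (by fun_prop))⟩

/-- The orientation of `M` that extends those of `E_L` and of the solid tori. -/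
def surgeryOrientation : Set (SingularSimplex 3 (L.Surgery a)) :=
  extendOrientation
    ({σ | ∃ τ ∈ L.exteriorOrientation, σ = (L.inExterior a).comp τ} ∪
      {σ | ∃ i, ∃ τ ∈ solidTorusOrientation 1, σ = (L.inSolid a i).comp τ})

/-- The s-triangulations of `E_L`. -/
def exteriorTri : Set (Chain 3 L.exterior) :=
  sTriangulations L.exteriorOrientation L.exteriorBoundary

/-- The s-triangulations of the closed manifold `M`. -/
def surgeryTri : Set (Chain 3 (L.Surgery a)) :=
  sTriangulations (L.surgeryOrientation a) ∅

variable {Γ : Type*} [Group Γ] {L a}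

/-- The restriction `ρ_L = ρ|_{E_L}`. -/
def restrictExterior (ρ : GroupoidRep (L.Surgery a) Γ) : GroupoidRep L.exterior Γ := GroupoidRep.pull ρ (L.inExterior a)

/-- `ρ(𝔪_i)`, for the meridian based at the point `(1, 1)` of `T²_i`. -/
def rhoMeridian (ρ : GroupoidRep (L.Surgery a) Γ) (i : Fin n) : Γ :=
  (restrictExterior ρ).val (meridian.map (L.torus i).continuous)

/-- `ρ(𝔩_i)`, for the longitude based at the point `(1, 1)` of `T²_i`. -/
def rhoLongitude (ρ : GroupoidRep (L.Surgery a) Γ) (i : Fin n) : Γ :=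
  (restrictExterior ρ).val (longitude.map (L.torus i).continuous)

end TubularLink

end SurgeryFormula

end

open SurgeryFormula SurgeryFormula.TubularLink

noncomputable section

namespace SurgeryFormula

/-! ### The calculus of singular chains -/

/-! The formula comes from evaluating the cocycle on one explicit fundamental cycle of M. Let ζ be
an s-triangulation of E_L whose boundary is the sum of the chains -ξ^st. Over the i-th solid torus
put `solidChain`, a fundamental chain with boundary ξ^st on S¹ × S¹, together with a chain y_i of
the torus whose boundary is the image of ξ^st under the inverse of a_i, minus ξ^st. The gluing map
a_i carries the boundary of this sum to ξ^st on T²_i, where it cancels the boundary of ζ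
(`boundary_surgeryChain`). Near an interior point of a piece only ζ or one `solidChain` is present,
so the result has the right local degrees (`surgeryChain_mem`).

The three kinds of summands evaluate separately. The chain ζ gives the term of E_L by definition.
The chain `solidChain` gives zero: it is a twisted prism over a triangle, all of whose vertices lie
over one longitude, and each of its tetrahedra has an edge on which the representation is trivial
(`evalHom_solidChain`). For y_i, the representation takes the lattice point (m, n) of the boundary
of the solid torus to z^n, where z is the value on the core. A chain y that carries ξ^st to its
image under b in SL(2, ℤ) can be chosen so that, for a representation (m, n) ↦ z^(lm + l'n), the
cocycle evaluates to ε((l, l')b) - ε(l, l'). For the two elementary transvections y is a single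
tetrahedron up to sign, and the formula is the coboundary relation for f_z; the property is
inherited by products and inverses, hence holds on all of SL(2, ℤ) (`exists_isTransfer`). With (l,
l') = (0, 1) and b the inverse of a_i this is ε(-q_i, p_i) - ε(0, 1), and the last term vanishes by
normalization. The element z_i is the core value, and it is unique because p_i and q_i are coprime.

Independence of choices is homological. Two s-triangulations of M differ by a cycle that is trivial
in the local homology at every point; in a compact 3-manifold such a 3-cycle bounds
(`trivialOn_of_forall_singleton`, `exists_eq_boundary`), and a cocycle vanishes on boundaries. Two
s-triangulations of E_L with the same boundary are compared in the same way inside M, over which the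
representation extends.

Everything is derived from singular chains. Barycentric subdivision gives a Mayer–Vietoris argument
for `TrivialOn`, the relation of being a boundary modulo the complement of a set. With linear
homotopies it yields the vanishing of the homology of ℝⁿ relative to complements of compact sets in
degrees above n, the local constancy of local classes, and the nontriviality of the class of a
simplex. Matrices of positive determinant act trivially on local homology at the origin of ℝ³, so
the orientations are coherent. The s-triangulation of E_L is obtained from the boundary of a
4-simplex projected to S³: subtract the fundamental chains of the solid tori, move the difference
off thinner tubes, and retract to E_L (`exists_exteriorTri`). That M is a manifold uses that the
tubes are open in S³, an invariance of domain which follows here from the orientation hypothesis on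
the parametrizations (`isOpen_nbhd_image`). -/

/-- Two faces of codimension one cancel in pairs. -/
theorem sum_succAbove_succAbove_eq_zero {G : Type*} [AddCommGroup G] {k : ℕ}
    (g : (Fin (k + 1) → Fin (k + 3)) → G) :
    ∑ i : Fin (k + 3), ∑ j : Fin (k + 2),
      ((-1 : ℤ) ^ (i : ℕ) * (-1) ^ (j : ℕ)) • g (fun m => i.succAbove (j.succAbove m)) = 0 := by
  rw [← Fintype.sum_prod_type'
    (fun (i : Fin (k + 3)) (j : Fin (k + 2)) =>
      ((-1 : ℤ) ^ (i : ℕ) * (-1) ^ (j : ℕ)) • g (fun m => i.succAbove (j.succAbove m)))]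
  -- The involution removes the same two vertices in the opposite order, which changes the sign.
  refine Finset.sum_involution (fun x _ => (x.1.succAbove x.2, x.2.predAbove x.1)) ?_ ?_ ?_ ?_
  · rintro ⟨i, j⟩ -
    have h : (fun m => (i.succAbove j).succAbove ((j.predAbove i).succAbove m)) =
        fun m => i.succAbove (j.succAbove m) :=
      funext fun m => Fin.succAbove_succAbove_succAbove_predAbove i j m
    have hs := Fin.neg_one_pow_succAbove_add_predAbove (R := ℤ) i j
    simp only [h]
    rw [← add_smul, ← pow_add, ← pow_add, hs, pow_add]
    simp
  · rintro ⟨i, j⟩ - - h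
    exact Fin.succAbove_ne i j (congrArg Prod.fst h)
  · intros; simp
  · rintro ⟨i, j⟩ -
    ext1
    · exact Fin.succAbove_succAbove_predAbove i j
    · exact Fin.predAbove_predAbove_succAbove i j

section Chains

variable {X Y Z : Type*} [TopologicalSpace X] [TopologicalSpace Y] [TopologicalSpace Z] {k : ℕ}

theorem boundary_single (σ : SingularSimplex (k + 1) X) (n : ℤ) :
    boundary (Finsupp.single σ n) =
      n • ∑ i : Fin (k + 2), (-1 : ℤ) ^ (i : ℕ) • Finsupp.single (face i σ) (1 : ℤ) := by
  simp [boundary]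

theorem push_single (f : C(X, Y)) (σ : SingularSimplex k X) (n : ℤ) :
    push f (Finsupp.single σ n) = Finsupp.single (f.comp σ) n := by
  simp [push]

/-- Two additive maps on chains agree if they agree on simplices. -/
theorem chain_hom_ext {S : Type*} {G : Type*} [AddCommGroup G] {φ ψ : (S →₀ ℤ) →+ G}
    (h : ∀ σ, φ (Finsupp.single σ 1) = ψ (Finsupp.single σ 1)) (c : S →₀ ℤ) : φ c = ψ c := by
  refine DFunLike.congr_fun (Finsupp.addHom_ext' fun σ => ?_) c
  ext
  simpa using h σ

theorem push_comp (g : C(Y, Z)) (f : C(X, Y)) (c : Chain k X) :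
    push g (push f c) = push (g.comp f) c :=
  chain_hom_ext (φ := (push g).comp (push f)) (ψ := push (g.comp f))
    (fun σ => by simp [push_single, ContinuousMap.comp_assoc]) c

theorem push_id (c : Chain k X) : push (ContinuousMap.id X) c = c :=
  chain_hom_ext (φ := push (ContinuousMap.id X)) (ψ := AddMonoidHom.id _)
    (fun σ => by simp [push_single]) c

theorem face_comp (f : C(X, Y)) (i : Fin (k + 2)) (σ : SingularSimplex (k + 1) X) :
    face i (f.comp σ) = f.comp (face i σ) := rfl

theorem push_boundary (f : C(X, Y)) (c : Chain (k + 1) X) :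
    push f (boundary c) = boundary (push f c) :=
  chain_hom_ext (φ := (push f).comp boundary) (ψ := boundary.comp (push f))
    (fun σ => by simp [push_single, boundary_single, face_comp]) c

theorem face_apply (i : Fin (k + 2)) (σ : SingularSimplex (k + 1) X) (t : Simplex k) :
    face i σ t = σ (stdSimplex.map i.succAbove t) := rfl

theorem boundary_boundary (c : Chain (k + 2) X) : boundary (boundary c) = 0 := by
  refine chain_hom_ext (φ := boundary.comp boundary) (ψ := 0) (fun σ => ?_) c
  have := sum_succAbove_succAbove_eq_zero (k := k) fun p =>
    Finsupp.single (σ.comp ⟨stdSimplex.map p, stdSimplex.continuous_map _⟩ : SingularSimplex k X)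
      (1 : ℤ)
  rw [AddMonoidHom.zero_apply, ← this]
  simp only [AddMonoidHom.comp_apply, boundary_single, map_sum, map_zsmul,
    Finset.smul_sum, smul_smul]
  refine Finset.sum_congr rfl fun i _ => Finset.sum_congr rfl fun j _ => ?_
  have : face j (face i σ) = σ.comp ⟨stdSimplex.map fun m => i.succAbove (j.succAbove m),
      stdSimplex.continuous_map _⟩ := by
    ext t
    simp [face_apply, stdSimplex.map_comp_apply, Function.comp_def]
  rw [this, one_mul, one_mul]

theorem push_injective {f : C(X, Y)} (hf : Function.Injective f) :
    Function.Injective (push f : Chain k X → Chain k Y) :=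
  Finsupp.mapDomain_injective fun σ τ h => by
    ext t
    exact hf (DFunLike.congr_fun h t)

/-! ### Supports -/

theorem SupportedIn.zero (S : Set X) : SupportedIn S (0 : Chain k X) := by
  simp [SupportedIn]

theorem SupportedIn.add {S : Set X} {c d : Chain k X} (hc : SupportedIn S c)
    (hd : SupportedIn S d) : SupportedIn S (c + d) := by
  classical
  intro σ h
  rcases Finset.mem_union.1 (Finsupp.support_add h) with h | h
  exacts [hc σ h, hd σ h]

theorem SupportedIn.neg {S : Set X} {c : Chain k X} (hc : SupportedIn S c) :
    SupportedIn S (-c) := by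
  intro σ h
  rw [Finsupp.support_neg] at h
  exact hc σ h

theorem SupportedIn.sub {S : Set X} {c d : Chain k X} (hc : SupportedIn S c)
    (hd : SupportedIn S d) : SupportedIn S (c - d) := by
  rw [sub_eq_add_neg]
  exact hc.add hd.neg

theorem SupportedIn.zsmul {S : Set X} {c : Chain k X} (hc : SupportedIn S c) (n : ℤ) :
    SupportedIn S (n • c) := fun σ h => hc σ (Finsupp.support_smul h)

theorem SupportedIn.sum {ι : Type*} {S : Set X} {c : ι → Chain k X} {s : Finset ι}
    (hc : ∀ i ∈ s, SupportedIn S (c i)) : SupportedIn S (∑ i ∈ s, c i) := by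
  classical
  induction s using Finset.induction_on with
  | empty => simpa using SupportedIn.zero S
  | insert a s ha ih =>
    rw [Finset.sum_insert ha]
    exact (hc a (by simp)).add (ih fun i hi => hc i (by simp [hi]))

theorem SupportedIn.mono {S T : Set X} {c : Chain k X} (hc : SupportedIn S c) (h : S ⊆ T) :
    SupportedIn T c := fun σ hσ => (hc σ hσ).trans h

theorem SupportedIn.inter {S T : Set X} {c : Chain k X} (hS : SupportedIn S c)
    (hT : SupportedIn T c) : SupportedIn (S ∩ T) c :=
  fun σ hσ => Set.subset_inter (hS σ hσ) (hT σ hσ)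

theorem supportedIn_single {S : Set X} {σ : SingularSimplex k X} (h : Set.range σ ⊆ S) (n : ℤ) :
    SupportedIn S (Finsupp.single σ n) := by
  intro τ hτ
  rw [Finset.mem_singleton.1 (Finsupp.support_single_subset hτ)]
  exact h

theorem supportedIn_univ (c : Chain k X) : SupportedIn Set.univ c := fun _ _ => Set.subset_univ _

/-- An additive operator respects supports if it does so on simplices. -/
theorem SupportedIn.map {l : ℕ} {S : Set X} {T : Set Y} {φ : Chain k X →+ Chain l Y}
    (h : ∀ σ : SingularSimplex k X, Set.range σ ⊆ S → SupportedIn T (φ (Finsupp.single σ 1)))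
    {c : Chain k X} (hc : SupportedIn S c) : SupportedIn T (φ c) := by
  have : c = ∑ σ ∈ c.support, c σ • Finsupp.single σ (1 : ℤ) := by
    conv_lhs => rw [← Finsupp.sum_single c, Finsupp.sum]
    simp
  rw [this, map_sum]
  refine SupportedIn.sum fun σ hσ => ?_
  rw [map_zsmul]
  exact (h σ (hc σ hσ)).zsmul _

theorem SupportedIn.boundary {S : Set X} {c : Chain (k + 1) X} (hc : SupportedIn S c) :
    SupportedIn S (SurgeryFormula.boundary c) := by
  refine SupportedIn.map (fun σ hσ => ?_) hc
  rw [boundary_single, one_smul]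
  refine SupportedIn.sum fun i _ => (supportedIn_single ?_ _).zsmul _
  rintro _ ⟨t, rfl⟩
  exact hσ ⟨_, rfl⟩

theorem SupportedIn.push {S : Set X} {T : Set Y} {f : C(X, Y)} (h : Set.MapsTo f S T)
    {c : Chain k X} (hc : SupportedIn S c) : SupportedIn T (push f c) := by
  refine SupportedIn.map (fun σ hσ => ?_) hc
  rw [push_single]
  refine supportedIn_single ?_ _
  rintro _ ⟨t, rfl⟩
  exact h (hσ ⟨t, rfl⟩)

/-- Composition with an injective map is injective on simplices, so no terms of the push-forward
cancel and every simplex of `c` is visible in it. -/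
theorem SupportedIn.of_push {f : C(X, Y)} (hf : Function.Injective f) {T : Set Y} {c : Chain k X}
    (h : SupportedIn T (SurgeryFormula.push f c)) : SupportedIn (f ⁻¹' T) c := by
  classical
  intro σ hσ
  have h1 := h (f.comp σ) (by
    rw [SurgeryFormula.push, Finsupp.mapDomain.addMonoidHom_apply,
      Finsupp.mapDomain_support_of_injective]
    · exact Finset.mem_image_of_mem _ hσ
    · intro σ τ h
      ext t
      exact hf (DFunLike.congr_fun h t))
  rintro _ ⟨t, rfl⟩
  exact h1 ⟨t, rfl⟩

theorem supportedIn_push {T : Set Y} {f : C(X, Y)} (h : Set.range f ⊆ T)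
    (c : Chain k X) : SupportedIn T (SurgeryFormula.push f c) :=
  SupportedIn.push (fun x _ => h ⟨x, rfl⟩) (supportedIn_univ c)

/-- A property of chains that is additive can be checked on simplices. -/
theorem SupportedIn.induction {S : Set X} {p : Chain k X → Prop} (h0 : p 0)
    (hadd : ∀ c d, p c → p d → p (c + d)) 
    (hs : ∀ (σ : SingularSimplex k X) (n : ℤ), Set.range σ ⊆ S → p (Finsupp.single σ n))
    {c : Chain k X} (hc : SupportedIn S c) : p c := by
  rw [← Finsupp.sum_single c, Finsupp.sum]
  exact Finset.sum_induction _ p hadd h0 fun σ hσ => hs σ _ (hc σ hσ)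

/-- A chain in the range of an embedding comes from the source. -/
theorem SupportedIn.exists_push {f : C(X, Y)} (hf : Topology.IsEmbedding f) {c : Chain k Y}
    (hc : SupportedIn (Set.range f) c) : ∃ d : Chain k X, SurgeryFormula.push f d = c := by
  refine SupportedIn.induction (p := fun c => ∃ d : Chain k X, SurgeryFormula.push f d = c)
    ⟨0, map_zero _⟩ ?_ ?_ hc
  · rintro _ _ ⟨c, rfl⟩ ⟨d, rfl⟩
    exact ⟨c + d, map_add _ _ _⟩
  · intro σ n hσ
    choose g hg using fun t => hσ ⟨t, rfl⟩
    have hgc : Continuous g := by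
      rw [hf.continuous_iff]
      convert σ.continuous using 1
      exact funext hg
    refine ⟨Finsupp.single ⟨g, hgc⟩ n, ?_⟩
    rw [push_single]
    congr 1
    ext t
    exact hg t

/-- The inclusion of a subset. -/
def incl (S : Set X) : C(S, X) := ⟨Subtype.val, continuous_subtype_val⟩

theorem SupportedIn.exists_incl {S : Set X} {c : Chain k X} (hc : SupportedIn S c) :
    ∃ d : Chain k S, SurgeryFormula.push (incl S) d = c :=
  SupportedIn.exists_push (f := incl S) Topology.IsEmbedding.subtypeVal
    (by rwa [show Set.range (incl S) = S from Subtype.range_coe])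

theorem incl_injective (S : Set X) : Function.Injective (incl S) := Subtype.val_injective

/-- The union of the ranges of the simplices of a chain. -/
def carrier (c : Chain k X) : Set X := ⋃ σ ∈ c.support, Set.range σ

theorem supportedIn_iff {S : Set X} {c : Chain k X} : SupportedIn S c ↔ carrier c ⊆ S := by
  simp [SupportedIn, carrier]

theorem isCompact_carrier (c : Chain k X) : IsCompact (carrier c) :=
  c.support.finite_toSet.isCompact_biUnion fun σ _ => isCompact_range σ.continuous

/-- Simplices are nonempty. This turns a relative cycle of a closed manifold into a cycle, and
triviality on the whole space into being a boundary. -/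
theorem eq_zero_of_supportedIn_empty {c : Chain k X} (hc : SupportedIn ∅ c) : c = 0 := by
  rw [← Finsupp.support_eq_empty, Finset.eq_empty_iff_forall_notMem]
  exact fun σ hσ => hc σ hσ ⟨stdSimplex.vertex 0, rfl⟩

end Chains

end SurgeryFormula

end

noncomputable section

namespace SurgeryFormula

/-! ### Chains of vertex tuples -/

/-- Formal combinations of `(k + 1)`-tuples of points, to be thought of as affine simplices. -/
abbrev TupleChain (k : ℕ) (V : Type*) := (Fin (k + 1) → V) →₀ ℤ

section Tuples

variable {V W : Type*} {k : ℕ}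

/-- The boundary of a chain of tuples. -/
def tupleBoundary : TupleChain (k + 1) V →+ TupleChain k V :=
  Finsupp.liftAddHom fun v => zmultiplesHom (TupleChain k V)
    (∑ i : Fin (k + 2), (-1 : ℤ) ^ (i : ℕ) • Finsupp.single (fun m => v (i.succAbove m)) (1 : ℤ))

/-- The cone over a chain of tuples. -/
def tupleCone (b : V) : TupleChain k V →+ TupleChain (k + 1) V :=
  Finsupp.mapDomain.addMonoidHom fun v => (Fin.cons b v : Fin (k + 2) → V)

/-- The action of a map of vertices. -/
def tupleMap (f : V → W) : TupleChain k V →+ TupleChain k W :=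
  Finsupp.mapDomain.addMonoidHom fun v m => f (v m)

theorem tupleBoundary_single (v : Fin (k + 2) → V) : tupleBoundary (Finsupp.single v 1) =
    ∑ i : Fin (k + 2), (-1 : ℤ) ^ (i : ℕ) • Finsupp.single (fun m => v (i.succAbove m)) (1 : ℤ) := by
  simp [tupleBoundary]

theorem tupleCone_single (b : V) (v : Fin (k + 1) → V) (n : ℤ) :
    tupleCone b (Finsupp.single v n) = Finsupp.single (Fin.cons b v : Fin (k + 2) → V) n := by
  simp [tupleCone]

theorem tupleMap_single (f : V → W) (v : Fin (k + 1) → V) (n : ℤ) :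
    tupleMap f (Finsupp.single v n) = Finsupp.single (fun m => f (v m)) n := by
  simp [tupleMap]

theorem tupleMap_tupleBoundary (f : V → W) (c : TupleChain (k + 1) V) :
    tupleMap f (tupleBoundary c) = tupleBoundary (tupleMap f c) :=
  chain_hom_ext (φ := (tupleMap f).comp tupleBoundary) (ψ := tupleBoundary.comp (tupleMap f))
    (fun v => by simp [tupleMap_single, tupleBoundary_single]) c

theorem tupleMap_tupleCone (f : V → W) (b : V) (c : TupleChain k V) :
    tupleMap f (tupleCone b c) = tupleCone (f b) (tupleMap f c) := by
  refine chain_hom_ext (φ := (tupleMap f).comp (tupleCone b))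
    (ψ := (tupleCone (f b)).comp (tupleMap f)) (fun v => ?_) c
  simp only [AddMonoidHom.comp_apply, tupleMap_single, tupleCone_single]
  congr 1
  ext m
  refine Fin.cases ?_ (fun m => ?_) m <;> simp

theorem tupleBoundary_tupleBoundary (c : TupleChain (k + 2) V) :
    tupleBoundary (tupleBoundary c) = 0 := by
  refine chain_hom_ext (φ := tupleBoundary.comp tupleBoundary) (ψ := 0) (fun v => ?_) c
  have := sum_succAbove_succAbove_eq_zero (k := k) fun p =>
    Finsupp.single (fun m => v (p m)) (1 : ℤ)
  rw [AddMonoidHom.zero_apply, ← this]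
  simp only [AddMonoidHom.comp_apply, tupleBoundary_single, map_sum, map_zsmul,
    Finset.smul_sum, smul_smul]

theorem tupleBoundary_cons (b : V) (v : Fin (k + 2) → V) :
    tupleBoundary (Finsupp.single (Fin.cons b v : Fin (k + 3) → V) 1) =
      Finsupp.single v 1 - tupleCone b (tupleBoundary (Finsupp.single v 1)) := by
  rw [tupleBoundary_single, Fin.sum_univ_succ, tupleBoundary_single, map_sum, sub_eq_add_neg,
    ← Finset.sum_neg_distrib]
  congr 1
  · simp
  · refine Finset.sum_congr rfl fun i _ => ?_
    rw [map_zsmul, tupleCone_single, Fin.val_succ, pow_succ, mul_neg_one, neg_smul]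
    congr 3
    ext m
    refine Fin.cases ?_ (fun m => ?_) m <;> simp

/-- In degree zero the cone formula has an extra term: the face opposite to the base is the apex
itself. -/
theorem tupleBoundary_cons_zero (b : V) (w : Fin 1 → V) :
    tupleBoundary (Finsupp.single (Fin.cons b w : Fin 2 → V) 1) =
      Finsupp.single w 1 - Finsupp.single (fun _ => b) 1 := by
  rw [tupleBoundary_single, Fin.sum_univ_two]
  have h0 : (fun m => (Fin.cons b w : Fin 2 → V) ((0 : Fin 2).succAbove m)) = w := by
    ext m; fin_cases m; rfl
  have h1 : (fun m => (Fin.cons b w : Fin 2 → V) ((1 : Fin 2).succAbove m)) = fun _ => b := by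
    ext m; fin_cases m; rfl
  rw [h0, h1]
  simp [sub_eq_add_neg]

theorem tupleBoundary_tupleCone (b : V) (c : TupleChain (k + 1) V) :
    tupleBoundary (tupleCone b c) = c - tupleCone b (tupleBoundary c) :=
  chain_hom_ext (φ := tupleBoundary.comp (tupleCone b))
    (ψ := AddMonoidHom.id _ - (tupleCone b).comp tupleBoundary)
    (fun v => by simpa [tupleCone_single] using tupleBoundary_cons b v) c

end Tuples

/-! ### Spaces with affine simplices -/

/-- A space in which tuples of points span affine singular simplices. -/
class HasAffineSimplices (V : Type*) [TopologicalSpace V] where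
  /-- The affine simplex with given vertices. -/
  aff : ∀ {k : ℕ}, (Fin (k + 1) → V) → C(Simplex k, V)
  aff_map : ∀ {k l : ℕ} (v : Fin (l + 1) → V) (f : Fin (k + 1) → Fin (l + 1)) (t : Simplex k),
    aff v (stdSimplex.map f t) = aff (fun m => v (f m)) t
  aff_vertex : ∀ {k : ℕ} (v : Fin (k + 1) → V) (i : Fin (k + 1)), aff v (stdSimplex.vertex i) = v i

open HasAffineSimplices

theorem sum_map_smul {E : Type*} [AddCommGroup E] [Module ℝ E] {k l : ℕ}
    (f : Fin (k + 1) → Fin (l + 1)) (t : Simplex k) (v : Fin (l + 1) → E) :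
    ∑ j, (stdSimplex.map f t) j • v j = ∑ i, t i • v (f i) := by
  classical
  simp only [stdSimplex.map_coe, FunOnFinite.linearMap_apply_apply, Finset.sum_smul]
  rw [← Finset.sum_fiberwise Finset.univ f (fun i => t i • v (f i))]
  refine Finset.sum_congr rfl fun j _ => Finset.sum_congr rfl fun i hi => ?_
  rw [(Finset.mem_filter.1 hi).2]

theorem sum_vertex_smul {E : Type*} [AddCommGroup E] [Module ℝ E] {k : ℕ}
    (i : Fin (k + 1)) (v : Fin (k + 1) → E) :
    ∑ j, (stdSimplex.vertex i : Simplex k) j • v j = v i := by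
  rw [Finset.sum_eq_single i] <;> simp +contextual

theorem continuous_sum_smul {E : Type*} [AddCommGroup E] [Module ℝ E] [TopologicalSpace E]
    [ContinuousAdd E] [ContinuousSMul ℝ E] {k : ℕ} (v : Fin (k + 1) → E) :
    Continuous fun t : Simplex k => ∑ i, t i • v i :=
  continuous_finsetSum _ fun i _ =>
    ((continuous_apply i).comp continuous_subtype_val).smul continuous_const

instance HasAffineSimplices.ofModule {E : Type*} [AddCommGroup E] [Module ℝ E] [TopologicalSpace E]
    [ContinuousAdd E] [ContinuousSMul ℝ E] : HasAffineSimplices E where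
  aff v := ⟨fun t => ∑ i, t i • v i, continuous_sum_smul v⟩
  aff_map v f t := sum_map_smul f t v
  aff_vertex v i := sum_vertex_smul i v

/-- Affine simplices in a convex set. -/
abbrev HasAffineSimplices.ofConvex {E : Type*} [AddCommGroup E] [Module ℝ E] [TopologicalSpace E]
    [ContinuousAdd E] [ContinuousSMul ℝ E] {S : Set E} (hS : Convex ℝ S) :
    HasAffineSimplices S where
  aff v := ⟨fun t => ⟨∑ i, t i • (v i : E), hS.sum_mem (fun i _ => stdSimplex.zero_le t i)
    (stdSimplex.sum_eq_one t) fun i _ => (v i).2⟩, (continuous_sum_smul _).subtype_mk _⟩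
  aff_map v f t := Subtype.ext (sum_map_smul f t fun i => (v i : E))
  aff_vertex v i := Subtype.ext (sum_vertex_smul i fun i => (v i : E))

instance (m : ℕ) : HasAffineSimplices (Simplex m) :=
  HasAffineSimplices.ofConvex (convex_stdSimplex ℝ (Fin (m + 1)))

instance (m : ℕ) : HasAffineSimplices (Simplex m × unitInterval) where
  aff v := ContinuousMap.prodMk (aff fun i => (v i).1)
    ((HasAffineSimplices.ofConvex (convex_Icc (0 : ℝ) 1)).aff fun i => (v i).2)
  aff_map _ f t := Prod.ext (aff_map _ f t)
    ((HasAffineSimplices.ofConvex (convex_Icc (0 : ℝ) 1)).aff_map _ f t)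
  aff_vertex _ i := Prod.ext (aff_vertex _ i)
    ((HasAffineSimplices.ofConvex (convex_Icc (0 : ℝ) 1)).aff_vertex _ i)

section Realize

variable {V W : Type*} [TopologicalSpace V] [HasAffineSimplices V] [TopologicalSpace W]
  [HasAffineSimplices W] {k : ℕ}

/-- A map that takes affine simplices to affine simplices. -/
def PreservesAffine (f : C(V, W)) : Prop :=
  ∀ (k : ℕ) (v : Fin (k + 1) → V) (t : Simplex k), f (aff v t) = aff (fun m => f (v m)) t

/-- The singular chain of a chain of tuples. -/
def realize : TupleChain k V →+ Chain k V := Finsupp.mapDomain.addMonoidHom aff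

theorem realize_single (v : Fin (k + 1) → V) (n : ℤ) :
    realize (Finsupp.single v n) = Finsupp.single (aff v) n := by
  simp [realize]

theorem face_aff (v : Fin (k + 2) → V) (i : Fin (k + 2)) :
    face i (aff v) = aff fun m => v (i.succAbove m) := by
  ext t
  exact aff_map v i.succAbove t

theorem realize_tupleBoundary (c : TupleChain (k + 1) V) :
    realize (tupleBoundary c) = boundary (realize c) :=
  chain_hom_ext (φ := realize.comp tupleBoundary) (ψ := boundary.comp realize)
    (fun v => by simp [realize_single, tupleBoundary_single, boundary_single, face_aff]) c

theorem push_realize {f : C(V, W)} (hf : PreservesAffine f) (c : TupleChain k V) :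
    push f (realize c) = realize (tupleMap f c) :=
  chain_hom_ext (φ := (push f).comp realize) (ψ := realize.comp (tupleMap f))
    (fun v => by
      simp only [AddMonoidHom.comp_apply, realize_single, push_single, tupleMap_single]
      congr 1
      ext t
      exact hf k v t) c

end Realize

/-! ### Barycentric subdivision of tuples -/

section Subdivision

variable {V W : Type*} [TopologicalSpace V] [HasAffineSimplices V] [TopologicalSpace W]
  [HasAffineSimplices W]

/-- The barycenter of a tuple. -/
def center {k : ℕ} (v : Fin (k + 1) → V) : V := aff v stdSimplex.barycenter

/-- Barycentric subdivision. -/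
def tupleSd : ∀ k : ℕ, TupleChain k V →+ TupleChain k V
  | 0 => AddMonoidHom.id _
  | k + 1 => Finsupp.liftAddHom fun v => zmultiplesHom _
      (tupleCone (center v) (tupleSd k (tupleBoundary (Finsupp.single v 1))))

/-- The chain homotopy from barycentric subdivision to the identity. -/
def tupleSdHomotopy : ∀ k : ℕ, TupleChain k V →+ TupleChain (k + 1) V
  | 0 => 0
  | k + 1 => Finsupp.liftAddHom fun v => zmultiplesHom _
      (tupleCone (center v) (Finsupp.single v 1 - tupleSd (k + 1) (Finsupp.single v 1) -
        tupleSdHomotopy k (tupleBoundary (Finsupp.single v 1))))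

theorem tupleSd_single (k : ℕ) (v : Fin (k + 2) → V) : tupleSd (k + 1) (Finsupp.single v 1) =
    tupleCone (center v) (tupleSd k (tupleBoundary (Finsupp.single v 1))) := by
  simp [tupleSd]

theorem tupleSdHomotopy_single (k : ℕ) (v : Fin (k + 2) → V) :
    tupleSdHomotopy (k + 1) (Finsupp.single v 1) =
      tupleCone (center v) (Finsupp.single v 1 - tupleSd (k + 1) (Finsupp.single v 1) -
        tupleSdHomotopy k (tupleBoundary (Finsupp.single v 1))) := by
  simp [tupleSdHomotopy]

theorem tupleBoundary_tupleSd (k : ℕ) (c : TupleChain (k + 1) V) :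
    tupleBoundary (tupleSd (k + 1) c) = tupleSd k (tupleBoundary c) := by
  refine chain_hom_ext (φ := tupleBoundary.comp (tupleSd (k + 1)))
    (ψ := (tupleSd k).comp tupleBoundary) (fun v => ?_) c
  simp only [AddMonoidHom.comp_apply, tupleSd_single]
  cases k with
  | zero =>
    -- In this degree each cone contributes its apex, and the apex terms cancel because the boundary
    -- of a 1-simplex has total coefficient zero.
    have h (w : Fin 1 → V) : tupleBoundary (tupleCone (center v) (Finsupp.single w 1)) =
        Finsupp.single w 1 - Finsupp.single (fun _ => center v) 1 := by
      rw [tupleCone_single, tupleBoundary_cons_zero]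
    have hb : tupleBoundary (Finsupp.single v 1) =
        Finsupp.single (fun m => v m.succ) 1 - Finsupp.single (fun _ => v 0) 1 := by
      have := tupleBoundary_cons_zero (v 0) (fun m => v m.succ)
      rwa [show (Fin.cons (v 0) (fun m => v m.succ) : Fin 2 → V) = v from Fin.cons_self_tail v]
        at this
    simp only [tupleSd, AddMonoidHom.id_apply, hb, map_sub, h, sub_sub_sub_cancel_right]
  | succ k =>
    rw [tupleBoundary_tupleCone, tupleBoundary_tupleSd k, tupleBoundary_tupleBoundary]
    simp

/-- The homotopy cones off the chain v - sd v - D∂v. By the identity one degree lower this chain is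
a cycle, so the cone on it has exactly this boundary. -/
theorem tupleBoundary_tupleSdHomotopy (k : ℕ) (c : TupleChain (k + 1) V) :
    tupleBoundary (tupleSdHomotopy (k + 1) c) + tupleSdHomotopy k (tupleBoundary c) =
      c - tupleSd (k + 1) c := by
  refine chain_hom_ext
    (φ := tupleBoundary.comp (tupleSdHomotopy (k + 1)) + (tupleSdHomotopy k).comp tupleBoundary)
    (ψ := AddMonoidHom.id _ - tupleSd (k + 1)) (fun v => ?_) c
  simp only [AddMonoidHom.add_apply, AddMonoidHom.comp_apply, AddMonoidHom.sub_apply,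
    AddMonoidHom.id_apply, tupleSdHomotopy_single]
  rw [tupleBoundary_tupleCone]
  suffices h : tupleBoundary (Finsupp.single v 1 - tupleSd (k + 1) (Finsupp.single v 1) -
      tupleSdHomotopy k (tupleBoundary (Finsupp.single v 1))) = 0 by
    rw [h]; simp
  rw [map_sub, map_sub, tupleBoundary_tupleSd]
  cases k with
  | zero => simp [tupleSdHomotopy, tupleSd]
  | succ k =>
    have := tupleBoundary_tupleSdHomotopy k (tupleBoundary (Finsupp.single v 1))
    rw [tupleBoundary_tupleBoundary, map_zero, add_zero] at this
    rw [this, sub_self]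

theorem center_map {f : C(V, W)} (hf : PreservesAffine f) {k : ℕ} (v : Fin (k + 1) → V) :
    f (center v) = center fun m => f (v m) := hf k v _

theorem tupleMap_tupleSd {f : C(V, W)} (hf : PreservesAffine f) (k : ℕ) (c : TupleChain k V) :
    tupleMap f (tupleSd k c) = tupleSd k (tupleMap f c) := by
  induction k with
  | zero => simp [tupleSd]
  | succ k ih =>
    refine chain_hom_ext (φ := (tupleMap f).comp (tupleSd (k + 1)))
      (ψ := (tupleSd (k + 1)).comp (tupleMap f)) (fun v => ?_) c
    simp only [AddMonoidHom.comp_apply, tupleSd_single, tupleMap_single, tupleMap_tupleCone, ih,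
      tupleMap_tupleBoundary, center_map hf]

theorem tupleMap_tupleSdHomotopy {f : C(V, W)} (hf : PreservesAffine f) (k : ℕ)
    (c : TupleChain k V) :
    tupleMap f (tupleSdHomotopy k c) = tupleSdHomotopy k (tupleMap f c) := by
  induction k with
  | zero => simp [tupleSdHomotopy]
  | succ k ih =>
    refine chain_hom_ext (φ := (tupleMap f).comp (tupleSdHomotopy (k + 1)))
      (ψ := (tupleSdHomotopy (k + 1)).comp (tupleMap f)) (fun v => ?_) c
    simp only [AddMonoidHom.comp_apply, tupleSdHomotopy_single, tupleMap_single,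
      tupleMap_tupleCone, ih, tupleMap_tupleBoundary, center_map hf, map_sub,
      tupleMap_tupleSd hf]

end Subdivision

/-! ### The prism over a tuple -/

section Prism

variable {V W : Type*} {k : ℕ}

/-- The prism decomposition of `[v₀, …, v_k] × [0, 1]`. -/
def tuplePrism : ∀ k : ℕ, TupleChain k V →+ TupleChain (k + 1) (V × unitInterval)
  | 0 => Finsupp.liftAddHom fun v => zmultiplesHom _ (tupleCone (v 0, 0)
      (Finsupp.single (fun m => (v m, 1)) 1))
  | k + 1 => Finsupp.liftAddHom fun v => zmultiplesHom _ (tupleCone (v 0, 0)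
      (Finsupp.single (fun m => (v m, 1)) 1 - tuplePrism k (Finsupp.single (fun m => v m.succ) 1)))

theorem tuplePrism_single_zero (v : Fin 1 → V) : tuplePrism 0 (Finsupp.single v 1) =
    tupleCone (v 0, 0) (Finsupp.single (fun m => (v m, 1)) 1) := by
  simp [tuplePrism]

theorem tuplePrism_single_succ (v : Fin (k + 2) → V) : tuplePrism (k + 1) (Finsupp.single v 1) =
    tupleCone (v 0, 0) (Finsupp.single (fun m => (v m, 1)) 1 -
      tuplePrism k (Finsupp.single (fun m => v m.succ) 1)) := by
  simp [tuplePrism]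

theorem tupleMap_tuplePrism (f : V → W) (c : TupleChain k V) :
    tupleMap (Prod.map f id) (tuplePrism k c) = tuplePrism k (tupleMap f c) := by
  induction k with
  | zero =>
    refine chain_hom_ext (φ := (tupleMap (Prod.map f id)).comp (tuplePrism 0))
      (ψ := (tuplePrism 0).comp (tupleMap f)) (fun v => ?_) c
    simp [tuplePrism_single_zero, tupleMap_tupleCone, tupleMap_single]
  | succ k ih =>
    refine chain_hom_ext (φ := (tupleMap (Prod.map f id)).comp (tuplePrism (k + 1)))
      (ψ := (tuplePrism (k + 1)).comp (tupleMap f)) (fun v => ?_) c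
    simp [tuplePrism_single_succ, tupleMap_tupleCone, tupleMap_single, ih]

theorem tupleBoundary_tuplePrism_zero (c : TupleChain 0 V) :
    tupleBoundary (tuplePrism 0 c) =
      tupleMap (fun v => (v, (1 : unitInterval))) c - tupleMap (fun v => (v, 0)) c := by
  refine chain_hom_ext (φ := tupleBoundary.comp (tuplePrism 0))
    (ψ := tupleMap (fun v => (v, (1 : unitInterval))) - tupleMap (fun v => (v, 0)))
    (fun v => ?_) c
  simp only [AddMonoidHom.comp_apply, AddMonoidHom.sub_apply, tuplePrism_single_zero,
    tupleCone_single, tupleBoundary_cons_zero, tupleMap_single]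
  congr 3
  ext m : 1
  rw [Subsingleton.elim m 0]

/-- The computation common to the lowest degree and the inductive step. The prism is a cone from the
bottom copy of the first vertex; `Q` stands for the prism over the boundary of the face opposite to
that vertex, and the `q j` for its summands. In the lowest degree all of them are zero. -/
theorem tuplePrism_tupleBoundary_aux (v : Fin (k + 2) → V) (Q : TupleChain k (V × unitInterval))
    (q : Fin (k + 1) → TupleChain k (V × unitInterval))
    (hQ : tupleBoundary (tuplePrism k (Finsupp.single (fun m => v m.succ) 1)) =
      Finsupp.single (fun m => (v m.succ, (1 : unitInterval))) 1 -
        Finsupp.single (fun m => (v m.succ, 0)) 1 - Q)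
    (hq : ∀ j : Fin (k + 1), tuplePrism k (Finsupp.single (fun m => v (j.succ.succAbove m)) 1) =
      tupleCone (v 0, 0) (Finsupp.single (fun m => (v (j.succ.succAbove m), 1)) 1 - q j))
    (hqQ : ∑ j : Fin (k + 1), (-1 : ℤ) ^ (j : ℕ) • q j = Q) :
    tupleBoundary (tuplePrism (k + 1) (Finsupp.single v 1)) +
      tuplePrism k (tupleBoundary (Finsupp.single v 1)) =
      Finsupp.single (fun m => (v m, 1)) 1 - Finsupp.single (fun m => (v m, 0)) 1 := by
  have hb : tupleBoundary (Finsupp.single (fun m => (v m, (1 : unitInterval))) 1) =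
      Finsupp.single (fun m => (v m.succ, (1 : unitInterval))) 1 -
      ∑ j : Fin (k + 1), (-1 : ℤ) ^ (j : ℕ) •
        Finsupp.single (fun m => (v (j.succ.succAbove m), (1 : unitInterval))) 1 := by
    rw [tupleBoundary_single, Fin.sum_univ_succ, sub_eq_add_neg, ← Finset.sum_neg_distrib]
    simp [pow_succ]
  have h0 : tupleCone (v 0, (0 : unitInterval)) (Finsupp.single (fun m => (v m.succ, 0)) 1) =
      Finsupp.single (fun m => (v m, 0)) 1 := by
    rw [tupleCone_single]
    congr 1
    ext m : 1
    refine Fin.cases ?_ (fun m => ?_) m <;> simp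
  have hp : tuplePrism k (tupleBoundary (Finsupp.single v 1)) =
      tuplePrism k (Finsupp.single (fun m => v m.succ) 1) -
      tupleCone (v 0, 0) (∑ j : Fin (k + 1), (-1 : ℤ) ^ (j : ℕ) •
        Finsupp.single (fun m => (v (j.succ.succAbove m), (1 : unitInterval))) 1 - Q) := by
    rw [tupleBoundary_single, Fin.sum_univ_succ, map_add, map_sum, sub_eq_add_neg, ← hqQ,
      ← Finset.sum_sub_distrib, map_sum, ← Finset.sum_neg_distrib]
    congr 1
    · simp
    · refine Finset.sum_congr rfl fun j _ => ?_
      rw [map_zsmul, hq, ← smul_sub, map_zsmul, Fin.val_succ, pow_succ, mul_neg_one, neg_smul]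
  rw [tuplePrism_single_succ, tupleBoundary_tupleCone, map_sub, hb, hQ, hp, ← h0]
  simp only [map_sub]
  abel

theorem tupleBoundary_tuplePrism_succ (c : TupleChain (k + 1) V) :
    tupleBoundary (tuplePrism (k + 1) c) + tuplePrism k (tupleBoundary c) =
      tupleMap (fun v => (v, (1 : unitInterval))) c - tupleMap (fun v => (v, 0)) c := by
  refine chain_hom_ext (φ := tupleBoundary.comp (tuplePrism (k + 1)) +
      (tuplePrism k).comp tupleBoundary)
    (ψ := tupleMap (fun v => (v, (1 : unitInterval))) - tupleMap (fun v => (v, 0)))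
    (fun v => ?_) c
  simp only [AddMonoidHom.comp_apply, AddMonoidHom.sub_apply, AddMonoidHom.add_apply,
    tupleMap_single]
  induction k with
  | zero =>
    refine tuplePrism_tupleBoundary_aux v 0 0 ?_ (fun j => ?_) (by simp)
    · rw [tupleBoundary_tuplePrism_zero, tupleMap_single, tupleMap_single, sub_zero]
    · rw [tuplePrism_single_zero]
      simp
  | succ k ih =>
    refine tuplePrism_tupleBoundary_aux v
      (tuplePrism k (tupleBoundary (Finsupp.single (fun m => v m.succ) 1)))
      (fun j => tuplePrism k (Finsupp.single (fun m => v (j.succAbove m).succ) 1)) ?_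
      (fun j => ?_) ?_
    · rw [eq_sub_iff_add_eq]
      exact ih 0 _
    · rw [tuplePrism_single_succ]
      simp
    · rw [tupleBoundary_single, map_sum]
      exact Finset.sum_congr rfl fun j _ => by rw [map_zsmul]

end Prism

end SurgeryFormula

end

noncomputable section

namespace SurgeryFormula

open HasAffineSimplices

/-! ### Subdivision and prisms of singular chains -/

section Singular

variable {X Y Z : Type*} [TopologicalSpace X] [TopologicalSpace Y] [TopologicalSpace Z] {k : ℕ}

/-- The vertices of the standard simplex. -/
def stdTuple (k : ℕ) : TupleChain k (Simplex k) :=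
  Finsupp.single (fun i => stdSimplex.vertex i) 1

/-- The `i`-th face of the standard simplex. -/
def stdFace (i : Fin (k + 2)) : C(Simplex k, Simplex (k + 1)) :=
  ⟨stdSimplex.map i.succAbove, stdSimplex.continuous_map _⟩

theorem face_eq (i : Fin (k + 2)) (σ : SingularSimplex (k + 1) X) :
    face i σ = σ.comp (stdFace i) := rfl

theorem coe_aff_simplex {m : ℕ} (v : Fin (k + 1) → Simplex m) (t : Simplex k) (j : Fin (m + 1)) :
    aff v t j = ∑ i, t i * v i j := by
  change (∑ i, t i • (v i : Fin (m + 1) → ℝ)) j = _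
  simp only [Finset.sum_apply, Pi.smul_apply, smul_eq_mul]

theorem aff_vertex_eq_id (t : Simplex k) :
    aff (fun i => (stdSimplex.vertex i : Simplex k)) t = t := by
  ext j
  rw [coe_aff_simplex, Finset.sum_eq_single j]
  · simp
  · intro i _ h
    simp [h]
  · simp

theorem preservesAffine_map {m : ℕ} (f : Fin (k + 1) → Fin (m + 1)) :
    PreservesAffine (⟨stdSimplex.map f, stdSimplex.continuous_map _⟩ :
      C(Simplex k, Simplex m)) := by
  intro l v t
  ext j
  rw [coe_aff_simplex]
  simp only [ContinuousMap.coe_mk, stdSimplex.map_coe, FunOnFinite.linearMap_apply_apply,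
    coe_aff_simplex, Finset.mul_sum]
  rw [Finset.sum_comm]

theorem preservesAffine_stdFace (i : Fin (k + 2)) : PreservesAffine (stdFace i) :=
  preservesAffine_map _

theorem tupleBoundary_stdTuple :
    tupleBoundary (stdTuple (k + 1)) =
      ∑ i : Fin (k + 2), (-1 : ℤ) ^ (i : ℕ) • tupleMap (stdFace i) (stdTuple k) := by
  rw [stdTuple, tupleBoundary_single]
  refine Finset.sum_congr rfl fun i _ => ?_
  rw [stdTuple, tupleMap_single]
  congr 2
  ext m : 1
  exact (stdSimplex.map_vertex i.succAbove m).symm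

/-- Barycentric subdivision of singular chains. -/
def sd (k : ℕ) : Chain k X →+ Chain k X :=
  Finsupp.liftAddHom fun σ => zmultiplesHom _ (push σ (realize (tupleSd k (stdTuple k))))

/-- The chain homotopy from barycentric subdivision to the identity. -/
def sdHomotopy (k : ℕ) : Chain k X →+ Chain (k + 1) X :=
  Finsupp.liftAddHom fun σ => zmultiplesHom _ (push σ (realize (tupleSdHomotopy k (stdTuple k))))

theorem sd_single (σ : SingularSimplex k X) :
    sd k (Finsupp.single σ 1) = push σ (realize (tupleSd k (stdTuple k))) := by
  simp [sd]

theorem sdHomotopy_single (σ : SingularSimplex k X) :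
    sdHomotopy k (Finsupp.single σ 1) = push σ (realize (tupleSdHomotopy k (stdTuple k))) := by
  simp [sdHomotopy]

/-- Subdivision is transported from the standard simplex, and face inclusions are affine, so the
identity for tuples passes to singular chains by naturality. -/
theorem boundary_sd (c : Chain (k + 1) X) : boundary (sd (k + 1) c) = sd k (boundary c) := by
  refine chain_hom_ext (φ := boundary.comp (sd (k + 1))) (ψ := (sd k).comp boundary)
    (fun σ => ?_) c
  simp only [AddMonoidHom.comp_apply, sd_single, ← push_boundary, ← realize_tupleBoundary,
    tupleBoundary_tupleSd, tupleBoundary_stdTuple, boundary_single, one_smul, map_sum, map_zsmul,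
    face_eq, ← push_comp]
  refine Finset.sum_congr rfl fun i _ => ?_
  rw [push_realize (preservesAffine_stdFace i), tupleMap_tupleSd (preservesAffine_stdFace i)]

theorem realize_stdTuple (σ : SingularSimplex k X) :
    push σ (realize (stdTuple k)) = Finsupp.single σ 1 := by
  rw [stdTuple, realize_single, push_single]
  congr 1
  ext t
  exact congrArg σ (aff_vertex_eq_id t)

theorem boundary_sdHomotopy (c : Chain (k + 1) X) :
    boundary (sdHomotopy (k + 1) c) + sdHomotopy k (boundary c) = c - sd (k + 1) c := by
  refine chain_hom_ext
    (φ := boundary.comp (sdHomotopy (k + 1)) + (sdHomotopy k).comp boundary)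
    (ψ := AddMonoidHom.id _ - sd (k + 1)) (fun σ => ?_) c
  have h := congrArg (fun c => push σ (realize c))
    (tupleBoundary_tupleSdHomotopy k (stdTuple (k + 1)))
  simp only [map_add, map_sub, realize_stdTuple] at h
  simp only [AddMonoidHom.add_apply, AddMonoidHom.comp_apply, AddMonoidHom.sub_apply,
    AddMonoidHom.id_apply, sd_single]
  rw [← h]
  simp only [sdHomotopy_single, ← push_boundary, ← realize_tupleBoundary, tupleBoundary_stdTuple,
    boundary_single, one_smul, map_sum, map_zsmul, face_eq, ← push_comp]
  congr 1
  refine Finset.sum_congr rfl fun i _ => ?_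
  rw [push_realize (preservesAffine_stdFace i),
    tupleMap_tupleSdHomotopy (preservesAffine_stdFace i)]

theorem SupportedIn.sd {S : Set X} {c : Chain k X} (hc : SupportedIn S c) :
    SupportedIn S (SurgeryFormula.sd k c) := by
  refine SupportedIn.map (fun σ hσ => ?_) hc
  rw [sd_single]
  exact supportedIn_push hσ _

theorem SupportedIn.sdHomotopy {S : Set X} {c : Chain k X} (hc : SupportedIn S c) :
    SupportedIn S (SurgeryFormula.sdHomotopy k c) := by
  refine SupportedIn.map (fun σ hσ => ?_) hc
  rw [sdHomotopy_single]
  exact supportedIn_push hσ _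

theorem push_sd (f : C(X, Y)) (c : Chain k X) : push f (sd k c) = sd k (push f c) :=
  chain_hom_ext (φ := (push f).comp (sd k)) (ψ := (sd k).comp (push f))
    (fun σ => by simp [push_single, sd_single, push_comp]) c

/-! ### Iterated subdivision -/

/-- The `n`-fold subdivision. -/
def sdIter (k : ℕ) : ℕ → Chain k X →+ Chain k X
  | 0 => AddMonoidHom.id _
  | n + 1 => (sdIter k n).comp (sd k)

/-- The chain homotopy from the `n`-fold subdivision to the identity. -/
def sdIterHomotopy (k : ℕ) : ℕ → Chain k X →+ Chain (k + 1) X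
  | 0 => 0
  | n + 1 => sdHomotopy k + (sdIterHomotopy k n).comp (sd k)

theorem boundary_sdIter (n : ℕ) (c : Chain (k + 1) X) :
    boundary (sdIter (k + 1) n c) = sdIter k n (boundary c) := by
  induction n generalizing c with
  | zero => rfl
  | succ n ih => simp [sdIter, ih, boundary_sd]

theorem boundary_sdIterHomotopy (n : ℕ) (c : Chain (k + 1) X) :
    boundary (sdIterHomotopy (k + 1) n c) + sdIterHomotopy k n (boundary c) =
      c - sdIter (k + 1) n c := by
  induction n generalizing c with
  | zero => simp [sdIter, sdIterHomotopy]
  | succ n ih =>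
    have h1 := boundary_sdHomotopy c
    have h2 := ih (sd (k + 1) c)
    rw [boundary_sd] at h2
    simp only [sdIter, sdIterHomotopy, AddMonoidHom.add_apply, AddMonoidHom.comp_apply, map_add]
    calc _ = (boundary (sdHomotopy (k + 1) c) + sdHomotopy k (boundary c)) +
        (boundary (sdIterHomotopy (k + 1) n (sd (k + 1) c)) +
          sdIterHomotopy k n (sd k (boundary c))) := by abel
      _ = _ := by rw [h1, h2]; abel

theorem SupportedIn.sdIter {S : Set X} {c : Chain k X} (hc : SupportedIn S c) (n : ℕ) :
    SupportedIn S (SurgeryFormula.sdIter k n c) := by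
  induction n generalizing c with
  | zero => exact hc
  | succ n ih => exact ih hc.sd

theorem SupportedIn.sdIterHomotopy {S : Set X} {c : Chain k X} (hc : SupportedIn S c) (n : ℕ) :
    SupportedIn S (SurgeryFormula.sdIterHomotopy k n c) := by
  induction n generalizing c with
  | zero => exact SupportedIn.zero _
  | succ n ih => exact hc.sdHomotopy.add (ih hc.sd)

theorem push_sdIter (f : C(X, Y)) (n : ℕ) (c : Chain k X) :
    push f (sdIter k n c) = sdIter k n (push f c) := by
  induction n generalizing c with
  | zero => rfl
  | succ n ih => simp [sdIter, ih, push_sd]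

/-! ### Homotopies -/

/-- The prism operator of a homotopy. -/
def prism (H : C(X × unitInterval, Y)) (k : ℕ) : Chain k X →+ Chain (k + 1) Y :=
  Finsupp.liftAddHom fun σ => zmultiplesHom _
    (push (H.comp (σ.prodMap (ContinuousMap.id _))) (realize (tuplePrism k (stdTuple k))))

theorem prism_single (H : C(X × unitInterval, Y)) (σ : SingularSimplex k X) :
    prism H k (Finsupp.single σ 1) =
      push (H.comp (σ.prodMap (ContinuousMap.id _))) (realize (tuplePrism k (stdTuple k))) := by
  simp [prism]

/-- A slice of a homotopy. -/
def slice (H : C(X × unitInterval, Y)) (s : unitInterval) : C(X, Y) :=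
  H.comp ((ContinuousMap.id X).prodMk (ContinuousMap.const X s))

theorem aff_slice {m : ℕ} (v : Fin (k + 1) → Simplex m) (s : unitInterval) (t : Simplex k) :
    aff (fun i => (v i, s)) t = (aff v t, s) := by
  refine Prod.ext rfl (Subtype.ext ?_)
  change ∑ i, t i • (s : ℝ) = s
  rw [← Finset.sum_smul, stdSimplex.sum_eq_one, one_smul]

theorem push_slice (H : C(X × unitInterval, Y)) (s : unitInterval) (σ : SingularSimplex k X) :
    push (H.comp (σ.prodMap (ContinuousMap.id _)))
      (realize (tupleMap (fun v => (v, s)) (stdTuple k))) = Finsupp.single ((slice H s).comp σ) 1 := by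
  rw [stdTuple, tupleMap_single, realize_single, push_single]
  congr 1
  ext t
  simp [aff_slice, slice, aff_vertex_eq_id]

theorem boundary_prism_zero (H : C(X × unitInterval, Y)) (c : Chain 0 X) :
    boundary (prism H 0 c) = push (slice H 1) c - push (slice H 0) c := by
  refine chain_hom_ext (φ := boundary.comp (prism H 0))
    (ψ := push (slice H 1) - push (slice H 0)) (fun σ => ?_) c
  simp only [AddMonoidHom.comp_apply, AddMonoidHom.sub_apply, prism_single, ← push_boundary,
    ← realize_tupleBoundary, tupleBoundary_tuplePrism_zero, map_sub, push_slice, push_single]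

theorem preservesAffine_prodMap {m l : ℕ} {f : C(Simplex m, Simplex l)} (hf : PreservesAffine f) :
    PreservesAffine (f.prodMap (ContinuousMap.id unitInterval)) :=
  fun k v t => Prod.ext (hf k (fun i => (v i).1) t) rfl

theorem boundary_prism (H : C(X × unitInterval, Y)) (c : Chain (k + 1) X) :
    boundary (prism H (k + 1) c) + prism H k (boundary c) =
      push (slice H 1) c - push (slice H 0) c := by
  refine chain_hom_ext (φ := boundary.comp (prism H (k + 1)) + (prism H k).comp boundary)
    (ψ := push (slice H 1) - push (slice H 0)) (fun σ => ?_) c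
  have h := congrArg (fun c => push (H.comp (σ.prodMap (ContinuousMap.id _))) (realize c))
    (tupleBoundary_tuplePrism_succ (stdTuple (k + 1)))
  simp only [map_add, map_sub, push_slice] at h
  simp only [AddMonoidHom.add_apply, AddMonoidHom.comp_apply, AddMonoidHom.sub_apply, push_single]
  rw [← h]
  simp only [prism_single, ← push_boundary, ← realize_tupleBoundary, tupleBoundary_stdTuple,
    boundary_single, one_smul, map_sum, map_zsmul, face_eq]
  congr 1
  refine Finset.sum_congr rfl fun i _ => ?_
  rw [← tupleMap_tuplePrism, show Prod.map (stdFace i) id =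
    (stdFace i).prodMap (ContinuousMap.id unitInterval) from rfl,
    ← push_realize (preservesAffine_prodMap (preservesAffine_stdFace i)), push_comp]
  rfl

theorem SupportedIn.prism {S : Set X} {T : Set Y} {H : C(X × unitInterval, Y)}
    (h : ∀ x ∈ S, ∀ s, H (x, s) ∈ T) {c : Chain k X} (hc : SupportedIn S c) :
    SupportedIn T (SurgeryFormula.prism H k c) := by
  refine SupportedIn.map (fun σ hσ => ?_) hc
  rw [prism_single]
  refine supportedIn_push ?_ _
  rintro _ ⟨⟨t, s⟩, rfl⟩
  exact h _ (hσ ⟨t, rfl⟩) s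

end Singular

end SurgeryFormula

end

noncomputable section

namespace SurgeryFormula

open HasAffineSimplices

/-! ### Small simplices -/

section Small

variable {V W : Type*} {k l : ℕ}

/-- All tuples that occur in a chain have a property. -/
def AllTuples (P : (Fin (k + 1) → V) → Prop) (c : TupleChain k V) : Prop := ∀ v ∈ c.support, P v

theorem AllTuples.add {P : (Fin (k + 1) → V) → Prop} {c d : TupleChain k V} (hc : AllTuples P c)
    (hd : AllTuples P d) : AllTuples P (c + d) := by
  classical
  intro σ h
  rcases Finset.mem_union.1 (Finsupp.support_add h) with h | h
  exacts [hc σ h, hd σ h]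

theorem AllTuples.zsmul {P : (Fin (k + 1) → V) → Prop} {c : TupleChain k V} (hc : AllTuples P c)
    (n : ℤ) : AllTuples P (n • c) := fun σ h => hc σ (Finsupp.support_smul h)

theorem AllTuples.sum {ι : Type*} {P : (Fin (k + 1) → V) → Prop} {c : ι → TupleChain k V}
    {s : Finset ι} (hc : ∀ i ∈ s, AllTuples P (c i)) : AllTuples P (∑ i ∈ s, c i) :=
  Finset.sum_induction c (AllTuples P) (fun _ _ => AllTuples.add) (by simp [AllTuples]) hc

theorem allTuples_single {P : (Fin (k + 1) → V) → Prop} {v : Fin (k + 1) → V} (h : P v) (n : ℤ) :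
    AllTuples P (Finsupp.single v n) := by
  intro τ hτ
  rw [Finset.mem_singleton.1 (Finsupp.support_single_subset hτ)]
  exact h

theorem AllTuples.map {P : (Fin (k + 1) → V) → Prop} {Q : (Fin (l + 1) → W) → Prop}
    {φ : TupleChain k V →+ TupleChain l W} (h : ∀ v, P v → AllTuples Q (φ (Finsupp.single v 1)))
    {c : TupleChain k V} (hc : AllTuples P c) : AllTuples Q (φ c) := by
  have : c = ∑ v ∈ c.support, c v • Finsupp.single v (1 : ℤ) := by
    conv_lhs => rw [← Finsupp.sum_single c, Finsupp.sum]
    simp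
  rw [this, map_sum]
  refine AllTuples.sum fun v hv => ?_
  rw [map_zsmul]
  exact (h v (hc v hv)).zsmul _

theorem coe_aff_mem {m : ℕ} {S : Set (Fin (m + 1) → ℝ)} (hS : Convex ℝ S)
    {v : Fin (k + 1) → Simplex m} (hv : ∀ i, (v i).1 ∈ S) (t : Simplex k) :
    (aff v t).1 ∈ S :=
  hS.sum_mem (fun i _ => stdSimplex.zero_le t i) (stdSimplex.sum_eq_one t) fun i _ => hv i

/-- The difference between `v j` and the barycenter is the average of the k + 2 differences `v j - v
i`. The one with i = j vanishes, so only k + 1 terms of size at most d remain. -/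
theorem dist_center_le {m : ℕ} {v : Fin (k + 2) → Simplex m} {d : ℝ}
    (hd : ∀ i j, dist (v i) (v j) ≤ d) (j : Fin (k + 2)) :
    dist (v j) (center v) ≤ (k + 1 : ℝ) / (k + 2) * d := by
  have hc : (center v : Simplex m).1 =
      ∑ i, ((k + 2 : ℝ)⁻¹) • (v i).1 := by
    change ∑ i, (stdSimplex.barycenter : Simplex (k + 1)) i • (v i).1 = _
    refine Finset.sum_congr rfl fun i _ => ?_
    congr 1
    change ((Fintype.card (Fin (k + 1 + 1)) : ℝ))⁻¹ = _
    rw [Fintype.card_fin]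
    push_cast
    ring
  have hv : (v j).1 = ∑ i : Fin (k + 2), ((k + 2 : ℝ)⁻¹) •
      (v j).1 := by
    rw [← Finset.sum_smul, Finset.sum_const, Finset.card_univ, Fintype.card_fin, nsmul_eq_mul]
    push_cast
    rw [mul_inv_cancel₀ (by positivity), one_smul]
  rw [Subtype.dist_eq, dist_eq_norm, hc]
  nth_rewrite 1 [hv]
  rw [← Finset.sum_sub_distrib]
  simp only [← smul_sub]
  rw [Fin.sum_univ_succAbove _ j, sub_self, smul_zero, zero_add]
  refine (norm_sum_le _ _).trans ?_
  calc _ ≤ ∑ i : Fin (k + 1), (k + 2 : ℝ)⁻¹ * d := by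
        refine Finset.sum_le_sum fun i _ => ?_
        rw [norm_smul, Real.norm_of_nonneg (by positivity), ← dist_eq_norm, ← Subtype.dist_eq]
        exact mul_le_mul_of_nonneg_left (hd _ _) (by positivity)
    _ = _ := by
        rw [Finset.sum_const, Finset.card_univ, Fintype.card_fin, nsmul_eq_mul]
        push_cast
        ring

/-- The tuple lies in the hull of `v` and has mesh at most `d`. -/
def IsSmallTuple {m : ℕ} (S : Set (Fin (m + 1) → ℝ)) (d : ℝ) (w : Fin (k + 1) → Simplex m) : Prop :=
  (∀ i, (w i).1 ∈ S) ∧ ∀ i j, dist (w i) (w j) ≤ d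

/-- Induction on the dimension. The convex set S allows the induction to remember more than the
mesh: for the faces it is intersected with a ball around the barycenter of the whole simplex, which
bounds the distances to the cone point. -/
theorem isSmallTuple_tupleSd {m : ℕ} {S : Set (Fin (m + 1) → ℝ)} (hS : Convex ℝ S) {d : ℝ}
    (hd0 : 0 ≤ d) {v : Fin (k + 1) → Simplex m} (hv : IsSmallTuple S d v) :
    AllTuples (IsSmallTuple S ((k : ℝ) / (k + 1) * d)) (tupleSd k (Finsupp.single v 1)) := by
  induction k generalizing S with
  | zero =>
    refine allTuples_single ⟨hv.1, fun i j => ?_⟩ 1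
    rw [Subsingleton.elim (α := Fin 1) i j]
    simp
  | succ k ih =>
    rw [tupleSd_single, tupleBoundary_single, map_sum, map_sum]
    refine AllTuples.sum fun i _ => ?_
    rw [map_zsmul, map_zsmul]
    refine AllTuples.zsmul ?_ _
    set r : ℝ := (k + 1 : ℝ) / (k + 2) * d with hr
    have hball : Convex ℝ (S ∩ Metric.closedBall (center v : Simplex m).1 r) :=
      hS.inter (convex_closedBall _ _)
    have h1 : IsSmallTuple (S ∩ Metric.closedBall (center v : Simplex m).1 r) d
        fun m => v (i.succAbove m) :=
      ⟨fun j => ⟨hv.1 _, by simpa [Subtype.dist_eq] using dist_center_le hv.2 (i.succAbove j)⟩,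
        fun _ _ => hv.2 _ _⟩
    refine AllTuples.map (P := IsSmallTuple _ ((k : ℝ) / (k + 1) * d)) (fun w hw => ?_)
      (ih hball h1)
    rw [tupleCone_single]
    have hle : (k : ℝ) / (k + 1) * d ≤ r := by
      refine mul_le_mul_of_nonneg_right ?_ hd0
      rw [div_le_div_iff₀ (by positivity) (by positivity)]
      nlinarith
    have hr' : ((k + 1 : ℕ) : ℝ) / ((k + 1 : ℕ) + 1) * d = r := by
      rw [hr]; push_cast; ring
    rw [hr']
    have hr0 : 0 ≤ r := by positivity
    have hcw (j) : dist (w j) (center v) ≤ r := by simpa [Subtype.dist_eq] using (hw.1 j).2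
    refine allTuples_single ⟨fun j => ?_, fun j j' => ?_⟩ 1
    · refine Fin.cases ?_ (fun j => ?_) j
      · exact coe_aff_mem hS hv.1 _
      · exact (hw.1 j).1
    · refine Fin.cases ?_ (fun j => ?_) j <;> refine Fin.cases ?_ (fun j' => ?_) j'
      · simpa using hr0
      · simpa [dist_comm] using hcw j'
      · simpa using hcw j
      · simpa using (hw.2 j j').trans hle

theorem isSmallTuple_iterate {m : ℕ} {d : ℝ} (hd0 : 0 ≤ d) {c : TupleChain k (Simplex m)}
    (hc : AllTuples (IsSmallTuple Set.univ d) c) (n : ℕ) :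
    AllTuples (IsSmallTuple Set.univ (((k : ℝ) / (k + 1)) ^ n * d)) ((tupleSd k)^[n] c) := by
  induction n with
  | zero => simpa using hc
  | succ n ih =>
    rw [Function.iterate_succ_apply', pow_succ', mul_assoc]
    exact AllTuples.map (fun v hv => isSmallTuple_tupleSd convex_univ (by positivity) hv) ih

theorem preservesAffine_aff {m : ℕ} (v : Fin (k + 1) → Simplex m) : PreservesAffine (aff v) := by
  intro l w t
  ext j
  simp only [coe_aff_simplex, Finset.sum_mul, Finset.mul_sum]
  rw [Finset.sum_comm]
  exact Finset.sum_congr rfl fun i _ => Finset.sum_congr rfl fun j _ => by ring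

theorem sd_realize {m : ℕ} (c : TupleChain k (Simplex m)) :
    sd k (realize c) = realize (tupleSd k c) := by
  refine chain_hom_ext (φ := (sd k).comp realize) (ψ := realize.comp (tupleSd k)) (fun v => ?_) c
  simp only [AddMonoidHom.comp_apply, realize_single, sd_single,
    push_realize (preservesAffine_aff v), tupleMap_tupleSd (preservesAffine_aff v), stdTuple,
    tupleMap_single, aff_vertex]

theorem sdIter_realize {m : ℕ} (c : TupleChain k (Simplex m)) (n : ℕ) :
    sdIter k n (realize c) = realize ((tupleSd k)^[n] c) := by
  induction n generalizing c with
  | zero => rfl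
  | succ n ih => simp [sdIter, sd_realize, ih]

theorem sdIter_single {X : Type*} [TopologicalSpace X] (σ : SingularSimplex k X) (n : ℕ) :
    sdIter k n (Finsupp.single σ 1) = push σ (realize ((tupleSd k)^[n] (stdTuple k))) := by
  rw [← sdIter_realize, push_sdIter, realize_stdTuple]

theorem dist_simplex_le {m : ℕ} (x y : Simplex m) : dist x y ≤ 1 := by
  rw [Subtype.dist_eq, dist_pi_le_iff zero_le_one]
  intro i
  rw [Real.dist_eq, abs_sub_le_iff]
  have h1 := stdSimplex.zero_le x i
  have h2 := stdSimplex.zero_le y i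
  have h3 := stdSimplex.le_one x i
  have h4 := stdSimplex.le_one y i
  exact ⟨by linarith! [h2, h3], by linarith! [h1, h4]⟩

/-- Iterated subdivision of a chain covered by two open sets splits. -/
theorem exists_sdIter_split {X : Type*} [TopologicalSpace X] {U V : Set X} (hU : IsOpen U)
    (hV : IsOpen V) {c : Chain k X} (hc : SupportedIn (U ∪ V) c) :
    ∃ n, ∃ c₁ c₂, sdIter k n c = c₁ + c₂ ∧ SupportedIn U c₁ ∧ SupportedIn V c₂ := by
  -- A single number of subdivisions is not additive in the chain; a splitting for all large numbers
  -- is, since two bounds have a common maximum.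
  suffices h : ∃ N, ∀ n ≥ N, ∃ c₁ c₂, sdIter k n c = c₁ + c₂ ∧
      SupportedIn U c₁ ∧ SupportedIn V c₂ by
    obtain ⟨N, hN⟩ := h
    exact ⟨N, hN N le_rfl⟩
  refine SupportedIn.induction (p := fun c => ∃ N, ∀ n ≥ N, ∃ c₁ c₂, sdIter k n c = c₁ + c₂ ∧
      SupportedIn U c₁ ∧ SupportedIn V c₂) ?_ ?_ ?_ hc
  · exact ⟨0, fun n _ => ⟨0, 0, by simp, SupportedIn.zero _, SupportedIn.zero _⟩⟩
  · rintro c d ⟨N, hN⟩ ⟨M, hM⟩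
    refine ⟨max N M, fun n hn => ?_⟩
    obtain ⟨c₁, c₂, h, h1, h2⟩ := hN n (le_trans (le_max_left _ _) hn)
    obtain ⟨d₁, d₂, h', h1', h2'⟩ := hM n (le_trans (le_max_right _ _) hn)
    refine ⟨c₁ + d₁, c₂ + d₂, ?_, h1.add h1', h2.add h2'⟩
    rw [map_add, h, h']
    abel
  · intro σ a hσ
    have hcov : (Set.univ : Set (Simplex k)) ⊆ ⋃ b : Bool, σ ⁻¹' (if b then U else V) := by
      intro t _
      rcases hσ ⟨t, rfl⟩ with h | h
      · exact Set.mem_iUnion.2 ⟨true, h⟩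
      · exact Set.mem_iUnion.2 ⟨false, h⟩
    -- Once the mesh is below a Lebesgue number of the cover, every small simplex lies in the ball
    -- around its first vertex, hence in one of the two open sets.
    obtain ⟨δ, hδ, hleb⟩ := lebesgue_number_lemma_of_metric isCompact_univ
      (fun b => IsOpen.preimage σ.continuous (by cases b <;> simpa)) hcov
    have hlim : Filter.Tendsto (fun n : ℕ => ((k : ℝ) / (k + 1)) ^ n) Filter.atTop (nhds 0) :=
      tendsto_pow_atTop_nhds_zero_of_lt_one (by positivity)
        ((div_lt_one (by positivity)).2 (by linarith))
    obtain ⟨N, hN⟩ := Filter.eventually_atTop.1 (hlim.eventually (gt_mem_nhds hδ))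
    refine ⟨N, fun n hn => ?_⟩
    have hsmall : AllTuples (IsSmallTuple Set.univ (((k : ℝ) / (k + 1)) ^ n * 1))
        ((tupleSd k)^[n] (stdTuple k)) :=
      isSmallTuple_iterate zero_le_one
        (allTuples_single ⟨fun _ => Set.mem_univ _, fun _ _ => dist_simplex_le _ _⟩ 1) n
    rw [show Finsupp.single σ a = a • Finsupp.single σ (1 : ℤ) by simp, map_zsmul, sdIter_single]
    have key : ∀ c : TupleChain k (Simplex k),
        AllTuples (IsSmallTuple Set.univ (((k : ℝ) / (k + 1)) ^ n * 1)) c →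
        ∃ c₁ c₂, push σ (realize c) = c₁ + c₂ ∧ SupportedIn U c₁ ∧ SupportedIn V c₂ := by
      intro c hc
      rw [← Finsupp.sum_single c, Finsupp.sum]
      refine Finset.sum_induction _ (fun c => ∃ c₁ c₂, push σ (realize c) = c₁ + c₂ ∧
        SupportedIn U c₁ ∧ SupportedIn V c₂) ?_ ?_ ?_
      · rintro c d ⟨c₁, c₂, h, h1, h2⟩ ⟨d₁, d₂, h', h1', h2'⟩
        refine ⟨c₁ + d₁, c₂ + d₂, ?_, h1.add h1', h2.add h2'⟩
        rw [map_add, map_add, h, h']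
        abel
      · exact ⟨0, 0, by simp, SupportedIn.zero _, SupportedIn.zero _⟩
      · intro v hv
        rw [realize_single, push_single]
        obtain ⟨b, hb⟩ := hleb (v 0) (Set.mem_univ _)
        have hr : Set.range (σ.comp (aff v)) ⊆ if b then U else V := by
          rintro _ ⟨t, rfl⟩
          refine hb ?_
          have := coe_aff_mem (convex_ball (v 0).1 δ) (v := v)
            (fun i => ?_) t
          · simpa [Subtype.dist_eq] using this
          · have h1 := (hc v hv).2 i 0
            rw [Subtype.dist_eq, mul_one] at h1
            exact lt_of_le_of_lt h1 (hN n hn)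
        cases b with
        | true => exact ⟨_, 0, (add_zero _).symm, supportedIn_single hr _, SupportedIn.zero _⟩
        | false => exact ⟨0, _, (zero_add _).symm, SupportedIn.zero _, supportedIn_single hr _⟩
    obtain ⟨c₁, c₂, h, h1, h2⟩ := key _ hsmall
    exact ⟨a • c₁, a • c₂, by rw [h, smul_add], h1.zsmul _, h2.zsmul _⟩

end Small

end SurgeryFormula

end

noncomputable section

namespace SurgeryFormula

open HasAffineSimplices

/-! ### Relative homology -/

section Relative

variable {X Y : Type*} [TopologicalSpace X] [TopologicalSpace Y] {k : ℕ}

/-- The chain `c` is a boundary modulo chains in the complement of `K`. -/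
def TrivialOn (K : Set X) (c : Chain k X) : Prop :=
  ∃ e : Chain (k + 1) X, SupportedIn Kᶜ (c - boundary e)

theorem SupportedIn.trivialOn {K : Set X} {c : Chain k X} (hc : SupportedIn Kᶜ c) :
    TrivialOn K c := ⟨0, by simpa using hc⟩

theorem trivialOn_boundary (K : Set X) (e : Chain (k + 1) X) : TrivialOn K (boundary e) :=
  ⟨e, by simpa using SupportedIn.zero _⟩

theorem TrivialOn.add {K : Set X} {c d : Chain k X} (hc : TrivialOn K c) (hd : TrivialOn K d) :
    TrivialOn K (c + d) := by
  obtain ⟨e, he⟩ := hc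
  obtain ⟨f, hf⟩ := hd
  refine ⟨e + f, ?_⟩
  rw [map_add, add_sub_add_comm]
  exact he.add hf

theorem TrivialOn.neg {K : Set X} {c : Chain k X} (hc : TrivialOn K c) : TrivialOn K (-c) := by
  obtain ⟨e, he⟩ := hc
  refine ⟨-e, ?_⟩
  rw [map_neg, ← neg_sub']
  exact he.neg

theorem TrivialOn.sub {K : Set X} {c d : Chain k X} (hc : TrivialOn K c) (hd : TrivialOn K d) :
    TrivialOn K (c - d) := by
  rw [sub_eq_add_neg]
  exact hc.add hd.neg

theorem TrivialOn.sum {ι : Type*} {K : Set X} {c : ι → Chain k X} {s : Finset ι}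
    (hc : ∀ i ∈ s, TrivialOn K (c i)) : TrivialOn K (∑ i ∈ s, c i) :=
  Finset.sum_induction c (TrivialOn K) (fun _ _ => TrivialOn.add)
    (SupportedIn.zero _).trivialOn hc

theorem TrivialOn.mono {K L : Set X} {c : Chain k X} (hc : TrivialOn L c) (h : K ⊆ L) :
    TrivialOn K c := by
  obtain ⟨e, he⟩ := hc
  exact ⟨e, he.mono (Set.compl_subset_compl.2 h)⟩

theorem TrivialOn.push {f : C(X, Y)} {K : Set X} {L : Set Y} (h : ∀ x, f x ∈ L → x ∈ K)
    {c : Chain k X} (hc : TrivialOn K c) : TrivialOn L (push f c) := by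
  obtain ⟨e, he⟩ := hc
  refine ⟨SurgeryFormula.push f e, ?_⟩
  rw [← push_boundary, ← map_sub]
  exact SupportedIn.push (S := Kᶜ) (T := Lᶜ) (f := f) (fun x hx hfx => hx (h x hfx)) he

theorem TrivialOn.symm {K : Set X} {c d : Chain k X} (h : TrivialOn K (c - d)) :
    TrivialOn K (d - c) := by
  rw [← neg_sub]
  exact h.neg

theorem TrivialOn.trans {K : Set X} {c d e : Chain k X} (h : TrivialOn K (c - d))
    (h' : TrivialOn K (d - e)) : TrivialOn K (c - e) := by
  rw [← sub_add_sub_cancel c d e]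
  exact h.add h'

/-- The Mayer–Vietoris argument for relative classes. -/
theorem TrivialOn.union {K₁ K₂ : Set X} (hK₁ : IsClosed K₁) (hK₂ : IsClosed K₂) {c : Chain k X}
    (h₁ : TrivialOn K₁ c) (h₂ : TrivialOn K₂ c)
    (hJ : ∀ d : Chain (k + 1) X, SupportedIn (K₁ ∩ K₂)ᶜ (boundary d) → TrivialOn (K₁ ∩ K₂) d) :
    TrivialOn (K₁ ∪ K₂) c := by
  obtain ⟨e₁, h₁⟩ := h₁
  obtain ⟨e₂, h₂⟩ := h₂
  have hb : boundary (e₁ - e₂) = (c - boundary e₂) - (c - boundary e₁) := by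
    rw [map_sub]; abel
  -- The two bounding chains differ by a cycle relative to the complement of the intersection. By
  -- `hJ` it is a boundary plus a chain `h` off the intersection, which after subdivision splits
  -- into a part `a₁` off K₁ and a part `a₂` off K₂.
  obtain ⟨g, hg⟩ := hJ (e₁ - e₂) (by
    rw [hb]
    exact (h₂.mono (Set.compl_subset_compl.2 Set.inter_subset_right)).sub
      (h₁.mono (Set.compl_subset_compl.2 Set.inter_subset_left)))
  set r₁ := c - boundary e₁ with hr₁
  set r₂ := c - boundary e₂ with hr₂
  set h := e₁ - e₂ - boundary g with hh
  rw [Set.compl_inter] at hg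
  obtain ⟨n, a₁, a₂, hS, ha₁, ha₂⟩ := exists_sdIter_split hK₁.isOpen_compl hK₂.isOpen_compl hg
  have hbh : boundary h = r₂ - r₁ := by rw [hh, map_sub, boundary_boundary, sub_zero, hb]
  have hD := boundary_sdIterHomotopy n h
  rw [hbh, hS, map_sub (sdIterHomotopy k n)] at hD
  -- Corrected by the two parts and by the subdivision homotopies, the two bounding chains acquire
  -- the same boundary; so one chain works for both sets at once.
  have e₁₂ : boundary (e₁ - a₁ + sdIterHomotopy k n r₁) =
      boundary (e₂ + a₂ + sdIterHomotopy k n r₂) := by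
    have : e₁ - a₁ + sdIterHomotopy k n r₁ = e₂ + a₂ + sdIterHomotopy k n r₂ +
        boundary (g + sdIterHomotopy (k + 1) n h) := by
      rw [map_add _ g, eq_sub_of_add_eq hD, hh]
      abel
    rw [this, map_add _ (e₂ + a₂ + sdIterHomotopy k n r₂), boundary_boundary, add_zero]
  refine ⟨e₁ - a₁ + sdIterHomotopy k n r₁, ?_⟩
  rw [Set.compl_union]
  refine SupportedIn.inter ?_ ?_
  · have : c - boundary (e₁ - a₁ + sdIterHomotopy k n r₁) =
        r₁ + boundary a₁ - boundary (sdIterHomotopy k n r₁) := by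
      rw [map_add, map_sub, hr₁]; abel
    rw [this]
    exact (h₁.add ha₁.boundary).sub (h₁.sdIterHomotopy n).boundary
  · have : c - boundary (e₂ + a₂ + sdIterHomotopy k n r₂) =
        r₂ - boundary a₂ - boundary (sdIterHomotopy k n r₂) := by
      rw [map_add, map_add, hr₂]; abel
    rw [e₁₂, this]
    exact (h₂.sub ha₂.boundary).sub (h₂.sdIterHomotopy n).boundary

/-- Excision, surjectivity: a relative cycle is represented in a neighbourhood. -/
theorem exists_excise {K U : Set X} (hK : IsClosed K) (hU : IsOpen U) (hKU : K ⊆ U)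
    {c : Chain (k + 1) X} (hc : SupportedIn Kᶜ (boundary c)) :
    ∃ d, SupportedIn U d ∧ SupportedIn Kᶜ (boundary d) ∧ TrivialOn K (c - d) := by
  have hcov : U ∪ Kᶜ = Set.univ :=
    Set.eq_univ_of_forall fun x => (em (x ∈ K)).imp (@hKU x) id
  obtain ⟨n, c₁, c₂, h, h₁, h₂⟩ := exists_sdIter_split (c := c) hU hK.isOpen_compl
    (by rw [hcov]; exact supportedIn_univ c)
  have hD := boundary_sdIterHomotopy n c
  rw [h] at hD
  refine ⟨c₁, h₁, ?_, sdIterHomotopy (k + 1) n c, ?_⟩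
  · have : boundary c₁ = sdIter k n (boundary c) - boundary c₂ := by
      rw [← boundary_sdIter, h, map_add, add_sub_cancel_right]
    rw [this]
    exact (hc.sdIter n).sub h₂.boundary
  · have : c - c₁ - boundary (sdIterHomotopy (k + 1) n c) =
        c₂ + sdIterHomotopy k n (boundary c) := by
      rw [eq_sub_of_add_eq hD]; abel
    rw [this]
    exact h₂.add (hc.sdIterHomotopy n)

/-- Excision, injectivity: a homology can be chosen in a neighbourhood. -/
theorem TrivialOn.excise {K U : Set X} (hK : IsClosed K) (hU : IsOpen U) (hKU : K ⊆ U)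
    {c : Chain k X} (hc : SupportedIn U c) (h : TrivialOn K c) :
    ∃ e, SupportedIn U e ∧ SupportedIn Kᶜ (c - boundary e) := by
  obtain ⟨e, he⟩ := h
  have hcov : U ∪ Kᶜ = Set.univ :=
    Set.eq_univ_of_forall fun x => (em (x ∈ K)).imp (@hKU x) id
  obtain ⟨n, e₁, e₂, h, h₁, h₂⟩ := exists_sdIter_split (c := e) hU hK.isOpen_compl
    (by rw [hcov]; exact supportedIn_univ e)
  set r := c - boundary e with hr
  have hD := congrArg boundary (boundary_sdIterHomotopy n e)
  rw [h, show boundary e = c - r by rw [hr]; abel] at hD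
  simp only [map_add, map_sub, boundary_boundary, zero_add] at hD
  refine ⟨e₁ + sdIterHomotopy k n c, h₁.add (hc.sdIterHomotopy n), ?_⟩
  have : c - boundary (e₁ + sdIterHomotopy k n c) =
      r + boundary e₂ - boundary (sdIterHomotopy k n r) := by
    rw [map_add, eq_add_of_sub_eq hD, hr]
    abel
  rw [this]
  exact (he.add h₂.boundary).sub (he.sdIterHomotopy n).boundary

/-- By excision the bounding chain can be taken inside the open range, where it comes from the
source. -/
theorem TrivialOn.of_push {f : C(Y, X)} (hf : Topology.IsOpenEmbedding f) {K : Set Y}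
    (hK : IsClosed (f '' K)) {c : Chain k Y} (h : TrivialOn (f '' K) (SurgeryFormula.push f c)) :
    TrivialOn K c := by
  obtain ⟨e, he, hr⟩ := TrivialOn.excise hK hf.isOpen_range (Set.image_subset_range _ _)
    (supportedIn_push subset_rfl c) h
  obtain ⟨e, rfl⟩ := SupportedIn.exists_push hf.isEmbedding he
  rw [← push_boundary, ← map_sub] at hr
  exact ⟨e, (hr.of_push hf.injective).mono fun x hx hxK => hx ⟨x, hxK, rfl⟩⟩

/-- A chain without boundary; every chain of degree zero counts. -/
def IsCycle : ∀ {k : ℕ}, Chain k X → Prop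
  | 0, _ => True
  | _ + 1, c => boundary c = 0

theorem isCycle_boundary (c : Chain (k + 1) X) : IsCycle (boundary c) := by
  cases k with
  | zero => trivial
  | succ k => exact boundary_boundary c

theorem IsCycle.of_push {f : C(X, Y)} (hf : Function.Injective f) {c : Chain k X}
    (h : IsCycle (push f c)) : IsCycle c := by
  cases k with
  | zero => trivial
  | succ k =>
    refine push_injective hf ?_
    rw [push_boundary, map_zero]
    exact h

theorem IsCycle.exists_homotopy {c : Chain k X} (hc : IsCycle c) (H : C(X × unitInterval, Y))
    {S : Set X} {T : Set Y} (hS : SupportedIn S c) (h : ∀ x ∈ S, ∀ s, H (x, s) ∈ T) :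
    ∃ P, SupportedIn T P ∧ boundary P = push (slice H 1) c - push (slice H 0) c := by
  refine ⟨prism H k c, hS.prism h, ?_⟩
  cases k with
  | zero => exact boundary_prism_zero H c
  | succ k =>
    have := boundary_prism H c
    rwa [show boundary c = 0 from hc, map_zero, add_zero] at this

end Relative

/-! ### Linear homotopies -/

section Linear

variable {X E : Type*} [TopologicalSpace X] [NormedAddCommGroup E] [NormedSpace ℝ E] {k : ℕ}

/-- The straight line homotopy. -/
def lineHomotopy (f g : C(X, E)) : C(X × unitInterval, E) :=
  ⟨fun p => (1 - (p.2 : ℝ)) • f p.1 + (p.2 : ℝ) • g p.1, by fun_prop⟩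

theorem slice_lineHomotopy_zero (f g : C(X, E)) : slice (lineHomotopy f g) 0 = f := by
  ext x
  simp [slice, lineHomotopy]

theorem slice_lineHomotopy_one (f g : C(X, E)) : slice (lineHomotopy f g) 1 = g := by
  ext x
  simp [slice, lineHomotopy]

theorem IsCycle.exists_line {c : Chain k X} (hc : IsCycle c) (f g : C(X, E))
    {S : Set X} {T : Set E} (hS : SupportedIn S c)
    (h : ∀ x ∈ S, ∀ s : ℝ, 0 ≤ s → s ≤ 1 → (1 - s) • f x + s • g x ∈ T) :
    ∃ P, SupportedIn T P ∧ boundary P = push g c - push f c := by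
  obtain ⟨P, hP, hb⟩ := hc.exists_homotopy (lineHomotopy f g) hS
    fun x hx s => h x hx s s.2.1 s.2.2
  exact ⟨P, hP, by rw [hb, slice_lineHomotopy_one, slice_lineHomotopy_zero]⟩

/-- A cycle of positive degree supported at a point bounds there. -/
theorem exists_boundary_const {Y : Type*} [TopologicalSpace Y] (p : Y) (c : Chain (k + 1) X)
    (hc : boundary c = 0) :
    ∃ w : Chain (k + 2) Y, SupportedIn {p} w ∧ boundary w = push (ContinuousMap.const X p) c := by
  have hpush (l : ℕ) (c : Chain l X) : ∃ m : ℤ, push (ContinuousMap.const X p) c =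
      Finsupp.single (ContinuousMap.const (Simplex l) p) m := by
    refine SupportedIn.induction (p := fun c => ∃ m : ℤ, push (ContinuousMap.const X p) c =
      Finsupp.single (ContinuousMap.const (Simplex l) p) m) ⟨0, by simp⟩ ?_ ?_ (supportedIn_univ c)
    · rintro c d ⟨m, hm⟩ ⟨n, hn⟩
      exact ⟨m + n, by rw [map_add, hm, hn, Finsupp.single_add]⟩
    · intro σ n _
      exact ⟨n, by rw [push_single]; rfl⟩
  have hbd (l : ℕ) (m : ℤ) : boundary (Finsupp.single (ContinuousMap.const (Simplex (l + 1)) p) m) =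
      Finsupp.single (ContinuousMap.const (Simplex l) p) (m * if Even l then 0 else 1) := by
    rw [boundary_single]
    have (i : Fin (l + 2)) : face i (ContinuousMap.const (Simplex (l + 1)) p) =
        ContinuousMap.const (Simplex l) p := rfl
    simp only [this, ← Finset.sum_smul, Fin.sum_neg_one_pow]
    have h2 : Even (l + 2) ↔ Even l := by simp [Nat.even_add]
    by_cases h : Even l <;> simp [h2, h]
  obtain ⟨m, hm⟩ := hpush _ c
  -- A constant simplex of degree k + 2 has k + 3 faces. If k is even, the alternating sum of these
  -- faces is one constant simplex, which fills the cycle; if k is odd, a constant (k + 1)-simplex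
  -- is not a cycle, so its coefficient must vanish.
  by_cases hk : Even k
  · refine ⟨Finsupp.single (ContinuousMap.const _ p) m, supportedIn_single (by simp) _, ?_⟩
    rw [hm, hbd, if_neg (by simpa [Nat.even_add_one] using hk), mul_one]
  · have h0 := congrArg (push (ContinuousMap.const X p)) hc
    rw [push_boundary, hm, hbd, if_neg hk, map_zero, mul_one, Finsupp.single_eq_zero] at h0
    exact ⟨0, SupportedIn.zero _, by rw [hm, h0]; simp⟩

/-- Cycles in star-shaped sets bound. -/
theorem exists_boundary_of_star {U : Set E} {p : E} (hp : p ∈ U)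
    (hU : ∀ x ∈ U, ∀ s : ℝ, 0 ≤ s → s ≤ 1 → (1 - s) • p + s • x ∈ U) {c : Chain (k + 1) E}
    (hc : boundary c = 0) (hcU : SupportedIn U c) :
    ∃ w, SupportedIn U w ∧ boundary w = c := by
  obtain ⟨P, hP, hb⟩ := IsCycle.exists_line (c := c) hc (ContinuousMap.const E p)
    (ContinuousMap.id E) hcU hU
  obtain ⟨w, hw, hbw⟩ := exists_boundary_const p c hc
  refine ⟨P + w, hP.add (hw.mono (by simpa using hp)), ?_⟩
  rw [map_add, hb, hbw, push_id, sub_add_cancel]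

theorem exists_boundary_of_cycle {c : Chain (k + 1) E} (hc : boundary c = 0) :
    ∃ w, boundary w = c := by
  obtain ⟨w, -, hw⟩ := exists_boundary_of_star (Set.mem_univ (0 : E))
    (fun _ _ _ _ _ => Set.mem_univ _) hc (supportedIn_univ c)
  exact ⟨w, hw⟩

/-- In a vector space cycles of positive degree bound, so a relative class depends only on the
boundary of the chain representing it. -/
theorem trivialOn_of_boundary_eq {K : Set E} {c c' : Chain (k + 1) E} (hc' : SupportedIn Kᶜ c')
    (h : boundary c' = boundary c) : TrivialOn K c := by
  obtain ⟨w, hw⟩ := exists_boundary_of_cycle (c := c - c') (by rw [map_sub, h, sub_self])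
  exact ⟨w, by rw [hw]; simpa using hc'⟩

theorem TrivialOn.exists_boundary_eq {X : Type*} [TopologicalSpace X] {K : Set X}
    {c : Chain (k + 1) X} (h : TrivialOn K c) :
    ∃ c', SupportedIn Kᶜ c' ∧ boundary c' = boundary c := by
  obtain ⟨e, he⟩ := h
  exact ⟨_, he, by rw [map_sub, boundary_boundary, sub_zero]⟩

/-- Triviality at a point of a convex bounded set spreads to the set. -/
theorem TrivialOn.of_mem_convex {K : Set E} (hK : Convex ℝ K) (hKb : Bornology.IsBounded K) {x : E}
    (hx : x ∈ K) {c : Chain (k + 1) E} (hc : SupportedIn Kᶜ (boundary c)) (h : TrivialOn {x} c) :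
    TrivialOn K c := by
  obtain ⟨c', hc', hbc⟩ := h.exists_boundary_eq
  obtain ⟨d, hd⟩ := hc'.exists_incl
  obtain ⟨z, hz⟩ := (hc.mono (Set.compl_subset_compl.2 (Set.singleton_subset_iff.2 hx))).exists_incl
  obtain ⟨R, hR, hKR⟩ := hKb.subset_ball_lt 0 x
  -- This pushes every point away from x by the distance R, and so out of K. The segment from a
  -- point outside K to its image stays outside K, because K is convex and contains x.
  let r : C(({x}ᶜ : Set E), E) := ⟨fun y => x + (1 + R / ‖(y : E) - x‖) • ((y : E) - x), by
    have h0 (y : ({x}ᶜ : Set E)) : ‖(y : E) - x‖ ≠ 0 := norm_ne_zero_iff.2 (sub_ne_zero.2 y.2)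
    fun_prop (disch := exact h0 _)⟩
  have hrK (y) : r y ∈ Kᶜ := by
    intro hy
    have h1 := hKR hy
    have h0 : 0 < ‖(y : E) - x‖ := norm_pos_iff.2 (sub_ne_zero.2 y.2)
    rw [Metric.mem_ball, dist_eq_norm] at h1
    have h2 : r y - x = (1 + R / ‖(y : E) - x‖) • ((y : E) - x) := by simp [r]
    rw [h2, norm_smul, Real.norm_of_nonneg (by positivity)] at h1
    have h3 : (1 + R / ‖(y : E) - x‖) * ‖(y : E) - x‖ = ‖(y : E) - x‖ + R := by field_simp
    linarith
  have hzc : IsCycle z := by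
    refine IsCycle.of_push (incl_injective _) ?_
    rw [hz]
    exact isCycle_boundary c
  have hzK : SupportedIn (incl ({x}ᶜ : Set E) ⁻¹' Kᶜ) z :=
    SupportedIn.of_push (incl_injective _) (by rwa [hz])
  obtain ⟨P, hP, hbP⟩ := hzc.exists_line (incl _) r hzK (T := Kᶜ) (by
    intro y hy s hs0 hs1 hmem
    have h0 : 0 < ‖(y : E) - x‖ := norm_pos_iff.2 (sub_ne_zero.2 y.2)
    have h1 : (1 - s) • incl _ y + s • r y = x + (1 + s * (R / ‖(y : E) - x‖)) • ((y : E) - x) := by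
      simp only [incl, r, ContinuousMap.coe_mk]
      module
    rw [h1] at hmem
    have hl : 0 < 1 + s * (R / ‖(y : E) - x‖) := by positivity
    refine hy ?_
    have h2 := hK hx hmem (a := 1 - (1 + s * (R / ‖(y : E) - x‖))⁻¹)
      (b := (1 + s * (R / ‖(y : E) - x‖))⁻¹) ?_ (by positivity) (by ring)
    · convert h2 using 1
      rw [smul_add, smul_smul, inv_mul_cancel₀ hl.ne']
      simp only [incl, ContinuousMap.coe_mk]
      module
    · rw [sub_nonneg]
      refine inv_le_one_of_one_le₀ ?_
      have : 0 ≤ s * (R / ‖(y : E) - x‖) := by positivity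
      linarith)
  refine trivialOn_of_boundary_eq (c' := SurgeryFormula.push r d - P)
    (SupportedIn.sub (supportedIn_push (Set.range_subset_iff.2 hrK) d) hP) ?_
  have hzd : z = boundary d := by
    refine push_injective (incl_injective _) ?_
    rw [hz, push_boundary, hd, hbc]
  rw [map_sub, hbP, ← push_boundary, ← hzd, hz]
  abel

end Linear

end SurgeryFormula

end

noncomputable section

namespace SurgeryFormula

open HasAffineSimplices

/-! ### Euclidean space -/

section Euclidean

variable {n k : ℕ}

/-- The complement of a closed half-line on the first axis. -/
def slitSpace (ε : ℝ) : Set (Fin (n + 1) → ℝ) := {x | ¬ (Fin.tail x = 0 ∧ ε * x 0 ≤ 0)}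

theorem isOpen_slitSpace (ε : ℝ) : IsOpen (slitSpace ε : Set (Fin (n + 1) → ℝ)) := by
  have : slitSpace ε = ({x | Fin.tail x = 0} ∩ {x | ε * x 0 ≤ 0} : Set (Fin (n + 1) → ℝ))ᶜ := rfl
  rw [this]
  refine (IsClosed.inter (isClosed_eq (continuous_pi fun i => continuous_apply i.succ)
    continuous_const) (isClosed_le (by fun_prop) continuous_const)).isOpen_compl

/-- The complement of a closed half-line starting at the origin is star-shaped about a point of the
opposite half-line. -/
theorem exists_boundary_slitSpace {ε : ℝ} (hε : ε * ε = 1) {c : Chain (k + 1) (Fin (n + 1) → ℝ)}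
    (hc : boundary c = 0) (hcU : SupportedIn (slitSpace ε) c) :
    ∃ w, SupportedIn (slitSpace ε) w ∧ boundary w = c := by
  refine exists_boundary_of_star (p := Fin.cons ε 0) ?_ ?_ hc hcU
  · rintro ⟨-, h⟩
    rw [Fin.cons_zero] at h
    linarith
  · rintro x hx s hs0 hs1 ⟨h1, h2⟩
    have h2' : (1 - s) + s * (ε * x 0) ≤ 0 := by
      simp only [Pi.add_apply, Pi.smul_apply, smul_eq_mul, Fin.cons_zero] at h2
      nlinarith
    rcases hs0.eq_or_lt with rfl | hs
    · norm_num at h2'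
    · refine hx ⟨?_, ?_⟩
      · ext i
        have := congrFun h1 i
        simp only [Fin.tail, Pi.add_apply, Pi.smul_apply, smul_eq_mul, Fin.cons_succ,
          Pi.zero_apply, mul_zero, zero_add, mul_eq_zero] at this
        exact this.resolve_left hs.ne'
      · by_contra! h
        nlinarith [mul_pos hs h]

/-- Dropping the first coordinate. -/
def tailMap (n : ℕ) : C(Fin (n + 1) → ℝ, Fin n → ℝ) :=
  ⟨Fin.tail, continuous_pi fun i => continuous_apply i.succ⟩

/-- The inclusion as the hyperplane of vanishing first coordinate. -/
def consMap (n : ℕ) : C(Fin n → ℝ, Fin (n + 1) → ℝ) :=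
  ⟨fun x => (Fin.cons 0 x : Fin (n + 1) → ℝ), by
    refine continuous_pi fun i => Fin.cases ?_ (fun i => ?_) i
    · exact continuous_const
    · exact continuous_apply i⟩

/-- The two slit spaces are contractible, cover the complement of the origin, and meet in the
complement of the first axis, which retracts to the punctured space of one dimension less. This is
what makes inductions on the dimension possible. -/
theorem mem_slit_inter {x : Fin (n + 1) → ℝ} :
    x ∈ slitSpace 1 ∩ slitSpace (-1) ↔ tailMap n x ≠ 0 := by
  simp only [slitSpace, Set.mem_inter_iff, Set.mem_ofPred_eq, tailMap, ContinuousMap.coe_mk, ne_eq,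
    not_and, one_mul, neg_mul]
  constructor
  · rintro ⟨h1, h2⟩ h
    have := h1 h
    have := h2 h
    linarith
  · exact fun h => ⟨fun h' => absurd h' h, fun h' => absurd h' h⟩

theorem slit_union : (slitSpace 1 ∪ slitSpace (-1) : Set (Fin (n + 1) → ℝ)) = {0}ᶜ := by
  ext x
  simp only [slitSpace, Set.mem_union, Set.mem_ofPred_eq, Set.mem_compl_iff, Set.mem_singleton_iff]
  rw [← not_and_or, not_iff_not]
  constructor
  · rintro ⟨⟨h1, h2⟩, -, h3⟩
    ext i
    refine Fin.cases ?_ (fun i => ?_) i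
    · rw [Pi.zero_apply]
      linarith
    · exact congrFun h1 i
  · rintro rfl
    exact ⟨⟨rfl, by simp⟩, rfl, by simp⟩

/-- A cycle off the first axis that bounds off zero after dropping the first coordinate bounds off
the axis. -/
theorem exists_boundary_off_axis {z : Chain k (Fin (n + 1) → ℝ)} (hz : IsCycle z)
    (hzs : SupportedIn (slitSpace 1 ∩ slitSpace (-1)) z) {c : Chain (k + 1) (Fin n → ℝ)}
    (hc : SupportedIn {0}ᶜ c) (hcz : boundary c = push (tailMap n) z) :
    ∃ w, SupportedIn (slitSpace 1 ∩ slitSpace (-1)) w ∧ boundary w = z := by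
  have htc (x : Fin n → ℝ) : tailMap n (consMap n x) = x := by
    simp [tailMap, consMap]
  obtain ⟨P, hP, hb⟩ := hz.exists_line ((consMap n).comp (tailMap n)) (ContinuousMap.id _) hzs
    (T := slitSpace 1 ∩ slitSpace (-1)) (by
      intro x hx s _ _
      rw [mem_slit_inter] at hx ⊢
      convert hx using 1
      ext i
      simp [tailMap, consMap, Fin.tail]
      ring)
  refine ⟨P + push (consMap n) c, hP.add (hc.push fun x hx => ?_), ?_⟩
  · rw [mem_slit_inter, htc]
    exact hx
  · rw [map_add, hb, push_id, ← push_boundary, hcz, push_comp, sub_add_cancel]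

/-- Boundaries of degree at least `n` off the origin of `ℝⁿ` bound off the origin. -/
theorem exists_boundary_off_zero (hk : n ≤ k) (c : Chain (k + 1) (Fin n → ℝ))
    (hc : SupportedIn {0}ᶜ (boundary c)) :
    ∃ c', SupportedIn {0}ᶜ c' ∧ boundary c' = boundary c := by
  induction n generalizing k with
  | zero =>
    refine ⟨0, SupportedIn.zero _, ?_⟩
    have : ({0}ᶜ : Set (Fin 0 → ℝ)) = ∅ := by
      rw [Set.compl_empty_iff]
      ext x
      simp [Subsingleton.elim x 0]
    rw [this] at hc
    rw [eq_zero_of_supportedIn_empty hc, map_zero]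
  | succ n ih =>
    obtain ⟨k, rfl⟩ : ∃ m, k = m + 1 := ⟨k - 1, by omega⟩
    rw [← slit_union] at hc ⊢
    obtain ⟨N, a, b, hS, ha, hb⟩ := exists_sdIter_split (isOpen_slitSpace 1)
      (isOpen_slitSpace (-1)) hc
    have hD := boundary_sdIterHomotopy N (boundary c)
    rw [boundary_boundary, map_zero, add_zero, hS] at hD
    have hbab : boundary a = - boundary b := by
      have := congrArg boundary hD
      rw [boundary_boundary, map_sub, boundary_boundary, map_add, zero_sub] at this
      exact eq_neg_of_add_eq_zero_left (neg_eq_zero.1 this.symm)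
    have hab : SupportedIn (slitSpace 1 ∩ slitSpace (-1)) (boundary a) := by
      refine ha.boundary.inter ?_
      rw [hbab]
      exact hb.boundary.neg
    -- The boundary of `a` lies off the axis. Dropping the first coordinate puts it in the situation
    -- of one dimension and one degree less; a filling found there lifts to a chain `w` off the
    -- axis, and `a - w` and `b + w` are cycles in the two star-shaped sets.
    obtain ⟨c', hc', hbc'⟩ := ih (k := k) (by omega) (push (tailMap n) a) (by
      rw [← push_boundary]
      exact hab.push fun x hx => mem_slit_inter.1 hx)
    obtain ⟨w, hw, hbw⟩ := exists_boundary_off_axis (isCycle_boundary a) hab hc'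
      (by rw [hbc', push_boundary])
    obtain ⟨u, hu, hbu⟩ := exists_boundary_slitSpace (ε := 1) (by norm_num) (c := a - w)
      (by rw [map_sub, hbw, sub_self]) (ha.sub (hw.mono Set.inter_subset_left))
    obtain ⟨v, hv, hbv⟩ := exists_boundary_slitSpace (ε := -1) (by norm_num) (c := b + w)
      (by rw [map_add, hbw, hbab, add_neg_cancel]) (hb.add (hw.mono Set.inter_subset_right))
    refine ⟨u + v + sdIterHomotopy (k + 1) N (boundary c), ?_, ?_⟩
    · exact ((hu.mono Set.subset_union_left).add (hv.mono Set.subset_union_right)).add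
        (hc.sdIterHomotopy N)
    · rw [map_add, map_add, hbu, hbv, hD]
      abel

/-- The translation by `x`. -/
def translate (x : Fin n → ℝ) : C(Fin n → ℝ, Fin n → ℝ) := ⟨fun y => y + x, by fun_prop⟩

theorem trivialOn_singleton (hk : n ≤ k) (x : Fin n → ℝ) {c : Chain (k + 1) (Fin n → ℝ)}
    (hc : SupportedIn {x}ᶜ (boundary c)) : TrivialOn {x} c := by
  obtain ⟨c', hc', hb⟩ := exists_boundary_off_zero hk (push (translate (-x)) c) (by
    rw [← push_boundary]
    refine SupportedIn.push (S := {x}ᶜ) (T := {0}ᶜ) (fun y hy h => hy ?_) hc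
    simpa [translate, add_neg_eq_zero] using h)
  have := (trivialOn_of_boundary_eq hc' hb).push (f := translate x) (L := {x}) fun y hy => by
    simpa [translate] using hy
  rw [push_comp] at this
  convert this
  rw [show (translate x).comp (translate (-x)) = ContinuousMap.id _ by ext y; simp [translate],
    push_id]

/-- Mayer–Vietoris induction on the number of sets. The intersection of a new set with the others is
again a union of compact convex sets, but it is needed one degree higher, which is why the degree
and the family vary in the induction. -/
theorem trivialOn_biUnion_convex {ι : Type*} (s : Finset ι) (K : ι → Set (Fin n → ℝ))
    (hK : ∀ i, Convex ℝ (K i)) (hKc : ∀ i, IsCompact (K i)) (hk : n ≤ k)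
    {c : Chain (k + 1) (Fin n → ℝ)} (hc : SupportedIn (⋃ i ∈ s, K i)ᶜ (boundary c)) :
    TrivialOn (⋃ i ∈ s, K i) c := by
  classical
  induction s using Finset.induction_on generalizing k K with
  | empty =>
    refine SupportedIn.trivialOn ?_
    simpa using supportedIn_univ c
  | insert a s ha ih =>
    rw [Finset.set_biUnion_insert] at hc ⊢
    refine TrivialOn.union (hKc a).isClosed
      (s.finite_toSet.isClosed_biUnion fun i _ => (hKc i).isClosed) ?_ ?_ ?_
    · rcases (K a).eq_empty_or_nonempty with h | ⟨x, hx⟩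
      · refine SupportedIn.trivialOn ?_
        simpa [h] using supportedIn_univ c
      · have hca := hc.mono (Set.compl_subset_compl.2 Set.subset_union_left)
        exact TrivialOn.of_mem_convex (hK a) (hKc a).isBounded hx hca
          (trivialOn_singleton hk x (hca.mono
            (Set.compl_subset_compl.2 (Set.singleton_subset_iff.2 hx))))
    · exact ih K hK hKc hk (hc.mono (Set.compl_subset_compl.2 Set.subset_union_right))
    · intro d hd
      rw [Set.inter_iUnion₂] at hd ⊢
      exact ih (fun i => K a ∩ K i) (fun i => (hK a).inter (hK i))
        (fun i => (hKc a).inter (hKc i)) (hk.trans (Nat.le_succ k)) hd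

/-- The relative homology of `ℝⁿ` modulo the complement of a compact set vanishes above `n`. -/
theorem trivialOn_of_isCompact (hk : n ≤ k) {K : Set (Fin n → ℝ)} (hK : IsCompact K)
    {c : Chain (k + 1) (Fin n → ℝ)} (hc : SupportedIn Kᶜ (boundary c)) : TrivialOn K c := by
  have hO : IsOpen (carrier (boundary c))ᶜ := (isCompact_carrier _).isClosed.isOpen_compl
  have hKO : K ⊆ (carrier (boundary c))ᶜ := Set.subset_compl_comm.1 (supportedIn_iff.1 hc)
  have hex (x : Fin n → ℝ) : ∃ r > 0, x ∈ K →
      Metric.closedBall x r ⊆ (carrier (boundary c))ᶜ := by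
    by_cases hx : x ∈ K
    · obtain ⟨r, hr, h⟩ := Metric.nhds_basis_closedBall.mem_iff.1 (hO.mem_nhds (hKO hx))
      exact ⟨r, hr, fun _ => h⟩
    · exact ⟨1, one_pos, fun h => absurd h hx⟩
  choose r hr0 hr using hex
  obtain ⟨s, hs, hcov⟩ := hK.elim_nhds_subcover (fun x => Metric.closedBall x (r x))
    fun x _ => Metric.closedBall_mem_nhds x (hr0 x)
  refine TrivialOn.mono ?_ hcov
  refine trivialOn_biUnion_convex s (fun x => Metric.closedBall x (r x))
    (fun x => convex_closedBall _ _) (fun x => isCompact_closedBall _ _) hk ?_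
  rw [supportedIn_iff, Set.subset_compl_comm]
  exact Set.iUnion₂_subset fun x hx => hr x (hs x hx)

/-! ### The standard simplex around the origin -/

/-- The vertices of a simplex of `ℝⁿ` that contains the origin in its interior. -/
def standardVertices : ∀ n : ℕ, Fin (n + 1) → Fin n → ℝ
  | 0 => fun _ => 0
  | n + 1 => Fin.cons (Fin.cons 1 0) fun i => Fin.cons (-1) (standardVertices n i)

/-- The first coordinate equates `t 0` with the sum of the other coefficients, and the remaining
coordinates form the same relation in one dimension less. In particular no proper face of the
standard simplex contains the origin. -/
theorem standardVertices_relation {t : Fin (n + 1) → ℝ} (ht : ∀ i, 0 ≤ t i)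
    (h : ∑ i, t i • standardVertices n i = 0) {j : Fin (n + 1)} (hj : t j = 0) (i) : t i = 0 := by
  induction n with
  | zero => rwa [Subsingleton.elim (α := Fin 1) i j]
  | succ n ih =>
    rw [Fin.sum_univ_succ] at h
    simp only [standardVertices, Fin.cons_zero, Fin.cons_succ] at h
    have h0 := congrFun h 0
    have h1 : ∑ i : Fin (n + 1), t i.succ • standardVertices n i = 0 := by
      ext m
      have := congrFun h m.succ
      simpa [Finset.sum_apply] using this
    simp only [Pi.add_apply, Pi.smul_apply, Fin.cons_zero, smul_eq_mul, mul_one, Finset.sum_apply,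
      mul_neg, Finset.sum_neg_distrib, Pi.zero_apply] at h0
    have hall : ∀ i : Fin (n + 1), t i.succ = 0 := by
      induction j using Fin.cases with
      | zero =>
        rw [hj, zero_add, neg_eq_zero, Finset.sum_eq_zero_iff_of_nonneg fun i _ => ht i.succ] at h0
        exact fun i => h0 i (Finset.mem_univ i)
      | succ j => exact fun i => ih (fun i => ht i.succ) h1 hj i
    refine Fin.cases ?_ hall i
    simp only [hall, Finset.sum_const_zero, neg_zero, add_zero] at h0
    exact h0

theorem map_succAbove_self (i : Fin (k + 2)) (t : Simplex k) :
    stdSimplex.map i.succAbove t i = 0 := by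
  rw [stdSimplex.map_coe, FunOnFinite.linearMap_apply_apply]
  refine Finset.sum_eq_zero fun j hj => absurd (Finset.mem_filter.1 hj).2 (Fin.succAbove_ne i j)

theorem supportedIn_boundary_single {X : Type*} [TopologicalSpace X] {S : Set X}
    {σ : SingularSimplex (k + 1) X} (h : ∀ t i, t i = 0 → σ t ∈ S) (m : ℤ) :
    SupportedIn S (boundary (Finsupp.single σ m)) := by
  rw [boundary_single]
  refine (SupportedIn.sum fun i _ => (supportedIn_single ?_ _).zsmul _).zsmul _
  rintro _ ⟨t, rfl⟩
  exact h _ i (map_succAbove_self i t)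

theorem aff_apply (v : Fin (k + 1) → Fin n → ℝ) (t : Simplex k) : aff v t = ∑ i, t i • v i := rfl

/-- Count the endpoints on the positive half-line with sign. By the intermediate value theorem a
path avoiding zero has both ends on the same side and contributes nothing, whereas the standard
segment runs from 1 to -1. -/
theorem not_exists_boundary_standard_zero {c : Chain 1 (Fin 1 → ℝ)} (hc : SupportedIn {0}ᶜ c) :
    boundary c ≠ boundary (Finsupp.single (aff (standardVertices 1)) 1) := by
  classical
  let ψ : Chain 0 (Fin 1 → ℝ) →+ ℤ := Finsupp.liftAddHom fun σ =>
    zmultiplesHom ℤ (if 0 < σ (stdSimplex.vertex 0) 0 then 1 else 0)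
  have hψ (σ : SingularSimplex 0 (Fin 1 → ℝ)) (m : ℤ) : ψ (Finsupp.single σ m) =
      m * if 0 < σ (stdSimplex.vertex 0) 0 then 1 else 0 := by simp [ψ]
  have hbd (σ : SingularSimplex 1 (Fin 1 → ℝ)) (m : ℤ) : ψ (boundary (Finsupp.single σ m)) =
      m * ((if 0 < σ (stdSimplex.vertex 1) 0 then 1 else 0) -
        if 0 < σ (stdSimplex.vertex 0) 0 then 1 else 0) := by
    rw [boundary_single, map_zsmul, map_sum, Fin.sum_univ_two, map_zsmul, map_zsmul, hψ, hψ]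
    simp only [face_apply, stdSimplex.map_vertex]
    rw [show (0 : Fin 2).succAbove 0 = 1 from rfl, show (1 : Fin 2).succAbove 0 = 0 from rfl]
    split_ifs <;> simp
  intro h
  have h1 : ψ (boundary c) = 0 := by
    refine SupportedIn.induction (p := fun c => ψ (boundary c) = 0) (by simp)
      (fun c d hc hd => by rw [map_add, map_add, hc, hd, add_zero]) ?_ hc
    intro σ m hσ
    have hcont : Continuous fun t => σ t 0 := (continuous_apply 0).comp σ.continuous
    have hne : ∀ a b : Simplex 1, 0 < σ a 0 → 0 < σ b 0 := by
      intro a b ha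
      by_contra! hb
      obtain ⟨t, ht⟩ := mem_range_of_exists_le_of_exists_ge hcont ⟨b, hb⟩ ⟨a, ha.le⟩
      refine hσ ⟨t, rfl⟩ ?_
      ext i
      rw [Subsingleton.elim i 0]
      exact ht
    rw [hbd]
    by_cases h0 : 0 < σ (stdSimplex.vertex 0) 0
    · rw [if_pos h0, if_pos (hne _ _ h0), sub_self, mul_zero]
    · rw [if_neg h0, if_neg fun h => h0 (hne _ _ h), sub_self, mul_zero]
  rw [h, hbd, aff_vertex, aff_vertex] at h1
  have h2 : ¬ 0 < standardVertices 1 1 0 := by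
    change ¬ (0 : ℝ) < -1
    norm_num
  have h3 : 0 < standardVertices 1 0 0 := by
    change (0 : ℝ) < 1
    norm_num
  rw [if_neg h2, if_pos h3] at h1
  norm_num at h1

/-- The standard simplex generates nontrivial local homology at the origin. -/
theorem not_exists_boundary_standard (m : ℕ) {c : Chain (m + 1) (Fin (m + 1) → ℝ)}
    (hc : SupportedIn {0}ᶜ c) :
    boundary c ≠ boundary (Finsupp.single (aff (standardVertices (m + 1))) 1) := by
  induction m with
  | zero => exact not_exists_boundary_standard_zero hc
  | succ m ih =>
    intro hbc
    -- The boundary of the standard simplex is the face `F` opposite to the first vertex, in the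
    -- hyperplane of first coordinate -1, plus the remaining faces `R`. The face `F` misses the
    -- nonnegative half of the first axis and `R` misses the nonpositive half.
    set u : Fin (m + 2) → Fin (m + 2) → ℝ := fun i => Fin.cons (-1) (standardVertices (m + 1) i)
    set F : Chain (m + 1) (Fin (m + 2) → ℝ) := Finsupp.single (aff u) 1
    have hz : boundary (Finsupp.single (aff (standardVertices (m + 2))) 1) - F =
        ∑ i : Fin (m + 2), (-1 : ℤ) ^ ((i.succ : Fin (m + 3)) : ℕ) •
          Finsupp.single (face i.succ (aff (standardVertices (m + 2)))) (1 : ℤ) := by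
      rw [boundary_single, one_smul, Fin.sum_univ_succ, sub_eq_iff_eq_add]
      refine (add_comm _ _).trans ?_
      congr 1
      rw [face_aff]
      simp [F, u, standardVertices]
    set R := boundary (Finsupp.single (aff (standardVertices (m + 2))) 1) - F with hR
    have hF : SupportedIn (slitSpace (-1)) F := by
      refine supportedIn_single ?_ 1
      rintro _ ⟨t, rfl⟩ ⟨-, h⟩
      have : aff u t 0 = -1 := by
        simp only [aff_apply, Finset.sum_apply, u, Pi.smul_apply, Fin.cons_zero, smul_eq_mul,
          mul_neg, mul_one, Finset.sum_neg_distrib, stdSimplex.sum_eq_one]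
      rw [this] at h
      norm_num at h
    have hRs : SupportedIn (slitSpace 1) R := by
      rw [hz]
      refine SupportedIn.sum fun j _ => (supportedIn_single ?_ _).zsmul _
      rintro _ ⟨t, rfl⟩ ⟨h1, h2⟩
      rw [face_apply] at h1 h2
      set t' := stdSimplex.map j.succ.succAbove t with ht'
      have hs : aff (standardVertices (m + 2)) t' = Fin.cons
          (t' 0 - ∑ i : Fin (m + 2), t' i.succ)
          (∑ i : Fin (m + 2), t' i.succ • standardVertices (m + 1) i) := by
        rw [aff_apply, Fin.sum_univ_succ]
        ext l
        refine Fin.cases ?_ (fun l => ?_) l <;>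
          simp [standardVertices, Finset.sum_apply, sub_eq_add_neg]
      rw [hs, Fin.tail_cons] at h1
      have h3 (i : Fin (m + 2)) : t' i.succ = 0 :=
        standardVertices_relation (t := fun i => t' i.succ) (fun i => stdSimplex.zero_le _ _) h1
          (map_succAbove_self _ t) i
      have h4 := stdSimplex.sum_eq_one t'
      rw [Fin.sum_univ_succ] at h4
      rw [hs, Fin.cons_zero] at h2
      simp only [h3, Finset.sum_const_zero] at h2 h4
      linarith
    rw [← slit_union] at hc
    obtain ⟨N, a, b, hS, ha, hb⟩ := exists_sdIter_split (isOpen_slitSpace 1)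
      (isOpen_slitSpace (-1)) hc
    have hFR : boundary c = F + R := by
      rw [hbc, hR]
      abel
    have hD := congrArg boundary (boundary_sdIterHomotopy N c)
    simp only [hS, map_add, map_sub, boundary_boundary, zero_add, hFR] at hD
    -- The same chain written in two ways, one supported in each slit space; hence it lies off the
    -- axis. Its boundary is that of `F`, so after dropping the first coordinate it would contradict
    -- the case of one dimension less.
    have hd : boundary a + boundary (sdIterHomotopy (m + 1) N R) - R =
        F - boundary b - boundary (sdIterHomotopy (m + 1) N F) := by
      rw [← sub_eq_zero] at hD ⊢
      rw [← hD]
      abel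
    have hsup : SupportedIn (slitSpace 1 ∩ slitSpace (-1))
        (boundary a + boundary (sdIterHomotopy (m + 1) N R) - R) := by
      refine SupportedIn.inter ((ha.boundary.add (hRs.sdIterHomotopy N).boundary).sub hRs) ?_
      rw [hd]
      exact (hF.sub hb.boundary).sub (hF.sdIterHomotopy N).boundary
    refine ih (c := push (tailMap (m + 1)) (boundary a +
      boundary (sdIterHomotopy (m + 1) N R) - R)) (hsup.push fun x hx => mem_slit_inter.1 hx) ?_
    have hbF : boundary (F - boundary b - boundary (sdIterHomotopy (m + 1) N F)) = boundary F := by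
      simp only [map_sub, boundary_boundary, sub_zero]
    rw [hd, ← push_boundary, hbF, push_boundary, push_single]
    congr 2
    ext t i
    simp [tailMap, aff_apply, u, Fin.tail, Finset.sum_apply]

theorem not_trivialOn_standard (m : ℕ) :
    ¬ TrivialOn {0} (Finsupp.single (aff (standardVertices (m + 1))) 1) := fun h => by
  obtain ⟨c, hc, hb⟩ := h.exists_boundary_eq
  exact not_exists_boundary_standard m hc hb

end Euclidean

end SurgeryFormula

end

noncomputable section

namespace SurgeryFormula

open HasAffineSimplices

/-! ### Local homology of 3-manifolds -/

section Manifold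

open Topology

variable {X Y : Type*} [TopologicalSpace X] [TopologicalSpace Y]

/-- The point `x` has a neighbourhood homeomorphic to `ℝ³`. -/
def HasChartAt (x : X) : Prop := ∃ φ : C(Fin 3 → ℝ, X), IsOpenEmbedding φ ∧ x ∈ Set.range φ

/-- The image of a compact convex set under a chart. -/
def IsCell (K : Set X) : Prop := ∃ φ : C(Fin 3 → ℝ, X), IsOpenEmbedding φ ∧
  ∃ K' : Set (Fin 3 → ℝ), Convex ℝ K' ∧ IsCompact K' ∧ K = φ '' K'

theorem IsCell.isCompact {K : Set X} (hK : IsCell K) : IsCompact K := by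
  obtain ⟨φ, -, K', -, h, rfl⟩ := hK
  exact h.image φ.continuous

theorem HasChartAt.exists_isCell {x : X} (hx : HasChartAt x) {O : Set X} (hO : O ∈ 𝓝 x) :
    ∃ K ∈ 𝓝 x, K ⊆ O ∧ IsCell K := by
  obtain ⟨φ, hφ, y, rfl⟩ := hx
  obtain ⟨r, hr, h⟩ := Metric.nhds_basis_closedBall.mem_iff.1
    (φ.continuous.continuousAt.preimage_mem_nhds hO)
  exact ⟨φ '' Metric.closedBall y r, hφ.image_mem_nhds.2 (Metric.closedBall_mem_nhds y hr),
    Set.image_subset_iff.2 h, φ, hφ, _, convex_closedBall y r, isCompact_closedBall y r, rfl⟩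

/-- A ball around each point of Euclidean space is homeomorphic to the whole space. -/
theorem exists_chart_ball (x : Fin 3 → ℝ) {r : ℝ} (hr : 0 < r) :
    ∃ φ : C(Fin 3 → ℝ, Fin 3 → ℝ), IsOpenEmbedding φ ∧ x ∈ Set.range φ ∧
      Set.range φ ⊆ Metric.ball x r := by
  let φ := OpenPartialHomeomorph.univBall x r
  have hs : φ.source = Set.univ := OpenPartialHomeomorph.univBall_source x r
  have ht : φ.target = Metric.ball x r := OpenPartialHomeomorph.univBall_target x hr
  have ho : IsOpenEmbedding φ := φ.isOpenEmbedding hs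
  refine ⟨⟨φ, ho.continuous⟩, ho, ⟨0, OpenPartialHomeomorph.univBall_apply_zero x r⟩, ?_⟩
  rintro _ ⟨y, rfl⟩
  rw [← ht]
  exact φ.map_source (by rw [hs]; trivial)

/-- Charts are transported by maps that are open embeddings near the point. -/
theorem hasChartAt_of_map {Z : Type*} [TopologicalSpace Z] {ψ : (Fin 3 → ℝ) → Z}
    {O : Set (Fin 3 → ℝ)} (hO : IsOpen O) (hψ : IsOpenEmbedding (O.domRestrict ψ)) {x : Fin 3 → ℝ}
    (hx : x ∈ O) : HasChartAt (ψ x) := by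
  obtain ⟨r, hr, hrO⟩ := Metric.isOpen_iff.1 hO x hx
  obtain ⟨φ, hφ, ⟨y, hy⟩, hφr⟩ := exists_chart_ball x hr
  have hmem (z) : φ z ∈ O := hrO (hφr ⟨z, rfl⟩)
  have h1 : IsOpenEmbedding (fun z => (⟨φ z, hmem z⟩ : O)) :=
    IsOpenEmbedding.of_comp _ hO.isOpenEmbedding_subtypeVal hφ
  exact ⟨⟨_, (hψ.comp h1).continuous⟩, hψ.comp h1, y, congrArg ψ hy⟩

theorem HasChartAt.map {O : Set X} {f : X → Y} (hO : IsOpen O)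
    (hf : IsOpenEmbedding (O.domRestrict f)) {x : X} (hx : x ∈ O) (h : HasChartAt x) :
    HasChartAt (f x) := by
  obtain ⟨φ, hφ, y, rfl⟩ := h
  have h2 : IsOpenEmbedding ((φ ⁻¹' O).domRestrict (f ∘ φ)) := by
    have h3 : IsOpenEmbedding (fun z : φ ⁻¹' O => (⟨φ z, z.2⟩ : O)) :=
      IsOpenEmbedding.of_comp _ hO.isOpenEmbedding_subtypeVal
        (hφ.comp (hO.preimage φ.continuous).isOpenEmbedding_subtypeVal)
    exact hf.comp h3
  exact hasChartAt_of_map (hO.preimage φ.continuous) h2 hx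

variable [T2Space X]

/-- Excision moves the cycle into the chart, where the homology relative to the complement of a
compact set vanishes above degree 3. -/
theorem trivialOn_of_subset_range {φ : C(Fin 3 → ℝ, X)} (hφ : IsOpenEmbedding φ) {J : Set X}
    (hJ : IsCompact J) (hJφ : J ⊆ Set.range φ) {d : Chain 4 X}
    (hd : SupportedIn Jᶜ (boundary d)) : TrivialOn J d := by
  obtain ⟨d₁, h1, h2, h3⟩ := exists_excise hJ.isClosed hφ.isOpen_range hJφ hd
  obtain ⟨d', rfl⟩ := SupportedIn.exists_push hφ.isEmbedding h1
  have hJ' : IsCompact (φ ⁻¹' J) := hφ.isInducing.isCompact_preimage_iff hJφ |>.2 hJ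
  have h4 : TrivialOn (φ ⁻¹' J) d' := by
    refine trivialOn_of_isCompact (k := 3) le_rfl hJ' ?_
    rw [← push_boundary] at h2
    exact h2.of_push hφ.injective
  have := h3.add (h4.push (f := φ) (L := J) fun x hx => hx)
  rwa [sub_add_cancel] at this

/-- Local homology classes are locally constant. -/
theorem IsCell.trivialOn {K : Set X} (hK : IsCell K) {c : Chain 3 X}
    (hc : SupportedIn Kᶜ (boundary c)) {y : X} (hy : y ∈ K) (h : TrivialOn {y} c) :
    TrivialOn K c := by
  have hKc := hK.isCompact
  obtain ⟨φ, hφ, K', hK'c, hK', rfl⟩ := hK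
  obtain ⟨y, hy, rfl⟩ := hy
  obtain ⟨d, h1, h2, h3⟩ := exists_excise hKc.isClosed hφ.isOpen_range
    (Set.image_subset_range _ _) hc
  obtain ⟨d', rfl⟩ := SupportedIn.exists_push hφ.isEmbedding h1
  have h4 : TrivialOn {y} d' := by
    refine TrivialOn.of_push hφ (by simp) ?_
    rw [Set.image_singleton]
    have h5 := h3.mono (Set.singleton_subset_iff.2 (Set.mem_image_of_mem φ hy))
    have := h.sub h5
    rwa [sub_sub_cancel] at this
  have h5 : TrivialOn K' d' := by
    refine TrivialOn.of_mem_convex hK'c hK'.isBounded hy ?_ h4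
    rw [← push_boundary] at h2
    exact (h2.of_push hφ.injective).mono fun x hx hxK => hx ⟨x, hxK, rfl⟩
  have := h3.add (h5.push (f := φ) (L := φ '' K') fun x hx => by
    obtain ⟨x', hx', h⟩ := hx
    rwa [← hφ.injective h])
  rwa [sub_add_cancel] at this

/-- A relative cycle that is trivial at each point of a compact set is trivial on the set. -/
theorem trivialOn_of_forall_singleton {A : Set X} (hA : IsCompact A) (hch : ∀ x ∈ A, HasChartAt x)
    {c : Chain 3 X} (hc : SupportedIn Aᶜ (boundary c)) (h : ∀ x ∈ A, TrivialOn {x} c) :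
    TrivialOn A c := by
  have hO : IsOpen (carrier (boundary c))ᶜ := (isCompact_carrier _).isClosed.isOpen_compl
  have hAO : A ⊆ (carrier (boundary c))ᶜ := Set.subset_compl_comm.1 (supportedIn_iff.1 hc)
  have hex (x : X) : ∃ K, x ∈ A → K ∈ 𝓝 x ∧ K ⊆ (carrier (boundary c))ᶜ ∧ IsCell K := by
    by_cases hx : x ∈ A
    · obtain ⟨K, h1, h2, h3⟩ := (hch x hx).exists_isCell (hO.mem_nhds (hAO hx))
      exact ⟨K, fun _ => ⟨h1, h2, h3⟩⟩
    · exact ⟨∅, fun h => absurd h hx⟩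
  choose K hK using hex
  obtain ⟨s, hcov⟩ := hA.elim_nhds_subcover' (fun x _ => K x) fun x hx => (hK x hx).1
  refine TrivialOn.mono ?_ hcov
  clear hcov
  classical
  induction s using Finset.induction_on with
  | empty =>
    refine SupportedIn.trivialOn ?_
    simpa using supportedIn_univ c
  | insert a s ha ih =>
    have hcpt (x : A) : IsCompact (K x) := (hK x x.2).2.2.isCompact
    have hcs : IsCompact (⋃ x ∈ s, K (x : X)) := s.finite_toSet.isCompact_biUnion fun x _ => hcpt x
    rw [Finset.set_biUnion_insert]
    refine TrivialOn.union (hcpt a).isClosed hcs.isClosed ?_ ih fun d hd => ?_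
    · obtain ⟨h1, h2, h3⟩ := hK a a.2
      refine h3.trivialOn ?_ (mem_of_mem_nhds h1) (h a a.2)
      rw [supportedIn_iff, Set.subset_compl_comm]
      exact h2
    -- The intersection lies in a single cell, hence in one chart, so Mayer–Vietoris has no
    -- obstruction in degree 4.
    · obtain ⟨φ, hφ, K', -, -, hKφ⟩ := (hK a a.2).2.2
      refine trivialOn_of_subset_range hφ ((hcpt a).inter hcs)
        (Set.inter_subset_left.trans ?_) hd
      rw [hKφ]
      exact Set.image_subset_range _ _

/-! ### Propagation of local degrees -/

/-- An injective simplex whose interior is open. -/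
def IsRegularSimplex (σ : SingularSimplex 3 X) : Prop :=
  Function.Injective σ ∧ IsOpen (σ '' simplexInterior 3)

theorem IsRegularSimplex.supportedIn_boundary {X : Type*} [TopologicalSpace X]
    {σ : SingularSimplex 3 X} (hσ : Function.Injective σ) :
    SupportedIn (σ '' simplexInterior 3)ᶜ (boundary (Finsupp.single σ 1)) := by
  refine supportedIn_boundary_single (fun t i ht => ?_) 1
  rintro ⟨s, hs, hst⟩
  rw [hσ hst] at hs
  exact (hs i).ne' ht

/-- Local degrees are locally constant: on a cell inside both O and the open interior of σ, the
chain `c - σ` is a relative cycle, and its triviality at one point spreads over the cell. -/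
theorem IsRegularSimplex.exists_nhds {σ : SingularSimplex 3 X} (hσ : IsRegularSimplex σ)
    {t : Simplex 3} (ht : t ∈ simplexInterior 3) (hch : HasChartAt (σ t)) {O : Set X}
    (hO : O ∈ 𝓝 (σ t)) {c : Chain 3 X} (hc : SupportedIn Oᶜ (boundary c)) :
    ∃ K ∈ 𝓝 (σ t), K ⊆ O ∧ K ⊆ σ '' simplexInterior 3 ∧ ∀ y ∈ K,
      TrivialOn {y} (c - Finsupp.single σ 1) → ∀ y' ∈ K, TrivialOn {y'} (c - Finsupp.single σ 1) := by
  obtain ⟨K, hK, hKO, hKc⟩ := hch.exists_isCell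
    (Filter.inter_mem hO (hσ.2.mem_nhds (Set.mem_image_of_mem σ ht)))
  refine ⟨K, hK, fun x hx => (hKO hx).1, fun x hx => (hKO hx).2, fun y hy h y' hy' => ?_⟩
  refine (hKc.trivialOn ?_ hy h).mono (Set.singleton_subset_iff.2 hy')
  rw [map_sub]
  exact (hc.mono (Set.compl_subset_compl.2 fun x hx => (hKO hx).1)).sub
    ((IsRegularSimplex.supportedIn_boundary hσ.1).mono
      (Set.compl_subset_compl.2 fun x hx => (hKO hx).2))

/-- On a connected open set, a relative cycle that agrees with a coherent family of simplices at one
point does so everywhere. -/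
theorem trivialOn_sub_of_isPreconnected {P : Set (SingularSimplex 3 X)} {W : Set X}
    (hWo : IsOpen W) (hW : IsPreconnected W) (hch : ∀ x ∈ W, HasChartAt x)
    (hP : ∀ σ ∈ P, IsRegularSimplex σ)
    (hcoh : ∀ σ ∈ P, ∀ τ ∈ P, ∀ s ∈ simplexInterior 3, ∀ t ∈ simplexInterior 3, σ s = τ t →
      σ s ∈ W → TrivialOn {σ s} (Finsupp.single σ (1 : ℤ) - Finsupp.single τ 1))
    (hcov : ∀ x ∈ W, ∃ σ ∈ P, ∃ t ∈ simplexInterior 3, σ t = x)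
    {c : Chain 3 X} (hc : SupportedIn Wᶜ (boundary c)) {σ₀ : SingularSimplex 3 X} (hσ₀ : σ₀ ∈ P)
    {t₀ : Simplex 3} (ht₀ : t₀ ∈ simplexInterior 3) (hW₀ : σ₀ t₀ ∈ W)
    (h₀ : TrivialOn {σ₀ t₀} (c - Finsupp.single σ₀ 1)) :
    ∀ σ ∈ P, ∀ t ∈ simplexInterior 3, σ t ∈ W → TrivialOn {σ t} (c - Finsupp.single σ 1) := by
  -- Goodness asks for agreement with every simplex through the point; by coherence one of them
  -- suffices. Good points and bad points of W then both form open sets.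
  let good (x : X) : Prop := ∀ σ ∈ P, ∀ t ∈ simplexInterior 3, σ t = x →
    TrivialOn {x} (c - Finsupp.single σ 1)
  have good_of {σ} (hσ : σ ∈ P) {t} (ht : t ∈ simplexInterior 3) (hx : σ t ∈ W)
      (h : TrivialOn {σ t} (c - Finsupp.single σ 1)) : good (σ t) := by
    intro τ hτ s hs hst
    exact h.trans (hcoh σ hσ τ hτ t ht s hs hst.symm hx)
  have hloc : ∀ x ∈ W, ∃ K ∈ 𝓝 x, K ⊆ W ∧ ∀ y ∈ K, good y → ∀ y' ∈ K, good y' := by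
    intro x hx
    obtain ⟨σ, hσ, t, ht, rfl⟩ := hcov x hx
    obtain ⟨K, hK, h1, h2, h3⟩ := (hP σ hσ).exists_nhds ht (hch _ hx) (hWo.mem_nhds hx) hc
    refine ⟨K, hK, h1, fun y hy hgy y' hy' => ?_⟩
    obtain ⟨s, hs, rfl⟩ := h2 hy
    obtain ⟨s', hs', rfl⟩ := h2 hy'
    exact good_of hσ hs' (h1 hy') (h3 _ hy (hgy σ hσ s hs rfl) _ hy')
  have hG : IsOpen {x | x ∈ W ∧ good x} := by
    rw [isOpen_iff_mem_nhds]
    rintro x ⟨hx, hg⟩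
    obtain ⟨K, hK, h1, h2⟩ := hloc x hx
    exact Filter.mem_of_superset hK fun y hy => ⟨h1 hy, h2 x (mem_of_mem_nhds hK) hg y hy⟩
  have hB : IsOpen {x | x ∈ W ∧ ¬ good x} := by
    rw [isOpen_iff_mem_nhds]
    rintro x ⟨hx, hg⟩
    obtain ⟨K, hK, h1, h2⟩ := hloc x hx
    exact Filter.mem_of_superset hK fun y hy =>
      ⟨h1 hy, fun h => hg (h2 y hy h x (mem_of_mem_nhds hK))⟩
  have hsub := hW.subset_left_of_subset_union hG hB
    (Set.disjoint_left.2 fun x h h' => h'.2 h.2) (fun x hx => by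
      by_cases h : good x
      · exact Or.inl ⟨hx, h⟩
      · exact Or.inr ⟨hx, h⟩) ⟨σ₀ t₀, hW₀, hW₀, good_of hσ₀ ht₀ hW₀ h₀⟩
  exact fun σ hσ t ht hx => (hsub hx).2 σ hσ t ht rfl

end Manifold

end SurgeryFormula

end

noncomputable section

namespace SurgeryFormula

open HasAffineSimplices

/-! ### Affine simplices of `ℝ³` -/

section Homotopy

variable {X Y E : Type*} [TopologicalSpace X] [TopologicalSpace Y] [NormedAddCommGroup E]
  [NormedSpace ℝ E] {k : ℕ}

/-- The prism over c bounds the difference up to the prism over the boundary of c, and only the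
latter has to stay off K. -/
theorem trivialOn_of_homotopy (H : C(X × unitInterval, Y)) {S : Set X} {K : Set Y}
    (h : ∀ x ∈ S, ∀ s, H (x, s) ∉ K) {c : Chain (k + 1) X} (hc : SupportedIn S (boundary c)) :
    TrivialOn K (push (slice H 1) c - push (slice H 0) c) := by
  refine ⟨prism H (k + 1) c, ?_⟩
  rw [← boundary_prism H c, add_sub_cancel_left]
  exact hc.prism h

theorem trivialOn_of_line (f g : C(X, E)) {S : Set X} {K : Set E}
    (h : ∀ x ∈ S, ∀ s : ℝ, 0 ≤ s → s ≤ 1 → (1 - s) • f x + s • g x ∉ K)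
    {c : Chain (k + 1) X} (hc : SupportedIn S (boundary c)) :
    TrivialOn K (push g c - push f c) := by
  have := trivialOn_of_homotopy (lineHomotopy f g) (K := K) (fun x hx s => h x hx s s.2.1 s.2.2) hc
  rwa [slice_lineHomotopy_one, slice_lineHomotopy_zero] at this

/-- Straight line homotopies of simplices that keep the boundary off a set. -/
theorem trivialOn_single_sub (σ τ : SingularSimplex (k + 1) E) {K : Set E}
    (h : ∀ t i, t i = 0 → ∀ s : ℝ, 0 ≤ s → s ≤ 1 → (1 - s) • σ t + s • τ t ∉ K) :
    TrivialOn K (Finsupp.single τ (1 : ℤ) - Finsupp.single σ 1) := by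
  have := trivialOn_of_line (K := K) σ τ (S := {t | ∃ i, t i = 0})
    (fun t ht => ht.elim fun i hi => h t i hi)
    (c := Finsupp.single (ContinuousMap.id _) 1)
    (supportedIn_boundary_single (S := {t : Simplex (k + 1) | ∃ i, t i = 0})
      (fun _ i ht => Exists.intro i ht) 1)
  rwa [push_single, push_single, ContinuousMap.comp_id, ContinuousMap.comp_id] at this

end Homotopy

/-! ### Matrices of positive determinant and local homology at the origin -/

section Matrices

open Matrix

variable {n : ℕ}

/-- Multiplication by a matrix. -/
def matrixMap (A : Matrix (Fin n) (Fin n) ℝ) : C(Fin n → ℝ, Fin n → ℝ) :=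
  ⟨fun x => A *ᵥ x, by fun_prop⟩

theorem matrixMap_mul (A B : Matrix (Fin n) (Fin n) ℝ) :
    matrixMap (A * B) = (matrixMap A).comp (matrixMap B) := by
  ext1 x
  exact (Matrix.mulVec_mulVec x A B).symm

theorem matrixMap_eq_zero {A : Matrix (Fin n) (Fin n) ℝ} (hA : A.det ≠ 0) {x : Fin n → ℝ}
    (h : matrixMap A x = 0) : x = 0 := Matrix.eq_zero_of_mulVec_eq_zero hA h

/-- An invertible matrix that acts trivially on the local homology at the origin. -/
def ActsTrivially (A : Matrix (Fin n) (Fin n) ℝ) : Prop :=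
  A.det ≠ 0 ∧ ∀ (k : ℕ) (c : Chain (k + 1) (Fin n → ℝ)), SupportedIn {0}ᶜ (boundary c) →
    TrivialOn {0} (push (matrixMap A) c - c)

theorem ActsTrivially.mul {A B : Matrix (Fin n) (Fin n) ℝ} (hA : ActsTrivially A)
    (hB : ActsTrivially B) : ActsTrivially (A * B) := by
  refine ⟨by rw [det_mul]; exact mul_ne_zero hA.1 hB.1, fun k c hc => ?_⟩
  rw [matrixMap_mul, ← push_comp]
  refine (hA.2 k _ ?_).trans (hB.2 k c hc)
  rw [← push_boundary]
  exact SupportedIn.push (S := {0}ᶜ) (T := {0}ᶜ) (fun x hx h => hx (matrixMap_eq_zero hB.1 h)) hc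

/-- A segment of invertible matrices is a linear homotopy that never moves a nonzero vector to the
origin. -/
theorem actsTrivially_of_segment {A : Matrix (Fin n) (Fin n) ℝ}
    (h : ∀ s : ℝ, 0 ≤ s → s ≤ 1 → ((1 - s) • (1 : Matrix (Fin n) (Fin n) ℝ) + s • A).det ≠ 0) :
    ActsTrivially A := by
  refine ⟨by simpa using h 1 zero_le_one le_rfl, fun k c hc => ?_⟩
  have := trivialOn_of_line (K := {0}) (ContinuousMap.id _) (matrixMap A) (fun x hx s h0 h1 h2 => ?_)
    hc
  · rwa [push_id] at this
  · refine hx (eq_zero_of_mulVec_eq_zero (h s h0 h1) (v := x) ?_)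
    rw [add_mulVec, smul_mulVec, smul_mulVec, one_mulVec]
    exact h2

theorem actsTrivially_one : ActsTrivially (1 : Matrix (Fin n) (Fin n) ℝ) :=
  actsTrivially_of_segment fun s _ _ => by rw [← add_smul]; simp

theorem actsTrivially_transvection (t : TransvectionStruct (Fin n) ℝ) :
    ActsTrivially t.toMatrix := by
  refine actsTrivially_of_segment fun s _ _ => ?_
  have : (1 - s) • (1 : Matrix (Fin n) (Fin n) ℝ) + s • t.toMatrix =
      transvection t.i t.j (s * t.c) := by
    rw [TransvectionStruct.toMatrix_mk, transvection, transvection, smul_add, ← add_assoc,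
      ← add_smul]
    simp
  rw [this, det_transvection_of_ne t.i t.j t.hij]
  exact one_ne_zero

theorem actsTrivially_list {L : List (Matrix (Fin n) (Fin n) ℝ)} (h : ∀ A ∈ L, ActsTrivially A) :
    ActsTrivially L.prod := by
  induction L with
  | nil => simpa using actsTrivially_one
  | cons A L ih =>
    rw [List.prod_cons]
    exact (h A (by simp)).mul (ih fun B hB => h B (by simp [hB]))

theorem actsTrivially_diagonal_pos {d : Fin n → ℝ} (hd : ∀ i, 0 < d i) :
    ActsTrivially (diagonal d) := by
  refine actsTrivially_of_segment fun s h0 h1 => ?_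
  have : (1 - s) • (1 : Matrix (Fin n) (Fin n) ℝ) + s • diagonal d =
      diagonal fun i => (1 - s) + s * d i := by
    ext i j
    by_cases h : i = j
    · subst h; simp
    · simp [h]
  rw [this, det_diagonal]
  refine (Finset.prod_pos fun i _ => ?_).ne'
  rcases h0.eq_or_lt with rfl | h
  · simp
  · nlinarith [mul_pos h (hd i)]

/-- The determinant along the segment from the identity to a quarter turn. The segment to a half
turn passes through a singular matrix, so half turns are treated as squares of quarter turns. -/
theorem quarterTurn_pos {s : ℝ} : 0 < (1 - s) * (1 - s) + s * s := by nlinarith [sq_nonneg (s - 1/2)]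

theorem actsTrivially_diagonal_neg₀ : ActsTrivially (diagonal ![1, -1, -1] : Matrix _ _ ℝ) := by
  have h : ActsTrivially (!![1, 0, 0; 0, 0, -1; 0, 1, 0] : Matrix (Fin 3) (Fin 3) ℝ) := by
    refine actsTrivially_of_segment fun s _ _ => (lt_of_lt_of_eq (quarterTurn_pos (s := s)) ?_).ne'
    simp [det_fin_three]
  convert h.mul h using 1
  ext i j
  fin_cases i <;> fin_cases j <;> simp [Matrix.mul_apply, Fin.sum_univ_three]

theorem actsTrivially_diagonal_neg₁ : ActsTrivially (diagonal ![-1, 1, -1] : Matrix _ _ ℝ) := by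
  have h : ActsTrivially (!![0, 0, -1; 0, 1, 0; 1, 0, 0] : Matrix (Fin 3) (Fin 3) ℝ) := by
    refine actsTrivially_of_segment fun s _ _ => (lt_of_lt_of_eq (quarterTurn_pos (s := s)) ?_).ne'
    simp [det_fin_three]
  convert h.mul h using 1
  ext i j
  fin_cases i <;> fin_cases j <;> simp [Matrix.mul_apply, Fin.sum_univ_three]

theorem actsTrivially_diagonal_neg₂ : ActsTrivially (diagonal ![-1, -1, 1] : Matrix _ _ ℝ) := by
  have h : ActsTrivially (!![0, -1, 0; 1, 0, 0; 0, 0, 1] : Matrix (Fin 3) (Fin 3) ℝ) := by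
    refine actsTrivially_of_segment fun s _ _ => (lt_of_lt_of_eq (quarterTurn_pos (s := s)) ?_).ne'
    simp [det_fin_three]
  convert h.mul h using 1
  ext i j
  fin_cases i <;> fin_cases j <;> simp [Matrix.mul_apply, Fin.sum_univ_three]

/-- The number of negative entries is even, so multiplying by the identity or by a half turn about a
coordinate axis makes all entries positive. -/
theorem actsTrivially_diagonal {d : Fin 3 → ℝ} (hd : 0 < (diagonal d).det) :
    ActsTrivially (diagonal d) := by
  rw [det_diagonal, Fin.prod_univ_three] at hd
  have h0 : d 0 ≠ 0 := by rintro h; simp [h] at hd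
  have h1 : d 1 ≠ 0 := by rintro h; simp [h] at hd
  have h2 : d 2 ≠ 0 := by rintro h; simp [h] at hd
  have key (e : Fin 3 → ℝ) (he : ActsTrivially (diagonal e)) (hp : ∀ i, 0 < e i * d i)
      (hee : ∀ i, e i * e i = 1) : ActsTrivially (diagonal d) := by
    have := he.mul (actsTrivially_diagonal_pos hp)
    rw [diagonal_mul_diagonal] at this
    have h : (fun i => e i * (e i * d i)) = d := by
      funext i
      rw [← mul_assoc, hee, one_mul]
    rwa [h] at this
  rcases h0.lt_or_gt with h0 | h0 <;> rcases h1.lt_or_gt with h1 | h1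
  · have h2 : 0 < d 2 := by nlinarith [mul_pos_of_neg_of_neg h0 h1]
    refine key _ actsTrivially_diagonal_neg₂ (fun i => ?_) (fun i => ?_) <;>
      fin_cases i <;> simp_all
  · have h2 : d 2 < 0 := by nlinarith [mul_neg_of_neg_of_pos h0 h1]
    refine key _ actsTrivially_diagonal_neg₁ (fun i => ?_) (fun i => ?_) <;>
      fin_cases i <;> simp_all
  · have h2 : d 2 < 0 := by nlinarith [mul_neg_of_pos_of_neg h0 h1]
    refine key _ actsTrivially_diagonal_neg₀ (fun i => ?_) (fun i => ?_) <;>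
      fin_cases i <;> simp_all
  · have h2 : 0 < d 2 := by nlinarith [mul_pos h0 h1]
    refine actsTrivially_diagonal_pos fun i => ?_
    fin_cases i <;> simp_all

/-- Matrices of positive determinant act trivially on local homology. -/
theorem actsTrivially_of_det_pos {A : Matrix (Fin 3) (Fin 3) ℝ} (hA : 0 < A.det) :
    ActsTrivially A := by
  obtain ⟨L, L', D, rfl⟩ := Pivot.exists_list_transvec_mul_diagonal_mul_list_transvec A
  have hL (L : List (TransvectionStruct (Fin 3) ℝ)) :
      ActsTrivially (L.map TransvectionStruct.toMatrix).prod := by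
    refine actsTrivially_list fun A hA => ?_
    obtain ⟨t, -, rfl⟩ := List.mem_map.1 hA
    exact actsTrivially_transvection t
  refine ((hL L).mul (actsTrivially_diagonal ?_)).mul (hL L')
  simpa only [det_mul, TransvectionStruct.det_toMatrix_prod, one_mul, mul_one] using hA

end Matrices

/-! ### Coherence of positively oriented affine simplices -/

section Coherence

open Matrix

/-- The determinant of the edges of an affine simplex. -/
def affDet (v : Fin 4 → Fin 3 → ℝ) : ℝ := (Matrix.of fun i j : Fin 3 => v i.succ j - v 0 j).det

theorem aff_apply_three (v : Fin 4 → Fin 3 → ℝ) (t : Simplex 3) (j : Fin 3) :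
    aff v t j = t 0 * v 0 j + t 1 * v 1 j + t 2 * v 2 j + t 3 * v 3 j := by
  rw [aff_apply, Finset.sum_apply]
  exact Fin.sum_univ_four _

theorem eq_zero_of_affDet {v : Fin 4 → Fin 3 → ℝ} (hv : affDet v ≠ 0) {b : Fin 4 → ℝ}
    (hb : ∑ i, b i = 0) (h : ∑ i, b i • v i = 0) : b = 0 := by
  have h1 : (fun i : Fin 3 => b i.succ) = 0 := by
    refine eq_zero_of_vecMul_eq_zero hv ?_
    ext j
    have h2 := congrFun h j
    rw [Fin.sum_univ_four] at hb
    simp only [Fin.sum_univ_four, Pi.add_apply, Pi.smul_apply, smul_eq_mul, Pi.zero_apply] at h2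
    simp only [vecMul, dotProduct, Fin.sum_univ_three, of_apply, Pi.zero_apply]
    change b 1 * (v 1 j - v 0 j) + b 2 * (v 2 j - v 0 j) + b 3 * (v 3 j - v 0 j) = 0
    linear_combination h2 - v 0 j * hb
  rw [Fin.sum_univ_succ] at hb
  have h2 (i : Fin 3) : b i.succ = 0 := congrFun h1 i
  ext i
  refine Fin.cases ?_ h2 i
  simpa [h2] using hb

theorem aff_injective {v : Fin 4 → Fin 3 → ℝ} (hv : affDet v ≠ 0) :
    Function.Injective (aff v : C(Simplex 3, Fin 3 → ℝ)) := by
  intro s t h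
  have h1 := eq_zero_of_affDet hv (b := fun i => s i - t i)
    (by rw [Finset.sum_sub_distrib, stdSimplex.sum_eq_one, stdSimplex.sum_eq_one, sub_self])
    (by simp only [sub_smul, Finset.sum_sub_distrib]; exact sub_eq_zero.2 h)
  ext i
  exact sub_eq_zero.1 (congrFun h1 i)

/-- Barycentric coordinates are affine functions of the point, given by the inverse of the edge
matrix, and the interior is cut out by strict inequalities between them. -/
theorem isOpen_aff_interior {v : Fin 4 → Fin 3 → ℝ} (hv : affDet v ≠ 0) :
    IsOpen ((aff v : C(Simplex 3, Fin 3 → ℝ)) '' simplexInterior 3) := by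
  set D : Matrix (Fin 3) (Fin 3) ℝ := Matrix.of fun i j : Fin 3 => v i.succ j - v 0 j with hD
  have hDu : IsUnit D.det := isUnit_iff_ne_zero.2 hv
  have hval (t : Simplex 3) : aff v t - v 0 = (fun i : Fin 3 => t i.succ) ᵥ* D := by
    have hs := stdSimplex.sum_eq_one t
    rw [Fin.sum_univ_four] at hs
    ext j
    simp only [aff_apply_three, Pi.sub_apply, vecMul, dotProduct, Fin.sum_univ_three, hD, of_apply]
    change _ = t 1 * (v 1 j - v 0 j) + t 2 * (v 2 j - v 0 j) + t 3 * (v 3 j - v 0 j)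
    linear_combination v 0 j * hs
  have : (aff v : C(Simplex 3, Fin 3 → ℝ)) '' simplexInterior 3 =
      {x | (∀ i, 0 < ((x - v 0) ᵥ* D⁻¹) i) ∧ ∑ i, ((x - v 0) ᵥ* D⁻¹) i < 1} := by
    ext x
    constructor
    · rintro ⟨t, ht, rfl⟩
      rw [Set.mem_ofPred_eq, hval, vecMul_vecMul, mul_nonsing_inv D hDu, vecMul_one]
      refine ⟨fun i => ht _, ?_⟩
      have hs := stdSimplex.sum_eq_one t
      rw [Fin.sum_univ_succ] at hs
      have := ht 0
      linarith
    · rintro ⟨h1, h2⟩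
      set y := (x - v 0) ᵥ* D⁻¹ with hy
      let t : Simplex 3 := ⟨Fin.cons (1 - ∑ i, y i) y, fun i =>
        Fin.cases (by simpa using h2.le) (fun i => by simpa using (h1 i).le) i, by
          rw [Fin.sum_univ_succ]; simp⟩
      refine ⟨t, fun i => Fin.cases (by change 0 < 1 - ∑ i, y i; linarith) h1 i, ?_⟩
      have h3 : aff v t - v 0 = x - v 0 := by
        rw [hval, show (fun i : Fin 3 => t i.succ) = y from rfl, hy, vecMul_vecMul,
          nonsing_inv_mul D hDu, vecMul_one]
      exact sub_left_injective h3
  rw [this]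
  have hc (i : Fin 3) : Continuous fun x : Fin 3 → ℝ => ((x - v 0) ᵥ* D⁻¹) i := by
    simp only [vecMul, dotProduct]
    fun_prop
  have h1 := isOpen_iInter_of_finite fun i => isOpen_lt continuous_const (hc i) (f := fun _ => (0 : ℝ))
  have h2 := isOpen_lt (continuous_finsetSum Finset.univ fun i _ => hc i)
    (continuous_const (y := (1 : ℝ)))
  convert h1.inter h2 using 1
  ext x
  simp

/-- Relations between the vertices form a line, spanned by the barycentric coordinates of the
origin. Those are all positive, so one vanishing coefficient makes the whole relation vanish. -/
theorem relation_of_affDet {v : Fin 4 → Fin 3 → ℝ} (hv : affDet v ≠ 0) {t : Simplex 3}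
    (ht : t ∈ simplexInterior 3) (h0 : aff v t = 0) {a : Fin 4 → ℝ} (ha : ∑ i, a i • v i = 0)
    {j : Fin 4} (hj : a j = 0) : a = 0 := by
  have h1 := eq_zero_of_affDet hv (b := fun i => a i - (∑ l, a l) * t i)
    (by rw [Finset.sum_sub_distrib, ← Finset.mul_sum, stdSimplex.sum_eq_one]; ring)
    (by
      simp only [sub_smul, Finset.sum_sub_distrib, mul_smul, ← Finset.smul_sum]
      rw [ha, ← aff_apply, h0, smul_zero, sub_zero])
  have h2 := congrFun h1 j
  simp only [hj, Pi.zero_apply, zero_sub, neg_eq_zero, mul_eq_zero, (ht j).ne', or_false] at h2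
  ext i
  have := congrFun h1 i
  simpa [h2] using this

/-- The determinant of the last three vertices of a simplex around the origin. -/
theorem mul_affDet {v : Fin 4 → Fin 3 → ℝ} {t : Simplex 3} (h0 : aff v t = 0) :
    t 0 * affDet v = (Matrix.of fun i j : Fin 3 => v j.succ i).det := by
  have hs := stdSimplex.sum_eq_one t
  rw [Fin.sum_univ_four] at hs
  have h (j : Fin 3) : t 0 * v 0 j + t 1 * v 1 j + t 2 * v 2 j + t 3 * v 3 j = 0 := by
    rw [← aff_apply_three, h0, Pi.zero_apply]
  have e0 := h 0
  have e1 := h 1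
  have e2 := h 2
  simp only [affDet, det_fin_three, of_apply]
  change t 0 * ((v 1 0 - v 0 0) * (v 2 1 - v 0 1) * (v 3 2 - v 0 2) -
    (v 1 0 - v 0 0) * (v 2 2 - v 0 2) * (v 3 1 - v 0 1) -
    (v 1 1 - v 0 1) * (v 2 0 - v 0 0) * (v 3 2 - v 0 2) +
    (v 1 1 - v 0 1) * (v 2 2 - v 0 2) * (v 3 0 - v 0 0) +
    (v 1 2 - v 0 2) * (v 2 0 - v 0 0) * (v 3 1 - v 0 1) -
    (v 1 2 - v 0 2) * (v 2 1 - v 0 1) * (v 3 0 - v 0 0)) =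
    v 1 0 * v 2 1 * v 3 2 - v 1 0 * v 3 1 * v 2 2 - v 2 0 * v 1 1 * v 3 2 +
    v 2 0 * v 3 1 * v 1 2 + v 3 0 * v 1 1 * v 2 2 - v 3 0 * v 2 1 * v 1 2
  linear_combination (v 1 0 * v 2 1 * v 3 2 - v 1 0 * v 3 1 * v 2 2 - v 2 0 * v 1 1 * v 3 2 +
    v 2 0 * v 3 1 * v 1 2 + v 3 0 * v 1 1 * v 2 2 - v 3 0 * v 2 1 * v 1 2) * hs -
    (v 2 1 * v 3 2 - v 2 2 * v 3 1 - (v 1 1 * v 3 2 - v 1 2 * v 3 1) +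
      (v 1 1 * v 2 2 - v 1 2 * v 2 1)) * e0 -
    (-(v 2 0 * v 3 2 - v 2 2 * v 3 0) + (v 1 0 * v 3 2 - v 1 2 * v 3 0) -
      (v 1 0 * v 2 2 - v 1 2 * v 2 0)) * e1 -
    (v 2 0 * v 3 1 - v 2 1 * v 3 0 - (v 1 0 * v 3 1 - v 1 1 * v 3 0) +
      (v 1 0 * v 2 1 - v 1 1 * v 2 0)) * e2

/-- Rescaling the vertices of a simplex around the origin. -/
theorem trivialOn_rescale {v : Fin 4 → Fin 3 → ℝ} (hv : affDet v ≠ 0) {t : Simplex 3}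
    (ht : t ∈ simplexInterior 3) (h0 : aff v t = 0) {μ : Fin 4 → ℝ} (hμ : ∀ i, 0 < μ i) :
    TrivialOn {0} (Finsupp.single (aff fun i => μ i • v i : C(Simplex 3, Fin 3 → ℝ)) (1 : ℤ) -
      Finsupp.single (aff v) 1) := by
  refine trivialOn_single_sub _ _ fun u j hj s hs0 hs1 h => ?_
  have hpos (i) : 0 < (1 - s) + s * μ i := by
    rcases hs0.eq_or_lt with rfl | hs
    · simp
    · nlinarith [mul_pos hs (hμ i)]
  have h1 : ∑ i, (u i * ((1 - s) + s * μ i)) • v i = 0 := by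
    rw [← Set.mem_singleton_iff.1 h, aff_apply, aff_apply, Finset.smul_sum, Finset.smul_sum,
      ← Finset.sum_add_distrib]
    refine Finset.sum_congr rfl fun i _ => ?_
    module
  have h2 := relation_of_affDet hv ht h0 h1 (j := j) (by rw [hj, zero_mul])
  have h3 (i) : u i = 0 := by
    have := congrFun h2 i
    exact (mul_eq_zero.1 this).resolve_right (hpos i).ne'
  have := stdSimplex.sum_eq_one u
  simp [h3] at this

/-- Positively oriented affine simplices agree in local homology. -/
theorem trivialOn_affine_sub_zero {v v' : Fin 4 → Fin 3 → ℝ} (hv : 0 < affDet v)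
    (hv' : 0 < affDet v') {t t' : Simplex 3} (ht : t ∈ simplexInterior 3)
    (ht' : t' ∈ simplexInterior 3) (h0 : aff v t = 0) (h0' : aff v' t' = 0) :
    TrivialOn {0} (Finsupp.single (aff v : C(Simplex 3, Fin 3 → ℝ)) (1 : ℤ) -
      Finsupp.single (aff v') 1) := by
  -- This rescaling gives the origin the same barycentric coordinates `t` in both simplices. The
  -- linear map matching the last three vertices then also matches the first, and its determinant is
  -- positive.
  set μ : Fin 4 → ℝ := fun i => t' i / t i with hμ
  have hμ0 (i) : 0 < μ i := div_pos (ht' i) (ht i)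
  refine TrivialOn.symm (TrivialOn.trans (TrivialOn.symm (trivialOn_rescale hv'.ne' ht' h0' hμ0)) ?_)
  set w : Fin 4 → Fin 3 → ℝ := fun i => μ i • v' i with hw
  have h0w : aff w t = 0 := by
    rw [← h0', aff_apply, aff_apply]
    refine Finset.sum_congr rfl fun i _ => ?_
    rw [hw, hμ, smul_smul, mul_div_cancel₀ _ (ht i).ne']
  set V : Matrix (Fin 3) (Fin 3) ℝ := Matrix.of fun i j : Fin 3 => v j.succ i with hV
  set W : Matrix (Fin 3) (Fin 3) ℝ := Matrix.of fun i j : Fin 3 => w j.succ i with hW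
  have hVd : 0 < V.det := by
    rw [← mul_affDet h0]
    exact mul_pos (ht 0) hv
  have hWd : 0 < W.det := by
    have h1 : W = (Matrix.of fun i j : Fin 3 => v' j.succ i) * diagonal fun j => μ j.succ := by
      ext i j
      rw [mul_diagonal, hW, of_apply, of_apply, hw]
      exact mul_comm _ _
    rw [h1, det_mul, ← mul_affDet h0', det_diagonal]
    exact mul_pos (mul_pos (ht' 0) hv') (Finset.prod_pos fun i _ => hμ0 _)
  have hVu : IsUnit V.det := isUnit_iff_ne_zero.2 hVd.ne'
  have hA : 0 < (W * V⁻¹).det := by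
    rw [det_mul, det_nonsing_inv, Ring.inverse_eq_inv']
    positivity
  have hcol (U : Matrix (Fin 3) (Fin 3) ℝ) (j : Fin 3) : U *ᵥ Pi.single j 1 = fun i => U i j := by
    ext i; simp
  have hAv (j : Fin 3) : (W * V⁻¹) *ᵥ v j.succ = w j.succ := by
    have h1 : v j.succ = V *ᵥ Pi.single j 1 := (hcol V j).symm
    rw [h1, mulVec_mulVec, mul_assoc, nonsing_inv_mul V hVu, mul_one]
    exact hcol W j
  have hAv0 : (W * V⁻¹) *ᵥ v 0 = w 0 := by
    have h1 := congrArg ((W * V⁻¹) *ᵥ ·) h0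
    have h2 := h0w
    simp only [aff_apply, mulVec_zero] at h1 h2
    rw [Fin.sum_univ_succ] at h1 h2
    simp only [mulVec_add, mulVec_sum, mulVec_smul, hAv] at h1
    rw [← h2] at h1
    exact smul_right_injective _ (ht 0).ne' (add_right_cancel h1)
  have hpush : push (matrixMap (W * V⁻¹)) (Finsupp.single (aff v) (1 : ℤ)) =
      Finsupp.single (aff w) 1 := by
    rw [push_single]
    congr 1
    ext1 u
    change (W * V⁻¹) *ᵥ (∑ i, u i • v i) = ∑ i, u i • w i
    rw [mulVec_sum]
    refine Finset.sum_congr rfl fun i _ => ?_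
    rw [mulVec_smul]
    congr 1
    exact Fin.cases hAv0 hAv i
  rw [← hpush]
  refine (actsTrivially_of_det_pos hA).2 2 _ (supportedIn_boundary_single (fun u j hj h => ?_) 1)
  have := relation_of_affDet hv.ne' ht h0 (a := fun i => u i) h hj
  have h2 := stdSimplex.sum_eq_one u
  simp only [fun i => congrFun this i] at h2
  simp at h2

theorem affDet_sub (v : Fin 4 → Fin 3 → ℝ) (x : Fin 3 → ℝ) :
    affDet (fun i => v i - x) = affDet v := by
  simp [affDet]

theorem translate_aff (v : Fin 4 → Fin 3 → ℝ) (x : Fin 3 → ℝ) :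
    (translate x).comp (aff v : C(Simplex 3, Fin 3 → ℝ)) = aff fun i => v i + x := by
  ext1 t
  change (∑ i, t i • v i) + x = ∑ i, t i • (v i + x)
  simp only [smul_add, Finset.sum_add_distrib, ← Finset.sum_smul]
  rw [stdSimplex.sum_eq_one, one_smul]

theorem trivialOn_affine_sub {v v' : Fin 4 → Fin 3 → ℝ} (hv : 0 < affDet v)
    (hv' : 0 < affDet v') {t t' : Simplex 3} (ht : t ∈ simplexInterior 3)
    (ht' : t' ∈ simplexInterior 3) (h : aff v t = aff v' t') :
    TrivialOn {aff v t} (Finsupp.single (aff v : C(Simplex 3, Fin 3 → ℝ)) (1 : ℤ) -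
      Finsupp.single (aff v') 1) := by
  set x := aff v t with hx
  have key (u : Fin 4 → Fin 3 → ℝ) : aff u = (translate x).comp
      (aff fun i => u i - x : C(Simplex 3, Fin 3 → ℝ)) := by
    rw [translate_aff]
    simp
  have h1 (u : Fin 4 → Fin 3 → ℝ) (s : Simplex 3) (hs : aff u s = x) :
      aff (fun i => u i - x) s = 0 := by
    have := DFunLike.congr_fun (key u) s
    rw [hs] at this
    simpa [translate] using this.symm
  have := trivialOn_affine_sub_zero (v := fun i => v i - x) (v' := fun i => v' i - x)
    (by rwa [affDet_sub]) (by rwa [affDet_sub]) ht ht' (h1 v t hx.symm) (h1 v' t' h.symm)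
  have := this.push (f := translate x) (L := {x}) fun y hy => by simpa [translate] using hy
  rwa [map_sub, push_single, push_single, ← key, ← key] at this

end Coherence

end SurgeryFormula

end

noncomputable section

namespace SurgeryFormula

open HasAffineSimplices

/-! ### Simplices around a point -/

section SmallSimplices

open Matrix

/-- The barycenter is interior. -/
def bary : Simplex 3 := ⟨fun _ => 1 / 4, fun _ => by norm_num, by simp⟩

theorem bary_mem : bary ∈ simplexInterior 3 := fun i => by
  change (0 : ℝ) < 1 / 4
  norm_num

/-- A small positively oriented simplex around the origin. -/
def smallVertices (r : ℝ) : Fin 4 → Fin 3 → ℝ :=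
  ![![-r, -r, -r], ![r, 0, 0], ![0, r, 0], ![0, 0, r]]

theorem affDet_smallVertices {r : ℝ} (hr : 0 < r) : 0 < affDet (smallVertices r) := by
  have : affDet (smallVertices r) = 4 * r ^ 3 := by
    simp [affDet, smallVertices, det_fin_three]
    ring
  rw [this]
  positivity

theorem aff_smallVertices (r : ℝ) : aff (smallVertices r) bary = 0 := by
  ext j
  rw [aff_apply_three]
  change 1 / 4 * smallVertices r 0 j + 1 / 4 * smallVertices r 1 j + 1 / 4 * smallVertices r 2 j +
    1 / 4 * smallVertices r 3 j = 0
  fin_cases j <;> simp [smallVertices]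

theorem range_aff_smallVertices {r : ℝ} (hr : 0 < r) :
    Set.range (aff (smallVertices r) : C(Simplex 3, Fin 3 → ℝ)) ⊆ Metric.closedBall 0 r := by
  rintro _ ⟨t, rfl⟩
  refine (convex_closedBall (0 : Fin 3 → ℝ) r).sum_mem (fun i _ => t.2.1 i) t.2.2 fun i _ => ?_
  rw [mem_closedBall_zero_iff, pi_norm_le_iff_of_nonneg hr.le]
  intro j
  fin_cases i <;> fin_cases j <;> simp [smallVertices, abs_of_pos hr, hr.le]

end SmallSimplices

/-! ### The 3-sphere -/

section Sphere

open Matrix WithLp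

/-- Radial projection to the sphere. -/
def radial : C(({0}ᶜ : Set (Fin 4 → ℝ)), Sphere3) where
  toFun y := ⟨‖toLp 2 y.1‖⁻¹ • toLp 2 y.1, by
    have : ‖toLp 2 y.1‖ ≠ 0 := norm_ne_zero_iff.2 fun h => y.2 (by simpa using h)
    rw [mem_sphere_zero_iff_norm, norm_smul, norm_inv, norm_norm, inv_mul_cancel₀ this]⟩
  continuous_toFun := by
    have hc : Continuous fun y : ({0}ᶜ : Set (Fin 4 → ℝ)) => toLp 2 y.1 :=
      (PiLp.continuous_toLp 2 _).comp continuous_subtype_val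
    refine Continuous.subtype_mk (Continuous.smul (Continuous.inv₀ hc.norm fun y => ?_) hc) _
    exact norm_ne_zero_iff.2 fun h => y.2 (by simpa using h)

theorem exists_eq_smul_radial (y : ({0}ᶜ : Set (Fin 4 → ℝ))) :
    ∃ c : ℝ, 0 < c ∧ y.1 = c • ofLp (radial y).1 := by
  have h : ‖toLp 2 y.1‖ ≠ 0 := norm_ne_zero_iff.2 fun h => y.2 (by simpa using h)
  refine ⟨‖toLp 2 y.1‖, (norm_nonneg _).lt_of_ne' h, ?_⟩
  change y.1 = ‖toLp 2 y.1‖ • ofLp (‖toLp 2 y.1‖⁻¹ • toLp 2 y.1)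
  rw [ofLp_smul, smul_smul, mul_inv_cancel₀ h, one_smul]

theorem radial_eq {y : ({0}ᶜ : Set (Fin 4 → ℝ))} {x : Sphere3} {c : ℝ} (hc : 0 < c)
    (h : y.1 = c • ofLp x.1) : radial y = x := by
  apply Subtype.ext
  change ‖toLp 2 y.1‖⁻¹ • toLp 2 y.1 = x.1
  rw [h, toLp_smul, toLp_ofLp, norm_smul, Real.norm_of_nonneg hc.le, norm_eq_of_mem_sphere,
    mul_one, smul_smul, inv_mul_cancel₀ hc.ne', one_smul]

theorem radial_eq_radial_iff {y z : ({0}ᶜ : Set (Fin 4 → ℝ))} :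
    radial y = radial z ↔ ∃ c : ℝ, 0 < c ∧ y.1 = c • z.1 := by
  obtain ⟨c, hc, h⟩ := exists_eq_smul_radial z
  constructor
  · intro h'
    obtain ⟨d, hd, h1⟩ := exists_eq_smul_radial y
    refine ⟨d / c, div_pos hd hc, ?_⟩
    rw [h1, h', h, smul_smul, div_mul_cancel₀ _ hc.ne']
  · rintro ⟨d, hd, h1⟩
    exact radial_eq (mul_pos hd hc) (by rw [h1, mul_smul, ← h])

theorem radial_congr {y z : ({0}ᶜ : Set (Fin 4 → ℝ))} (h : y.1 = z.1) : radial y = radial z :=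
  congrArg radial (Subtype.ext h)

theorem simplex_ne_zero {k : ℕ} (t : Simplex k) : t.1 ≠ 0 := by
  intro h
  have := t.2.2
  rw [h] at this
  simp at this

theorem vecMul_mem {W : Matrix (Fin 4) (Fin 4) ℝ} (hW : W.det ≠ 0) {y : Fin 4 → ℝ} (hy : y ≠ 0) :
    y ᵥ* W ∈ ({0}ᶜ : Set (Fin 4 → ℝ)) := fun h => hy (eq_zero_of_vecMul_eq_zero hW h)

/-- The spherical simplex given by the rows of an invertible matrix. -/
def sphereSimplex (W : Matrix (Fin 4) (Fin 4) ℝ) (hW : W.det ≠ 0) : SingularSimplex 3 Sphere3 :=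
  radial.comp ⟨fun t => ⟨t.1 ᵥ* W, vecMul_mem hW (simplex_ne_zero t)⟩,
    Continuous.subtype_mk (Continuous.matrix_vecMul continuous_subtype_val continuous_const) _⟩

theorem sphereSimplex_apply (W : Matrix (Fin 4) (Fin 4) ℝ) (hW : W.det ≠ 0) (t : Simplex 3) :
    sphereSimplex W hW t = radial ⟨t.1 ᵥ* W, vecMul_mem hW (simplex_ne_zero t)⟩ := rfl

theorem mem_sphereOrientation_iff {σ : SingularSimplex 3 Sphere3} :
    σ ∈ sphereOrientation ↔ ∃ W : Matrix (Fin 4) (Fin 4) ℝ, ∃ h : 0 < W.det,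
      σ = sphereSimplex W h.ne' := by
  have key (v : Fin 4 → EuclideanSpace ℝ (Fin 4)) (t : Simplex 3) :
      toLp 2 (t.1 ᵥ* (Matrix.of fun i j : Fin 4 => v i j)) = ∑ k, t k • v k := by
    ext j
    simp only [vecMul, dotProduct, of_apply]
    rw [WithLp.ofLp_sum, Finset.sum_apply]
    rfl
  constructor
  · rintro ⟨v, hv, h⟩
    refine ⟨_, hv, ?_⟩
    ext1 t
    apply Subtype.ext
    rw [h, ← key]
    rfl
  · rintro ⟨W, hW, rfl⟩
    refine ⟨fun i => toLp 2 (W i), hW, fun t => ?_⟩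
    rw [← key]
    rfl

theorem sphereSimplex_eq_iff {W : Matrix (Fin 4) (Fin 4) ℝ} {hW : W.det ≠ 0} {t : Simplex 3}
    {x : Sphere3} : sphereSimplex W hW t = x ↔ ∃ c : ℝ, 0 < c ∧ t.1 ᵥ* W = c • ofLp x.1 := by
  constructor
  · rintro rfl
    exact exists_eq_smul_radial ⟨t.1 ᵥ* W, vecMul_mem hW (simplex_ne_zero t)⟩
  · rintro ⟨c, hc, h⟩
    exact radial_eq hc h

/-- Points with the same projection have proportional coefficient vectors, and coefficients summing
to one fix the factor. The interior consists of the points whose coordinates with respect to the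
rows are all positive. -/
theorem isRegularSimplex_sphereSimplex (W : Matrix (Fin 4) (Fin 4) ℝ) (hW : W.det ≠ 0) :
    IsRegularSimplex (sphereSimplex W hW) := by
  have hWu : IsUnit W.det := isUnit_iff_ne_zero.2 hW
  constructor
  · intro s t h
    obtain ⟨c, hc, h⟩ := radial_eq_radial_iff.1 h
    have h1 : s.1 = c • t.1 := by
      have h2 : (s.1 - c • t.1) ᵥ* W = 0 := by
        rw [sub_vecMul, smul_vecMul]
        exact sub_eq_zero.2 h
      exact sub_eq_zero.1 (eq_zero_of_vecMul_eq_zero hW h2)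
    have hc1 : c = 1 := by
      have h2 := s.2.2
      rw [h1] at h2
      simp only [Pi.smul_apply, smul_eq_mul, ← Finset.mul_sum] at h2
      rwa [t.2.2, mul_one] at h2
    rw [hc1, one_smul] at h1
    exact Subtype.ext h1
  · have : sphereSimplex W hW '' simplexInterior 3 = ⋂ i, {x | 0 < (ofLp x.1 ᵥ* W⁻¹) i} := by
      ext x
      rw [Set.mem_iInter]
      constructor
      · rintro ⟨t, ht, h⟩ i
        obtain ⟨c, hc, h⟩ := sphereSimplex_eq_iff.1 h
        have h1 : t.1 = c • (ofLp x.1 ᵥ* W⁻¹) := by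
          rw [← smul_vecMul, ← h, vecMul_vecMul, mul_nonsing_inv W hWu, vecMul_one]
        have h2 : t i = c * (ofLp x.1 ᵥ* W⁻¹) i := congrFun h1 i
        have h3 := ht i
        rw [h2] at h3
        exact pos_of_mul_pos_right h3 hc.le
      · intro h
        replace h (i) : 0 < (ofLp x.1 ᵥ* W⁻¹) i := h i
        set y := ofLp x.1 ᵥ* W⁻¹ with hy
        have hs : 0 < ∑ i, y i := Finset.sum_pos (fun i _ => h i) ⟨0, Finset.mem_univ _⟩
        refine ⟨⟨(∑ i, y i)⁻¹ • y, fun i => ?_, ?_⟩, fun i => ?_,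
          sphereSimplex_eq_iff.2 ⟨(∑ i, y i)⁻¹, inv_pos.2 hs, ?_⟩⟩
        · exact mul_nonneg (inv_nonneg.2 hs.le) (h i).le
        · simp only [Pi.smul_apply, smul_eq_mul, ← Finset.mul_sum]
          exact inv_mul_cancel₀ hs.ne'
        · exact mul_pos (inv_pos.2 hs) (h i)
        · change ((∑ i, y i)⁻¹ • y) ᵥ* W = _
          rw [smul_vecMul, hy, vecMul_vecMul, nonsing_inv_mul W hWu, vecMul_one]
    rw [this]
    refine isOpen_iInter_of_finite fun i => isOpen_lt continuous_const ?_
    simp only [vecMul, dotProduct]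
    fun_prop

theorem isRegularSimplex_of_mem_sphereOrientation {σ : SingularSimplex 3 Sphere3}
    (h : σ ∈ sphereOrientation) : IsRegularSimplex σ := by
  obtain ⟨W, hW, rfl⟩ := mem_sphereOrientation_iff.1 h
  exact isRegularSimplex_sphereSimplex W _

theorem hasChartAt_sphere (x : Sphere3) : HasChartAt x := by
  have : Fact (Module.finrank ℝ (EuclideanSpace ℝ (Fin 4)) = 3 + 1) := ⟨by simp⟩
  let φ := (stereographic' 3 (-x)).symm
  have ho : Topology.IsOpenEmbedding φ :=
    φ.isOpenEmbedding (by rw [OpenPartialHomeomorph.symm_source]; exact stereographic'_target _)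
  let e : (Fin 3 → ℝ) ≃ₜ EuclideanSpace ℝ (Fin 3) := (PiLp.homeomorph 2 fun _ : Fin 3 => ℝ).symm
  refine ⟨⟨φ ∘ e, (ho.comp e.isOpenEmbedding).continuous⟩, ho.comp e.isOpenEmbedding, ?_⟩
  have hx : x ∈ φ.target := by
    rw [OpenPartialHomeomorph.symm_target, stereographic'_source]
    exact ne_neg_of_mem_unit_sphere ℝ x
  exact ⟨e.symm (φ.symm x), by simp [φ.right_inv hx]⟩

/-- The orthonormal frame `x, x i, x j, x k` at `x`. -/
def frame (x : Fin 4 → ℝ) : Matrix (Fin 4) (Fin 4) ℝ :=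
  !![x 0, x 1, x 2, x 3; -x 1, x 0, -x 3, x 2; -x 2, x 3, x 0, -x 1; -x 3, -x 2, x 1, x 0]

theorem sum_sq_eq_one (x : Sphere3) :
    x.1 0 ^ 2 + x.1 1 ^ 2 + x.1 2 ^ 2 + x.1 3 ^ 2 = 1 := by
  have := EuclideanSpace.norm_sq_eq x.1
  rw [norm_eq_of_mem_sphere, Fin.sum_univ_four] at this
  simpa using this.symm

theorem frame_transpose_mul (x : Sphere3) : (frame x.1)ᵀ * frame x.1 = 1 := by
  have h := sum_sq_eq_one x
  ext i j
  rw [mul_apply, Fin.sum_univ_four]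
  fin_cases i <;> fin_cases j <;> simp [frame] <;>
    first | linear_combination h | ring_nf

theorem det_frame (x : Sphere3) : (frame x.1).det = 1 := by
  have h := sum_sq_eq_one x
  have h1 : (frame x.1).det = (x.1 0 ^ 2 + x.1 1 ^ 2 + x.1 2 ^ 2 + x.1 3 ^ 2) ^ 2 := by
    simp [frame, det_succ_row_zero, Fin.sum_univ_succ, Fin.succAbove]
    ring
  rw [h1, h, one_pow]

theorem single_vecMul_frame (x : Sphere3) :
    (vecCons 1 (0 : Fin 3 → ℝ)) ᵥ* frame x.1 = ofLp x.1 := by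
  ext j
  simp only [vecMul, dotProduct, Fin.sum_univ_four]
  fin_cases j <;> simp [frame]

/-- Central projection from the tangent space at `x` to the sphere. -/
def gnomonic (x : Sphere3) : C(Fin 3 → ℝ, Sphere3) :=
  radial.comp ⟨fun u => ⟨vecCons 1 u ᵥ* frame x.1, vecMul_mem (by rw [det_frame]; exact one_ne_zero)
      fun h => one_ne_zero (congrFun h 0)⟩, by
    refine Continuous.subtype_mk (Continuous.matrix_vecMul ?_ continuous_const) _
    exact continuous_const.matrixVecCons continuous_id⟩

theorem gnomonic_zero (x : Sphere3) : gnomonic x 0 = x :=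
  radial_eq one_pos (by rw [one_smul]; exact single_vecMul_frame x)

theorem eq_zero_of_gnomonic {x : Sphere3} {u : Fin 3 → ℝ} (h : gnomonic x u = x) : u = 0 := by
  obtain ⟨c, hc, h'⟩ := exists_eq_smul_radial (⟨vecCons 1 u ᵥ* frame x.1,
    vecMul_mem (by rw [det_frame]; exact one_ne_zero) fun h => one_ne_zero (congrFun h 0)⟩ :
      ({0}ᶜ : Set (Fin 4 → ℝ)))
  replace h' : vecCons 1 u ᵥ* frame x.1 = c • vecCons 1 0 ᵥ* frame x.1 := by
    rw [single_vecMul_frame]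
    refine h'.trans ?_
    congr 2
    exact congrArg Subtype.val h
  have h1 := eq_zero_of_vecMul_eq_zero (M := frame x.1) (by rw [det_frame]; exact one_ne_zero)
    (v := vecCons 1 u - c • vecCons 1 0) (by rw [sub_vecMul, h', smul_vecMul, sub_self])
  ext i
  simpa using congrFun h1 i.succ

theorem det_vecCons_one (p : Fin 4 → Fin 3 → ℝ) :
    (Matrix.of fun i => vecCons 1 (p i) : Matrix (Fin 4) (Fin 4) ℝ).det = affDet p := by
  simp [affDet, det_succ_row_zero, Fin.sum_univ_succ, Fin.succAbove]
  ring

theorem vecMul_vecCons (t : Fin 4 → ℝ) (a : Fin 4 → ℝ) (p : Fin 4 → Fin 3 → ℝ) :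
    t ᵥ* (Matrix.of fun i => vecCons (a i) (p i) : Matrix (Fin 4) (Fin 4) ℝ) =
      vecCons (∑ i, t i * a i) (∑ i, t i • p i) := by
  ext j
  refine Fin.cases ?_ (fun j => ?_) j
  · simp [vecMul, dotProduct]
  · simp [vecMul, dotProduct]

/-- In the frame at x the vertices are the vectors `(1, p i)`, whose determinant is `affDet p`, and
the frame itself has determinant one. -/
theorem gnomonic_comp_aff_mem (x : Sphere3) {p : Fin 4 → Fin 3 → ℝ} (hp : 0 < affDet p) :
    (gnomonic x).comp (aff p) ∈ sphereOrientation := by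
  have h : 0 < ((Matrix.of fun i => vecCons 1 (p i) : Matrix (Fin 4) (Fin 4) ℝ) *
      frame x.1).det := by
    rwa [det_mul, det_frame, mul_one, det_vecCons_one]
  refine mem_sphereOrientation_iff.2 ⟨_, h, ?_⟩
  ext1 t
  rw [sphereSimplex_apply]
  refine radial_congr ?_
  change vecCons 1 (aff p t) ᵥ* frame x.1 = t.1 ᵥ* (_ * _)
  rw [← vecMul_vecMul, vecMul_vecCons]
  congr 2
  simp only [mul_one]
  exact t.2.2.symm

/-- Positive simplices of the sphere around a point, within a given neighbourhood. -/
theorem exists_sphereSimplex {x : Sphere3} {O : Set Sphere3} (hO : O ∈ nhds x) :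
    ∃ σ ∈ sphereOrientation, ∃ t ∈ simplexInterior 3, σ t = x ∧ Set.range σ ⊆ O := by
  have h1 : gnomonic x ⁻¹' O ∈ nhds 0 :=
    (gnomonic x).continuous.continuousAt.preimage_mem_nhds (by rwa [gnomonic_zero])
  obtain ⟨r, hr, h⟩ := Metric.nhds_basis_closedBall.mem_iff.1 h1
  refine ⟨_, gnomonic_comp_aff_mem x (affDet_smallVertices hr), bary, bary_mem, ?_, ?_⟩
  · rw [ContinuousMap.comp_apply, aff_smallVertices, gnomonic_zero]
  · rintro _ ⟨t, rfl⟩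
    exact h (range_aff_smallVertices hr ⟨t, rfl⟩)

/-- Positive simplices are locally central projections of affine simplices. -/
theorem exists_trivialOn_gnomonic {W : Matrix (Fin 4) (Fin 4) ℝ} (hW : 0 < W.det) {t : Simplex 3}
    (ht : t ∈ simplexInterior 3) {x : Sphere3} (hx : sphereSimplex W hW.ne' t = x) :
    ∃ p : Fin 4 → Fin 3 → ℝ, 0 < affDet p ∧ aff p t = 0 ∧
      TrivialOn {x} (push (gnomonic x) (Finsupp.single (aff p) (1 : ℤ)) -
        Finsupp.single (sphereSimplex W hW.ne') 1) := by
  obtain ⟨c, hc, htW⟩ := sphereSimplex_eq_iff.1 hx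
  have hB : (frame x.1).det ≠ 0 := by rw [det_frame]; exact one_ne_zero
  set C := W * (frame x.1)ᵀ with hC
  have hCW : C * frame x.1 = W := by rw [hC, mul_assoc, frame_transpose_mul, mul_one]
  have hCd : 0 < C.det := by rwa [hC, det_mul, det_transpose, det_frame, mul_one]
  -- In the frame at x, `a i` is the component of the i-th vertex along x and `p i` is its
  -- tangential part. At the parameter t the tangential part of the combination vanishes.
  set p : Fin 4 → Fin 3 → ℝ := fun i j => C i j.succ with hp
  set a : Fin 4 → ℝ := fun i => C i 0 with ha
  have hCof : C = Matrix.of fun i => vecCons (a i) (p i) := by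
    ext i j
    refine Fin.cases ?_ (fun j => ?_) j <;> simp [ha, hp]
  have hvec (y : Fin 4 → ℝ) : y ᵥ* W = vecCons (∑ i, y i * a i) (∑ i, y i • p i) ᵥ* frame x.1 := by
    rw [← hCW, ← vecMul_vecMul, ← vecMul_vecCons, ← hCof]
  have inj {y z : Fin 4 → ℝ} (h : y ᵥ* frame x.1 = z ᵥ* frame x.1) : y = z :=
    sub_eq_zero.1 (eq_zero_of_vecMul_eq_zero hB (by rw [sub_vecMul, h, sub_self]))
  have hrow : vecCons (∑ i, t i * a i) (∑ i, t i • p i) = c • vecCons 1 0 := by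
    refine inj ?_
    rw [smul_vecMul, single_vecMul_frame, ← htW]
    exact (hvec t.1).symm
  have hta : ∑ i, t i * a i = c := by simpa using congrFun hrow 0
  have htp : aff p t = 0 := by
    rw [aff_apply]
    ext j
    have := congrFun hrow j.succ
    simpa using this
  -- Replace the first row by the combination of all rows with weights `t`, which is c times the
  -- first basis vector, and expand the determinant along it.
  have hpd : 0 < affDet p := by
    have h1 := det_updateRow_sum C 0 (fun i => t i)
    have h2 : (∑ k, t k • C k) = c • vecCons 1 0 := by
      rw [← hrow, ← vecMul_vecCons, ← hCof]
      ext j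
      simp [vecMul, dotProduct]
    have h3 : (C.updateRow 0 (c • vecCons 1 0)).det = c * (t 0 * affDet p) := by
      rw [mul_affDet htp, ← det_transpose (Matrix.of fun i j : Fin 3 => p j.succ i),
        det_succ_row_zero, Fin.sum_univ_succ]
      simp only [updateRow_self, Pi.smul_apply, cons_val_zero, cons_val_succ, Pi.zero_apply,
        mul_zero, zero_mul, Finset.sum_const_zero, add_zero, smul_eq_mul, mul_one,
        Fin.val_zero, pow_zero, one_mul]
      congr 1
    rw [h2, h3, smul_eq_mul] at h1
    have h4 : affDet p * c = C.det := by
      have := (ht 0).ne'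
      refine mul_left_cancel₀ this ?_
      rw [← h1]
      ring
    rw [← h4] at hCd
    exact pos_of_mul_pos_left hCd hc.le
  refine ⟨p, hpd, htp, ?_⟩
  have hinj {u : Simplex 3} (h : ∑ i, u i • p i = 0) : u = t :=
    aff_injective hpd.ne' ((aff_apply p u).trans (h.trans htp.symm))
  -- Deform the component along x linearly to 1 and keep the tangential part. The latter vanishes
  -- only at t, where the former moves between c and 1 and stays positive; so the vector is never
  -- zero and the boundary never meets x.
  let h₀ : Simplex 3 × unitInterval → Fin 4 → ℝ := fun z =>
    vecCons ((1 - (z.2 : ℝ)) * ∑ i, z.1 i * a i + z.2) (∑ i, z.1 i • p i)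
  have hc₀ : Continuous h₀ := by
    have hcoord (i : Fin 4) : Continuous fun z : Simplex 3 × unitInterval => z.1 i :=
      (continuous_apply i).comp (continuous_subtype_val.comp continuous_fst)
    have hp2 : Continuous fun z : Simplex 3 × unitInterval => (z.2 : ℝ) :=
      continuous_subtype_val.comp continuous_snd
    refine Continuous.matrixVecCons ?_ ?_
    · exact ((continuous_const.sub hp2).mul (continuous_finsetSum _ fun i _ =>
        (hcoord i).mul continuous_const)).add hp2
    · exact continuous_finsetSum _ fun i _ => (hcoord i).smul continuous_const
  have hne (z) : h₀ z ≠ 0 := by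
    intro h
    have h1 : ∑ i, z.1 i • p i = 0 := by
      ext j
      simpa [h₀] using congrFun h j.succ
    have h2 := congrFun h 0
    simp only [h₀, cons_val_zero, hinj h1, hta, Pi.zero_apply] at h2
    have h3 := z.2.2.1
    have h4 := z.2.2.2
    rcases h3.eq_or_lt with h5 | h5
    · rw [← h5] at h2
      simp [hc.ne'] at h2
    · nlinarith [mul_nonneg (sub_nonneg.2 h4) hc.le]
  let H : C(Simplex 3 × unitInterval, Sphere3) := radial.comp
    ⟨fun z => ⟨h₀ z ᵥ* frame x.1, vecMul_mem hB (hne z)⟩,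
      Continuous.subtype_mk (hc₀.matrix_vecMul continuous_const) _⟩
  have key := trivialOn_of_homotopy H (K := {x}) (S := {u : Simplex 3 | ∃ i, u i = 0})
    (fun u hu s hs => ?_) (c := Finsupp.single (ContinuousMap.id _) 1)
    (supportedIn_boundary_single (S := {u : Simplex 3 | ∃ i, u i = 0})
      (fun _ i h => Exists.intro i h) 1)
  · rw [push_single, push_single, ContinuousMap.comp_id, ContinuousMap.comp_id] at key
    convert key using 3
    · rw [push_single]
      congr 1
      ext1 u
      refine radial_congr ?_
      change vecCons 1 (aff p u) ᵥ* frame x.1 = h₀ (u, 1) ᵥ* frame x.1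
      simp [h₀, aff_apply]
    · ext1 u
      refine radial_congr ?_
      change u.1 ᵥ* W = h₀ (u, 0) ᵥ* frame x.1
      rw [hvec]
      simp [h₀]
      rfl
  · obtain ⟨i, hi⟩ := hu
    obtain ⟨d, hd, h1⟩ := exists_eq_smul_radial (⟨h₀ (u, s) ᵥ* frame x.1, vecMul_mem hB (hne _)⟩ :
      ({0}ᶜ : Set (Fin 4 → ℝ)))
    have h2 : h₀ (u, s) = d • vecCons 1 0 := by
      refine inj ?_
      rw [smul_vecMul, single_vecMul_frame]
      refine h1.trans ?_
      congr 2
      exact congrArg Subtype.val (Set.mem_singleton_iff.1 hs)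
    have h3 : ∑ i, u i • p i = 0 := by
      ext j
      simpa [h₀] using congrFun h2 j.succ
    rw [hinj h3] at hi
    exact (ht i).ne' hi

theorem trivialOn_sphere_sub {σ τ : SingularSimplex 3 Sphere3} (hσ : σ ∈ sphereOrientation)
    (hτ : τ ∈ sphereOrientation) {s t : Simplex 3} (hs : s ∈ simplexInterior 3)
    (ht : t ∈ simplexInterior 3) (h : σ s = τ t) :
    TrivialOn {σ s} (Finsupp.single σ (1 : ℤ) - Finsupp.single τ 1) := by
  obtain ⟨V, hV, rfl⟩ := mem_sphereOrientation_iff.1 hσ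
  obtain ⟨W, hW, rfl⟩ := mem_sphereOrientation_iff.1 hτ
  obtain ⟨p, hp, hps, h1⟩ := exists_trivialOn_gnomonic hV hs rfl
  obtain ⟨q, hq, hqt, h2⟩ := exists_trivialOn_gnomonic hW ht h.symm
  refine h1.symm.trans (TrivialOn.trans ?_ h2)
  rw [← map_sub]
  exact (trivialOn_affine_sub_zero hp hq hs ht hps hqt).push fun y hy => eq_zero_of_gnomonic hy

/-- The vertices of a simplex of `ℝ⁴` around the origin. -/
def crossVertices : Fin 5 → Fin 4 → ℝ := Fin.cons (fun _ => -1) fun i => Pi.single i 1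

theorem aff_crossVertices (t : Simplex 4) (j : Fin 4) :
    aff crossVertices t j = t.1 j.succ - t.1 0 := by
  rw [aff_apply, Finset.sum_apply, Fin.sum_univ_succ]
  simp only [crossVertices, Pi.smul_apply, Fin.cons_zero, Fin.cons_succ, smul_eq_mul, mul_neg,
    mul_one, Pi.single_apply, mul_ite, mul_zero, Finset.sum_ite_eq, Finset.mem_univ, if_true]
  exact neg_add_eq_sub _ _

theorem supportedIn_boundary_crossVertices :
    SupportedIn {0}ᶜ (boundary (Finsupp.single
      (aff crossVertices : C(Simplex 4, Fin 4 → ℝ)) 1)) := by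
  refine supportedIn_boundary_single (fun t i ht h => ?_) 1
  have h1 (j : Fin 4) : t.1 j.succ = t.1 0 :=
    sub_eq_zero.1 ((aff_crossVertices t j).symm.trans (congrFun h j))
  have h2 (j : Fin 5) : t.1 j = t.1 0 := Fin.cases rfl h1 j
  refine simplex_ne_zero t ?_
  ext j
  rw [h2 j, ← h2 i]
  exact ht

/-- The 3-sphere has a fundamental cycle. -/
theorem exists_sphereCycle : ∃ s : Chain 3 Sphere3, boundary s = 0 ∧
    ∀ σ ∈ sphereOrientation, ∀ t ∈ simplexInterior 3,
      TrivialOn {σ t} (s - Finsupp.single σ 1) := by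
  -- The cycle is the radial projection of the boundary of a 4-simplex around the origin. The face
  -- opposite to the first vertex projects to `σ₀`; every other face misses the open positive
  -- orthant, hence the ray through the barycenter of `σ₀`. So the degree is right at one point, and
  -- connectedness does the rest.
  obtain ⟨d, hd⟩ := supportedIn_boundary_crossVertices.exists_incl
  have hbd : boundary d = 0 := by
    refine push_injective (incl_injective _) ?_
    rw [push_boundary, hd, boundary_boundary, map_zero]
  have hdet : 0 < (1 : Matrix (Fin 4) (Fin 4) ℝ).det := by simp
  set σ₀ := sphereSimplex 1 hdet.ne' with hσ₀
  have hσ₀P : σ₀ ∈ sphereOrientation := mem_sphereOrientation_iff.2 ⟨_, hdet, rfl⟩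
  have hcyc : boundary (push radial d) = 0 := by rw [← push_boundary, hbd, map_zero]
  have h0 : TrivialOn {σ₀ bary} (push radial d - Finsupp.single σ₀ 1) := by
    let f₀ : SingularSimplex 3 ({0}ᶜ : Set (Fin 4 → ℝ)) :=
      ⟨fun t => ⟨t.1 ᵥ* (1 : Matrix (Fin 4) (Fin 4) ℝ), vecMul_mem hdet.ne' (simplex_ne_zero t)⟩,
        Continuous.subtype_mk (Continuous.matrix_vecMul continuous_subtype_val continuous_const) _⟩
    have h1 : Finsupp.single σ₀ 1 = push radial (Finsupp.single f₀ (1 : ℤ)) := by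
      rw [push_single]
      rfl
    have hf₀ : (incl _).comp f₀ = face 0 (aff crossVertices) := by
      rw [face_aff]
      ext1 t
      rw [aff_apply]
      change t.1 ᵥ* (1 : Matrix (Fin 4) (Fin 4) ℝ) = _
      rw [vecMul_one]
      ext j
      simp [crossVertices, Pi.single_apply]
      rfl
    rw [h1, ← map_sub]
    set R : Set (Fin 4 → ℝ) := {y | ∀ j, 0 < y j} with hR
    have h2 : SupportedIn Rᶜ (push (incl _) (d - Finsupp.single f₀ 1)) := by
      rw [map_sub, hd, push_single, hf₀, boundary_single, one_smul, Fin.sum_univ_succ]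
      simp only [Fin.val_zero, pow_zero, one_smul, add_sub_cancel_left]
      refine SupportedIn.sum fun i _ => (supportedIn_single ?_ _).zsmul _
      rintro _ ⟨t, rfl⟩ h
      have h3 := h i
      rw [face_apply, aff_crossVertices] at h3
      have h4 : (stdSimplex.map i.succ.succAbove t).1 i.succ = 0 := map_succAbove_self i.succ t
      have h5 := (stdSimplex.map i.succ.succAbove t).2.1 0
      rw [h4] at h3
      linarith
    have h3 : Set.MapsTo radial ((incl {0}ᶜ) ⁻¹' Rᶜ) {σ₀ bary}ᶜ := by
      intro y hy h
      refine hy ?_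
      obtain ⟨c, hc, h3⟩ := radial_eq_radial_iff.1 (Set.mem_singleton_iff.1 h)
      intro j
      change 0 < y.1 j
      rw [h3]
      refine mul_pos hc ?_
      change 0 < (bary.1 ᵥ* (1 : Matrix (Fin 4) (Fin 4) ℝ)) j
      rw [vecMul_one]
      exact bary_mem j
    exact ((h2.of_push (incl_injective _)).push h3).trivialOn
  have hconn : IsPreconnected (Set.univ : Set Sphere3) := by
    have h : 1 < Module.rank ℝ (EuclideanSpace ℝ (Fin 4)) := by
      rw [← Module.finrank_eq_rank, finrank_euclideanSpace_fin]
      norm_num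
    exact (isPreconnected_iff_preconnectedSpace.1 (isPreconnected_sphere h 0 1)).isPreconnected_univ
  refine ⟨_, hcyc, fun σ hσ t ht => ?_⟩
  refine trivialOn_sub_of_isPreconnected (P := sphereOrientation) isOpen_univ hconn
    (fun x _ => hasChartAt_sphere x) (fun σ h => isRegularSimplex_of_mem_sphereOrientation h)
    (fun σ hσ τ hτ s hs t ht h _ => trivialOn_sphere_sub hσ hτ hs ht h) (fun x _ => ?_) ?_ hσ₀P
    bary_mem trivial h0 σ hσ t ht trivial
  · obtain ⟨σ, hσ, t, ht, h, -⟩ := exists_sphereSimplex (x := x) Filter.univ_mem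
    exact ⟨σ, hσ, t, ht, h⟩
  · rw [hcyc]
    exact SupportedIn.zero _

end Sphere

end SurgeryFormula

end

noncomputable section

namespace SurgeryFormula

open HasAffineSimplices

/-! ### The open solid torus and its universal cover -/

section Wrap

open Matrix

theorem continuous_complex_mk {X : Type*} [TopologicalSpace X] {f g : X → ℝ} (hf : Continuous f)
    (hg : Continuous g) : Continuous fun x => (⟨f x, g x⟩ : ℂ) := by
  simp only [Complex.mk_eq_add_mul_I]
  fun_prop

/-- The universal covering of `ℂ × S¹`. -/
def wrap : C(Fin 3 → ℝ, ℂ × Circle) where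
  toFun x := (⟨x 0, x 1⟩, Circle.exp (2 * Real.pi * x 2))
  continuous_toFun := by
    have h : Continuous fun x : Fin 3 → ℝ => (⟨x 0, x 1⟩ : ℂ) :=
      continuous_complex_mk (continuous_apply 0) (continuous_apply 1)
    exact h.prodMk (by fun_prop)

theorem wrap_apply (x : Fin 3 → ℝ) : wrap x = (⟨x 0, x 1⟩, Circle.exp (2 * Real.pi * x 2)) := rfl

theorem exp_two_pi_mul_eq_iff {x y : ℝ} :
    Circle.exp (2 * Real.pi * x) = Circle.exp (2 * Real.pi * y) ↔ ∃ n : ℤ, x = y + n := by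
  rw [Circle.exp_eq_exp]
  have h : 2 * Real.pi ≠ 0 := by positivity
  refine exists_congr fun n => ⟨fun h' => mul_left_cancel₀ h ?_, fun h' => ?_⟩
  · linarith
  · rw [h']
    ring

theorem wrap_eq_wrap_iff {x y : Fin 3 → ℝ} :
    wrap x = wrap y ↔ ∃ n : ℤ, x = y + ![0, 0, (n : ℝ)] := by
  rw [wrap_apply, wrap_apply, Prod.mk.injEq, Complex.mk.injEq, exp_two_pi_mul_eq_iff]
  constructor
  · rintro ⟨⟨h0, h1⟩, n, h2⟩
    refine ⟨n, ?_⟩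
    ext j
    fin_cases j <;> simp [h0, h1, h2]
  · rintro ⟨n, rfl⟩
    simp

theorem eq_of_wrap_eq {x y : Fin 3 → ℝ} (h : wrap x = wrap y) (hxy : |x 2 - y 2| < 1) : x = y := by
  obtain ⟨n, rfl⟩ := wrap_eq_wrap_iff.1 h
  have h1 : |(n : ℝ)| < 1 := by simpa using hxy
  have h2 : n = 0 := Int.abs_lt_one_iff.1 (by exact_mod_cast h1)
  subst h2
  ext j
  fin_cases j <;> simp

theorem wrap_surjective : Function.Surjective wrap := by
  rintro ⟨w, u⟩
  refine ⟨![w.re, w.im, Complex.arg u / (2 * Real.pi)], ?_⟩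
  rw [wrap_apply]
  refine Prod.ext rfl ?_
  simp only [cons_val]
  rw [mul_div_cancel₀ _ (by positivity), Circle.exp_arg]

theorem isOpenMap_exp_two_pi : IsOpenMap fun x : ℝ => Circle.exp (2 * Real.pi * x) :=
  isLocalHomeomorph_circleExp.isOpenMap.comp
    (Homeomorph.mulLeft₀ (2 * Real.pi) (by positivity)).isOpenMap

theorem isOpenMap_wrap : IsOpenMap wrap := by
  have h1 : IsOpenMap (Prod.map (id : ℂ → ℂ) fun x : ℝ => Circle.exp (2 * Real.pi * x)) :=
    IsOpenMap.id.prodMap isOpenMap_exp_two_pi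
  let e : (Fin 3 → ℝ) ≃ₜ ℂ × ℝ :=
    { toFun := fun x => (⟨x 0, x 1⟩, x 2)
      invFun := fun z => ![z.1.re, z.1.im, z.2]
      left_inv := fun x => by ext j; fin_cases j <;> rfl
      right_inv := fun z => rfl
      continuous_toFun := (continuous_complex_mk (continuous_apply 0) (continuous_apply 1)).prodMk
        (continuous_apply 2)
      continuous_invFun := by
        refine continuous_pi fun j => ?_
        fin_cases j
        · exact Complex.continuous_re.comp continuous_fst
        · exact Complex.continuous_im.comp continuous_fst
        · exact continuous_snd }
  exact h1.comp e.isOpenMap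

/-- The points at height less than `r` from that of `z`. -/
def slab (z : Fin 3 → ℝ) (r : ℝ) : Set (Fin 3 → ℝ) := {x | |x 2 - z 2| < r}

theorem isOpen_slab (z : Fin 3 → ℝ) (r : ℝ) : IsOpen (slab z r) :=
  isOpen_lt (by fun_prop) continuous_const

theorem hasChartAt_wrap (z : ℂ × Circle) : HasChartAt z := by
  obtain ⟨x, rfl⟩ := wrap_surjective z
  refine hasChartAt_of_map (isOpen_slab x (1 / 2)) (Topology.IsOpenEmbedding.of_continuous_injective_isOpenMap
    (wrap.continuous.comp continuous_subtype_val) ?_ (isOpenMap_wrap.domRestrict (isOpen_slab _ _)))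
    (show |x 2 - x 2| < 1 / 2 by simp)
  rintro ⟨y, hy⟩ ⟨y', hy'⟩ h
  refine Subtype.ext (eq_of_wrap_eq h ?_)
  rw [show y 2 - y' 2 = (y 2 - x 2) - (y' 2 - x 2) by ring]
  refine (abs_sub _ _).trans_lt ?_
  have h1 : |y 2 - x 2| < 1 / 2 := hy
  have h2 : |y' 2 - x 2| < 1 / 2 := hy'
  linarith

theorem aff_mem_slab {v : Fin 4 → Fin 3 → ℝ} {z : Fin 3 → ℝ} {r : ℝ} (h : ∀ i, v i ∈ slab z r)
    (t : Simplex 3) : aff v t ∈ slab z r := by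
  have hc : Convex ℝ (slab z r) := by
    have : slab z r = (LinearMap.proj 2 : (Fin 3 → ℝ) →ₗ[ℝ] ℝ) ⁻¹' Metric.ball (z 2) r := by
      ext x
      rw [Set.mem_preimage, Metric.mem_ball, Real.dist_eq]
      rfl
    rw [this]
    exact (convex_ball _ _).linear_preimage _
  exact hc.sum_mem (fun i _ => t.2.1 i) t.2.2 fun i _ => h i

theorem mem_slab_of_aff {v : Fin 4 → Fin 3 → ℝ} (h : ∀ i j, |v i 2 - v j 2| < 1) (t : Simplex 3)
    (i : Fin 4) : v i ∈ slab (aff v t) 1 := by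
  have h1 : aff v t ∈ slab (v i) 1 := aff_mem_slab (fun j => h j i) t
  rw [slab, Set.mem_ofPred_eq, abs_sub_comm]
  exact h1

theorem wrap_comp_aff_shift (v : Fin 4 → Fin 3 → ℝ) (n : ℤ) :
    wrap.comp (aff fun i => v i + ![0, 0, (n : ℝ)] : C(Simplex 3, Fin 3 → ℝ)) =
      wrap.comp (aff v) := by
  rw [← translate_aff]
  ext1 t
  exact wrap_eq_wrap_iff.2 ⟨n, rfl⟩

theorem affDet_add (v : Fin 4 → Fin 3 → ℝ) (x : Fin 3 → ℝ) :
    affDet (fun i => v i + x) = affDet v := by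
  simp [affDet]

/-- The bounding chain has to be excised into the slab before it is pushed down: there z is the only
point over `wrap z`, while outside there are other lifts. -/
theorem trivialOn_push_wrap {k : ℕ} {z : Fin 3 → ℝ} {c : Chain k (Fin 3 → ℝ)} (h : TrivialOn {z} c)
    (hc : SupportedIn (slab z 1) c) :
    TrivialOn {wrap z} (push wrap c) := by
  obtain ⟨e, he, he'⟩ := h.excise isClosed_singleton (isOpen_slab z 1)
    (Set.singleton_subset_iff.2 (show |z 2 - z 2| < (1 : ℝ) by simp)) hc
  refine ⟨push wrap e, ?_⟩
  rw [← push_boundary, ← map_sub]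
  exact ((hc.sub he.boundary).inter he').push (T := {wrap z}ᶜ) fun x hx h =>
    hx.2 (eq_of_wrap_eq h hx.1)

theorem trivialOn_wrap_sub {v v' : Fin 4 → Fin 3 → ℝ} (hv : 0 < affDet v) (hv' : 0 < affDet v')
    {t t' : Simplex 3} (ht : t ∈ simplexInterior 3) (ht' : t' ∈ simplexInterior 3)
    (hs : ∀ i, v i ∈ slab (aff v t) 1) (hs' : ∀ i, v' i ∈ slab (aff v' t') 1)
    (h : wrap (aff v t) = wrap (aff v' t')) :
    TrivialOn {wrap (aff v t)} (Finsupp.single (wrap.comp (aff v)) (1 : ℤ) -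
      Finsupp.single (wrap.comp (aff v')) 1) := by
  obtain ⟨n, hn⟩ := wrap_eq_wrap_iff.1 h
  rw [← wrap_comp_aff_shift v' n]
  set u : Fin 4 → Fin 3 → ℝ := fun i => v' i + ![0, 0, (n : ℝ)] with hu
  have hut : aff v t = aff u t' := by
    rw [hn, hu, ← translate_aff]
    rfl
  have hsu (i) : u i ∈ slab (aff v t) 1 := by
    have := hs' i
    rw [hn]
    change |(v' i 2 + n) - (aff v' t' 2 + n)| < 1
    rw [add_sub_add_right_eq_sub]
    exact this
  set z := aff v t
  have hud : 0 < affDet u := by rwa [hu, affDet_add]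
  have := trivialOn_push_wrap (trivialOn_affine_sub hv hud ht ht' hut) (by
    refine SupportedIn.sub (supportedIn_single ?_ _) (supportedIn_single ?_ _)
    · rintro _ ⟨s, rfl⟩
      exact aff_mem_slab hs s
    · rintro _ ⟨s, rfl⟩
      exact aff_mem_slab hsu s)
  rwa [map_sub, push_single, push_single] at this

/-- The positively oriented simplices of `ℂ × S¹`. -/
def wrapOrientation : Set (SingularSimplex 3 (ℂ × Circle)) :=
  {σ | ∃ v : Fin 4 → Fin 3 → ℝ, 0 < affDet v ∧ (∀ i j, |v i 2 - v j 2| < 1) ∧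
    σ = wrap.comp (aff v)}

theorem isRegularSimplex_of_mem_wrapOrientation {σ : SingularSimplex 3 (ℂ × Circle)}
    (h : σ ∈ wrapOrientation) : IsRegularSimplex σ := by
  obtain ⟨v, hv, hv', rfl⟩ := h
  constructor
  · intro s t h
    exact aff_injective hv.ne' (eq_of_wrap_eq h (aff_mem_slab (mem_slab_of_aff hv' t) s))
  · rw [ContinuousMap.coe_comp, Set.image_comp]
    exact isOpenMap_wrap _ (isOpen_aff_interior hv.ne')

theorem trivialOn_wrapOrientation_sub {σ τ : SingularSimplex 3 (ℂ × Circle)}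
    (hσ : σ ∈ wrapOrientation) (hτ : τ ∈ wrapOrientation) {s t : Simplex 3}
    (hs : s ∈ simplexInterior 3) (ht : t ∈ simplexInterior 3) (h : σ s = τ t) :
    TrivialOn {σ s} (Finsupp.single σ (1 : ℤ) - Finsupp.single τ 1) := by
  obtain ⟨v, hv, hv', rfl⟩ := hσ
  obtain ⟨w, hw, hw', rfl⟩ := hτ
  exact trivialOn_wrap_sub hv hw hs ht (mem_slab_of_aff hv' s) (mem_slab_of_aff hw' t) h

theorem exists_wrapSimplex {z : ℂ × Circle} {O : Set (ℂ × Circle)} (hO : O ∈ nhds z) :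
    ∃ σ ∈ wrapOrientation, ∃ t ∈ simplexInterior 3, σ t = z ∧ Set.range σ ⊆ O := by
  obtain ⟨x, rfl⟩ := wrap_surjective z
  let f : C(Fin 3 → ℝ, ℂ × Circle) := wrap.comp (translate x)
  have hf0 : f 0 = wrap x := by simp [f, translate]
  have h1 : f ⁻¹' O ∈ nhds 0 := f.continuous.continuousAt.preimage_mem_nhds (by rwa [hf0])
  obtain ⟨r, hr, h⟩ := Metric.nhds_basis_closedBall.mem_iff.1 h1
  -- The heights of the vertices then differ by at most 1/2, as embedding in the quotient requires
  -- less than 1.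
  set r' := min r (1 / 4)
  have hr' : 0 < r' := lt_min hr (by norm_num)
  have h4 : r' ≤ 1 / 4 := min_le_right _ _
  refine ⟨f.comp (aff (smallVertices r')), ⟨fun i => smallVertices r' i + x, ?_, fun i j => ?_, ?_⟩,
    bary, bary_mem, ?_, ?_⟩
  · rw [affDet_add]
    exact affDet_smallVertices hr'
  · change |smallVertices r' i 2 + x 2 - (smallVertices r' j 2 + x 2)| < 1
    rw [add_sub_add_right_eq_sub, abs_lt]
    fin_cases i <;> fin_cases j <;> simp [smallVertices] <;> (constructor <;> linarith)
  · rw [ContinuousMap.comp_assoc, translate_aff]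
  · rw [ContinuousMap.comp_apply, aff_smallVertices, hf0]
  · rintro _ ⟨t, rfl⟩
    exact h (Metric.closedBall_subset_closedBall (min_le_left _ _)
      (range_aff_smallVertices hr' ⟨t, rfl⟩))

end Wrap

/-! ### The compact solid tori -/

section SolidTori

variable {r : ℝ}

/-- The inclusion of the compact solid torus in `ℂ × S¹`. -/
def solidIncl (r : ℝ) : C(SolidTorus r, ℂ × Circle) := ⟨fun x => (x.1, x.2), by fun_prop⟩

theorem solidIncl_injective (r : ℝ) : Function.Injective (solidIncl r) := fun _ _ h =>
  Prod.ext (Subtype.ext (congrArg (fun z : ℂ × Circle => z.1) h))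
    (congrArg (fun z : ℂ × Circle => z.2) h)

/-- The radial retraction to the compact solid torus. -/
def clamp (hr : 0 < r) : C(ℂ × Circle, SolidTorus r) where
  toFun z := (⟨(r / max r ‖z.1‖) • z.1, by
    have h : 0 < max r ‖z.1‖ := hr.trans_le (le_max_left _ _)
    rw [mem_closedBall_zero_iff, norm_smul, Real.norm_of_nonneg (by positivity), div_mul_eq_mul_div,
      div_le_iff₀ h]
    exact mul_le_mul_of_nonneg_left (le_max_right _ _) hr.le⟩, z.2)
  continuous_toFun := by
    refine Continuous.prodMk (Continuous.subtype_mk ?_ _) continuous_snd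
    refine Continuous.smul (continuous_const.div
      (continuous_const.max continuous_fst.norm) fun z => ?_) continuous_fst
    exact (hr.trans_le (le_max_left _ _)).ne'

theorem solidIncl_clamp (hr : 0 < r) {z : ℂ × Circle} (hz : ‖z.1‖ ≤ r) :
    solidIncl r (clamp hr z) = z := by
  refine Prod.ext ?_ rfl
  change (r / max r ‖z.1‖) • z.1 = z.1
  rw [max_eq_left hz, div_self hr.ne', one_smul]

theorem clamp_solidIncl (hr : 0 < r) (x : SolidTorus r) : clamp hr (solidIncl r x) = x :=
  solidIncl_injective r (solidIncl_clamp hr (mem_closedBall_zero_iff.1 x.1.2))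

/-- Points outside the solid torus are clamped to its boundary, so an interior point has only itself
as preimage. Hence local homology at interior points can be computed in the manifold ℂ × S¹. -/
theorem eq_solidIncl_of_clamp (hr : 0 < r) {z : ℂ × Circle} {x : SolidTorus r}
    (hx : ‖(x.1 : ℂ)‖ < r) (h : clamp hr z = x) : z = solidIncl r x := by
  rw [← h, solidIncl_clamp]
  by_contra hz
  rw [not_le] at hz
  rw [← h] at hx
  change ‖(r / max r ‖z.1‖) • z.1‖ < r at hx
  rw [max_eq_right hz.le, norm_smul, Real.norm_of_nonneg (by positivity),
    div_mul_cancel₀ _ (hr.trans hz).ne'] at hx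
  exact lt_irrefl _ hx

theorem mem_solidTorusOrientation_iff {σ : SingularSimplex 3 (SolidTorus r)} :
    σ ∈ solidTorusOrientation r ↔ (solidIncl r).comp σ ∈ wrapOrientation := by
  refine exists_congr fun v => and_congr Iff.rfl (and_congr Iff.rfl ?_)
  constructor
  · intro h
    ext1 t
    refine Prod.ext ((h t).1.trans ?_) ((h t).2.trans ?_)
    · change _ = (⟨aff v t 0, aff v t 1⟩ : ℂ)
      simp only [aff_apply, Finset.sum_apply, Pi.smul_apply, smul_eq_mul]
    · change _ = Circle.exp (2 * Real.pi * aff v t 2)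
      simp only [aff_apply, Finset.sum_apply, Pi.smul_apply, smul_eq_mul]
  · intro h t
    have h1 := DFunLike.congr_fun h t
    refine ⟨(congrArg Prod.fst h1).trans ?_, (congrArg Prod.snd h1).trans ?_⟩
    · change (⟨aff v t 0, aff v t 1⟩ : ℂ) = _
      simp only [aff_apply, Finset.sum_apply, Pi.smul_apply, smul_eq_mul]
    · change Circle.exp (2 * Real.pi * aff v t 2) = _
      simp only [aff_apply, Finset.sum_apply, Pi.smul_apply, smul_eq_mul]

theorem isRegularSimplex_of_mem_solidTorusOrientation {σ : SingularSimplex 3 (SolidTorus r)}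
    (h : σ ∈ solidTorusOrientation r) : IsRegularSimplex σ := by
  obtain ⟨h1, h2⟩ := isRegularSimplex_of_mem_wrapOrientation (mem_solidTorusOrientation_iff.1 h)
  refine ⟨fun s t h => h1 (congrArg (solidIncl r) h), ?_⟩
  convert h2.preimage (solidIncl r).continuous
  rw [ContinuousMap.coe_comp, Set.image_comp, Set.preimage_image_eq _ (solidIncl_injective r)]

/-- The open solid torus of radius `s`. -/
def openSolid (r s : ℝ) : Set (SolidTorus r) := {x | ‖(x.1 : ℂ)‖ < s}

theorem isOpen_openSolid (r s : ℝ) : IsOpen (openSolid r s) :=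
  isOpen_lt (by fun_prop) continuous_const

theorem trivialOn_clamp (hr : 0 < r) {x : SolidTorus r} (hx : x ∈ openSolid r r) {k : ℕ}
    {c : Chain k (ℂ × Circle)} (h : TrivialOn {solidIncl r x} c) :
    TrivialOn {x} (push (clamp hr) c) :=
  h.push fun _ hz => eq_solidIncl_of_clamp hr hx hz

theorem clamp_comp_solidIncl (hr : 0 < r) : (clamp hr).comp (solidIncl r) = ContinuousMap.id _ :=
  ContinuousMap.ext (clamp_solidIncl hr)

theorem trivialOn_of_push_solidIncl {x : SolidTorus r} (hx : x ∈ openSolid r r) {k : ℕ}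
    {c : Chain k (SolidTorus r)} (h : TrivialOn {solidIncl r x} (push (solidIncl r) c)) :
    TrivialOn {x} c := by
  have hr : 0 < r := (norm_nonneg _).trans_lt hx
  have := trivialOn_clamp hr hx h
  rwa [push_comp, clamp_comp_solidIncl, push_id] at this

theorem trivialOn_solidTorus_sub {σ τ : SingularSimplex 3 (SolidTorus r)}
    (hσ : σ ∈ solidTorusOrientation r) (hτ : τ ∈ solidTorusOrientation r) {s t : Simplex 3}
    (hs : s ∈ simplexInterior 3) (ht : t ∈ simplexInterior 3) (h : σ s = τ t)
    (hx : σ s ∈ openSolid r r) :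
    TrivialOn {σ s} (Finsupp.single σ (1 : ℤ) - Finsupp.single τ 1) := by
  refine trivialOn_of_push_solidIncl hx ?_
  rw [map_sub, push_single, push_single]
  exact trivialOn_wrapOrientation_sub (mem_solidTorusOrientation_iff.1 hσ)
    (mem_solidTorusOrientation_iff.1 hτ) hs ht (congrArg (solidIncl r) h)

theorem exists_clamp_mem {σ : SingularSimplex 3 (ℂ × Circle)} (hr : 0 < r)
    (hσ : σ ∈ wrapOrientation) (h : ∀ t, ‖(σ t).1‖ ≤ r) :
    (clamp hr).comp σ ∈ solidTorusOrientation r := by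
  rw [mem_solidTorusOrientation_iff]
  convert hσ using 1
  ext1 t
  exact solidIncl_clamp hr (h t)

theorem exists_solidTorusSimplex {x : SolidTorus r} (hx : x ∈ openSolid r r)
    {O : Set (SolidTorus r)} (hO : O ∈ nhds x) :
    ∃ σ ∈ solidTorusOrientation r, ∃ t ∈ simplexInterior 3, σ t = x ∧ Set.range σ ⊆ O := by
  have hr : 0 < r := (norm_nonneg _).trans_lt hx
  have h1 : (clamp hr) ⁻¹' O ∈ nhds (solidIncl r x) :=
    (clamp hr).continuous.continuousAt.preimage_mem_nhds (by rwa [clamp_solidIncl])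
  have h2 : {z : ℂ × Circle | ‖z.1‖ < r} ∈ nhds (solidIncl r x) :=
    (isOpen_lt (by fun_prop) continuous_const).mem_nhds hx
  obtain ⟨σ, hσ, t, ht, hσt, h⟩ := exists_wrapSimplex (Filter.inter_mem h1 h2)
  refine ⟨(clamp hr).comp σ, exists_clamp_mem hr hσ fun t => (h ⟨t, rfl⟩).2.le, t, ht, ?_, ?_⟩
  · rw [ContinuousMap.comp_apply, hσt, clamp_solidIncl]
  · rintro _ ⟨t, rfl⟩
    exact (h ⟨t, rfl⟩).1

theorem hasChartAt_solidTorus {x : SolidTorus r} (hx : x ∈ openSolid r r) : HasChartAt x := by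
  have hr : 0 < r := (norm_nonneg _).trans_lt hx
  rw [← clamp_solidIncl hr x]
  have hO : IsOpen {z : ℂ × Circle | ‖z.1‖ < r} := isOpen_lt (by fun_prop) continuous_const
  refine HasChartAt.map hO
    (Topology.IsOpenEmbedding.of_continuous_injective_isOpenMap
      ((clamp hr).continuous.comp continuous_subtype_val) ?_ ?_) hx (hasChartAt_wrap _)
  · rintro ⟨y, hy⟩ ⟨z, hz⟩ h
    refine Subtype.ext ?_
    exact (solidIncl_clamp hr (le_of_lt hy)).symm.trans
      ((congrArg (solidIncl r) h).trans (solidIncl_clamp hr (le_of_lt hz)))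
  · intro U hU
    convert (hO.isOpenMap_subtype_val U hU).preimage (solidIncl r).continuous
    ext y
    constructor
    · rintro ⟨z, hz, rfl⟩
      exact ⟨z, hz, (solidIncl_clamp hr (le_of_lt z.2)).symm⟩
    · rintro ⟨z, hz, h⟩
      refine ⟨z, hz, ?_⟩
      change clamp hr z = y
      rw [h, clamp_solidIncl]

end SolidTori

end SurgeryFormula

end

noncomputable section

namespace SurgeryFormula

open HasAffineSimplices

/-! ### The fundamental chain of the solid torus -/

section Cylinder

open Matrix

theorem aff_prod_fst {k m : ℕ} (v : Fin (k + 1) → Simplex m × unitInterval) (t : Simplex k)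
    (j : Fin (m + 1)) : (aff v t).1.1 j = ∑ i, t.1 i * (v i).1.1 j := by
  change (∑ i, t.1 i • (v i).1.1) j = _
  rw [Finset.sum_apply]
  rfl

theorem aff_prod_snd {k m : ℕ} (v : Fin (k + 1) → Simplex m × unitInterval) (t : Simplex k) :
    ((aff v t).2 : ℝ) = ∑ i, t.1 i * ((v i).2 : ℝ) := rfl

/-- The triangulation of `Δ² × [0, 1]`. -/
def cylinder : Chain 3 (Simplex 2 × unitInterval) := realize (tuplePrism 2 (stdTuple 2))

/-- The vertices of the triangulation of `Δ² × [0, 1]`. -/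
def cylinderVertices : Fin 3 → Fin 4 → Simplex 2 × unitInterval :=
  ![![(stdSimplex.vertex 0, 0), (stdSimplex.vertex 0, 1), (stdSimplex.vertex 1, 1),
      (stdSimplex.vertex 2, 1)],
    ![(stdSimplex.vertex 0, 0), (stdSimplex.vertex 1, 0), (stdSimplex.vertex 1, 1),
      (stdSimplex.vertex 2, 1)],
    ![(stdSimplex.vertex 0, 0), (stdSimplex.vertex 1, 0), (stdSimplex.vertex 2, 0),
      (stdSimplex.vertex 2, 1)]]

theorem map_succAbove_apply {k : ℕ} (i : Fin (k + 2)) (t : Simplex k) (j : Fin (k + 1)) :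
    (stdSimplex.map i.succAbove t).1 (i.succAbove j) = t.1 j := by
  change (stdSimplex.map i.succAbove t) (i.succAbove j) = t.1 j
  rw [stdSimplex.map_coe, FunOnFinite.linearMap_apply_apply, Finset.sum_eq_single j]
  · rfl
  · intro l hl hlj
    exact absurd (Fin.succAbove_right_injective (Finset.mem_filter.1 hl).2) hlj
  · intro h
    simp at h

theorem vec_three {V : Type*} (f : Fin 3 → V) : f = ![f 0, f 1, f 2] := by
  ext i; fin_cases i <;> rfl

theorem vec_four {V : Type*} (f : Fin 4 → V) : f = ![f 0, f 1, f 2, f 3] := by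
  ext i; fin_cases i <;> rfl

theorem tuplePrism_one {V : Type*} (v : Fin 2 → V) : tuplePrism 1 (Finsupp.single v 1) =
    Finsupp.single ![(v 0, 0), (v 0, 1), (v 1, 1)] 1 -
      Finsupp.single ![(v 0, 0), (v 1, 0), (v 1, 1)] 1 := by
  rw [tuplePrism_single_succ, tuplePrism_single_zero, map_sub]
  simp only [tupleCone_single]
  congr 2
  all_goals exact vec_three _

theorem tuplePrism_two {V : Type*} (v : Fin 3 → V) : tuplePrism 2 (Finsupp.single v 1) =
    Finsupp.single ![(v 0, 0), (v 0, 1), (v 1, 1), (v 2, 1)] 1 -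
      Finsupp.single ![(v 0, 0), (v 1, 0), (v 1, 1), (v 2, 1)] 1 +
      Finsupp.single ![(v 0, 0), (v 1, 0), (v 2, 0), (v 2, 1)] 1 := by
  rw [tuplePrism_single_succ, tuplePrism_one, map_sub, map_sub, ← sub_add]
  simp only [tupleCone_single]
  congr 3
  · exact vec_four (Fin.cons (v 0, 0) fun m => (v m, 1))

theorem cylinder_eq : cylinder = Finsupp.single (aff (cylinderVertices 0)) 1 -
    Finsupp.single (aff (cylinderVertices 1)) 1 + Finsupp.single (aff (cylinderVertices 2)) 1 := by
  rw [cylinder, stdTuple, tuplePrism_two, map_add, map_sub, realize_single, realize_single,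
    realize_single]
  rfl

/-- The boundary of `Δ² × [0, 1]`. -/
def cylinderBoundary : Set (Simplex 2 × unitInterval) :=
  {x | x.2 = 0 ∨ x.2 = 1 ∨ ∃ i, x.1 i = 0}

theorem prism_id {X : Type*} [TopologicalSpace X] (H : C(Simplex 2 × unitInterval, X)) :
    prism H 2 (Finsupp.single (ContinuousMap.id _) 1) = push H cylinder := by
  rw [prism_single]
  rfl

theorem supportedIn_boundary_cylinder : SupportedIn cylinderBoundary (boundary cylinder) := by
  have h := boundary_prism (ContinuousMap.id (Simplex 2 × unitInterval))
    (Finsupp.single (ContinuousMap.id (Simplex 2)) 1)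
  rw [prism_id, push_id, ← eq_sub_iff_add_eq, push_single, push_single] at h
  rw [h]
  have hb : SupportedIn {t : Simplex 2 | ∃ i, t i = 0}
      (boundary (Finsupp.single (ContinuousMap.id (Simplex 2)) 1)) :=
    supportedIn_boundary_single (σ := ContinuousMap.id (Simplex 2))
      (fun _ i h => Exists.intro i h) 1
  have hm : ∀ x ∈ {t : Simplex 2 | ∃ i, t i = 0}, ∀ s,
      ContinuousMap.id (Simplex 2 × unitInterval) (x, s) ∈ cylinderBoundary :=
    fun x hx s => Or.inr (Or.inr hx)
  have hp : SupportedIn cylinderBoundary (prism (ContinuousMap.id (Simplex 2 × unitInterval)) 1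
      (boundary (Finsupp.single (ContinuousMap.id (Simplex 2)) 1))) :=
    SupportedIn.prism (H := ContinuousMap.id (Simplex 2 × unitInterval)) (T := cylinderBoundary)
      (S := {t : Simplex 2 | ∃ i, t i = 0}) hm hb
  refine ((supportedIn_single ?_ _).sub (supportedIn_single ?_ _)).sub hp
  · rintro _ ⟨t, rfl⟩
    exact Or.inr (Or.inl rfl)
  · rintro _ ⟨t, rfl⟩
    exact Or.inl rfl

/-- A disk bounded by the unit circle, times the interval. -/
def cylinderLift : C(Simplex 2 × unitInterval, Fin 3 → ℝ) where
  -- The bracket vanishes where the second or third barycentric coordinate is zero, so two edges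
  -- collapse to the point 1. Where the first coordinate is zero it equals twice a sine, and the
  -- double angle formulas make that edge run once around the unit circle.
  toFun x := ![1 - Real.sin (Real.pi * x.1.1 2) * (Real.sin (Real.pi * x.1.1 1) +
      Real.sin (Real.pi * x.1.1 2) - Real.sin (Real.pi * (x.1.1 1 + x.1.1 2))),
    Real.cos (Real.pi * x.1.1 2) * (Real.sin (Real.pi * x.1.1 1) +
      Real.sin (Real.pi * x.1.1 2) - Real.sin (Real.pi * (x.1.1 1 + x.1.1 2))), x.2]
  continuous_toFun := by
    have h (i : Fin 3) : Continuous fun x : Simplex 2 × unitInterval => x.1.1 i :=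
      (continuous_apply i).comp (continuous_subtype_val.comp continuous_fst)
    have h1 := h 1
    have h2 := h 2
    refine continuous_pi fun j => ?_
    fin_cases j
    · simp only
      fun_prop
    · simp only
      fun_prop
    · exact continuous_subtype_val.comp continuous_snd

/-- A triangle around the disk, times the interval. -/
def triangleLift : C(Simplex 2 × unitInterval, Fin 3 → ℝ) where
  toFun x := ![x.1.1 0 - x.1.1 1 - x.1.1 2, x.1.1 1 - x.1.1 2, x.2]
  continuous_toFun := by
    have h (i : Fin 3) : Continuous fun x : Simplex 2 × unitInterval => x.1.1 i :=
      (continuous_apply i).comp (continuous_subtype_val.comp continuous_fst)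
    have h0 := h 0
    have h1 := h 1
    have h2 := h 2
    refine continuous_pi fun j => ?_
    fin_cases j
    · simp only
      fun_prop
    · simp only
      fun_prop
    · exact continuous_subtype_val.comp continuous_snd

theorem cylinderLift_of_eq_zero {x : Simplex 2 × unitInterval} (h : x.1.1 1 = 0 ∨ x.1.1 2 = 0) :
    cylinderLift x = ![1, 0, (x.2 : ℝ)] := by
  rcases h with h | h <;> simp [cylinderLift, h]

theorem cylinderLift_of_zero {x : Simplex 2 × unitInterval} (h : x.1.1 0 = 0) :
    cylinderLift x =
      ![Real.cos (2 * Real.pi * x.1.1 2), Real.sin (2 * Real.pi * x.1.1 2), (x.2 : ℝ)] := by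
  have hs := x.1.2.2
  rw [Fin.sum_univ_three, h, zero_add] at hs
  have h1 : x.1.1 1 = 1 - x.1.1 2 := by linarith
  have e1 : Real.sin (Real.pi * x.1.1 1) = Real.sin (Real.pi * x.1.1 2) := by
    rw [h1, mul_sub, mul_one, Real.sin_pi_sub]
  have e2 : Real.cos (2 * Real.pi * x.1.1 2) = 1 - 2 * Real.sin (Real.pi * x.1.1 2) ^ 2 := by
    rw [mul_assoc, Real.cos_two_mul, Real.cos_sq']
    ring
  have e3 : Real.sin (2 * Real.pi * x.1.1 2) =
      2 * Real.sin (Real.pi * x.1.1 2) * Real.cos (Real.pi * x.1.1 2) := by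
    rw [mul_assoc, Real.sin_two_mul]
  have e4 : Real.sin (Real.pi * x.1.1 1) + Real.sin (Real.pi * x.1.1 2) -
      Real.sin (Real.pi * (x.1.1 1 + x.1.1 2)) = 2 * Real.sin (Real.pi * x.1.1 2) := by
    rw [e1, hs, mul_one, Real.sin_pi]
    ring
  ext j
  fin_cases j
  · change 1 - _ * _ = Real.cos _
    rw [e4, e2]
    ring
  · change _ * _ = Real.sin _
    rw [e4, e3]
    ring
  · rfl

/-- A point in the interior of the triangle times the interval. -/
def cylinderPoint : Fin 3 → ℝ := ![-3 / 5, 0, 1 / 5]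

/-- Top and bottom have heights 1 and 0, not 1/5. On the walls, compare the second coordinates of
the two lifts: on the edge over the circle they have the same sign, so the segment can meet the
first axis only at first coordinate 1 or -1; on the collapsed edges it meets the axis only at 1. -/
theorem line_ne_cylinderPoint {x : Simplex 2 × unitInterval} (hx : x ∈ cylinderBoundary) {u : ℝ}
    (h0 : 0 ≤ u) (h1 : u ≤ 1) :
    (1 - u) • cylinderLift x + u • triangleLift x ≠ cylinderPoint := by
  intro h
  have e0 := congrFun h 0
  have e1 := congrFun h 1
  have e2 := congrFun h 2
  simp only [Pi.add_apply, Pi.smul_apply, smul_eq_mul, cylinderPoint, cons_val] at e0 e1 e2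
  have hs := x.1.2.2
  rw [Fin.sum_univ_three] at hs
  have p1 := x.1.2.1 1
  have p2 := x.1.2.1 2
  have t0 : triangleLift x 0 = x.1.1 0 - x.1.1 1 - x.1.1 2 := rfl
  have t1 : triangleLift x 1 = x.1.1 1 - x.1.1 2 := rfl
  rcases hx with hx | hx | ⟨i, hx⟩
  · have l2 : cylinderLift x 2 = 0 := congrArg Subtype.val hx
    have t2 : triangleLift x 2 = 0 := congrArg Subtype.val hx
    rw [l2, t2] at e2
    norm_num at e2
  · have l2 : cylinderLift x 2 = 1 := congrArg Subtype.val hx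
    have t2 : triangleLift x 2 = 1 := congrArg Subtype.val hx
    rw [l2, t2] at e2
    linarith
  · change x.1.1 i = 0 at hx
    rw [t0] at e0
    rw [t1] at e1
    fin_cases i
    · replace hx : x.1.1 0 = 0 := hx
      rw [cylinderLift_of_zero hx] at e0 e1
      simp only [cons_val] at e0 e1
      set y := x.1.1 2 with hy
      have hy1 : x.1.1 1 = 1 - y := by linarith
      rw [hx, hy1] at e0
      rw [hy1] at e1
      have hy2 : y ≤ 1 := by linarith
      have hlt : y = 0 ∨ (0 < y ∧ y < 1 / 2) ∨ y = 1 / 2 ∨ (1 / 2 < y ∧ y < 1) ∨ y = 1 := by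
        rcases p2.eq_or_lt with h | h
        · exact Or.inl h.symm
        · rcases lt_trichotomy y (1 / 2) with h' | h' | h'
          · exact Or.inr (Or.inl ⟨h, h'⟩)
          · exact Or.inr (Or.inr (Or.inl h'))
          · rcases hy2.eq_or_lt with h'' | h''
            · exact Or.inr (Or.inr (Or.inr (Or.inr h'')))
            · exact Or.inr (Or.inr (Or.inr (Or.inl ⟨h', h''⟩)))
      have hπ := Real.pi_pos
      rcases hlt with h | ⟨h, h'⟩ | h | ⟨h, h'⟩ | h
      · rw [h] at e0 e1
        simp at e0 e1
        rw [e1] at e0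
        norm_num at e0
      · have hsin : 0 < Real.sin (2 * Real.pi * y) :=
          Real.sin_pos_of_pos_of_lt_pi (by positivity) (by nlinarith)
        rcases h0.eq_or_lt with hu | hu
        · rw [← hu] at e1
          simp [hsin.ne'] at e1
        · nlinarith [mul_nonneg (sub_nonneg.2 h1) hsin.le]
      · have : 2 * Real.pi * y = Real.pi := by rw [h]; ring
        rw [this, Real.cos_pi] at e0
        linarith
      · have hsin : Real.sin (2 * Real.pi * y) < 0 := by
          have := Real.sin_pos_of_pos_of_lt_pi (x := 2 * Real.pi * y - Real.pi) (by nlinarith)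
            (by nlinarith)
          rw [Real.sin_sub_pi] at this
          linarith
        rcases h0.eq_or_lt with hu | hu
        · rw [← hu] at e1
          simp [hsin.ne] at e1
        · nlinarith [mul_nonneg (sub_nonneg.2 h1) (neg_nonneg.2 hsin.le)]
      · rw [h] at e0 e1
        simp at e0 e1
        rw [e1] at e0
        norm_num at e0
    · replace hx : x.1.1 1 = 0 := hx
      rw [cylinderLift_of_eq_zero (Or.inl hx)] at e0 e1
      simp only [cons_val] at e0 e1
      rw [hx] at e0 e1 hs
      have h2 : u * x.1.1 2 = 0 := by linarith
      nlinarith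
    · replace hx : x.1.1 2 = 0 := hx
      rw [cylinderLift_of_eq_zero (Or.inr hx)] at e0 e1
      simp only [cons_val] at e0 e1
      rw [hx] at e0 e1 hs
      have h2 : u * x.1.1 1 = 0 := by linarith
      nlinarith

theorem triangleLift_aff (v : Fin 4 → Simplex 2 × unitInterval) :
    triangleLift.comp (aff v) = aff fun i => triangleLift (v i) := by
  ext t j
  rw [aff_apply_three]
  fin_cases j
  · change (aff v t).1.1 0 - (aff v t).1.1 1 - (aff v t).1.1 2 = _
    rw [aff_prod_fst, aff_prod_fst, aff_prod_fst]
    rw [Fin.sum_univ_four, Fin.sum_univ_four, Fin.sum_univ_four]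
    simp only [triangleLift, ContinuousMap.coe_mk]
    change _ = t.1 0 * _ + t.1 1 * _ + t.1 2 * _ + t.1 3 * _
    simp
    ring
  · change (aff v t).1.1 1 - (aff v t).1.1 2 = _
    rw [aff_prod_fst, aff_prod_fst]
    rw [Fin.sum_univ_four, Fin.sum_univ_four]
    simp only [triangleLift, ContinuousMap.coe_mk]
    change _ = t.1 0 * _ + t.1 1 * _ + t.1 2 * _ + t.1 3 * _
    simp
    ring
  · change ((aff v t).2 : ℝ) = _
    rw [aff_prod_snd, Fin.sum_univ_four]
    rfl

theorem push_triangleLift_cylinder : push triangleLift cylinder =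
    Finsupp.single (aff fun i => triangleLift (cylinderVertices 0 i)) 1 -
    Finsupp.single (aff fun i => triangleLift (cylinderVertices 1 i)) 1 +
    Finsupp.single (aff fun i => triangleLift (cylinderVertices 2 i)) 1 := by
  rw [cylinder_eq, map_add, map_sub, push_single, push_single, push_single, triangleLift_aff,
    triangleLift_aff, triangleLift_aff]

theorem triangleLift_vertices_zero : (fun i => triangleLift (cylinderVertices 0 i)) =
    ![![1, 0, 0], ![1, 0, 1], ![-1, 1, 1], ![-1, -1, 1]] := by
  ext i j
  fin_cases i <;> fin_cases j <;> simp [triangleLift, cylinderVertices]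

theorem triangleLift_vertices_one : (fun i => triangleLift (cylinderVertices 1 i)) =
    ![![1, 0, 0], ![-1, 1, 0], ![-1, 1, 1], ![-1, -1, 1]] := by
  ext i j
  fin_cases i <;> fin_cases j <;> simp [triangleLift, cylinderVertices]

theorem triangleLift_vertices_two : (fun i => triangleLift (cylinderVertices 2 i)) =
    ![![1, 0, 0], ![-1, 1, 0], ![-1, -1, 0], ![-1, -1, 1]] := by
  ext i j
  fin_cases i <;> fin_cases j <;> simp [triangleLift, cylinderVertices]

/-- The barycentric coordinates of `cylinderPoint` in the third simplex. -/
def cylinderWeights : Simplex 3 := ⟨![1 / 5, 2 / 5, 1 / 5, 1 / 5],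
  fun i => by fin_cases i <;> norm_num, by simp [Fin.sum_univ_succ]; norm_num⟩

/-- A linear homotopy replaces the curved prism by an affine one. Of its three tetrahedra only the
third, which enters with sign +1, contains the chosen point. -/
theorem trivialOn_cylinder :
    TrivialOn {cylinderPoint} (push cylinderLift cylinder -
      Finsupp.single (aff fun i => triangleLift (cylinderVertices 2 i)) 1) := by
  have h1 : TrivialOn {cylinderPoint} (push triangleLift cylinder - push cylinderLift cylinder) :=
    trivialOn_of_line _ _ (fun x hx u h0 h1 h => line_ne_cylinderPoint hx h0 h1 h)
      supportedIn_boundary_cylinder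
  refine h1.symm.trans (SupportedIn.trivialOn ?_)
  rw [push_triangleLift_cylinder, add_sub_cancel_right, triangleLift_vertices_zero,
    triangleLift_vertices_one]
  refine (supportedIn_single ?_ _).sub (supportedIn_single ?_ _)
  all_goals
    rintro _ ⟨t, rfl⟩ h
    have hs := t.2.2
    rw [Fin.sum_univ_four] at hs
    have p1 : 0 ≤ t 1 := t.2.1 1
    have p2 : 0 ≤ t 2 := t.2.1 2
    replace hs : t 0 + t 1 + t 2 + t 3 = 1 := hs
    have e0 := congrFun h 0
    have e1 := congrFun h 1
    have e2 := congrFun h 2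
    rw [aff_apply_three] at e0 e1 e2
    simp [cylinderPoint] at e0 e1 e2
    linarith

theorem height_triangleLift (i : Fin 3) (j : Fin 4) :
    triangleLift (cylinderVertices i j) ∈ slab cylinderPoint 1 := by
  change |((cylinderVertices i j).2 : ℝ) - 1 / 5| < 1
  have h0 := (cylinderVertices i j).2.2.1
  have h1 := (cylinderVertices i j).2.2.2
  rw [abs_lt]
  constructor <;> linarith

/-- The fundamental chain of the solid torus of radius one. -/
def coreChain : Chain 3 (ℂ × Circle) := push (wrap.comp cylinderLift) cylinder

theorem isPreconnected_circle : IsPreconnected (Set.univ : Set Circle) := by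
  have h : Function.Surjective Circle.exp := fun z => ⟨_, Circle.exp_arg z⟩
  rw [← h.range_eq]
  exact isPreconnected_range Circle.exp.continuous

theorem trivialOn_coreChain_point : TrivialOn {wrap cylinderPoint} (coreChain -
    Finsupp.single (wrap.comp (aff fun i => triangleLift (cylinderVertices 2 i))) 1) := by
  have := trivialOn_push_wrap trivialOn_cylinder (by
    refine SupportedIn.sub (supportedIn_push ?_ _) (supportedIn_single ?_ _)
    · rintro _ ⟨x, rfl⟩
      change |(x.2 : ℝ) - 1 / 5| < 1
      have h0 := x.2.2.1
      have h1 := x.2.2.2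
      rw [abs_lt]
      constructor <;> linarith
    · rintro _ ⟨t, rfl⟩
      exact aff_mem_slab (height_triangleLift 2) t)
  rwa [map_sub, push_comp, push_single] at this

theorem slice_wrap_cylinderLift : slice (wrap.comp cylinderLift) 0 =
    slice (wrap.comp cylinderLift) 1 := by
  ext1 t
  refine wrap_eq_wrap_iff.2 ⟨-1, ?_⟩
  ext j
  fin_cases j <;> simp [cylinderLift]

/-- The inclusion of the torus in `ℂ × S¹`. -/
def torusIncl : C(Torus, ℂ × Circle) := ⟨fun x => (x.1, x.2), by fun_prop⟩

/-- Top and bottom of the prism coincide in ℂ × S¹ and cancel. So do the walls over the two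
collapsed edges, which are equal and enter with opposite signs. The third wall is the unit torus,
cut along the diagonal of the square. -/
theorem boundary_coreChain : boundary coreChain = push torusIncl xiSt := by
  have h := boundary_prism (wrap.comp cylinderLift)
    (Finsupp.single (ContinuousMap.id (Simplex 2)) 1)
  rw [prism_id, push_single, push_single, slice_wrap_cylinderLift, sub_self, boundary_single,
    one_smul, Fin.sum_univ_three, map_add, map_add, map_zsmul, map_zsmul, map_zsmul, prism_single,
    prism_single, prism_single] at h
  have h12 : (wrap.comp cylinderLift).comp ((face 1 (ContinuousMap.id (Simplex 2))).prodMap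
      (ContinuousMap.id _)) = (wrap.comp cylinderLift).comp
        ((face 2 (ContinuousMap.id (Simplex 2))).prodMap (ContinuousMap.id _)) := by
    ext1 x
    have e1 : cylinderLift (stdSimplex.map (Fin.succAbove 1) x.1, x.2) = _ :=
      cylinderLift_of_eq_zero (Or.inl (map_succAbove_self (k := 1) 1 x.1))
    have e2 : cylinderLift (stdSimplex.map (Fin.succAbove 2) x.1, x.2) = _ :=
      cylinderLift_of_eq_zero (Or.inr (map_succAbove_self (k := 1) 2 x.1))
    exact congrArg wrap (e1.trans e2.symm)
  rw [h12] at h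
  have h0 : boundary coreChain = -push ((wrap.comp cylinderLift).comp
      ((face 0 (ContinuousMap.id (Simplex 2))).prodMap (ContinuousMap.id _)))
      (realize (tuplePrism 1 (stdTuple 1))) := by
    rw [coreChain, ← add_eq_zero_iff_eq_neg]
    simpa using h
  rw [h0, stdTuple, tuplePrism_one, map_sub, realize_single, realize_single, map_sub, push_single,
    push_single, neg_sub, xiSt, map_sub, push_single, push_single]
  have key (v : Fin 3 → Simplex 1 × unitInterval) (V : Fin 3 → ℝ × ℝ)
      (hV : ∀ i, V i = ((v i).1.1 1, ((v i).2 : ℝ))) : ((wrap.comp cylinderLift).comp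
      ((face 0 (ContinuousMap.id (Simplex 2))).prodMap (ContinuousMap.id _))).comp (aff v) =
      torusIncl.comp (torusSimplex V) := by
    ext1 t
    have e0 : cylinderLift (stdSimplex.map (Fin.succAbove 0) (aff v t).1, (aff v t).2) =
        _ := cylinderLift_of_zero (map_succAbove_self (k := 1) 0 _)
    have e1 : (stdSimplex.map (Fin.succAbove (0 : Fin 3)) (aff v t).1).1 2 = (aff v t).1.1 1 :=
      map_succAbove_apply (k := 1) 0 (aff v t).1 1
    refine (congrArg wrap e0).trans ?_
    rw [e1, wrap_apply, aff_prod_fst]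
    simp only [Matrix.cons_val, aff_prod_snd]
    refine Prod.ext ?_ ?_
    · change _ = (Circle.exp (2 * Real.pi * ∑ i, t i * (V i).1) : ℂ)
      rw [Circle.coe_exp, Complex.exp_mul_I, ← Complex.ofReal_cos, ← Complex.ofReal_sin,
        ← Complex.mk_eq_add_mul_I]
      simp only [hV]
      rfl
    · change _ = Circle.exp (2 * Real.pi * ∑ i, t i * (V i).2)
      simp only [hV]
      rfl
  congr 2
  · refine key _ _ fun i => ?_
    fin_cases i <;> simp
  · refine key _ _ fun i => ?_
    fin_cases i <;> simp

/-- The open solid torus is connected and misses the boundary of the chain, so agreement at the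
single point `wrap cylinderPoint` propagates everywhere. -/
theorem trivialOn_coreChain {σ : SingularSimplex 3 (ℂ × Circle)} (hσ : σ ∈ wrapOrientation)
    {t : Simplex 3} (ht : t ∈ simplexInterior 3) (hx : ‖(σ t).1‖ < 1) :
    TrivialOn {σ t} (coreChain - Finsupp.single σ 1) := by
  have hO : IsOpen {z : ℂ × Circle | ‖z.1‖ < 1} := isOpen_lt (by fun_prop) continuous_const
  have hW : IsPreconnected {z : ℂ × Circle | ‖z.1‖ < 1} := by
    have : {z : ℂ × Circle | ‖z.1‖ < 1} = Metric.ball 0 1 ×ˢ Set.univ := by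
      ext z
      simp
    rw [this]
    exact (convex_ball (0 : ℂ) 1).isPreconnected.prod isPreconnected_circle
  obtain ⟨σ₀, ⟨v, hv, hv', hσ₀⟩, t₀, ht₀, h₀, -⟩ := exists_wrapSimplex (z := wrap cylinderPoint)
    Filter.univ_mem
  have hw : aff (fun i => triangleLift (cylinderVertices 2 i)) cylinderWeights = cylinderPoint := by
    rw [triangleLift_vertices_two]
    ext j
    rw [aff_apply_three]
    rw [show cylinderWeights 0 = 1 / 5 from rfl, show cylinderWeights 1 = 2 / 5 from rfl,
      show cylinderWeights 2 = 1 / 5 from rfl, show cylinderWeights 3 = 1 / 5 from rfl]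
    fin_cases j <;> simp [cylinderPoint] <;> norm_num
  have hd : 0 < affDet fun i => triangleLift (cylinderVertices 2 i) := by
    rw [triangleLift_vertices_two]
    simp [affDet, det_fin_three]
    norm_num
  have hint : cylinderWeights ∈ simplexInterior 3 := by
    intro i
    change 0 < (![1 / 5, 2 / 5, 1 / 5, 1 / 5] : Fin 4 → ℝ) i
    fin_cases i <;> norm_num
  subst hσ₀
  have h1 := trivialOn_wrap_sub hd hv hint ht₀ (fun i => hw ▸ height_triangleLift 2 i)
    (mem_slab_of_aff hv' t₀) (by rw [hw]; exact h₀.symm)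
  rw [hw] at h1
  have h2 := trivialOn_coreChain_point.trans h1
  rw [← h₀] at h2
  refine trivialOn_sub_of_isPreconnected (P := wrapOrientation) hO hW
    (fun x _ => hasChartAt_wrap x) (fun σ h => isRegularSimplex_of_mem_wrapOrientation h)
    (fun σ hσ τ hτ s hs t ht h _ => trivialOn_wrapOrientation_sub hσ hτ hs ht h) (fun x _ => ?_) ?_
    ⟨v, hv, hv', rfl⟩ ht₀ ?_ h2 σ hσ t ht hx
  · obtain ⟨σ, hσ, t, ht, h, -⟩ := exists_wrapSimplex (z := x) Filter.univ_mem
    exact ⟨σ, hσ, t, ht, h⟩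
  · rw [boundary_coreChain]
    refine supportedIn_push ?_ _
    rintro _ ⟨x, rfl⟩ h
    have : ‖(x.1 : ℂ)‖ < 1 := h
    rw [Circle.norm_coe] at this
    exact lt_irrefl _ this
  · rw [h₀]
    change ‖(⟨-3 / 5, 0⟩ : ℂ)‖ < 1
    have : (⟨-3 / 5, 0⟩ : ℂ) = ((-3 / 5 : ℝ) : ℂ) := rfl
    rw [this, Complex.norm_real]
    norm_num [abs_of_nonpos]

/-- The fundamental chain of the part of radius one of a solid torus. -/
def solidChain (r : ℝ) (hr : 0 < r) : Chain 3 (SolidTorus r) := push (clamp hr) coreChain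

theorem boundary_solidChain {r : ℝ} (hr : 1 ≤ r) :
    boundary (solidChain r (zero_lt_one.trans_le hr)) = push (torusInSolid r hr) xiSt := by
  rw [solidChain, ← push_boundary, boundary_coreChain, push_comp]
  have h : (clamp (zero_lt_one.trans_le hr)).comp torusIncl = torusInSolid r hr :=
    ContinuousMap.ext fun x => clamp_solidIncl (zero_lt_one.trans_le hr) (torusInSolid r hr x)
  rw [h]

theorem trivialOn_solidChain {r : ℝ} (hr : 1 ≤ r) {σ : SingularSimplex 3 (SolidTorus r)}
    (hσ : σ ∈ solidTorusOrientation r) {t : Simplex 3} (ht : t ∈ simplexInterior 3)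
    (hx : σ t ∈ openSolid r 1) :
    TrivialOn {σ t} (solidChain r (zero_lt_one.trans_le hr) - Finsupp.single σ 1) := by
  have h1 := trivialOn_coreChain (mem_solidTorusOrientation_iff.1 hσ) ht hx
  have h2 := trivialOn_clamp (zero_lt_one.trans_le hr)
    (lt_of_lt_of_le (show ‖((σ t).1 : ℂ)‖ < 1 from hx) hr) h1
  rwa [map_sub, push_single, ← ContinuousMap.comp_assoc, clamp_comp_solidIncl,
    ContinuousMap.id_comp] at h2

end Cylinder

end SurgeryFormula

end

noncomputable section

namespace SurgeryFormula

open HasAffineSimplices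

/-! ### Cochains on the integers -/

section Integers

variable {Γ : Type*} [Group Γ] {A : Type*} [AddCommGroup A]

/-- Sums over intervals of integers. -/
def intSum (h : ℤ → A) : ℤ → A
  | Int.ofNat n => ∑ i ∈ Finset.range n, h i
  | Int.negSucc n => -∑ i ∈ Finset.range (n + 1), h (-(i + 1))

theorem intSum_zero (h : ℤ → A) : intSum h 0 = 0 := Finset.sum_range_zero _

theorem intSum_add_one (h : ℤ → A) (b : ℤ) : intSum h (b + 1) = intSum h b + h b := by
  rcases b with n | n
  · exact Finset.sum_range_succ _ n
  · rcases n with _ | n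
    · change ∑ i ∈ Finset.range 0, h i = -∑ i ∈ Finset.range 1, h (-((i : ℤ) + 1)) + h (-1)
      simp
    · have h1 : Int.negSucc (n + 1) + 1 = Int.negSucc n := rfl
      rw [h1]
      change -∑ i ∈ Finset.range (n + 1), h (-((i : ℤ) + 1)) =
        -∑ i ∈ Finset.range (n + 1 + 1), h (-((i : ℤ) + 1)) + h (Int.negSucc (n + 1))
      rw [Finset.sum_range_succ _ (n + 1), Int.negSucc_eq]
      push_cast
      abel

/-- The third cohomology of the integers vanishes. -/
theorem exists_trivializes {α : Γ → Γ → Γ → A} (hα : IsThreeCocycle α)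
    (hα' : IsStronglyNormalized α) (z : Γ) : ∃ f : ℤ → ℤ → A, Trivializes α z f := by
  -- Chosen so that the defect `D 1 b c` vanishes, as a recursion in b that starts from `f 0 c = 0`.
  -- The cocycle identity with first argument z then shows that the defect does not depend on its
  -- first argument.
  set f : ℤ → ℤ → A := fun b c => -intSum (fun j => α z (z ^ j) (z ^ c)) b with hf
  have hf0 (c) : f 0 c = 0 := by rw [hf]; simp [intSum_zero]
  have hfs (b c) : f (b + 1) c = f b c - α z (z ^ b) (z ^ c) := by
    simp only [hf, intSum_add_one]
    abel
  have hf1 (c) : f 1 c = 0 := by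
    have h1 := hfs 0 c
    rw [zero_add, hf0, zpow_zero, hα' z 1 _ (by simp)] at h1
    simpa using h1
  set D : ℤ → ℤ → ℤ → A := fun a b c =>
    α (z ^ a) (z ^ b) (z ^ c) - (f b c - f (a + b) c + f a (b + c) - f a b) with hD
  have hD1 (b c) : D 1 b c = 0 := by
    simp only [hD, hf1, zpow_one, add_comm 1 b, hfs]
    abel
  have hDs (a b c) : D (a + 1) b c = D a b c := by
    have h1 := hα (z ^ (1 : ℤ)) (z ^ a) (z ^ b) (z ^ c)
    simp only [← zpow_add] at h1
    have h2 : D 1 a b - D (1 + a) b c + D 1 (a + b) c - D 1 a (b + c) + D a b c = 0 := by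
      refine Eq.trans ?_ h1
      simp only [hD, ← add_assoc]
      abel
    rw [hD1, hD1, hD1, add_comm 1 a] at h2
    have h3 : D a b c - D (a + 1) b c = 0 := by
      rw [← h2]
      abel
    exact (sub_eq_zero.1 h3).symm
  have hD0 (a b c) : D a b c = 0 := by
    induction a using Int.induction_on with
    | zero => rw [← hDs, zero_add, hD1]
    | succ i ih => rw [hDs, ih]
    | pred i ih => rw [← hDs, sub_add_cancel, ih]
  exact ⟨f, fun a b c => sub_eq_zero.1 (hD0 a b c)⟩

/-- Normalization kills the cocycle at the exponents (1, 0, 0) and (0, 0, 1), and the coboundary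
relation there identifies `f 1 0`, `f 0 0` and `f 0 1`. This removes the constant term of the
surgery formula. -/
theorem antisymmetrize_zero_one {α : Γ → Γ → Γ → A} (hα' : IsStronglyNormalized α) {z : Γ}
    {f : ℤ → ℤ → A} (hf : Trivializes α z f) : antisymmetrize f 0 1 = 0 := by
  have h1 := hf 1 0 0
  have h2 := hf 0 0 1
  rw [hα' _ _ _ (by simp)] at h1 h2
  simp only [add_zero, zero_add] at h1 h2
  have h3 : f 0 0 = f 1 0 := by
    rw [← sub_eq_zero, h1]
    abel
  have h4 : f 0 1 = f 0 0 := by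
    rw [← sub_eq_zero, h2]
    abel
  rw [antisymmetrize, h4, h3, sub_self]

/-- By Bézout, an element is recovered from its powers with exponents p and -q. -/
theorem eq_of_zpow_eq {z w : Γ} {p q p' q' : ℤ} (h : p * q' - p' * q = 1) (hp : z ^ p = w ^ p)
    (hq : z ^ (-q) = w ^ (-q)) : z = w := by
  have key (x : Γ) : x = (x ^ p) ^ q' * (x ^ (-q)) ^ p' := by
    rw [← zpow_mul, ← zpow_mul, ← zpow_add, show p * q' + -q * p' = 1 by linarith, zpow_one]
  rw [key z, key w, hp, hq]

end Integers

/-! ### Evaluation of cocycles on chains -/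

section Evaluation

variable {X Y Z : Type*} [TopologicalSpace X] [TopologicalSpace Y] [TopologicalSpace Z]
variable {Γ : Type*} [Group Γ] {A : Type*} [AddCommGroup A]

theorem GroupoidRep.val_trans (ρ : GroupoidRep X Γ) {x y z : X} (p : Path x y) (q : Path y z) :
    ρ.val (p.trans q) = ρ.val p * ρ.val q := by
  have h := ρ.map_comp (FundamentalGroupoid.fromPath (Path.Homotopic.Quotient.mk p))
    (FundamentalGroupoid.fromPath (Path.Homotopic.Quotient.mk q))
  exact congrArg MulOpposite.unop h

theorem GroupoidRep.val_congr (ρ : GroupoidRep X Γ) {x y : X} {p q : Path x y}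
    (h : p.Homotopic q) : ρ.val p = ρ.val q := by
  rw [GroupoidRep.val, GroupoidRep.val, Path.Homotopic.Quotient.eq.2 h]

theorem GroupoidRep.val_ext (ρ : GroupoidRep X Γ) {x y x' y' : X} {p : Path x y} {q : Path x' y'}
    (h : ∀ s, p s = q s) : ρ.val p = ρ.val q := by
  obtain rfl : x = x' := by rw [← p.source, ← q.source, h]
  obtain rfl : y = y' := by rw [← p.target, ← q.target, h]
  rw [Path.ext (funext h)]

theorem GroupoidRep.val_pull (ρ : GroupoidRep Y Γ) (f : C(X, Y)) {x y : X} (p : Path x y) :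
    (ρ.pull f).val p = ρ.val (p.map f.continuous) := rfl

/-- The value on the image of any path in a simply connected space. -/
def GroupoidRep.along (ρ : GroupoidRep X Γ) [SimplyConnectedSpace Y] (f : C(Y, X)) (a b : Y) : Γ :=
  ρ.val ((PathConnectedSpace.somePath a b).map f.continuous)

variable (ρ : GroupoidRep X Γ) [SimplyConnectedSpace Y]

theorem GroupoidRep.val_map (f : C(Y, X)) {a b : Y} (p : Path a b) :
    ρ.val (p.map f.continuous) = ρ.along f a b :=
  ρ.val_congr ((SimplyConnectedSpace.paths_homotopic p _).map f)

theorem GroupoidRep.along_mul (f : C(Y, X)) (a b c : Y) :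
    ρ.along f a b * ρ.along f b c = ρ.along f a c := by
  rw [GroupoidRep.along, GroupoidRep.along, ← GroupoidRep.val_trans, ← Path.map_trans,
    GroupoidRep.val_map]

theorem GroupoidRep.along_self (f : C(Y, X)) (a : Y) : ρ.along f a a = 1 := by
  have := ρ.along_mul f a a a
  simpa using this

theorem GroupoidRep.along_comp [SimplyConnectedSpace Z] (f : C(Y, X)) (g : C(Z, Y)) (a b : Z) :
    ρ.along (f.comp g) a b = ρ.along f (g a) (g b) := by
  rw [← ρ.val_map f ((PathConnectedSpace.somePath a b).map g.continuous)]
  rfl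

theorem GroupoidRep.along_pull {W : Type*} [TopologicalSpace W] (g : C(X, W))
    (ρ : GroupoidRep W Γ) (f : C(Y, X)) (a b : Y) :
    (ρ.pull g).along f a b = ρ.along (g.comp f) a b := rfl

instance (k : ℕ) : ContractibleSpace (Simplex k) :=
  (convex_stdSimplex ℝ (Fin (k + 1))).contractibleSpace ⟨_, (stdSimplex.vertex 0 : Simplex k).2⟩

theorem GroupoidRep.val_edge {k : ℕ} (σ : SingularSimplex k X) (i j : Fin (k + 1)) :
    ρ.val (edge σ i j) = ρ.along σ (stdSimplex.vertex i) (stdSimplex.vertex j) :=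
  ρ.val_map σ (stdEdge i j)

variable (α : Γ → Γ → Γ → A)

/-- The evaluation of a cochain as a homomorphism. -/
def evalHom : Chain 3 X →+ A :=
  Finsupp.liftAddHom fun σ => zmultiplesHom A
    (α (ρ.val (edge σ 0 1)) (ρ.val (edge σ 1 2)) (ρ.val (edge σ 2 3)))

theorem evalChain_eq (ζ : Chain 3 X) : evalChain α ρ ζ = evalHom ρ α ζ := rfl

theorem evalHom_single (σ : SingularSimplex 3 X) : evalHom ρ α (Finsupp.single σ 1) =
    α (ρ.along σ (stdSimplex.vertex 0) (stdSimplex.vertex 1))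
      (ρ.along σ (stdSimplex.vertex 1) (stdSimplex.vertex 2))
      (ρ.along σ (stdSimplex.vertex 2) (stdSimplex.vertex 3)) := by
  rw [← ρ.val_edge, ← ρ.val_edge, ← ρ.val_edge]
  simp [evalHom]

theorem evalHom_push {W : Type*} [TopologicalSpace W] (ρ : GroupoidRep W Γ) (f : C(X, W))
    (c : Chain 3 X) : evalHom ρ α (push f c) = evalHom (ρ.pull f) α c :=
  chain_hom_ext (φ := (evalHom ρ α).comp (push f)) (ψ := evalHom (ρ.pull f) α) (fun σ => by
    rw [AddMonoidHom.comp_apply, push_single, evalHom_single, evalHom_single]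
    rfl) c

theorem along_face {k : ℕ} (σ : SingularSimplex (k + 1) X) (i : Fin (k + 2)) (a b : Fin (k + 1)) :
    ρ.along (face i σ) (stdSimplex.vertex a) (stdSimplex.vertex b) =
      ρ.along σ (stdSimplex.vertex (i.succAbove a)) (stdSimplex.vertex (i.succAbove b)) := by
  rw [face, ρ.along_comp]
  simp only [ContinuousMap.coe_mk, stdSimplex.map_vertex]

variable {α}

/-- The five faces of a 4-simplex give the five terms of the cocycle identity at the values on its
four consecutive edges. -/
theorem evalHom_boundary (hα : IsThreeCocycle α) (e : Chain 4 X) :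
    evalHom ρ α (boundary e) = 0 := by
  refine chain_hom_ext (φ := (evalHom ρ α).comp boundary) (ψ := 0) (fun σ => ?_) e
  rw [AddMonoidHom.comp_apply, boundary_single, one_smul, map_sum, Fin.sum_univ_five]
  simp only [map_zsmul, evalHom_single, along_face]
  set g := fun i j : Fin 5 => ρ.along σ (stdSimplex.vertex i) (stdSimplex.vertex j) with hg
  have hmul (i j l) : g i j * g j l = g i l := ρ.along_mul _ _ _ _
  have h := hα (g 0 1) (g 1 2) (g 2 3) (g 3 4)
  rw [hmul, hmul, hmul] at h
  change (-1 : ℤ) ^ 0 • α (g 1 2) (g 2 3) (g 3 4) + (-1 : ℤ) ^ 1 • α (g 0 2) (g 2 3) (g 3 4) +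
    (-1 : ℤ) ^ 2 • α (g 0 1) (g 1 3) (g 3 4) + (-1 : ℤ) ^ 3 • α (g 0 1) (g 1 2) (g 2 4) +
    (-1 : ℤ) ^ 4 • α (g 0 1) (g 1 2) (g 2 3) = 0
  rw [← h]
  simp only [pow_zero, pow_one, one_smul, neg_smul, Int.reduceNeg, even_two, Even.neg_pow, one_pow,
    show (-1 : ℤ) ^ 3 = -1 by norm_num, show (-1 : ℤ) ^ 4 = 1 by norm_num]
  abel

theorem evalHom_aff [HasAffineSimplices Y] (f : C(Y, X)) (v : Fin 4 → Y) :
    evalHom ρ α (Finsupp.single (f.comp (aff v)) 1) =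
      α (ρ.along f (v 0) (v 1)) (ρ.along f (v 1) (v 2)) (ρ.along f (v 2) (v 3)) := by
  rw [evalHom_single]
  simp only [ρ.along_comp, aff_vertex]

end Evaluation

/-! ### Periodic maps and the core of a solid torus -/

section Lattice

variable {X : Type*} [TopologicalSpace X] {Γ : Type*} [Group Γ] {A : Type*} [AddCommGroup A]

/-- Representations are periodic along periodic maps. -/
theorem GroupoidRep.along_add (ρ : GroupoidRep X Γ) {E : Type*} [AddCommGroup E] [TopologicalSpace E]
    [SimplyConnectedSpace E] [ContinuousAdd E] (f : C(E, X)) {v : E} (hv : ∀ x, f (x + v) = f x)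
    (a b : E) : ρ.along f (a + v) (b + v) = ρ.along f a b := by
  have h : f.comp ⟨fun x => x + v, by fun_prop⟩ = f := ContinuousMap.ext hv
  have := ρ.along_comp f ⟨fun x => x + v, by fun_prop⟩ a b
  rw [h] at this
  exact this.symm

/-- By periodicity the value on a segment depends only on its displacement, so n ↦ (value along n •
v) is a homomorphism from ℤ. -/
theorem GroupoidRep.along_zsmul (ρ : GroupoidRep X Γ) {E : Type*} [AddCommGroup E]
    [TopologicalSpace E] [SimplyConnectedSpace E] [ContinuousAdd E] (f : C(E, X)) {v : E}
    (hv : ∀ x, f (x + v) = f x) (a : E) (n : ℤ) :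
    ρ.along f a (a + n • v) = ρ.along f a (a + v) ^ n := by
  have hn (n : ℤ) (x) : f (x + n • v) = f x := by
    induction n using Int.induction_on with
    | zero => simp
    | succ i ih => rw [add_smul, one_smul, ← add_assoc, hv, ih]
    | pred i ih => rw [← hv, add_assoc, ← add_one_zsmul, sub_add_cancel, ih]
  let g : Multiplicative ℤ →* Γ :=
    { toFun := fun n => ρ.along f a (a + n.toAdd • v)
      map_one' := by simp [ρ.along_self]
      map_mul' := fun m n => by
        rw [toAdd_mul, add_smul, ← ρ.along_mul f a (a + m.toAdd • v)]
        congr 1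
        have := ρ.along_add f (hn m.toAdd) a (a + n.toAdd • v)
        rw [← this]
        congr 1
        abel }
  have h1 : g (Multiplicative.ofAdd n) = g (Multiplicative.ofAdd 1) ^ n := by
    rw [← map_zpow, ← ofAdd_zsmul, smul_eq_mul, mul_one]
  simpa [g] using h1

variable {r : ℝ} (hr : 0 < r) (ρ : GroupoidRep (SolidTorus r) Γ)

/-- The universal covering of the solid torus, composed with the retraction. -/
def solidCover (hr : 0 < r) : C(Fin 3 → ℝ, SolidTorus r) := (clamp hr).comp wrap

theorem solidCover_periodic (x : Fin 3 → ℝ) : solidCover hr (x + ![0, 0, 1]) = solidCover hr x :=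
  congrArg (clamp hr) (wrap_eq_wrap_iff.2 ⟨1, by simp⟩)

/-- The value of a representation on the core of a solid torus. -/
def coreVal : Γ := ρ.along (solidCover hr) ![1, 0, 0] ![1, 0, 1]

theorem along_solidCover (n : ℤ) :
    ρ.along (solidCover hr) ![1, 0, 0] ![1, 0, (n : ℝ)] = coreVal hr ρ ^ n := by
  have := ρ.along_zsmul (solidCover hr) (solidCover_periodic hr) ![1, 0, 0] n
  simpa [coreVal] using this

theorem cylinderLift_vertices (i : Fin 3) (j : Fin 4) :
    cylinderLift (cylinderVertices i j) = ![1, 0, ((cylinderVertices i j).2 : ℝ)] := by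
  refine cylinderLift_of_eq_zero ?_
  fin_cases i <;> fin_cases j <;> simp [cylinderVertices]

/-- The fundamental chain of the solid torus does not contribute. -/
theorem evalHom_solidChain {α : Γ → Γ → Γ → A} (hα' : IsStronglyNormalized α) :
    evalHom ρ α (solidChain r hr) = 0 := by
  have h : solidChain r hr = push ((solidCover hr).comp cylinderLift) cylinder := by
    rw [solidChain, coreChain, push_comp, ← ContinuousMap.comp_assoc]
    rfl
  -- All vertices of the prism are lifted to the line over the longitude through 1, and their
  -- positions differ only by height. Two consecutive vertices of equal height give an edge of value
  -- 1, and every tetrahedron has such a pair.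
  have key (i : Fin 3) (hi : ∃ j : Fin 3, (cylinderVertices i j.castSucc).2 =
      (cylinderVertices i j.succ).2) : evalHom ρ α (Finsupp.single
      (((solidCover hr).comp cylinderLift).comp (aff (cylinderVertices i))) 1) = 0 := by
    rw [evalHom_single]
    refine hα' _ _ _ ?_
    have h1 (j : Fin 3) (hj : (cylinderVertices i j.castSucc).2 = (cylinderVertices i j.succ).2) :
        ρ.along (((solidCover hr).comp cylinderLift).comp (aff (cylinderVertices i)))
          (stdSimplex.vertex j.castSucc) (stdSimplex.vertex j.succ) = 1 := by
      rw [ContinuousMap.comp_assoc, ρ.along_comp, ContinuousMap.comp_apply,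
        ContinuousMap.comp_apply, aff_vertex, aff_vertex, cylinderLift_vertices,
        cylinderLift_vertices, hj, ρ.along_self]
    obtain ⟨j, hj⟩ := hi
    have := h1 j hj
    fin_cases j
    · exact Or.inl this
    · exact Or.inr (Or.inl this)
    · exact Or.inr (Or.inr (Or.inl this))
  rw [h, cylinder_eq, map_add, map_sub, push_single, push_single, push_single, map_add, map_sub,
    key 0 ⟨1, rfl⟩, key 1 ⟨0, rfl⟩, key 2 ⟨0, rfl⟩]
  simp

end Lattice

end SurgeryFormula

end

noncomputable section

namespace SurgeryFormula

open HasAffineSimplices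

/-! ### Linear maps of the torus -/

section TorusMaps

open Matrix

variable {Γ : Type*} [Group Γ] {A : Type*} [AddCommGroup A]

/-- The universal covering of the torus. -/
def torusCover : C(ℝ × ℝ, Torus) :=
  ⟨fun x => (Circle.exp (2 * Real.pi * x.1), Circle.exp (2 * Real.pi * x.2)), by fun_prop⟩

theorem torusCover_periodic (m n : ℤ) (x : ℝ × ℝ) :
    torusCover (x + ((m : ℝ), (n : ℝ))) = torusCover x :=
  Prod.ext (exp_two_pi_mul_eq_iff.2 ⟨m, rfl⟩) (exp_two_pi_mul_eq_iff.2 ⟨n, rfl⟩)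

theorem torusSimplex_eq (V : Fin 3 → ℝ × ℝ) : torusSimplex V = torusCover.comp (aff V) := by
  ext1 t
  change _ = (Circle.exp (2 * Real.pi * (∑ i, t i • V i).1),
    Circle.exp (2 * Real.pi * (∑ i, t i • V i).2))
  rw [Prod.fst_sum, Prod.snd_sum]
  rfl

/-- The simplex of the torus with integral vertices. -/
def latticeSimplex {k : ℕ} (V : Fin (k + 1) → ℤ × ℤ) : SingularSimplex k Torus :=
  torusCover.comp (aff fun i => (((V i).1 : ℝ), ((V i).2 : ℝ)))

theorem latticeSimplex_add {k : ℕ} (V : Fin (k + 1) → ℤ × ℤ) (w : ℤ × ℤ) :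
    latticeSimplex (fun i => V i + w) = latticeSimplex V := by
  ext1 t
  refine Eq.trans (congrArg torusCover ?_) (torusCover_periodic w.1 w.2 _)
  change ∑ i, t i • _ = (∑ i, t i • _) + _
  have h : (((w.1 : ℝ), (w.2 : ℝ)) : ℝ × ℝ) = ∑ i, t i • ((w.1 : ℝ), (w.2 : ℝ)) := by
    rw [← Finset.sum_smul, stdSimplex.sum_eq_one, one_smul]
  rw [h, ← Finset.sum_add_distrib]
  refine Finset.sum_congr rfl fun i _ => ?_
  rw [← smul_add]
  congr 1
  simp

theorem face_latticeSimplex {k : ℕ} (V : Fin (k + 2) → ℤ × ℤ) (i : Fin (k + 2)) :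
    face i (latticeSimplex V) = latticeSimplex fun m => V (i.succAbove m) := by
  rw [latticeSimplex, face_comp, face_aff]
  rfl

theorem xiSt_eq : xiSt = Finsupp.single (latticeSimplex ![(0, 0), (1, 0), (1, 1)]) 1 -
    Finsupp.single (latticeSimplex ![(0, 0), (0, 1), (1, 1)]) 1 := by
  rw [xiSt, torusSimplex_eq, torusSimplex_eq, latticeSimplex, latticeSimplex]
  congr 5
  all_goals
    ext i <;> fin_cases i <;> simp

/-- The action of an integral matrix on lattice points. -/
def latticeMap (b : SpecialLinearGroup (Fin 2) ℤ) (v : ℤ × ℤ) : ℤ × ℤ :=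
  (b 0 0 * v.1 + b 0 1 * v.2, b 1 0 * v.1 + b 1 1 * v.2)

/-- The linear map of the plane that covers `torusMap b`. -/
def planeMap (b : SpecialLinearGroup (Fin 2) ℤ) : C(ℝ × ℝ, ℝ × ℝ) :=
  ⟨fun x => (b 0 0 * x.1 + b 0 1 * x.2, b 1 0 * x.1 + b 1 1 * x.2), by fun_prop⟩

theorem torusMap_comp_torusCover (b : SpecialLinearGroup (Fin 2) ℤ) :
    (torusMap b).comp torusCover = torusCover.comp (planeMap b) := by
  have h (m : ℤ) (x : ℝ) : Circle.exp (2 * Real.pi * x) ^ m = Circle.exp (2 * Real.pi * (m * x)) := by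
    rw [← Circle.exp_intCast_mul]
    congr 1
    ring
  ext1 x
  refine Prod.ext ?_ ?_
  · change _ ^ _ * _ ^ _ = Circle.exp (2 * Real.pi * (_ + _))
    rw [mul_add, Circle.exp_add, ← h, ← h]
    rfl
  · change _ ^ _ * _ ^ _ = Circle.exp (2 * Real.pi * (_ + _))
    rw [mul_add, Circle.exp_add, ← h, ← h]
    rfl

theorem torusMap_latticeSimplex {k : ℕ} (b : SpecialLinearGroup (Fin 2) ℤ)
    (V : Fin (k + 1) → ℤ × ℤ) :
    (torusMap b).comp (latticeSimplex V) = latticeSimplex fun i => latticeMap b (V i) := by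
  rw [latticeSimplex, ← ContinuousMap.comp_assoc, torusMap_comp_torusCover,
    ContinuousMap.comp_assoc, latticeSimplex]
  congr 1
  ext1 t
  change planeMap b (∑ i, t i • _) = ∑ i, t i • _
  simp only [planeMap, ContinuousMap.coe_mk, Prod.fst_sum, Prod.snd_sum, latticeMap]
  refine Prod.ext ?_ ?_
  · simp only [Prod.fst_sum, Finset.mul_sum, ← Finset.sum_add_distrib]
    refine Finset.sum_congr rfl fun i _ => ?_
    simp
    ring
  · simp only [Prod.snd_sum, Finset.mul_sum, ← Finset.sum_add_distrib]
    refine Finset.sum_congr rfl fun i _ => ?_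
    simp
    ring

theorem specialLinearGroup_mul_apply (b c : SpecialLinearGroup (Fin 2) ℤ) (i j : Fin 2) :
    (b * c) i j = b i 0 * c 0 j + b i 1 * c 1 j := by
  change (b.1 * c.1) i j = _
  rw [mul_apply, Fin.sum_univ_two]

theorem torusMap_mul (b c : SpecialLinearGroup (Fin 2) ℤ) :
    torusMap (b * c) = (torusMap b).comp (torusMap c) := by
  have key (x : Torus) (i : Fin 2) : x.1 ^ (b * c) i 0 * x.2 ^ (b * c) i 1 =
      (x.1 ^ c 0 0 * x.2 ^ c 0 1) ^ b i 0 * (x.1 ^ c 1 0 * x.2 ^ c 1 1) ^ b i 1 := by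
    rw [specialLinearGroup_mul_apply, specialLinearGroup_mul_apply, _root_.zpow_add,
      _root_.zpow_add, mul_zpow, mul_zpow]
    simp only [← _root_.zpow_mul, mul_comm (c _ _) (b _ _)]
    rw [mul_mul_mul_comm]
  ext1 x
  exact Prod.ext (key x 0) (key x 1)

theorem torusMap_one : torusMap 1 = ContinuousMap.id Torus := by
  ext1 x
  simp [torusMap]

/-- The value of a representation of the torus on the line from the origin to a lattice point. -/
def lineVal (ρ : GroupoidRep Torus Γ) (v : ℤ × ℤ) : Γ :=
  ρ.along torusCover 0 ((v.1 : ℝ), (v.2 : ℝ))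

theorem along_torusCover (ρ : GroupoidRep Torus Γ) (v w : ℤ × ℤ) :
    ρ.along torusCover ((v.1 : ℝ), (v.2 : ℝ)) ((w.1 : ℝ), (w.2 : ℝ)) = lineVal ρ (w - v) := by
  have := ρ.along_add torusCover (torusCover_periodic v.1 v.2) 0
    (((w - v).1 : ℝ), ((w - v).2 : ℝ))
  rw [lineVal, ← this]
  simp

theorem lineVal_pull (ρ : GroupoidRep Torus Γ) (b : SpecialLinearGroup (Fin 2) ℤ) (v : ℤ × ℤ) :
    lineVal (ρ.pull (torusMap b)) v = lineVal ρ (latticeMap b v) := by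
  rw [lineVal, GroupoidRep.along_pull, torusMap_comp_torusCover, ρ.along_comp, lineVal]
  simp [planeMap, latticeMap]
  rfl

theorem evalHom_latticeSimplex (ρ : GroupoidRep Torus Γ) (α : Γ → Γ → Γ → A)
    (V : Fin 4 → ℤ × ℤ) : evalHom ρ α (Finsupp.single (latticeSimplex V) 1) =
      α (lineVal ρ (V 1 - V 0)) (lineVal ρ (V 2 - V 1)) (lineVal ρ (V 3 - V 2)) := by
  rw [latticeSimplex, evalHom_aff, along_torusCover, along_torusCover, along_torusCover]

/-- The representation of the torus takes the lattice point `(m, n)` to `z ^ (l m + l' n)`. -/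
def HasExponents (ρ : GroupoidRep Torus Γ) (z : Γ) (l l' : ℤ) : Prop :=
  ∀ v, lineVal ρ v = z ^ (l * v.1 + l' * v.2)

theorem HasExponents.pull {ρ : GroupoidRep Torus Γ} {z : Γ} {l l' : ℤ} (h : HasExponents ρ z l l')
    (b : SpecialLinearGroup (Fin 2) ℤ) : HasExponents (ρ.pull (torusMap b)) z
      (l * b 0 0 + l' * b 1 0) (l * b 0 1 + l' * b 1 1) := by
  intro v
  rw [lineVal_pull, h, latticeMap]
  congr 1
  ring

/-- A chain that bounds the difference of `xiSt` and its image under `torusMap b`, on which cocycles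
evaluate as expected. -/
def IsTransfer (α : Γ → Γ → Γ → A) (b : SpecialLinearGroup (Fin 2) ℤ) (y : Chain 3 Torus) : Prop :=
  boundary y = push (torusMap b) xiSt - xiSt ∧
    ∀ (ρ : GroupoidRep Torus Γ) (z : Γ) (l l' : ℤ), HasExponents ρ z l l' →
      ∀ f : ℤ → ℤ → A, Trivializes α z f → evalHom ρ α y =
        antisymmetrize f (l * b 0 0 + l' * b 1 0) (l * b 0 1 + l' * b 1 1) - antisymmetrize f l l'

variable {α : Γ → Γ → Γ → A}

theorem IsTransfer.one : IsTransfer α 1 0 := by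
  constructor
  · rw [torusMap_one, push_id, map_zero, sub_self]
  · intro ρ z l l' h f hf
    simp

/-- The chain for c is moved by b, which replaces the exponents (l, l') by (l, l')b in its
evaluation; the two differences of ε then telescope. -/
theorem IsTransfer.mul {b c : SpecialLinearGroup (Fin 2) ℤ} {y y' : Chain 3 Torus}
    (hy : IsTransfer α b y) (hy' : IsTransfer α c y') :
    IsTransfer α (b * c) (push (torusMap b) y' + y) := by
  constructor
  · rw [map_add, ← push_boundary, hy.1, hy'.1, map_sub, push_comp, ← torusMap_mul]
    abel
  · intro ρ z l l' h f hf
    rw [map_add, evalHom_push, hy.2 ρ z l l' h f hf, hy'.2 _ z _ _ (h.pull b) f hf,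
      sub_add_sub_cancel]
    congr 2
    all_goals
      rw [specialLinearGroup_mul_apply, specialLinearGroup_mul_apply]
      ring

theorem IsTransfer.inv {b : SpecialLinearGroup (Fin 2) ℤ} {y : Chain 3 Torus}
    (hy : IsTransfer α b y) : IsTransfer α b⁻¹ (-push (torusMap b⁻¹) y) := by
  constructor
  · rw [map_neg, ← push_boundary, hy.1, map_sub, push_comp, ← torusMap_mul, inv_mul_cancel,
      torusMap_one, push_id, neg_sub]
  · intro ρ z l l' h f hf
    rw [map_neg, evalHom_push, hy.2 _ z _ _ (h.pull b⁻¹) f hf, neg_sub]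
    have h1 : (b⁻¹ * b : SpecialLinearGroup (Fin 2) ℤ) = 1 := inv_mul_cancel b
    have h2 (i j) : (b⁻¹) i 0 * b 0 j + (b⁻¹) i 1 * b 1 j =
        (1 : Matrix (Fin 2) (Fin 2) ℤ) i j := by
      rw [← specialLinearGroup_mul_apply, h1]
      rfl
    have e1 := h2 0 0
    have e2 := h2 0 1
    have e3 := h2 1 0
    have e4 := h2 1 1
    simp only [one_apply_eq] at e1 e4
    rw [one_apply_ne (by decide)] at e2 e3
    congr 2
    · linear_combination l * e1 + l' * e3
    · linear_combination l * e2 + l' * e4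

/-- Up to translation, the four faces of this tetrahedron are the triangles of ξ^st and of its
sheared image. Its edges have exponents l, l', l, and the coboundary relation at this triple is the
difference of ε(l, l + l') and ε(l, l'). -/
theorem isTransfer_T : IsTransfer α ModularGroup.T
    (Finsupp.single (latticeSimplex ![(0, 0), (1, 0), (1, 1), (2, 1)]) 1) := by
  constructor
  · rw [boundary_single, one_smul, Fin.sum_univ_four, xiSt_eq, map_sub, push_single, push_single,
      torusMap_latticeSimplex, torusMap_latticeSimplex]
    simp only [face_latticeSimplex]
    have e0 : (fun m => (![(0, 0), (1, 0), (1, 1), (2, 1)] : Fin 4 → ℤ × ℤ) (Fin.succAbove 0 m)) =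
        fun i => ![(0, 0), (0, 1), (1, 1)] i + (1, 0) := by decide
    have e1 : (fun m => (![(0, 0), (1, 0), (1, 1), (2, 1)] : Fin 4 → ℤ × ℤ) (Fin.succAbove 1 m)) =
        fun i => latticeMap ModularGroup.T (![(0, 0), (0, 1), (1, 1)] i) := by decide
    have e2 : (fun m => (![(0, 0), (1, 0), (1, 1), (2, 1)] : Fin 4 → ℤ × ℤ) (Fin.succAbove 2 m)) =
        fun i => latticeMap ModularGroup.T (![(0, 0), (1, 0), (1, 1)] i) := by decide
    have e3 : (fun m => (![(0, 0), (1, 0), (1, 1), (2, 1)] : Fin 4 → ℤ × ℤ) (Fin.succAbove 3 m)) =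
        ![(0, 0), (1, 0), (1, 1)] := by decide
    rw [e0, e1, e2, e3, latticeSimplex_add]
    norm_num
    abel
  · intro ρ z l l' h f hf
    have h1 := hf l l' l
    rw [evalHom_latticeSimplex, h, h, h]
    simp [ModularGroup.T, antisymmetrize]
    rw [h1, add_comm l' l]
    abel

/-- The transpose of the standard transvection. -/
def transvectionTranspose : SpecialLinearGroup (Fin 2) ℤ :=
  ⟨!![1, 0; 1, 1], by simp [det_fin_two]⟩

theorem isTransfer_transvectionTranspose : IsTransfer α transvectionTranspose
    (-Finsupp.single (latticeSimplex ![(0, 0), (0, 1), (1, 1), (1, 2)]) 1) := by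
  constructor
  · rw [map_neg, boundary_single, one_smul, Fin.sum_univ_four, xiSt_eq, map_sub, push_single,
      push_single, torusMap_latticeSimplex, torusMap_latticeSimplex]
    simp only [face_latticeSimplex]
    have e0 : (fun m => (![(0, 0), (0, 1), (1, 1), (1, 2)] : Fin 4 → ℤ × ℤ) (Fin.succAbove 0 m)) =
        fun i => ![(0, 0), (1, 0), (1, 1)] i + (0, 1) := by decide
    have e1 : (fun m => (![(0, 0), (0, 1), (1, 1), (1, 2)] : Fin 4 → ℤ × ℤ) (Fin.succAbove 1 m)) =
        fun i => latticeMap transvectionTranspose (![(0, 0), (1, 0), (1, 1)] i) := by decide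
    have e2 : (fun m => (![(0, 0), (0, 1), (1, 1), (1, 2)] : Fin 4 → ℤ × ℤ) (Fin.succAbove 2 m)) =
        fun i => latticeMap transvectionTranspose (![(0, 0), (0, 1), (1, 1)] i) := by decide
    have e3 : (fun m => (![(0, 0), (0, 1), (1, 1), (1, 2)] : Fin 4 → ℤ × ℤ) (Fin.succAbove 3 m)) =
        ![(0, 0), (0, 1), (1, 1)] := by decide
    rw [e0, e1, e2, e3, latticeSimplex_add]
    norm_num
    abel
  · intro ρ z l l' h f hf
    have h1 := hf l' l l'
    rw [map_neg, evalHom_latticeSimplex, h, h, h]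
    simp [transvectionTranspose, antisymmetrize]
    rw [h1, add_comm l' l]
    abel

theorem exists_isTransfer (b : SpecialLinearGroup (Fin 2) ℤ) : ∃ y, IsTransfer α b y := by
  let H : Subgroup (SpecialLinearGroup (Fin 2) ℤ) :=
    { carrier := {b | ∃ y, IsTransfer α b y}
      mul_mem' := fun ⟨_, hy⟩ ⟨_, hy'⟩ => ⟨_, hy.mul hy'⟩
      one_mem' := ⟨_, IsTransfer.one⟩
      inv_mem' := fun ⟨_, hy⟩ => ⟨_, hy.inv⟩ }
  have hT : ModularGroup.T ∈ H := ⟨_, isTransfer_T⟩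
  have hU : transvectionTranspose ∈ H := ⟨_, isTransfer_transvectionTranspose⟩
  have hS : ModularGroup.S ∈ H := by
    have h : ModularGroup.S =
        ModularGroup.T⁻¹ * transvectionTranspose * ModularGroup.T⁻¹ := by decide
    rw [h]
    exact H.mul_mem (H.mul_mem (H.inv_mem hT) hU) (H.inv_mem hT)
  have hH : H = ⊤ := by
    rw [eq_top_iff, ← SpecialLinearGroup.SL2Z_generators, Subgroup.closure_le]
    rintro _ (rfl | rfl)
    exacts [hS, hT]
  have hb : b ∈ H := hH ▸ Subgroup.mem_top b
  exact hb

theorem val_meridian (ρ : GroupoidRep Torus Γ) : ρ.val meridian = lineVal ρ (1, 0) := by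
  let p : Path (0 : ℝ × ℝ) (((1 : ℤ) : ℝ), ((0 : ℤ) : ℝ)) :=
    { toFun := fun s => (s, 0)
      continuous_toFun := by fun_prop
      source' := by simp
      target' := by simp }
  rw [lineVal, ← ρ.val_map torusCover p]
  refine ρ.val_ext fun s => ?_
  refine Prod.ext rfl ?_
  change 1 = Circle.exp (2 * Real.pi * 0)
  simp

theorem val_longitude (ρ : GroupoidRep Torus Γ) : ρ.val longitude = lineVal ρ (0, 1) := by
  let p : Path (0 : ℝ × ℝ) (((0 : ℤ) : ℝ), ((1 : ℤ) : ℝ)) :=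
    { toFun := fun s => (0, s)
      continuous_toFun := by fun_prop
      source' := by simp
      target' := by simp }
  rw [lineVal, ← ρ.val_map torusCover p]
  refine ρ.val_ext fun s => ?_
  refine Prod.ext ?_ rfl
  change 1 = Circle.exp (2 * Real.pi * 0)
  simp

/-- Meridians bound in the solid torus and longitudes are homotopic to the core. -/
theorem hasExponents_torusInSolid {r : ℝ} (hr : 1 ≤ r) (ρ : GroupoidRep (SolidTorus r) Γ) :
    HasExponents (ρ.pull (torusInSolid r hr)) (coreVal (zero_lt_one.trans_le hr) ρ) 0 1 := by
  intro v
  -- A lift of the boundary torus to the covering D² × ℝ. It returns to the same longitude at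
  -- integral points, so the horizontal displacement is lost and only the height counts.
  let g : C(ℝ × ℝ, Fin 3 → ℝ) :=
    ⟨fun x => ![Real.cos (2 * Real.pi * x.1), Real.sin (2 * Real.pi * x.1), x.2], by
      refine continuous_pi fun j => ?_
      fin_cases j
      · simp only
        fun_prop
      · simp only
        fun_prop
      · exact continuous_snd⟩
  have h : (torusInSolid r hr).comp torusCover = (solidCover (zero_lt_one.trans_le hr)).comp g := by
    ext1 x
    refine Eq.trans (clamp_solidIncl (zero_lt_one.trans_le hr) _).symm (congrArg (clamp _) ?_)
    refine Prod.ext ?_ rfl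
    change (Circle.exp (2 * Real.pi * x.1) : ℂ) = ⟨Real.cos _, Real.sin _⟩
    rw [Circle.coe_exp, Complex.exp_mul_I, ← Complex.ofReal_cos, ← Complex.ofReal_sin,
      ← Complex.mk_eq_add_mul_I]
  have h0 : g 0 = ![1, 0, 0] := by simp [g]
  have hv : g ((v.1 : ℝ), (v.2 : ℝ)) = ![1, 0, (v.2 : ℝ)] := by
    have e1 : Real.cos (2 * Real.pi * v.1) = 1 := by
      rw [mul_comm]
      exact Real.cos_int_mul_two_pi v.1
    have e2 : Real.sin (2 * Real.pi * v.1) = 0 := by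
      rw [mul_comm, ← mul_assoc, mul_comm _ (2 : ℝ)]
      exact_mod_cast Real.sin_int_mul_pi (2 * v.1)
    simp [g, e1, e2]
  rw [lineVal, GroupoidRep.along_pull, h, ρ.along_comp, h0, hv, along_solidCover, zero_mul,
    one_mul, zero_add]

end TorusMaps

end SurgeryFormula

end

noncomputable section

namespace SurgeryFormula

open HasAffineSimplices

/-! ### Nontriviality of spherical simplices and openness of tubular neighbourhoods -/

section Nontrivial

open Matrix WithLp

/-- All positive simplices around the origin share one class, that of `w'`. The standard simplex
`w`, known to be nontrivial, is negatively oriented, and the reflection R takes `w'` to it. -/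
theorem not_trivialOn_affine {p : Fin 4 → Fin 3 → ℝ} (hp : 0 < affDet p) {t : Simplex 3}
    (ht : t ∈ simplexInterior 3) (h0 : aff p t = 0) :
    ¬ TrivialOn {0} (Finsupp.single (aff p : C(Simplex 3, Fin 3 → ℝ)) (1 : ℤ)) := by
  intro h
  set R : Matrix (Fin 3) (Fin 3) ℝ := diagonal ![-1, 1, 1] with hR
  have hRR : R * R = 1 := by
    rw [hR, diagonal_mul_diagonal, ← diagonal_one]
    congr 1
    ext i
    fin_cases i <;> simp
  have hRd : R.det ≠ 0 := by
    intro h0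
    have := congrArg Matrix.det hRR
    rw [det_mul, h0] at this
    simp at this
  set w : Fin 4 → Fin 3 → ℝ := ![![1, 0, 0], ![-1, 1, 0], ![-1, -1, 1], ![-1, -1, -1]] with hw
  have hstd : standardVertices 3 = w := by
    ext i j
    fin_cases i <;> fin_cases j <;> rfl
  set w' : Fin 4 → Fin 3 → ℝ := ![![-1, 0, 0], ![1, 1, 0], ![1, -1, 1], ![1, -1, -1]] with hw'
  have hRw (i) : R *ᵥ w' i = w i := by
    ext j
    rw [hR, mulVec_diagonal]
    fin_cases i <;> fin_cases j <;> simp [hw, hw']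
  have hd : 0 < affDet w' := by
    simp [affDet, det_fin_three, hw']
    norm_num
  let s : Simplex 3 := ⟨![1 / 2, 1 / 4, 1 / 8, 1 / 8], fun i => by fin_cases i <;> norm_num, by
    simp [Fin.sum_univ_succ]; norm_num⟩
  have hs : s ∈ simplexInterior 3 := by
    intro i
    change 0 < (![1 / 2, 1 / 4, 1 / 8, 1 / 8] : Fin 4 → ℝ) i
    fin_cases i <;> norm_num
  have hs0 : aff w' s = 0 := by
    ext j
    rw [aff_apply_three, show s 0 = 1 / 2 from rfl, show s 1 = 1 / 4 from rfl,
      show s 2 = 1 / 8 from rfl, show s 3 = 1 / 8 from rfl]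
    fin_cases j <;> simp [hw'] <;> norm_num
  have h1 : TrivialOn {0} (Finsupp.single (aff w' : C(Simplex 3, Fin 3 → ℝ)) (1 : ℤ)) := by
    have := h.sub (trivialOn_affine_sub_zero hp hd ht hs h0 hs0)
    rwa [sub_sub_cancel] at this
  have h2 := h1.push (f := matrixMap R) (L := {0}) fun x hx => matrixMap_eq_zero hRd hx
  have h3 : (matrixMap R).comp (aff w') = (aff w : C(Simplex 3, Fin 3 → ℝ)) := by
    ext1 t
    change R *ᵥ (∑ i, t i • w' i) = ∑ i, t i • w i
    rw [mulVec_sum]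
    refine Finset.sum_congr rfl fun i _ => ?_
    rw [mulVec_smul, hRw]
  rw [push_single, h3, ← hstd] at h2
  exact not_trivialOn_standard 2 h2

/-- The coordinates of a point of the sphere in the frame at `x`. -/
def frameCoord (x y : Sphere3) : Fin 4 → ℝ := ofLp y.1 ᵥ* (frame x.1)ᵀ

theorem continuous_frameCoord (x : Sphere3) : Continuous (frameCoord x) := by
  have h : Continuous fun y : Sphere3 => ofLp y.1 :=
    (PiLp.continuous_ofLp 2 _).comp continuous_subtype_val
  exact h.matrix_vecMul continuous_const

theorem frameCoord_gnomonic (x : Sphere3) (u : Fin 3 → ℝ) :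
    ∃ c : ℝ, 0 < c ∧ frameCoord x (gnomonic x u) = c • vecCons 1 u := by
  obtain ⟨c, hc, h⟩ := exists_eq_smul_radial (⟨vecCons 1 u ᵥ* frame x.1,
    vecMul_mem (by rw [det_frame]; exact one_ne_zero) fun h => one_ne_zero (congrFun h 0)⟩ :
      ({0}ᶜ : Set (Fin 4 → ℝ)))
  replace h : vecCons 1 u ᵥ* frame x.1 = c • ofLp (gnomonic x u).1 := h
  have hB : frame x.1 * (frame x.1)ᵀ = 1 := mul_eq_one_comm.1 (frame_transpose_mul x)
  refine ⟨c⁻¹, inv_pos.2 hc, ?_⟩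
  have h1 : ofLp (gnomonic x u).1 = c⁻¹ • (vecCons 1 u ᵥ* frame x.1) := by
    rw [h, smul_smul, inv_mul_cancel₀ hc.ne', one_smul]
  rw [frameCoord, h1, smul_vecMul, vecMul_vecMul, hB, vecMul_one]

theorem eq_of_frameCoord {x y : Sphere3} (h0 : 0 < frameCoord x y 0)
    (h : ∀ j : Fin 3, frameCoord x y j.succ = 0) : y = x := by
  have h1 : frameCoord x y = frameCoord x y 0 • vecCons 1 0 := by
    ext j
    refine Fin.cases (by simp) (fun j => ?_) j
    rw [h]
    simp
  have h2 : ofLp y.1 = frameCoord x y 0 • ofLp x.1 := by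
    have h3 : ofLp y.1 = frameCoord x y ᵥ* frame x.1 := by
      rw [frameCoord, vecMul_vecMul, frame_transpose_mul, vecMul_one]
    rw [← single_vecMul_frame x, ← smul_vecMul, ← h1, h3]
  have hy : ofLp y.1 ∈ ({0}ᶜ : Set (Fin 4 → ℝ)) := by
    intro h3
    have := sum_sq_eq_one y
    simp [Set.mem_singleton_iff.1 h3] at this
  exact (radial_eq (y := ⟨_, hy⟩) one_pos (one_smul ℝ _).symm).symm.trans (radial_eq h0 h2)

/-- The tangential coordinates map the sphere to ℝ³, and composed with the central projection they
scale each vector by a positive factor, which is linearly homotopic to the identity off the origin.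
Since they also vanish at the antipode of x, the bounding chain is first excised into the open
hemisphere. -/
theorem not_trivialOn_sphere {σ : SingularSimplex 3 Sphere3} (hσ : σ ∈ sphereOrientation)
    {t : Simplex 3} (ht : t ∈ simplexInterior 3) :
    ¬ TrivialOn {σ t} (Finsupp.single σ (1 : ℤ)) := by
  intro h
  obtain ⟨W, hW, rfl⟩ := mem_sphereOrientation_iff.1 hσ
  set x := sphereSimplex W hW.ne' t with hx
  obtain ⟨p, hp, hpt, h1⟩ := exists_trivialOn_gnomonic hW ht hx.symm
  refine not_trivialOn_affine hp ht hpt ?_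
  have h2 : TrivialOn {x} (push (gnomonic x) (Finsupp.single (aff p) (1 : ℤ))) := by
    have := h1.add h
    rwa [sub_add_cancel] at this
  set c : Chain 3 (Fin 3 → ℝ) := Finsupp.single (aff p) (1 : ℤ) with hc
  set U : Set Sphere3 := {y | 0 < frameCoord x y 0} with hU
  have hUo : IsOpen U :=
    isOpen_lt continuous_const ((continuous_apply 0).comp (continuous_frameCoord x))
  have hκU (u) : gnomonic x u ∈ U := by
    obtain ⟨c, hc, h⟩ := frameCoord_gnomonic x u
    rw [hU, Set.mem_ofPred_eq, h]
    simpa using hc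
  have hcU : SupportedIn U (push (gnomonic x) c) := by
    refine supportedIn_push ?_ _
    rintro _ ⟨u, rfl⟩
    exact hκU u
  have hxU : {x} ⊆ U := by
    rw [Set.singleton_subset_iff, ← gnomonic_zero x]
    exact hκU 0
  obtain ⟨e, he, he'⟩ := h2.excise isClosed_singleton hUo hxU hcU
  let g : C(Sphere3, Fin 3 → ℝ) := ⟨fun y j => frameCoord x y j.succ,
    continuous_pi fun j => (continuous_apply _).comp (continuous_frameCoord x)⟩
  have h3 : TrivialOn {0} (push g (push (gnomonic x) c)) := by
    refine ⟨push g e, ?_⟩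
    rw [← push_boundary, ← map_sub]
    exact ((hcU.sub he.boundary).inter he').push (T := {0}ᶜ) fun y hy h =>
      hy.2 (eq_of_frameCoord hy.1 fun j => congrFun h j)
  have h4 : TrivialOn {0} (c - push g (push (gnomonic x) c)) := by
    have := trivialOn_of_line (K := {0}) (g.comp (gnomonic x)) (ContinuousMap.id _) (S := {0}ᶜ)
      (fun u hu s h0 h1 h => hu ?_) (c := c) ?_
    · rwa [push_id, ← push_comp] at this
    · obtain ⟨d, hd, h5⟩ := frameCoord_gnomonic x u
      have h6 : g (gnomonic x u) = d • u := by
        ext j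
        change frameCoord x (gnomonic x u) j.succ = _
        rw [h5]
        simp
      rw [ContinuousMap.comp_apply, h6, ContinuousMap.id_apply, smul_smul, ← add_smul] at h
      refine (smul_eq_zero.1 h).resolve_left (ne_of_gt ?_)
      rcases h0.eq_or_lt with h7 | h7
      · rw [← h7]
        simpa using hd
      · nlinarith [mul_nonneg (sub_nonneg.2 h1) hd.le]
    · refine supportedIn_boundary_single (fun u j hj h => ?_) 1
      rw [aff_injective hp.ne' (h.trans hpt.symm)] at hj
      exact (ht j).ne' hj
  have := h4.add h3
  rwa [sub_add_cancel] at this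

end Nontrivial

/-! ### Tubes around the link and the retraction to the exterior -/

namespace TubularLink

variable {n : ℕ} (L : TubularLink n)

theorem nbhd_eq_iff {i j : Fin n} {w w' : SolidTorus 2} :
    L.nbhd i w = L.nbhd j w' ↔ i = j ∧ w = w' := by
  constructor
  · intro h
    have := @L.injective (i, w) (j, w') h
    exact ⟨congrArg Prod.fst this, congrArg Prod.snd this⟩
  · rintro ⟨rfl, rfl⟩
    rfl

theorem nbhd_injective (i : Fin n) : Function.Injective (L.nbhd i) := fun _ _ h =>
  (L.nbhd_eq_iff.1 h).2

/-- An invariance of domain. By the orientation hypothesis the image of a small simplex has the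
class of a positive spherical simplex at the image point, and by local constancy also at nearby
points. A nearby point outside the image would make that class trivial, against
`not_trivialOn_sphere`. -/
theorem isOpen_nbhd_image (i : Fin n) {O : Set (SolidTorus 2)} (hO : IsOpen O)
    (hO2 : O ⊆ openSolid 2 2) : IsOpen (L.nbhd i '' O) := by
  rw [isOpen_iff_mem_nhds]
  rintro _ ⟨x, hx, rfl⟩
  obtain ⟨σ, hσ, t, ht, rfl, hσO⟩ := exists_solidTorusSimplex (hO2 hx) (hO.mem_nhds hx)
  obtain ⟨τ, hτ, t', ht', hττ, -⟩ := exists_sphereSimplex (x := L.nbhd i (σ t)) Filter.univ_mem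
  have h1 : TrivialOn {τ t'} (push (L.nbhd i) (Finsupp.single σ 1) - Finsupp.single τ 1) :=
    L.positive i σ hσ τ hτ t ht t' ht' hττ.symm
  set D : Set Sphere3 := L.nbhd i '' (σ '' {s | ∃ j, s j = 0}) with hD
  have hDc : IsClosed D := by
    have h2 : IsClosed {s : Simplex 3 | ∃ j, s j = 0} := by
      have h3 : {s : Simplex 3 | ∃ j, s j = 0} = ⋃ j : Fin 4, {s : Simplex 3 | s j = 0} := by
        ext s
        simp
      rw [h3]
      exact isClosed_iUnion_of_finite fun j =>
        isClosed_eq ((continuous_apply j).comp continuous_subtype_val) continuous_const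
    exact ((h2.isCompact.image σ.continuous).image (L.nbhd i).continuous).isClosed
  have hσi := (isRegularSimplex_of_mem_solidTorusOrientation hσ).1
  have hxD : Dᶜ ∈ nhds (τ t') := by
    refine hDc.isOpen_compl.mem_nhds ?_
    rw [hττ]
    rintro ⟨_, ⟨s, ⟨j, hj⟩, rfl⟩, h⟩
    rw [hσi (L.nbhd_injective i h)] at hj
    exact (ht j).ne' hj
  have hbd : SupportedIn Dᶜᶜ (boundary (push (L.nbhd i) (Finsupp.single σ (1 : ℤ)))) := by
    rw [push_single]
    refine supportedIn_boundary_single (fun s j hj => ?_) 1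
    exact not_not.2 ⟨_, ⟨s, ⟨j, hj⟩, rfl⟩, rfl⟩
  obtain ⟨K, hK, -, hKτ, hKc⟩ := (isRegularSimplex_of_mem_sphereOrientation hτ).exists_nhds ht'
    (hasChartAt_sphere _) hxD hbd
  rw [← hττ]
  refine Filter.mem_of_superset hK fun y hy => ?_
  by_contra hyO
  have h2 := hKc _ (mem_of_mem_nhds hK) h1 y hy
  have h3 : TrivialOn {y} (push (L.nbhd i) (Finsupp.single σ (1 : ℤ))) := by
    rw [push_single]
    refine (supportedIn_single ?_ _).trivialOn
    rintro _ ⟨s, rfl⟩ rfl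
    exact hyO ⟨σ s, hσO ⟨s, rfl⟩, rfl⟩
  obtain ⟨s, hs, rfl⟩ := hKτ hy
  refine not_trivialOn_sphere hτ hs ?_
  have := h3.sub h2
  rwa [sub_sub_cancel] at this

/-- The union of the closed tubes of radius `r`. -/
def tube (r : ℝ) : Set Sphere3 := {x | ∃ i, ∃ w : SolidTorus 2, ‖(w.1 : ℂ)‖ ≤ r ∧ L.nbhd i w = x}

theorem nbhd_mem_tube {r : ℝ} {i : Fin n} {w : SolidTorus 2} :
    L.nbhd i w ∈ L.tube r ↔ ‖(w.1 : ℂ)‖ ≤ r := by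
  constructor
  · rintro ⟨j, w', h, h'⟩
    rwa [(L.nbhd_eq_iff.1 h').2] at h
  · exact fun h => ⟨i, w, h, rfl⟩

theorem nbhd_mem_exterior {i : Fin n} {w : SolidTorus 2} :
    L.nbhd i w ∈ L.exterior ↔ 1 ≤ ‖(w.1 : ℂ)‖ := by
  constructor
  · intro h
    by_contra h'
    exact h i w (not_le.1 h') rfl
  · intro h j w' hw' h'
    rw [(L.nbhd_eq_iff.1 h').2] at hw'
    exact absurd h (not_le.2 hw')

theorem isCompact_tube (r : ℝ) : IsCompact (L.tube r) := by
  have h : L.tube r = ⋃ i, L.nbhd i '' {w : SolidTorus 2 | ‖(w.1 : ℂ)‖ ≤ r} := by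
    ext x
    simp [tube]
  rw [h]
  have hc : IsClosed {w : SolidTorus 2 | ‖(w.1 : ℂ)‖ ≤ r} :=
    isClosed_le (by fun_prop) continuous_const
  exact isCompact_iUnion fun i => hc.isCompact.image (L.nbhd i).continuous

theorem isClosed_exterior : IsClosed L.exterior := by
  have h : L.exterior = (⋃ i, L.nbhd i '' openSolid 2 1)ᶜ := by
    ext x
    simp only [exterior, openSolid, Set.mem_ofPred_eq, Set.mem_compl_iff, Set.mem_iUnion,
      Set.mem_image, not_exists, not_and]
  rw [h]
  exact (isOpen_iUnion fun i => L.isOpen_nbhd_image i (isOpen_openSolid 2 1) fun w hw =>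
    (show ‖(w.1 : ℂ)‖ < 2 from
      lt_trans (show ‖(w.1 : ℂ)‖ < 1 from hw) one_lt_two)).isClosed_compl

theorem mem_exterior_of_not_mem_tube {x : Sphere3} (hx : x ∉ L.tube 1) : x ∈ L.exterior :=
  fun i w hw h => hx ⟨i, w, hw.le, h⟩

/-- Functions on the sphere that are continuous on the tubes and off the tubes are continuous. -/
theorem continuous_of_nbhd {Z : Type*} [TopologicalSpace Z] {F : Sphere3 → Z}
    (h : ∀ i, Continuous fun w => F (L.nbhd i w)) (h' : ContinuousOn F (L.tube 1)ᶜ) :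
    Continuous F := by
  rw [continuous_iff_continuousAt]
  intro x
  by_cases hx : x ∈ L.tube 1
  · obtain ⟨i, w, hw, rfl⟩ := hx
    have hO := isOpen_openSolid 2 2
    have hg : Topology.IsOpenEmbedding ((openSolid 2 2).domRestrict (L.nbhd i)) := by
      refine Topology.IsOpenEmbedding.of_continuous_injective_isOpenMap
        ((L.nbhd i).continuous.comp continuous_subtype_val)
        ((L.nbhd_injective i).comp Subtype.val_injective) fun U hU => ?_
      have := L.isOpen_nbhd_image i (hO.isOpenMap_subtype_val U hU) (by
        rintro _ ⟨z, -, rfl⟩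
        exact z.2)
      rwa [← Set.image_comp] at this
    exact (hg.continuousAt_iff (x := ⟨w, hw.trans_lt one_lt_two⟩)).1
      ((h i).comp continuous_subtype_val).continuousAt
  · exact h'.continuousAt ((L.isCompact_tube 1).isClosed.isOpen_compl.mem_nhds hx)

/-- A radial map of the solid torus that takes the points of radius `1/2` to the unit torus. -/
def stretch : C(SolidTorus 2, SolidTorus 2) where
  -- The radius is doubled up to 1/2, is sent to 1 between 1/2 and 1, and is unchanged from 1 on.
  toFun w := (⟨(max 1 ‖(w.1 : ℂ)‖ / max ‖(w.1 : ℂ)‖ (1 / 2)) • (w.1 : ℂ), by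
    have h : 0 < max ‖(w.1 : ℂ)‖ (1 / 2) := lt_max_of_lt_right (by norm_num)
    rw [mem_closedBall_zero_iff, norm_smul, Real.norm_of_nonneg (by positivity), div_mul_eq_mul_div,
      div_le_iff₀ h]
    refine mul_le_mul (max_le one_le_two (mem_closedBall_zero_iff.1 w.1.2)) (le_max_left _ _)
      (norm_nonneg _) zero_le_two⟩, w.2)
  continuous_toFun := by
    have hc : Continuous fun w : SolidTorus 2 => ‖(w.1 : ℂ)‖ := by fun_prop
    refine Continuous.prodMk (Continuous.subtype_mk ?_ _) continuous_snd
    refine Continuous.smul ((continuous_const.max hc).div (hc.max continuous_const) fun w => ?_)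
      (continuous_subtype_val.comp continuous_fst)
    exact (lt_max_of_lt_right (by norm_num : (0 : ℝ) < 1 / 2)).ne'

theorem norm_stretch (w : SolidTorus 2) : ‖((stretch w).1 : ℂ)‖ =
    max 1 ‖(w.1 : ℂ)‖ / max ‖(w.1 : ℂ)‖ (1 / 2) * ‖(w.1 : ℂ)‖ := by
  change ‖(max 1 ‖(w.1 : ℂ)‖ / max ‖(w.1 : ℂ)‖ (1 / 2)) • (w.1 : ℂ)‖ = _
  rw [norm_smul, Real.norm_of_nonneg (by positivity)]

theorem stretch_of_one_le {w : SolidTorus 2} (h : 1 ≤ ‖(w.1 : ℂ)‖) : stretch w = w := by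
  refine Prod.ext (Subtype.ext ?_) rfl
  change (max 1 ‖(w.1 : ℂ)‖ / max ‖(w.1 : ℂ)‖ (1 / 2)) • (w.1 : ℂ) = w.1
  rw [max_eq_right h, max_eq_left (by linarith), div_self (by positivity), one_smul]

theorem one_le_norm_stretch {w : SolidTorus 2} (h : 1 / 2 < ‖(w.1 : ℂ)‖) :
    1 ≤ ‖((stretch w).1 : ℂ)‖ := by
  rw [norm_stretch, max_eq_left h.le, div_mul_cancel₀ _ (by positivity)]
  exact le_max_left _ _

theorem norm_stretch_le {w : SolidTorus 2} (h : ‖(w.1 : ℂ)‖ ≤ 1) : ‖((stretch w).1 : ℂ)‖ ≤ 1 := by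
  have h' : 0 < max ‖(w.1 : ℂ)‖ (1 / 2) := lt_max_of_lt_right (by norm_num)
  rw [norm_stretch, max_eq_left h, div_mul_eq_mul_div, one_mul, div_le_iff₀ h', one_mul]
  exact le_max_left _ _

open Classical in
/-- The map of the sphere that is `stretch` on the tubular neighbourhoods. -/
def stretchFun (x : Sphere3) : Sphere3 :=
  if h : ∃ z : Fin n × SolidTorus 2, L.nbhd z.1 z.2 = x then
    L.nbhd h.choose.1 (stretch h.choose.2) else x

theorem stretchFun_nbhd (i : Fin n) (w : SolidTorus 2) :
    L.stretchFun (L.nbhd i w) = L.nbhd i (stretch w) := by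
  have h : ∃ z : Fin n × SolidTorus 2, L.nbhd z.1 z.2 = L.nbhd i w := ⟨(i, w), rfl⟩
  rw [stretchFun, dif_pos h]
  obtain ⟨h1, h2⟩ := L.nbhd_eq_iff.1 h.choose_spec
  rw [h1, h2]

theorem stretchFun_of_mem_exterior {x : Sphere3} (hx : x ∈ L.exterior) : L.stretchFun x = x := by
  by_cases h : ∃ z : Fin n × SolidTorus 2, L.nbhd z.1 z.2 = x
  · obtain ⟨⟨i, w⟩, rfl⟩ := h
    rw [stretchFun_nbhd, stretch_of_one_le (L.nbhd_mem_exterior.1 hx)]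
  · rw [stretchFun, dif_neg h]

theorem continuous_stretchFun : Continuous L.stretchFun := by
  refine L.continuous_of_nbhd (fun i => ?_) ?_
  · simp only [stretchFun_nbhd]
    fun_prop
  · exact continuousOn_id.congr fun x hx =>
      L.stretchFun_of_mem_exterior (L.mem_exterior_of_not_mem_tube hx)

theorem stretchFun_mem_exterior {x : Sphere3} (hx : x ∉ L.tube (1 / 2)) :
    L.stretchFun x ∈ L.exterior := by
  by_cases h : ∃ z : Fin n × SolidTorus 2, L.nbhd z.1 z.2 = x
  · obtain ⟨⟨i, w⟩, rfl⟩ := h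
    rw [L.nbhd_mem_tube, not_le] at hx
    rw [stretchFun_nbhd, L.nbhd_mem_exterior]
    exact one_le_norm_stretch hx
  · rw [stretchFun, dif_neg h]
    exact fun i w hw h' => h ⟨(i, w), h'⟩

/-- The retraction to the exterior. -/
def retract : C(((L.tube (1 / 2))ᶜ : Set Sphere3), L.exterior) where
  toFun x := ⟨L.stretchFun x, L.stretchFun_mem_exterior x.2⟩
  continuous_toFun := (L.continuous_stretchFun.comp continuous_subtype_val).subtype_mk _

/-- Stretching maps the unit tubes into themselves, so a point off these tubes has no other
preimage; the retraction therefore respects local homology there. -/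
theorem eq_of_stretchFun_eq {x y : Sphere3} (hx : x ∉ L.tube 1) (h : L.stretchFun y = x) :
    y = x := by
  by_cases h' : y ∈ L.exterior
  · rw [← h, L.stretchFun_of_mem_exterior h']
  · have h'' : y ∈ L.tube 1 := by
      by_contra h1
      exact h' (L.mem_exterior_of_not_mem_tube h1)
    obtain ⟨i, w, hw, rfl⟩ := h''
    rw [stretchFun_nbhd] at h
    rw [← h, L.nbhd_mem_tube] at hx
    exact absurd (norm_stretch_le hw) hx

theorem exterior_subset : L.exterior ⊆ (L.tube (1 / 2))ᶜ := by
  rintro x hx ⟨i, w, hw, rfl⟩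
  have := L.nbhd_mem_exterior.1 hx
  linarith

/-- The inclusion of the exterior in the complement of the thin tubes. -/
def exteriorInclThin : C(L.exterior, ((L.tube (1 / 2))ᶜ : Set Sphere3)) :=
  ⟨Set.inclusion L.exterior_subset, continuous_inclusion _⟩

theorem retract_comp : L.retract.comp L.exteriorInclThin = ContinuousMap.id _ :=
  ContinuousMap.ext fun x => Subtype.ext (L.stretchFun_of_mem_exterior x.2)

/-- Local homology of the exterior at interior points is that of the sphere. -/
theorem trivialOn_retract {x : L.exterior} (hx : (x : Sphere3) ∉ L.tube 1) {k : ℕ}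
    {d : Chain k ((L.tube (1 / 2))ᶜ : Set Sphere3)}
    (h : TrivialOn {(x : Sphere3)} (push (incl _) d)) : TrivialOn {x} (push L.retract d) := by
  have ho : IsOpen ((L.tube (1 / 2))ᶜ : Set Sphere3) :=
    (L.isCompact_tube _).isClosed.isOpen_compl
  set x' : ((L.tube (1 / 2))ᶜ : Set Sphere3) := ⟨x, L.exterior_subset x.2⟩
  have himg : incl _ '' {x'} = {(x : Sphere3)} := Set.image_singleton
  have h1 : TrivialOn {x'} d := by
    refine TrivialOn.of_push (f := incl _) ho.isOpenEmbedding_subtypeVal ?_ ?_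
    · rw [himg]
      exact isClosed_singleton
    · rwa [himg]
  refine h1.push fun y hy => Subtype.ext ?_
  exact L.eq_of_stretchFun_eq hx (congrArg Subtype.val (Set.mem_singleton_iff.1 hy))

theorem trivialOn_of_push_exteriorIncl {x : L.exterior} (hx : (x : Sphere3) ∉ L.tube 1) {k : ℕ}
    {c : Chain k L.exterior} (h : TrivialOn {(x : Sphere3)} (push L.exteriorIncl c)) :
    TrivialOn {x} c := by
  have := L.trivialOn_retract hx (d := push L.exteriorInclThin c) (by rwa [push_comp])
  rwa [push_comp, retract_comp, push_id] at this

end TubularLink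

end SurgeryFormula

end

noncomputable section

namespace SurgeryFormula

open HasAffineSimplices

/-! ### An s-triangulation of the link exterior -/

/-- The inclusion of the unit solid torus in the larger one. -/
def widen : C(SolidTorus 1, SolidTorus 2) :=
  ⟨fun x => (⟨x.1, Metric.closedBall_subset_closedBall one_le_two x.1.2⟩, x.2), by fun_prop⟩

theorem widen_injective : Function.Injective widen := fun _ _ h =>
  solidIncl_injective 1 (congrArg (solidIncl 2) h)

/-- The fundamental chain of the unit solid torus, as a chain of the larger one. -/
def wideChain : Chain 3 (SolidTorus 2) := push widen (solidChain 1 one_pos)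

theorem boundary_wideChain : boundary wideChain = push (torusInSolid 2 one_le_two) xiSt := by
  have h := boundary_solidChain (le_refl (1 : ℝ))
  rw [wideChain, ← push_boundary, h, push_comp]
  rfl

theorem supportedIn_wideChain : SupportedIn {w | ‖(w.1 : ℂ)‖ ≤ 1} wideChain := by
  refine supportedIn_push ?_ _
  rintro _ ⟨x, rfl⟩
  exact mem_closedBall_zero_iff.1 x.1.2

theorem trivialOn_wideChain {σ : SingularSimplex 3 (SolidTorus 2)}
    (hσ : σ ∈ solidTorusOrientation 2) {t : Simplex 3} (ht : t ∈ simplexInterior 3)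
    (hx : σ t ∈ openSolid 2 1) : TrivialOn {σ t} (wideChain - Finsupp.single σ 1) := by
  set y : SolidTorus 1 := (⟨(σ t).1, mem_closedBall_zero_iff.2 (le_of_lt hx)⟩, (σ t).2) with hy
  have hyw : widen y = σ t := rfl
  obtain ⟨τ, hτ, t', ht', h1, -⟩ := exists_solidTorusSimplex (x := y) (r := 1) hx Filter.univ_mem
  have h2 := (trivialOn_solidChain le_rfl hτ ht' (h1 ▸ hx : τ t' ∈ openSolid 1 1)).push
    (f := widen) (L := {σ t}) fun x hx => by
      rw [h1]
      exact widen_injective (hx.trans hyw.symm)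
  rw [map_sub, push_single] at h2
  have h3 : widen.comp τ ∈ solidTorusOrientation 2 := by
    rw [mem_solidTorusOrientation_iff] at hτ ⊢
    exact hτ
  have h4 : σ t = widen.comp τ t' := by
    rw [ContinuousMap.comp_apply, h1, hyw]
  have h5 := trivialOn_solidTorus_sub hσ h3 ht ht' h4
    (show ‖((σ t).1 : ℂ)‖ < 2 from lt_trans (show ‖((σ t).1 : ℂ)‖ < 1 from hx) one_lt_two)
  exact h2.trans h5.symm

/-- Every point of the solid torus is a limit of points closer to the core. -/
theorem exists_smul_mem {r : ℝ} {w : SolidTorus r} {O : Set (SolidTorus r)} (hO : O ∈ nhds w) :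
    ∃ w' ∈ O, ∃ s : ℝ, 0 < s ∧ s < 1 ∧ (w'.1 : ℂ) = s • (w.1 : ℂ) := by
  let f : ℝ → SolidTorus r := fun s =>
    (⟨(Set.projIcc (0 : ℝ) 1 zero_le_one s : ℝ) • (w.1 : ℂ), by
      rw [mem_closedBall_zero_iff, norm_smul, Real.norm_of_nonneg (Set.projIcc _ _ _ s).2.1]
      exact (mul_le_of_le_one_left (norm_nonneg _) (Set.projIcc _ _ _ s).2.2).trans
        (mem_closedBall_zero_iff.1 w.1.2)⟩, w.2)
  have hf : Continuous f := by
    refine Continuous.prodMk (Continuous.subtype_mk ?_ _) continuous_const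
    exact (continuous_subtype_val.comp continuous_projIcc).smul continuous_const
  have hfs {s : ℝ} (h0 : 0 ≤ s) (h1 : s ≤ 1) : ((f s).1 : ℂ) = s • (w.1 : ℂ) := by
    change (Set.projIcc (0 : ℝ) 1 zero_le_one s : ℝ) • (w.1 : ℂ) = _
    rw [Set.projIcc_of_mem zero_le_one ⟨h0, h1⟩]
  have h1 : f 1 = w :=
    Prod.ext (Subtype.ext ((hfs zero_le_one le_rfl).trans (one_smul _ _))) rfl
  have h2 : ∀ᶠ s in nhds (1 : ℝ), f s ∈ O := hf.continuousAt.eventually_mem (by rwa [h1])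
  obtain ⟨s, hs, hs0, hs1⟩ := ((h2.filter_mono nhdsWithin_le_nhds).and
    (Ioo_mem_nhdsLT (zero_lt_one' ℝ))).exists
  exact ⟨f s, hs, s, hs0, hs1, hfs hs0.le hs1.le⟩

namespace TubularLink

variable {n : ℕ} (L : TubularLink n)

/-- The interior of such a simplex is open in S³, while every point of a closed tube is a limit of
points of the open tube, which do not belong to the exterior. -/
theorem not_mem_tube_of_mem_exteriorOrientation {σ : SingularSimplex 3 L.exterior}
    (hσ : σ ∈ L.exteriorOrientation) {t : Simplex 3} (ht : t ∈ simplexInterior 3) :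
    (σ t : Sphere3) ∉ L.tube 1 := by
  rintro ⟨i, w, hw, h⟩
  have ho := (isRegularSimplex_of_mem_sphereOrientation hσ).2
  have h1 : L.nbhd i w ∈ L.exteriorIncl.comp σ '' simplexInterior 3 := ⟨t, ht, h.symm⟩
  obtain ⟨w', ⟨t', -, h2⟩, s, hs0, hs1, hw'⟩ :=
    exists_smul_mem ((L.nbhd i).continuous.continuousAt.preimage_mem_nhds (ho.mem_nhds h1))
  have h3 : L.nbhd i w' ∈ L.exterior := h2 ▸ (σ t').2
  rw [nbhd_mem_exterior, hw', norm_smul, Real.norm_of_nonneg hs0.le] at h3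
  nlinarith [norm_nonneg (w.1 : ℂ)]

theorem supportedIn_push_wideChain (i : Fin n) :
    SupportedIn (L.tube 1) (push (L.nbhd i) wideChain) :=
  have h : Set.MapsTo (L.nbhd i) {w | ‖(w.1 : ℂ)‖ ≤ 1} (L.tube 1) := fun w hw => ⟨i, w, hw, rfl⟩
  supportedIn_wideChain.push h

/-- In the i-th open tube the sphere cycle and the i-th fundamental chain have the same local class,
because the parametrization preserves orientation; the other chains stay away. -/
theorem trivialOn_tube_complement {s : Chain 3 Sphere3}
    (hs : ∀ σ ∈ sphereOrientation, ∀ t ∈ simplexInterior 3,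
      TrivialOn {σ t} (s - Finsupp.single σ 1)) {i : Fin n} {w : SolidTorus 2}
    (hw : ‖(w.1 : ℂ)‖ < 1) :
    TrivialOn {L.nbhd i w} (s - ∑ j, push (L.nbhd j) wideChain) := by
  obtain ⟨σ, hσ, t, ht, rfl, -⟩ := exists_solidTorusSimplex (x := w) (r := 2)
    (show ‖(w.1 : ℂ)‖ < 2 from lt_trans hw one_lt_two) Filter.univ_mem
  obtain ⟨τ, hτ, t', ht', h1, -⟩ := exists_sphereSimplex (x := L.nbhd i (σ t)) Filter.univ_mem
  have h2 := hs τ hτ t' ht'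
  have h3 : TrivialOn {τ t'} (push (L.nbhd i) (Finsupp.single σ 1) - Finsupp.single τ 1) :=
    L.positive i σ hσ τ hτ t ht t' ht' h1.symm
  have h4 := (trivialOn_wideChain hσ ht hw).push (f := L.nbhd i) (L := {L.nbhd i (σ t)})
    fun x hx => L.nbhd_injective i hx
  rw [h1] at h2 h3
  rw [map_sub] at h4
  have h5 : TrivialOn {L.nbhd i (σ t)}
      (∑ j ∈ Finset.univ.erase i, push (L.nbhd j) wideChain) := by
    refine TrivialOn.sum fun j hj => (supportedIn_push ?_ _).trivialOn
    rintro _ ⟨w', rfl⟩ h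
    exact (Finset.ne_of_mem_erase hj) (L.nbhd_eq_iff.1 h).1
  have h6 := (h2.trans (h4.trans h3).symm).sub h5
  rwa [sub_sub, Finset.add_sum_erase _ (fun j => push (L.nbhd j) wideChain) (Finset.mem_univ i)] at h6

theorem supportedIn_xiBoundary : SupportedIn L.exteriorBoundary L.xiBoundary :=
  SupportedIn.sum fun i _ => (supportedIn_push
    (Set.subset_iUnion (fun i => Set.range (L.torus i)) i) _).neg

/-- The sphere cycle minus the chains of the solid tori is locally trivial over the thin tubes, so
up to a boundary it avoids them and can be retracted to E_L. The thin tubes are used because the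
boundary of the difference lies on the unit tori; it is off the thin tubes, and the retraction fixes
it. -/
theorem exists_exteriorTri : ∃ ζ ∈ L.exteriorTri, boundary ζ = L.xiBoundary := by
  obtain ⟨s, hs, hs'⟩ := exists_sphereCycle
  set c : Chain 3 Sphere3 := s - ∑ j, push (L.nbhd j) wideChain with hc
  have hbc : boundary c = push L.exteriorIncl L.xiBoundary := by
    rw [hc, map_sub, hs, zero_sub, xiBoundary, map_sum, map_sum, ← Finset.sum_neg_distrib]
    refine Finset.sum_congr rfl fun i _ => ?_
    rw [← push_boundary, boundary_wideChain, map_neg, push_comp, push_comp]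
    rfl
  have hbs : SupportedIn (L.tube (1 / 2))ᶜ (boundary c) := by
    rw [hbc]
    refine supportedIn_push ?_ _
    rintro _ ⟨x, rfl⟩
    exact L.exterior_subset x.2
  obtain ⟨e, he⟩ := trivialOn_of_forall_singleton (L.isCompact_tube _)
    (fun x _ => hasChartAt_sphere x) hbs (by
      rintro _ ⟨i, w, hw, rfl⟩
      exact L.trivialOn_tube_complement hs' (hw.trans_lt (by norm_num)))
  obtain ⟨d, hd⟩ := he.exists_incl
  have hbd : boundary d = push L.exteriorInclThin L.xiBoundary := by
    refine push_injective (incl_injective _) ?_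
    rw [push_boundary, hd, map_sub, boundary_boundary, sub_zero, hbc, push_comp]
    rfl
  have hbz : boundary (push L.retract d) = L.xiBoundary := by
    rw [← push_boundary, hbd, push_comp, retract_comp, push_id]
  refine ⟨push L.retract d, ⟨by rw [hbz]; exact L.supportedIn_xiBoundary, fun σ hσ t ht => ?_⟩, hbz⟩
  have hx := L.not_mem_tube_of_mem_exteriorOrientation hσ ht
  have h1 : push L.retract d - Finsupp.single σ 1 =
      push L.retract (d - push L.exteriorInclThin (Finsupp.single σ 1)) := by
    rw [map_sub, push_comp, retract_comp, push_id]
  change TrivialOn {σ t} (push L.retract d - Finsupp.single σ 1)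
  rw [h1]
  refine L.trivialOn_retract hx ?_
  rw [map_sub, hd, push_comp]
  have h2 : TrivialOn {(σ t : Sphere3)} _ := hs' _ hσ t ht
  have h3 : TrivialOn {(σ t : Sphere3)} (∑ j, push (L.nbhd j) wideChain) :=
    (SupportedIn.sum fun j _ => (L.supportedIn_push_wideChain j).mono
      (Set.subset_compl_singleton_iff.2 hx)).trivialOn
  have h4 := (h2.sub h3).sub (trivialOn_boundary _ e)
  convert h4 using 1
  rw [push_single, hc]
  change _ - Finsupp.single (L.exteriorIncl.comp σ) 1 = _
  abel

end TubularLink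

end SurgeryFormula

end

noncomputable section

namespace SurgeryFormula

open HasAffineSimplices

/-! ### Topology of the surgery manifold -/

section Topology

open Topology

variable {X Y : Type*} [TopologicalSpace X] [TopologicalSpace Y]

/-- Quotients of normal spaces by closed maps are Hausdorff. -/
theorem t2Space_of_isClosedMap [NormalSpace X] [T1Space X] {f : X → Y} (hf : Continuous f)
    (hc : IsClosedMap f) (hs : Function.Surjective f) : T2Space Y := by
  have hpt (y : Y) : IsClosed ({y} : Set Y) := by
    obtain ⟨x, rfl⟩ := hs y
    rw [← Set.image_singleton]
    exact hc _ isClosed_singleton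
  refine ⟨fun y y' hy => ?_⟩
  obtain ⟨U, V, hU, hV, hyU, hyV, hUV⟩ := normal_separation ((hpt y).preimage hf)
    ((hpt y').preimage hf) (by
      rw [Set.disjoint_left]
      rintro x h h'
      exact hy (h.symm.trans h'))
  refine ⟨(f '' Uᶜ)ᶜ, (f '' Vᶜ)ᶜ, (hc _ hU.isClosed_compl).isOpen_compl,
    (hc _ hV.isClosed_compl).isOpen_compl, ?_, ?_, ?_⟩
  · rintro ⟨x, hx, h⟩
    exact hx (hyU h)
  · rintro ⟨x, hx, h⟩
    exact hx (hyV h)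
  · rw [Set.disjoint_left]
    intro z hz hz'
    obtain ⟨x, rfl⟩ := hs z
    have h1 : x ∈ U := by
      by_contra h
      exact hz ⟨x, h, rfl⟩
    have h2 : x ∈ V := by
      by_contra h
      exact hz' ⟨x, h, rfl⟩
    exact Set.disjoint_left.1 hUV h1 h2

/-- By injectivity on K, the image of the part of O in an open set U is f(O) minus the compact set
f(K ∖ U). -/
theorem isOpenEmbedding_of_isCompact [T2Space Y] (f : C(X, Y)) {O K : Set X}
    (hK : IsCompact K) (hOK : O ⊆ K) (hf : Set.InjOn f K) (hfO : IsOpen (f '' O)) :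
    IsOpenEmbedding (O.domRestrict f) := by
  refine IsOpenEmbedding.of_continuous_injective_isOpenMap
    (f.continuous.comp continuous_subtype_val)
    (fun x y h => Subtype.ext (hf (hOK x.2) (hOK y.2) h)) ?_
  rintro _ ⟨U, hU, rfl⟩
  have h : O.domRestrict f '' (Subtype.val ⁻¹' U) = f '' O ∩ (f '' (K \ U))ᶜ := by
    ext y
    constructor
    · rintro ⟨⟨x, hx⟩, hxU, rfl⟩
      refine ⟨⟨x, hx, rfl⟩, ?_⟩
      rintro ⟨x', hx', h⟩
      exact hx'.2 (hf hx'.1 (hOK hx) h ▸ hxU)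
    · rintro ⟨⟨x, hx, rfl⟩, h⟩
      refine ⟨⟨x, hx⟩, ?_, rfl⟩
      by_contra hxU
      exact h ⟨x, ⟨hOK hx, hxU⟩, rfl⟩
  rw [h]
  exact hfO.inter ((hK.diff hU).image f.continuous).isClosed.isOpen_compl

theorem hasChartAt_torus_prod (y : Torus × ℝ) : HasChartAt y := by
  let e : (Fin 3 → ℝ) ≃ₜ (ℝ × ℝ) × ℝ :=
    { toFun := fun x => ((x 0, x 1), x 2)
      invFun := fun z => ![z.1.1, z.1.2, z.2]
      left_inv := fun x => by ext j; fin_cases j <;> rfl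
      right_inv := fun z => rfl
      continuous_toFun := by fun_prop
      continuous_invFun := by
        refine continuous_pi fun j => ?_
        fin_cases j
        · exact continuous_fst.comp continuous_fst
        · exact continuous_snd.comp continuous_fst
        · exact continuous_snd }
  let f : (Fin 3 → ℝ) → Torus × ℝ := fun x =>
    ((Circle.exp (2 * Real.pi * x 0), Circle.exp (2 * Real.pi * x 1)), x 2)
  have hf : IsOpenMap f :=
    ((isOpenMap_exp_two_pi.prodMap isOpenMap_exp_two_pi).prodMap IsOpenMap.id).comp e.isOpenMap
  have hfc : Continuous f := by fun_prop
  have hexp (u : Circle) : ∃ x : ℝ, Circle.exp (2 * Real.pi * x) = u :=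
    ⟨Complex.arg u / (2 * Real.pi), by rw [mul_div_cancel₀ _ (by positivity), Circle.exp_arg]⟩
  obtain ⟨x₀, h0⟩ := hexp y.1.1
  obtain ⟨x₁, h1⟩ := hexp y.1.2
  have hy : f ![x₀, x₁, y.2] = y := Prod.ext (Prod.ext h0 h1) rfl
  let O : Set (Fin 3 → ℝ) := {x | |x 0 - x₀| < 1 / 2} ∩ {x | |x 1 - x₁| < 1 / 2}
  have hO : IsOpen O := (isOpen_lt (by fun_prop) continuous_const).inter
    (isOpen_lt (by fun_prop) continuous_const)
  have key {s t c : ℝ} (hs : |s - c| < 1 / 2) (ht : |t - c| < 1 / 2)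
      (h : Circle.exp (2 * Real.pi * s) = Circle.exp (2 * Real.pi * t)) : s = t := by
    obtain ⟨m, hm⟩ := exp_two_pi_mul_eq_iff.1 h
    have h1 : |(m : ℝ)| < 1 := by
      rw [show (m : ℝ) = (s - c) - (t - c) by rw [hm]; ring]
      exact (abs_sub _ _).trans_lt (by linarith)
    have h2 : m = 0 := Int.abs_lt_one_iff.1 (by exact_mod_cast h1)
    rw [hm, h2, Int.cast_zero, add_zero]
  rw [← hy]
  refine hasChartAt_of_map hO (IsOpenEmbedding.of_continuous_injective_isOpenMap
    (hfc.comp continuous_subtype_val) ?_ (hf.domRestrict hO)) ⟨?_, ?_⟩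
  · rintro ⟨x, hx⟩ ⟨x', hx'⟩ h
    obtain ⟨h1, h2⟩ := Prod.ext_iff.1 h
    obtain ⟨h3, h4⟩ := Prod.ext_iff.1 h1
    have e0 : x 0 = x' 0 := key hx.1 hx'.1 h3
    have e1 : x 1 = x' 1 := key hx.2 hx'.2 h4
    refine Subtype.ext (funext fun j => ?_)
    fin_cases j
    exacts [e0, e1, h2]
  · simp
  · simp

end Topology

/-- The point of the solid torus with polar coordinates `(t, s)`. -/
def polar (r : ℝ) (t : Torus) (s : Set.Icc 0 r) : SolidTorus r :=
  (⟨(s : ℝ) • (t.1 : ℂ), by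
    rw [mem_closedBall_zero_iff, norm_smul, Circle.norm_coe, mul_one, Real.norm_of_nonneg s.2.1]
    exact s.2.2⟩, t.2)

theorem norm_polar {r : ℝ} (t : Torus) (s : Set.Icc 0 r) : ‖((polar r t s).1 : ℂ)‖ = s := by
  change ‖(s : ℝ) • (t.1 : ℂ)‖ = s
  rw [norm_smul, Circle.norm_coe, mul_one, Real.norm_of_nonneg s.2.1]

theorem continuous_polar (r : ℝ) : Continuous fun y : Torus × Set.Icc 0 r => polar r y.1 y.2 := by
  refine Continuous.prodMk (Continuous.subtype_mk ?_ _) (by fun_prop)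
  fun_prop

theorem polar_one {r : ℝ} (hr : 1 ≤ r) (t : Torus) :
    polar r t ⟨1, zero_le_one, hr⟩ = torusInSolid r hr t :=
  Prod.ext (Subtype.ext (one_smul ℝ _)) rfl

theorem polar_injective {r : ℝ} {t t' : Torus} {s s' : Set.Icc 0 r} (hs : 0 < (s : ℝ))
    (h : polar r t s = polar r t' s') : t = t' ∧ s = s' := by
  have h1 : s = s' := Subtype.ext (by rw [← norm_polar t, h, norm_polar])
  subst h1
  refine ⟨Prod.ext (Circle.ext ?_) (congrArg (fun w : SolidTorus r => w.2) h), rfl⟩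
  have h2 : (s : ℝ) • (t.1 : ℂ) = (s : ℝ) • (t'.1 : ℂ) :=
    congrArg (fun w : SolidTorus r => (w.1 : ℂ)) h
  exact smul_right_injective _ hs.ne' h2

theorem exists_polar {r : ℝ} (w : SolidTorus r) (hw : 0 < ‖(w.1 : ℂ)‖) :
    ∃ t, polar r t ⟨‖(w.1 : ℂ)‖, norm_nonneg _, mem_closedBall_zero_iff.1 w.1.2⟩ = w := by
  refine ⟨(⟨(‖(w.1 : ℂ)‖⁻¹ : ℝ) • (w.1 : ℂ), ?_⟩, w.2), Prod.ext (Subtype.ext ?_) rfl⟩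
  · rw [← SetLike.mem_coe, Submonoid.coe_unitSphere, mem_sphere_zero_iff_norm, norm_smul, Real.norm_of_nonneg (by positivity),
      inv_mul_cancel₀ hw.ne']
  · change ‖(w.1 : ℂ)‖ • ((‖(w.1 : ℂ)‖⁻¹ : ℝ) • (w.1 : ℂ)) = w.1
    rw [smul_smul, mul_inv_cancel₀ hw.ne', one_smul]

theorem norm_torusInSolid {r : ℝ} (hr : 1 ≤ r) (t : Torus) :
    ‖((torusInSolid r hr t).1 : ℂ)‖ = 1 := Circle.norm_coe t.1

theorem torusInSolid_injective {r : ℝ} (hr : 1 ≤ r) : Function.Injective (torusInSolid r hr) := by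
  intro t t' h
  rw [← polar_one, ← polar_one] at h
  exact (polar_injective one_pos h).1

theorem exists_torusInSolid {r : ℝ} (hr : 1 ≤ r) {w : SolidTorus r} (hw : ‖(w.1 : ℂ)‖ = 1) :
    ∃ t, torusInSolid r hr t = w := by
  obtain ⟨t, ht⟩ := exists_polar w (by rw [hw]; exact one_pos)
  refine ⟨t, ?_⟩
  rw [← polar_one, ← ht]
  congr 1
  exact Subtype.ext hw.symm

theorem torusMap_inv_apply (b : Matrix.SpecialLinearGroup (Fin 2) ℤ) (t : Torus) :
    torusMap b⁻¹ (torusMap b t) = t := by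
  rw [← ContinuousMap.comp_apply, ← torusMap_mul, inv_mul_cancel, torusMap_one]
  rfl

theorem torusMap_apply_inv (b : Matrix.SpecialLinearGroup (Fin 2) ℤ) (t : Torus) :
    torusMap b (torusMap b⁻¹ t) = t := by
  rw [← ContinuousMap.comp_apply, ← torusMap_mul, mul_inv_cancel, torusMap_one]
  rfl

theorem torusMap_injective (b : Matrix.SpecialLinearGroup (Fin 2) ℤ) :
    Function.Injective (torusMap b) :=
  Function.LeftInverse.injective (torusMap_inv_apply b)

namespace TubularLink

variable {n : ℕ} (L : TubularLink n) (a : Fin n → Matrix.SpecialLinearGroup (Fin 2) ℤ)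

/-- The gluing map from the boundary of the `i`-th solid torus. -/
def glueMap (i : Fin n) : C(Torus, L.exterior) := (L.torus i).comp (torusMap (a i))

theorem coe_glueMap (i : Fin n) (t : Torus) : (L.glueMap a i t : Sphere3) =
    L.nbhd i (torusInSolid 2 one_le_two (torusMap (a i) t)) := rfl

theorem glueMap_mem_tube (i : Fin n) (t : Torus) : (L.glueMap a i t : Sphere3) ∈ L.tube 1 :=
  ⟨i, _, (norm_torusInSolid _ _).le, rfl⟩

theorem inExterior_glueMap (i : Fin n) (t : Torus) :
    L.inExterior a (L.glueMap a i t) = L.inSolid a i (torusInSolid 1 le_rfl t) :=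
  Quot.sound (SurgeryRel.glue i t)

theorem inSolid_comp_torusInSolid (i : Fin n) :
    (L.inSolid a i).comp (torusInSolid 1 le_rfl) = (L.inExterior a).comp (L.glueMap a i) :=
  ContinuousMap.ext fun t => (L.inExterior_glueMap a i t).symm

open Classical in
/-- The representative of a point of the surgery manifold that lies in the exterior if possible. -/
def normalForm : L.exterior ⊕ (Fin n × SolidTorus 1) → L.exterior ⊕ (Fin n × SolidTorus 1)
  | Sum.inl x => Sum.inl x
  | Sum.inr y => if h : ∃ t, torusInSolid 1 le_rfl t = y.2 then
      Sum.inl (L.glueMap a y.1 h.choose) else Sum.inr y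

theorem normalForm_torusInSolid (i : Fin n) (t : Torus) :
    L.normalForm a (Sum.inr (i, torusInSolid 1 le_rfl t)) = Sum.inl (L.glueMap a i t) := by
  have h : ∃ t', torusInSolid 1 le_rfl t' = torusInSolid 1 le_rfl t := ⟨t, rfl⟩
  rw [normalForm, dif_pos h, torusInSolid_injective _ h.choose_spec]

theorem normalForm_of_ne (i : Fin n) {w : SolidTorus 1} (h : ¬ ∃ t, torusInSolid 1 le_rfl t = w) :
    L.normalForm a (Sum.inr (i, w)) = Sum.inr (i, w) := by
  rw [normalForm, dif_neg h]

/-- Glued points have the same normal form, so it descends to the quotient. This decides equality in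
M without describing the generated equivalence relation. -/
theorem normalForm_eq_of_mk {u v : L.exterior ⊕ (Fin n × SolidTorus 1)}
    (h : Quot.mk (L.SurgeryRel a) u = Quot.mk _ v) : L.normalForm a u = L.normalForm a v := by
  refine congrArg (Quot.lift (L.normalForm a) ?_) h
  rintro _ _ ⟨i, t⟩
  exact (L.normalForm_torusInSolid a i t).symm

theorem inExterior_injective : Function.Injective (L.inExterior a) := fun _ _ h =>
  Sum.inl_injective (L.normalForm_eq_of_mk a h)

theorem exists_of_inExterior_eq_inSolid {x : L.exterior} {i : Fin n} {w : SolidTorus 1}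
    (h : L.inExterior a x = L.inSolid a i w) :
    ∃ t, torusInSolid 1 le_rfl t = w ∧ L.glueMap a i t = x := by
  have h' : Sum.inl x = L.normalForm a (Sum.inr (i, w)) := L.normalForm_eq_of_mk a h
  by_cases hw : ∃ t, torusInSolid 1 le_rfl t = w
  · obtain ⟨t, rfl⟩ := hw
    rw [normalForm_torusInSolid] at h'
    exact ⟨t, rfl, (Sum.inl_injective h').symm⟩
  · rw [L.normalForm_of_ne a i hw] at h'
    cases h'

theorem inSolid_eq_inSolid_iff {i j : Fin n} {w w' : SolidTorus 1} :
    L.inSolid a i w = L.inSolid a j w' ↔ i = j ∧ w = w' := by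
  refine ⟨fun h => ?_, by rintro ⟨rfl, rfl⟩; rfl⟩
  by_cases hw : ∃ t, torusInSolid 1 le_rfl t = w
  · obtain ⟨t, rfl⟩ := hw
    rw [← inExterior_glueMap] at h
    obtain ⟨t', rfl, h'⟩ := L.exists_of_inExterior_eq_inSolid a h
    obtain ⟨rfl, h2⟩ := L.nbhd_eq_iff.1 (congrArg Subtype.val h')
    exact ⟨rfl, by rw [torusMap_injective _ (torusInSolid_injective _ h2)]⟩
  · by_cases hw' : ∃ t, torusInSolid 1 le_rfl t = w'
    · obtain ⟨t, rfl⟩ := hw'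
      rw [← inExterior_glueMap] at h
      obtain ⟨t', h1, -⟩ := L.exists_of_inExterior_eq_inSolid a h.symm
      exact absurd ⟨t', h1⟩ hw
    · have h' := L.normalForm_eq_of_mk a h
      rw [L.normalForm_of_ne a i hw, L.normalForm_of_ne a j hw'] at h'
      exact ⟨congrArg Prod.fst (Sum.inr_injective h'), congrArg Prod.snd (Sum.inr_injective h')⟩

theorem inSolid_injective (i : Fin n) : Function.Injective (L.inSolid a i) := fun _ _ h =>
  ((L.inSolid_eq_inSolid_iff a).1 h).2

theorem surgery_cases (m : L.Surgery a) :
    (∃ x : L.exterior, (x : Sphere3) ∉ L.tube 1 ∧ L.inExterior a x = m) ∨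
      ∃ i w, L.inSolid a i w = m := by
  obtain ⟨x | ⟨i, w⟩, rfl⟩ := Quot.exists_rep m
  · by_cases hx : (x : Sphere3) ∈ L.tube 1
    · obtain ⟨i, w, hw, h⟩ := hx
      have hw' : 1 ≤ ‖(w.1 : ℂ)‖ := by
        rw [← L.nbhd_mem_exterior, h]
        exact x.2
      obtain ⟨t, rfl⟩ := exists_torusInSolid one_le_two (le_antisymm hw hw')
      refine Or.inr ⟨i, torusInSolid 1 le_rfl (torusMap (a i)⁻¹ t), ?_⟩
      rw [← inExterior_glueMap]
      refine congrArg (L.inExterior a) (Subtype.ext ?_)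
      rw [coe_glueMap, torusMap_apply_inv, h]
    · exact Or.inl ⟨x, hx, rfl⟩
  · exact Or.inr ⟨i, w, rfl⟩

theorem isOpen_surgery_iff {U : Set (L.Surgery a)} : IsOpen U ↔
    IsOpen (L.inExterior a ⁻¹' U) ∧ ∀ i, IsOpen (L.inSolid a i ⁻¹' U) := by
  refine ⟨fun h => ⟨h.preimage (L.inExterior a).continuous,
    fun i => h.preimage (L.inSolid a i).continuous⟩, fun h => ?_⟩
  refine isOpen_coinduced.2 (isOpen_sum_iff.2 ⟨h.1, ?_⟩)
  have h1 : (Sum.inr ⁻¹' (Quot.mk (L.SurgeryRel a) ⁻¹' U) : Set (Fin n × SolidTorus 1)) =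
      ⋃ i, {i} ×ˢ (L.inSolid a i ⁻¹' U) := by
    ext ⟨i, w⟩
    simp only [Set.mem_iUnion, Set.mem_prod, Set.mem_singleton_iff, Set.mem_preimage]
    exact ⟨fun h => ⟨i, rfl, h⟩, by rintro ⟨j, rfl, h⟩; exact h⟩
  have h2 : IsOpen (⋃ i, {i} ×ˢ (L.inSolid a i ⁻¹' U) : Set (Fin n × SolidTorus 1)) :=
    isOpen_iUnion fun i => (isOpen_discrete _).prod (h.2 i)
  rw [← h1] at h2
  exact h2

theorem isClosed_surgery_iff {C : Set (L.Surgery a)} : IsClosed C ↔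
    IsClosed (L.inExterior a ⁻¹' C) ∧ ∀ i, IsClosed (L.inSolid a i ⁻¹' C) := by
  simp only [← isOpen_compl_iff, isOpen_surgery_iff, Set.preimage_compl]

instance : CompactSpace L.exterior := isCompact_iff_compactSpace.1 L.isClosed_exterior.isCompact

instance : CompactSpace (L.Surgery a) :=
  inferInstanceAs (CompactSpace (Quot (L.SurgeryRel a)))

theorem isClosedMap_inExterior : IsClosedMap (L.inExterior a) := by
  intro C hC
  refine (L.isClosed_surgery_iff a).2 ⟨?_, fun i => ?_⟩
  · rwa [Set.preimage_image_eq _ (L.inExterior_injective a)]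
  · have h : L.inSolid a i ⁻¹' (L.inExterior a '' C) =
        torusInSolid 1 le_rfl '' (L.glueMap a i ⁻¹' C) := by
      ext w
      constructor
      · rintro ⟨x, hx, h⟩
        obtain ⟨t, rfl, rfl⟩ := L.exists_of_inExterior_eq_inSolid a h
        exact ⟨t, hx, rfl⟩
      · rintro ⟨t, ht, rfl⟩
        exact ⟨_, ht, L.inExterior_glueMap a i t⟩
    rw [h]
    exact ((hC.preimage (L.glueMap a i).continuous).isCompact.image
      (torusInSolid 1 le_rfl).continuous).isClosed

theorem isClosedMap_inSolid (i : Fin n) : IsClosedMap (L.inSolid a i) := by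
  intro C hC
  refine (L.isClosed_surgery_iff a).2 ⟨?_, fun j => ?_⟩
  · have h : L.inExterior a ⁻¹' (L.inSolid a i '' C) =
        L.glueMap a i '' (torusInSolid 1 le_rfl ⁻¹' C) := by
      ext x
      constructor
      · rintro ⟨w, hw, h⟩
        obtain ⟨t, rfl, rfl⟩ := L.exists_of_inExterior_eq_inSolid a h.symm
        exact ⟨t, hw, rfl⟩
      · rintro ⟨t, ht, rfl⟩
        exact ⟨_, ht, (L.inExterior_glueMap a i t).symm⟩
    rw [h]
    exact ((hC.preimage (torusInSolid 1 le_rfl).continuous).isCompact.image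
      (L.glueMap a i).continuous).isClosed
  · by_cases hij : i = j
    · subst hij
      rwa [Set.preimage_image_eq _ (L.inSolid_injective a i)]
    · have h : L.inSolid a j ⁻¹' (L.inSolid a i '' C) = ∅ := by
        refine Set.eq_empty_of_forall_notMem ?_
        rintro w ⟨w', -, h⟩
        exact hij ((L.inSolid_eq_inSolid_iff a).1 h).1
      rw [h]
      exact isClosed_empty

instance : T2Space (L.Surgery a) := by
  refine t2Space_of_isClosedMap (f := Quot.mk (L.SurgeryRel a)) continuous_quot_mk ?_ Quot.mk_surjective
  intro C hC
  have h : Quot.mk (L.SurgeryRel a) '' C = L.inExterior a '' (Sum.inl ⁻¹' C) ∪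
      ⋃ i, L.inSolid a i '' ((fun w => Sum.inr (i, w)) ⁻¹' C) := by
    ext m
    constructor
    · rintro ⟨x | ⟨i, w⟩, hx, rfl⟩
      · exact Or.inl ⟨x, hx, rfl⟩
      · exact Or.inr (Set.mem_iUnion.2 ⟨i, w, hx, rfl⟩)
    · rintro (⟨x, hx, rfl⟩ | h)
      · exact ⟨_, hx, rfl⟩
      · obtain ⟨i, w, hx, rfl⟩ := Set.mem_iUnion.1 h
        exact ⟨_, hx, rfl⟩
  have h1 := (L.isClosedMap_inExterior a _ (hC.preimage continuous_inl)).union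
    (isClosed_iUnion_of_finite fun i => L.isClosedMap_inSolid a i _
      (hC.preimage (f := fun w => Sum.inr (i, w)) (continuous_inr.comp (by fun_prop))))
  rw [← h] at h1
  exact h1

theorem isOpen_inExterior_image {U : Set L.exterior} (hU : IsOpen U)
    (h : ∀ x ∈ U, (x : Sphere3) ∉ L.tube 1) : IsOpen (L.inExterior a '' U) := by
  refine (L.isOpen_surgery_iff a).2 ⟨?_, fun i => ?_⟩
  · rwa [Set.preimage_image_eq _ (L.inExterior_injective a)]
  · have h' : L.inSolid a i ⁻¹' (L.inExterior a '' U) = ∅ := by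
      refine Set.eq_empty_of_forall_notMem ?_
      rintro w ⟨x, hx, hxw⟩
      obtain ⟨t, -, rfl⟩ := L.exists_of_inExterior_eq_inSolid a hxw
      exact h _ hx (L.glueMap_mem_tube a i t)
    rw [h']
    exact isOpen_empty

theorem isOpen_inSolid_image (i : Fin n) {U : Set (SolidTorus 1)} (hU : IsOpen U)
    (h : U ⊆ openSolid 1 1) : IsOpen (L.inSolid a i '' U) := by
  refine (L.isOpen_surgery_iff a).2 ⟨?_, fun j => ?_⟩
  · have h' : L.inExterior a ⁻¹' (L.inSolid a i '' U) = ∅ := by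
      refine Set.eq_empty_of_forall_notMem ?_
      rintro x ⟨w, hw, hxw⟩
      obtain ⟨t, rfl, -⟩ := L.exists_of_inExterior_eq_inSolid a hxw.symm
      exact (norm_torusInSolid le_rfl t).not_lt (h hw)
    rw [h']
    exact isOpen_empty
  · by_cases hij : i = j
    · subst hij
      rwa [Set.preimage_image_eq _ (L.inSolid_injective a i)]
    · have h : L.inSolid a j ⁻¹' (L.inSolid a i '' U) = ∅ := by
        refine Set.eq_empty_of_forall_notMem ?_
        rintro w ⟨w', -, h⟩
        exact hij ((L.inSolid_eq_inSolid_iff a).1 h).1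
      rw [h]
      exact isOpen_empty

/-! ### Charts of the surgery manifold -/

open Topology

open Classical in
theorem hasChartAt_inExterior {x : L.exterior} (hx : (x : Sphere3) ∉ L.tube 1) :
    HasChartAt (L.inExterior a x) := by
  let f : Sphere3 → L.Surgery a := fun y =>
    L.inExterior a (if h : y ∈ L.exterior then ⟨y, h⟩ else x)
  have hf (y : L.exterior) : f y = L.inExterior a y := congrArg (L.inExterior a) (dif_pos y.2)
  have hO : IsOpen (L.tube 1)ᶜ := (L.isCompact_tube 1).isClosed.isOpen_compl
  let g : ((L.tube 1)ᶜ : Set Sphere3) → L.exterior := fun y =>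
    ⟨y, L.mem_exterior_of_not_mem_tube y.2⟩
  have hg : Continuous g := by fun_prop
  have hfg : (L.tube 1)ᶜ.domRestrict f = L.inExterior a ∘ g := funext fun y => hf (g y)
  have hgo : IsOpenMap g := by
    rintro _ ⟨U, hU, rfl⟩
    have : g '' (Subtype.val ⁻¹' U) = Subtype.val ⁻¹' (U ∩ (L.tube 1)ᶜ) := by
      ext y
      constructor
      · rintro ⟨z, hz, rfl⟩
        exact ⟨hz, z.2⟩
      · rintro ⟨h1, h2⟩
        exact ⟨⟨y, h2⟩, h1, rfl⟩
    rw [this]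
    exact (hU.inter hO).preimage continuous_subtype_val
  rw [← hf]
  refine HasChartAt.map hO ?_ hx (hasChartAt_sphere _)
  rw [hfg]
  refine IsOpenEmbedding.of_continuous_injective_isOpenMap ((L.inExterior a).continuous.comp hg)
    ((L.inExterior_injective a).comp fun y z h => Subtype.ext (congrArg (fun w : L.exterior => (w : Sphere3)) h))
    fun U hU => ?_
  rw [Set.image_comp]
  refine L.isOpen_inExterior_image a (hgo U hU) ?_
  rintro _ ⟨y, -, rfl⟩
  exact y.2

theorem hasChartAt_inSolid_of_norm_lt (i : Fin n) {w : SolidTorus 1} (hw : w ∈ openSolid 1 1) :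
    HasChartAt (L.inSolid a i w) := by
  have hO := isOpen_openSolid 1 1
  refine HasChartAt.map hO (IsOpenEmbedding.of_continuous_injective_isOpenMap
    ((L.inSolid a i).continuous.comp continuous_subtype_val)
    ((L.inSolid_injective a i).comp Subtype.val_injective) fun U hU => ?_) hw
    (hasChartAt_solidTorus hw)
  change IsOpen ((L.inSolid a i ∘ Subtype.val) '' U)
  rw [Set.image_comp]
  refine L.isOpen_inSolid_image a i (hO.isOpenMap_subtype_val U hU) ?_
  rintro _ ⟨y, -, rfl⟩
  exact y.2

/-- The part of the bicollar of the `i`-th torus in the solid torus. -/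
def innerCollar (y : Torus × ℝ) : SolidTorus 1 := polar 1 y.1 (Set.projIcc 0 1 zero_le_one y.2)

/-- The part of the bicollar of the `i`-th torus in the exterior. -/
def outerCollar (i : Fin n) (y : Torus × ℝ) : SolidTorus 2 :=
  polar 2 (torusMap (a i) y.1) (Set.inclusion (Set.Icc_subset_Icc_left zero_le_one)
    (Set.projIcc (1 : ℝ) 2 one_le_two y.2))

theorem norm_innerCollar {y : Torus × ℝ} (h0 : 0 ≤ y.2) (h1 : y.2 ≤ 1) :
    ‖((innerCollar y).1 : ℂ)‖ = y.2 := by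
  rw [innerCollar, norm_polar, Set.projIcc_of_mem zero_le_one ⟨h0, h1⟩]

theorem norm_outerCollar {i : Fin n} {y : Torus × ℝ} (h1 : 1 ≤ y.2) (h2 : y.2 ≤ 2) :
    ‖((outerCollar a i y).1 : ℂ)‖ = y.2 := by
  rw [outerCollar, norm_polar, Set.projIcc_of_mem one_le_two ⟨h1, h2⟩]

theorem outerCollar_mem (i : Fin n) (y : Torus × ℝ) : L.nbhd i (outerCollar a i y) ∈ L.exterior := by
  rw [nbhd_mem_exterior, outerCollar, norm_polar]
  exact (Set.projIcc (1 : ℝ) 2 one_le_two y.2).2.1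

theorem collar_agree (i : Fin n) {y : Torus × ℝ} (h : y.2 = 1) :
    L.inSolid a i (innerCollar y) =
      L.inExterior a ⟨L.nbhd i (outerCollar a i y), L.outerCollar_mem a i y⟩ := by
  have h1 : innerCollar y = torusInSolid 1 le_rfl y.1 := by
    rw [← polar_one, innerCollar]
    congr 1
    rw [h]
    exact Set.projIcc_right (zero_le_one (α := ℝ))
  rw [h1, ← inExterior_glueMap]
  refine congrArg (L.inExterior a) (Subtype.ext ?_)
  rw [coe_glueMap, ← polar_one]
  change _ = L.nbhd i (outerCollar a i y)
  rw [outerCollar]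
  congr 2
  rw [h, Set.projIcc_left]

/-- A bicollar of the `i`-th torus in the surgery manifold. -/
def collar (i : Fin n) : C(Torus × ℝ, L.Surgery a) where
  toFun y := if y.2 ≤ 1 then L.inSolid a i (innerCollar y) else
    L.inExterior a ⟨L.nbhd i (outerCollar a i y), L.outerCollar_mem a i y⟩
  continuous_toFun := by
    refine Continuous.if_le ?_ ?_ continuous_snd continuous_const fun y h => L.collar_agree a i h
    · refine (L.inSolid a i).continuous.comp ?_
      exact (continuous_polar 1).comp
        (continuous_fst.prodMk
          ((continuous_projIcc (h := zero_le_one (α := ℝ))).comp continuous_snd))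
    · refine (L.inExterior a).continuous.comp (Continuous.subtype_mk ?_ _)
      refine (L.nbhd i).continuous.comp ?_
      exact (continuous_polar 2).comp (((torusMap (a i)).continuous.comp continuous_fst).prodMk
        ((continuous_inclusion (Set.Icc_subset_Icc_left zero_le_one)).comp (continuous_projIcc.comp continuous_snd)))

theorem collar_of_le (i : Fin n) {y : Torus × ℝ} (h : y.2 ≤ 1) :
    L.collar a i y = L.inSolid a i (innerCollar y) := if_pos h

theorem collar_of_ge (i : Fin n) {y : Torus × ℝ} (h : 1 ≤ y.2) :
    L.collar a i y = L.inExterior a ⟨L.nbhd i (outerCollar a i y), L.outerCollar_mem a i y⟩ := by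
  rcases h.eq_or_lt with h | h
  · rw [L.collar_of_le a i h.ge, L.collar_agree a i h.symm]
  · exact if_neg (not_le.2 h)

theorem collar_ne (i j : Fin n) {y : Torus × ℝ} (h1 : 1 < y.2) (h2 : y.2 ≤ 2) (w : SolidTorus 1) :
    L.collar a i y ≠ L.inSolid a j w := by
  rw [L.collar_of_ge a i h1.le]
  intro h
  obtain ⟨t, -, h'⟩ := L.exists_of_inExterior_eq_inSolid a h
  have h3 := (L.nbhd_eq_iff.1 (congrArg Subtype.val h')).2
  have h4 := norm_outerCollar a (i := i) h1.le h2
  rw [← h3, norm_torusInSolid] at h4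
  exact h1.ne h4

theorem collar_injOn (i : Fin n) :
    Set.InjOn (L.collar a i) (Set.univ ×ˢ Set.Icc (1 / 2 : ℝ) (3 / 2)) := by
  rintro ⟨t, s⟩ ⟨-, hs, hs'⟩ ⟨t', s'⟩ ⟨-, hu, hu'⟩ h
  simp only at hs hs' hu hu'
  rcases le_or_gt s 1 with h1 | h1 <;> rcases le_or_gt s' 1 with h2 | h2
  · rw [L.collar_of_le a i h1, L.collar_of_le a i h2] at h
    have h3 := L.inSolid_injective a i h
    have e1 := norm_innerCollar (y := (t, s)) (by linarith) h1
    have e2 := norm_innerCollar (y := (t', s')) (by linarith) h2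
    have e3 : s = s' := by
      rw [h3] at e1
      exact e1.symm.trans e2
    rw [innerCollar, innerCollar] at h3
    refine Prod.ext (polar_injective ?_ h3).1 e3
    rw [Set.projIcc_of_mem zero_le_one ⟨by linarith, h1⟩]
    linarith
  · rw [L.collar_of_le a i h1] at h
    exact absurd h.symm (L.collar_ne a i i h2 (by linarith) _)
  · rw [L.collar_of_le a i (y := (t', s')) h2] at h
    exact absurd h (L.collar_ne a i i h1 (by linarith) _)
  · rw [L.collar_of_ge a i h1.le, L.collar_of_ge a i h2.le] at h
    have h3 := L.nbhd_injective i (congrArg Subtype.val (L.inExterior_injective a h))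
    have e1 := norm_outerCollar a (i := i) (y := (t, s)) h1.le (by linarith)
    have e2 := norm_outerCollar a (i := i) (y := (t', s')) h2.le (by linarith)
    have e3 : s = s' := by
      rw [h3] at e1
      exact e1.symm.trans e2
    rw [outerCollar, outerCollar] at h3
    refine Prod.ext (torusMap_injective _ (polar_injective ?_ h3).1) e3
    rw [Set.projIcc_of_mem one_le_two ⟨h1.le, by linarith⟩]
    exact zero_lt_one.trans h1

/-- Openness in M is tested on the pieces. In E_L the collar is the part of the i-th tube of radius
below 3/2, open by `isOpen_nbhd_image`; in the i-th solid torus it is the part of radius above 1/2.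
-/
theorem isOpen_collar_image (i : Fin n) :
    IsOpen (L.collar a i '' (Set.univ ×ˢ Set.Ioo (1 / 2 : ℝ) (3 / 2))) := by
  refine (L.isOpen_surgery_iff a).2 ⟨?_, fun j => ?_⟩
  · have h : L.inExterior a ⁻¹' (L.collar a i '' (Set.univ ×ˢ Set.Ioo (1 / 2 : ℝ) (3 / 2))) =
        Subtype.val ⁻¹' (L.nbhd i '' openSolid 2 (3 / 2)) := by
      ext x
      constructor
      · rintro ⟨⟨t, s⟩, ⟨-, hs, hs'⟩, h⟩
        simp only at hs hs'
        rcases le_or_gt 1 s with h1 | h1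
        · rw [L.collar_of_ge a i h1] at h
          refine ⟨_, ?_, congrArg Subtype.val (L.inExterior_injective a h)⟩
          change ‖((outerCollar a i (t, s)).1 : ℂ)‖ < 3 / 2
          rw [norm_outerCollar a h1 (by linarith)]
          exact hs'
        · rw [L.collar_of_le a i h1.le] at h
          obtain ⟨t', -, rfl⟩ := L.exists_of_inExterior_eq_inSolid a h.symm
          refine ⟨_, ?_, (L.coe_glueMap a i t').symm⟩
          change ‖((torusInSolid 2 one_le_two (torusMap (a i) t')).1 : ℂ)‖ < 3 / 2
          rw [norm_torusInSolid]
          norm_num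
      · rintro ⟨w, hw, h⟩
        replace hw : ‖(w.1 : ℂ)‖ < 3 / 2 := hw
        have hw' : 1 ≤ ‖(w.1 : ℂ)‖ := by
          rw [← L.nbhd_mem_exterior, h]
          exact x.2
        obtain ⟨t, ht⟩ := exists_polar w (by linarith)
        refine ⟨(torusMap (a i)⁻¹ t, ‖(w.1 : ℂ)‖), ⟨trivial, ?_, hw⟩, ?_⟩
        · change 1 / 2 < ‖(w.1 : ℂ)‖
          linarith
        · rw [L.collar_of_ge a i hw']
          refine congrArg (L.inExterior a) (Subtype.ext ?_)
          rw [← h]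
          refine congrArg (L.nbhd i) (Eq.trans ?_ ht)
          rw [outerCollar, torusMap_apply_inv]
          congr 1
          refine Subtype.ext ?_
          rw [Set.projIcc_of_mem one_le_two ⟨hw', by linarith⟩]
    rw [h]
    refine (L.isOpen_nbhd_image i (isOpen_openSolid 2 _) fun w hw => ?_).preimage
      continuous_subtype_val
    replace hw : ‖(w.1 : ℂ)‖ < 3 / 2 := hw
    change ‖(w.1 : ℂ)‖ < 2
    linarith
  · by_cases hij : i = j
    · subst hij
      have h : L.inSolid a i ⁻¹' (L.collar a i '' (Set.univ ×ˢ Set.Ioo (1 / 2 : ℝ) (3 / 2))) =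
          {w | 1 / 2 < ‖(w.1 : ℂ)‖} := by
        ext w
        constructor
        · rintro ⟨⟨t, s⟩, ⟨-, hs, hs'⟩, h⟩
          simp only at hs hs'
          rcases le_or_gt s 1 with h1 | h1
          · rw [L.collar_of_le a i h1] at h
            rw [← L.inSolid_injective a i h, Set.mem_ofPred_eq, norm_innerCollar (by simp only; linarith) h1]
            exact hs
          · exact absurd h (L.collar_ne a i i h1 (by simp only; linarith) w)
        · intro hw
          replace hw : 1 / 2 < ‖(w.1 : ℂ)‖ := hw
          have hw' := mem_closedBall_zero_iff.1 w.1.2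
          obtain ⟨t, ht⟩ := exists_polar w (by linarith)
          refine ⟨(t, ‖(w.1 : ℂ)‖), ⟨trivial, hw, ?_⟩, ?_⟩
          · change ‖(w.1 : ℂ)‖ < 3 / 2
            linarith
          · rw [L.collar_of_le a i hw', innerCollar]
            refine congrArg (L.inSolid a i) (Eq.trans ?_ ht)
            congr 1
            exact Set.projIcc_of_mem zero_le_one ⟨norm_nonneg _, hw'⟩
      rw [h]
      exact isOpen_lt continuous_const (by fun_prop)
    · have h : L.inSolid a j ⁻¹' (L.collar a i '' (Set.univ ×ˢ Set.Ioo (1 / 2 : ℝ) (3 / 2))) = ∅ := by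
        refine Set.eq_empty_of_forall_notMem ?_
        rintro w ⟨⟨t, s⟩, ⟨-, hs, hs'⟩, h⟩
        simp only at hs hs'
        rcases le_or_gt s 1 with h1 | h1
        · rw [L.collar_of_le a i h1] at h
          exact hij ((L.inSolid_eq_inSolid_iff a).1 h).1
        · exact absurd h (L.collar_ne a i j h1 (by simp only; linarith) w)
      rw [h]
      exact isOpen_empty

/-- Away from the gluing tori the charts come from S³ and from ℂ × S¹. On a gluing torus they come
from the bicollar, whose outer half exists because the parametrizations extend to radius 2. -/
theorem hasChartAt_surgery (m : L.Surgery a) : HasChartAt m := by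
  rcases L.surgery_cases a m with ⟨x, hx, rfl⟩ | ⟨i, w, rfl⟩
  · exact L.hasChartAt_inExterior a hx
  · rcases (mem_closedBall_zero_iff.1 w.1.2).lt_or_eq with hw | hw
    · exact L.hasChartAt_inSolid_of_norm_lt a i hw
    · obtain ⟨t, rfl⟩ := exists_torusInSolid le_rfl hw
      have h : L.collar a i (t, 1) = L.inSolid a i (torusInSolid 1 le_rfl t) := by
        rw [L.collar_of_le a i le_rfl, innerCollar, ← polar_one]
        congr 2
        exact Set.projIcc_right (zero_le_one (α := ℝ))
      rw [← h]
      refine HasChartAt.map (isOpen_univ.prod isOpen_Ioo) (isOpenEmbedding_of_isCompact _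
        (isCompact_univ.prod isCompact_Icc) (Set.prod_mono le_rfl Set.Ioo_subset_Icc_self)
        (L.collar_injOn a i) (L.isOpen_collar_image a i)) ⟨trivial, ?_⟩ (hasChartAt_torus_prod _)
      constructor <;> norm_num

end TubularLink

end SurgeryFormula

end

noncomputable section

namespace SurgeryFormula

open HasAffineSimplices

/-! ### S-triangulations of the surgery manifold -/

/-- The interior of the simplex is open in ℂ × S¹, so a point of it on the boundary torus could be
pushed outwards, beyond radius 1. -/
theorem mem_openSolid_of_mem_solidTorusOrientation {σ : SingularSimplex 3 (SolidTorus 1)}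
    (hσ : σ ∈ solidTorusOrientation 1) {t : Simplex 3} (ht : t ∈ simplexInterior 3) :
    σ t ∈ openSolid 1 1 := by
  have ho := (isRegularSimplex_of_mem_wrapOrientation (mem_solidTorusOrientation_iff.1 hσ)).2
  have hf : Continuous fun s : ℝ => ((s • ((σ t).1 : ℂ), (σ t).2) : ℂ × Circle) := by fun_prop
  have h1 : ((1 : ℝ) • ((σ t).1 : ℂ), (σ t).2) ∈
      (solidIncl 1).comp σ '' simplexInterior 3 := by
    rw [one_smul]
    exact ⟨t, ht, rfl⟩
  have h2 := hf.continuousAt.eventually_mem (ho.mem_nhds h1)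
  obtain ⟨s, ⟨t', -, h3⟩, hs1, -⟩ := ((h2.filter_mono nhdsWithin_le_nhds).and
    (Ioo_mem_nhdsGT (one_lt_two (α := ℝ)))).exists
  have h4 : ((σ t').1 : ℂ) = s • ((σ t).1 : ℂ) := congrArg (fun z : ℂ × Circle => z.1) h3
  have h5 := mem_closedBall_zero_iff.1 (σ t').1.2
  rw [h4, norm_smul, Real.norm_of_nonneg (by linarith)] at h5
  change ‖((σ t).1 : ℂ)‖ < 1
  by_contra h6
  nlinarith [not_lt.1 h6]

namespace TubularLink

variable {n : ℕ} (L : TubularLink n) (a : Fin n → Matrix.SpecialLinearGroup (Fin 2) ℤ)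

/-- The positive simplices of the exterior and of the solid tori. -/
def pieces : Set (SingularSimplex 3 (L.Surgery a)) :=
  {σ | ∃ τ ∈ L.exteriorOrientation, σ = (L.inExterior a).comp τ} ∪
    {σ | ∃ i, ∃ τ ∈ solidTorusOrientation 1, σ = (L.inSolid a i).comp τ}

theorem inExterior_ne_inSolid {x : L.exterior} (hx : (x : Sphere3) ∉ L.tube 1) (i : Fin n)
    (w : SolidTorus 1) : L.inExterior a x ≠ L.inSolid a i w := by
  intro h
  obtain ⟨t, -, rfl⟩ := L.exists_of_inExterior_eq_inSolid a h
  exact hx (L.glueMap_mem_tube a i t)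

theorem inExterior_ne_inSolid' {w : SolidTorus 1} (hw : w ∈ openSolid 1 1) (i : Fin n)
    (x : L.exterior) : L.inExterior a x ≠ L.inSolid a i w := by
  intro h
  obtain ⟨t, rfl, -⟩ := L.exists_of_inExterior_eq_inSolid a h
  exact (norm_torusInSolid le_rfl t).not_lt hw

theorem isEmbedding_of_injective {σ : SingularSimplex 3 (L.Surgery a)}
    (h : Function.Injective σ) : Topology.IsEmbedding σ :=
  (σ.continuous.isClosedEmbedding h).isEmbedding

theorem inExterior_comp_mem {σ : SingularSimplex 3 L.exterior} (hσ : σ ∈ L.exteriorOrientation) :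
    (L.inExterior a).comp σ ∈ L.surgeryOrientation a := by
  have hr := isRegularSimplex_of_mem_sphereOrientation hσ
  have hi : Function.Injective σ := fun s t h => hr.1 (congrArg Subtype.val h)
  refine ⟨L.isEmbedding_of_injective a ((L.inExterior_injective a).comp hi), ?_, ?_⟩
  · have h1 : σ '' simplexInterior 3 =
        Subtype.val ⁻¹' (L.exteriorIncl.comp σ '' simplexInterior 3) := by
      ext x
      constructor
      · rintro ⟨t, ht, rfl⟩
        exact ⟨t, ht, rfl⟩
      · rintro ⟨t, ht, h⟩
        exact ⟨t, ht, Subtype.ext h⟩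
    have h2 : (L.inExterior a).comp σ '' simplexInterior 3 =
        L.inExterior a '' (σ '' simplexInterior 3) := Set.image_comp (L.inExterior a) σ _
    rw [h2]
    refine L.isOpen_inExterior_image a ?_ ?_
    · rw [h1]
      exact hr.2.preimage continuous_subtype_val
    · rintro _ ⟨t, ht, rfl⟩
      exact L.not_mem_tube_of_mem_exteriorOrientation hσ ht
  · have hx {s} (hs : s ∈ simplexInterior 3) := L.not_mem_tube_of_mem_exteriorOrientation hσ hs
    rintro _ (⟨τ, hτ, rfl⟩ | ⟨i, τ, hτ, rfl⟩) s hs t ht h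
    · have h1 : σ s = τ t := L.inExterior_injective a h
      have h2 : TrivialOn {(σ s : Sphere3)} _ :=
        trivialOn_sphere_sub hσ hτ hs ht (congrArg Subtype.val h1)
      rw [← push_single, ← push_single, ← map_sub] at h2
      have h3 := (L.trivialOn_of_push_exteriorIncl (hx hs) h2).push (f := L.inExterior a)
        (L := {L.inExterior a (τ t)}) fun x hx => (L.inExterior_injective a hx).trans h1.symm
      rwa [map_sub, push_single, push_single] at h3
    · exact absurd h (L.inExterior_ne_inSolid a (hx hs) i _)

theorem inSolid_comp_mem (i : Fin n) {σ : SingularSimplex 3 (SolidTorus 1)}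
    (hσ : σ ∈ solidTorusOrientation 1) : (L.inSolid a i).comp σ ∈ L.surgeryOrientation a := by
  have hr := isRegularSimplex_of_mem_solidTorusOrientation hσ
  refine ⟨L.isEmbedding_of_injective a ((L.inSolid_injective a i).comp hr.1), ?_, ?_⟩
  · have h2 : (L.inSolid a i).comp σ '' simplexInterior 3 =
        L.inSolid a i '' (σ '' simplexInterior 3) := Set.image_comp (L.inSolid a i) σ _
    rw [h2]
    refine L.isOpen_inSolid_image a i hr.2 ?_
    rintro _ ⟨t, ht, rfl⟩
    exact mem_openSolid_of_mem_solidTorusOrientation hσ ht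
  · have hx {s} (hs : s ∈ simplexInterior 3) := mem_openSolid_of_mem_solidTorusOrientation hσ hs
    rintro _ (⟨τ, hτ, rfl⟩ | ⟨j, τ, hτ, rfl⟩) s hs t ht h
    · exact absurd h.symm (L.inExterior_ne_inSolid' a (hx hs) i _)
    · obtain ⟨rfl, h1⟩ := (L.inSolid_eq_inSolid_iff a).1 h
      have h3 := (trivialOn_solidTorus_sub hσ hτ hs ht h1 (hx hs)).push (f := L.inSolid a i)
        (L := {L.inSolid a i (τ t)}) fun x hx => (L.inSolid_injective a i hx).trans h1.symm
      rwa [map_sub, push_single, push_single] at h3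

theorem pieces_subset : L.pieces a ⊆ L.surgeryOrientation a := by
  rintro _ (⟨τ, hτ, rfl⟩ | ⟨i, τ, hτ, rfl⟩)
  exacts [L.inExterior_comp_mem a hτ, L.inSolid_comp_mem a i hτ]

theorem exists_exteriorSimplex {x : L.exterior} (hx : (x : Sphere3) ∉ L.tube 1) :
    ∃ σ ∈ L.exteriorOrientation, ∃ t ∈ simplexInterior 3, σ t = x := by
  obtain ⟨σ, hσ, t, ht, h, hr⟩ := exists_sphereSimplex
    ((L.isCompact_tube 1).isClosed.isOpen_compl.mem_nhds hx)
  exact ⟨⟨fun s => ⟨σ s, L.mem_exterior_of_not_mem_tube (hr ⟨s, rfl⟩)⟩,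
    σ.continuous.subtype_mk _⟩, hσ, t, ht, Subtype.ext h⟩

/-- The interiors of the pieces are dense. -/
theorem exists_piece {m : L.Surgery a} {K : Set (L.Surgery a)} (hK : K ∈ nhds m) :
    ∃ σ ∈ L.pieces a, ∃ t ∈ simplexInterior 3, σ t ∈ K := by
  rcases L.surgery_cases a m with ⟨x, hx, rfl⟩ | ⟨i, w, rfl⟩
  · obtain ⟨σ, hσ, t, ht, rfl⟩ := L.exists_exteriorSimplex hx
    exact ⟨_, Or.inl ⟨σ, hσ, rfl⟩, t, ht, mem_of_mem_nhds hK⟩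
  · obtain ⟨w', hw', s, hs0, hs1, h⟩ :=
      exists_smul_mem ((L.inSolid a i).continuous.continuousAt.preimage_mem_nhds hK)
    have h1 : w' ∈ openSolid 1 1 := by
      change ‖(w'.1 : ℂ)‖ < 1
      rw [h, norm_smul, Real.norm_of_nonneg hs0.le]
      exact (mul_le_of_le_one_right hs0.le (mem_closedBall_zero_iff.1 w.1.2)).trans_lt hs1
    obtain ⟨σ, hσ, t, ht, rfl, -⟩ := exists_solidTorusSimplex h1 Filter.univ_mem
    exact ⟨_, Or.inr ⟨i, σ, hσ, rfl⟩, t, ht, hw'⟩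

/-- A cycle of the surgery manifold that is locally trivial on the pieces is a boundary. -/
theorem exists_eq_boundary {c : Chain 3 (L.Surgery a)} (hc : boundary c = 0)
    (h : ∀ σ ∈ L.pieces a, ∀ t ∈ simplexInterior 3, TrivialOn {σ t} c) :
    ∃ e, c = boundary e := by
  have hs (S : Set (L.Surgery a)) : SupportedIn S (boundary c) := by
    rw [hc]
    exact SupportedIn.zero S
  obtain ⟨e, he⟩ := trivialOn_of_forall_singleton isCompact_univ
    (fun m _ => L.hasChartAt_surgery a m) (hs _) (fun m _ => by
      -- Points on the gluing tori are interior to no piece, but a cell around them meets one, and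
      -- triviality there spreads over the cell.
      obtain ⟨K, hK, -, hKc⟩ := (L.hasChartAt_surgery a m).exists_isCell Filter.univ_mem
      obtain ⟨σ, hσ, t, ht, hm⟩ := L.exists_piece a hK
      exact (hKc.trivialOn (hs _) hm (h σ hσ t ht)).mono
        (Set.singleton_subset_iff.2 (mem_of_mem_nhds hK)))
  rw [Set.compl_univ] at he
  exact ⟨e, sub_eq_zero.1 (eq_zero_of_supportedIn_empty he)⟩

theorem trivialOn_sub_of_mem_exteriorTri {ζ ζ' : Chain 3 L.exterior} (h : ζ ∈ L.exteriorTri)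
    (h' : ζ' ∈ L.exteriorTri) {σ : SingularSimplex 3 L.exterior} (hσ : σ ∈ L.exteriorOrientation)
    {t : Simplex 3} (ht : t ∈ simplexInterior 3) : TrivialOn {σ t} (ζ - ζ') :=
  TrivialOn.trans (h.2 σ hσ t ht) (TrivialOn.symm (h'.2 σ hσ t ht))

/-! ### Independence of the chosen s-triangulation -/

section Evaluation

variable {Γ : Type*} [Group Γ] {A : Type*} [AddCommGroup A] {α : Γ → Γ → Γ → A}
variable {L a} (ρ : GroupoidRep (L.Surgery a) Γ)

theorem boundary_of_mem_surgeryTri {ζ : Chain 3 (L.Surgery a)} (h : ζ ∈ L.surgeryTri a) :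
    boundary ζ = 0 := eq_zero_of_supportedIn_empty h.1

theorem evalHom_eq_of_mem_surgeryTri (hα : IsThreeCocycle α) {ζ ζ' : Chain 3 (L.Surgery a)}
    (h : ζ ∈ L.surgeryTri a) (h' : ζ' ∈ L.surgeryTri a) : evalHom ρ α ζ = evalHom ρ α ζ' := by
  obtain ⟨e, he⟩ := L.exists_eq_boundary a (c := ζ - ζ')
    (by rw [map_sub, boundary_of_mem_surgeryTri h, boundary_of_mem_surgeryTri h', sub_zero])
    fun σ hσ t ht => TrivialOn.trans (h.2 σ (L.pieces_subset a hσ) t ht)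
      (TrivialOn.symm (h'.2 σ (L.pieces_subset a hσ) t ht))
  rw [← sub_eq_zero, ← map_sub, he, evalHom_boundary ρ hα]

/-- The representation is the restriction of one on M, so the difference, a cycle of E_L, may be
compared in M. There it is locally trivial on the pieces of E_L, misses the open solid tori, and
hence bounds. -/
theorem evalHom_eq_of_mem_exteriorTri (hα : IsThreeCocycle α) {ζ ζ' : Chain 3 L.exterior}
    (h : ζ ∈ L.exteriorTri) (h' : ζ' ∈ L.exteriorTri) (hb : boundary ζ = boundary ζ') :
    evalHom (restrictExterior ρ) α ζ = evalHom (restrictExterior ρ) α ζ' := by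
  obtain ⟨e, he⟩ := L.exists_eq_boundary a (c := push (L.inExterior a) (ζ - ζ'))
    (by rw [← push_boundary, map_sub, hb, sub_self, map_zero]) (by
      rintro _ (⟨σ, hσ, rfl⟩ | ⟨i, σ, hσ, rfl⟩) t ht
      · exact (L.trivialOn_sub_of_mem_exteriorTri h h' hσ ht).push
          (L := {L.inExterior a (σ t)}) fun x hx => L.inExterior_injective a hx
      · refine (supportedIn_push ?_ _).trivialOn
        rintro _ ⟨x, rfl⟩
        exact L.inExterior_ne_inSolid' a (mem_openSolid_of_mem_solidTorusOrientation hσ ht) i x)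
  rw [← sub_eq_zero, ← map_sub, restrictExterior, ← evalHom_push, he, evalHom_boundary ρ hα]

end Evaluation

/-- The chain of the surgery manifold assembled from chains of the exterior and of the tori. -/
def surgeryChain (ζ : Chain 3 L.exterior) (y : Fin n → Chain 3 Torus) : Chain 3 (L.Surgery a) :=
  push (L.inExterior a) ζ + ∑ i, push (L.inSolid a i)
    (solidChain 1 one_pos + push (torusInSolid 1 le_rfl) (y i))

/-- On the boundary of the i-th solid torus the two chains add up to the image of ξ^st under the
inverse of a_i. The gluing map turns this into ξ^st on T²_i, which cancels the boundary of ζ. -/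
theorem boundary_surgeryChain {ζ : Chain 3 L.exterior} (hζ : boundary ζ = L.xiBoundary)
    {y : Fin n → Chain 3 Torus}
    (hy : ∀ i, boundary (y i) = push (torusMap (a i)⁻¹) xiSt - xiSt) :
    boundary (L.surgeryChain a ζ y) = 0 := by
  rw [surgeryChain, map_add, ← push_boundary, hζ, xiBoundary, map_sum, map_sum,
    ← Finset.sum_add_distrib]
  refine Finset.sum_eq_zero fun i _ => ?_
  have h1 := boundary_solidChain (le_refl (1 : ℝ))
  have h2 : (torusMap (a i)).comp (torusMap (a i)⁻¹) = ContinuousMap.id _ :=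
    ContinuousMap.ext (torusMap_apply_inv (a i))
  rw [← push_boundary, map_add, h1, ← push_boundary, hy, map_sub, add_sub_cancel,
    push_comp (torusInSolid 1 le_rfl), push_comp, ← ContinuousMap.comp_assoc,
    inSolid_comp_torusInSolid, glueMap, ContinuousMap.comp_assoc, ContinuousMap.comp_assoc, h2,
    ContinuousMap.comp_id, map_neg, push_comp, neg_add_cancel]

/-- Interior points of a piece are missed by the chains of all other pieces, and by the correction
chains, which lie on the gluing tori. -/
theorem trivialOn_surgeryChain {ζ : Chain 3 L.exterior} (hζ : ζ ∈ L.exteriorTri)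
    (y : Fin n → Chain 3 Torus) {σ : SingularSimplex 3 (L.Surgery a)} (hσ : σ ∈ L.pieces a)
    {t : Simplex 3} (ht : t ∈ simplexInterior 3) :
    TrivialOn {σ t} (L.surgeryChain a ζ y - Finsupp.single σ 1) := by
  rcases hσ with ⟨σ, hσ, rfl⟩ | ⟨i, σ, hσ, rfl⟩
  · have hx := L.not_mem_tube_of_mem_exteriorOrientation hσ ht
    have h0 : TrivialOn {σ t} (ζ - Finsupp.single σ 1) := hζ.2 σ hσ t ht
    have h1 := h0.push (f := L.inExterior a) (L := {L.inExterior a (σ t)})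
      fun x hx => L.inExterior_injective a hx
    have h2 : TrivialOn {L.inExterior a (σ t)} (∑ i, push (L.inSolid a i)
        (solidChain 1 one_pos + push (torusInSolid 1 le_rfl) (y i))) :=
      TrivialOn.sum fun i _ => (supportedIn_push (by
        rintro _ ⟨w, rfl⟩ h
        exact L.inExterior_ne_inSolid a hx i w h.symm) _).trivialOn
    have h3 := h1.add h2
    rwa [map_sub, push_single, sub_add_eq_add_sub] at h3
  · have hx := mem_openSolid_of_mem_solidTorusOrientation hσ ht
    set m := L.inSolid a i (σ t) with hm
    have h1 : TrivialOn {m} (push (L.inExterior a) ζ) := (supportedIn_push (by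
      rintro _ ⟨x, rfl⟩ h
      exact L.inExterior_ne_inSolid' a hx i x h) _).trivialOn
    have h2 : TrivialOn {m} (∑ j ∈ Finset.univ.erase i, push (L.inSolid a j)
        (solidChain 1 one_pos + push (torusInSolid 1 le_rfl) (y j))) :=
      TrivialOn.sum fun j hj => (supportedIn_push (by
        rintro _ ⟨w, rfl⟩ h
        exact (Finset.ne_of_mem_erase hj) ((L.inSolid_eq_inSolid_iff a).1 h).1) _).trivialOn
    have h3 : TrivialOn {m} (push (L.inSolid a i) (push (torusInSolid 1 le_rfl) (y i))) := by
      rw [push_comp]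
      refine (supportedIn_push ?_ _).trivialOn
      rintro _ ⟨t', rfl⟩ h
      exact L.inExterior_ne_inSolid' a hx i _ ((L.inExterior_glueMap a i t').trans h)
    have h4 := (trivialOn_solidChain le_rfl hσ ht hx).push (f := L.inSolid a i) (L := {m})
      fun x hx => L.inSolid_injective a i hx
    have h5 := (h1.add h2).add (h3.add h4)
    have h6 : L.surgeryChain a ζ y = push (L.inExterior a) ζ + (push (L.inSolid a i)
        (solidChain 1 one_pos + push (torusInSolid 1 le_rfl) (y i)) +
        ∑ j ∈ Finset.univ.erase i, push (L.inSolid a j)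
          (solidChain 1 one_pos + push (torusInSolid 1 le_rfl) (y j))) :=
      congrArg _ (Finset.add_sum_erase _ _ (Finset.mem_univ i)).symm
    change TrivialOn {m} _
    convert h5 using 1
    rw [h6, map_sub, push_single, map_add]
    abel

/-- A positive simplex of M may cross the gluing tori. Since the chain is a cycle, its local degree
can be tested at a nearby point interior to a piece. -/
theorem surgeryChain_mem {ζ : Chain 3 L.exterior} (hζ : ζ ∈ L.exteriorTri)
    (hb : boundary ζ = L.xiBoundary) {y : Fin n → Chain 3 Torus}
    (hy : ∀ i, boundary (y i) = push (torusMap (a i)⁻¹) xiSt - xiSt) :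
    L.surgeryChain a ζ y ∈ L.surgeryTri a := by
  have hc := L.boundary_surgeryChain a hb hy
  refine ⟨by rw [hc]; exact SupportedIn.zero _, fun σ hσ t ht => ?_⟩
  obtain ⟨K, hK, -, hKσ, hKc⟩ := IsRegularSimplex.exists_nhds (σ := σ) ⟨hσ.1.injective, hσ.2.1⟩ ht
    (L.hasChartAt_surgery a _) Filter.univ_mem (c := L.surgeryChain a ζ y)
    (by rw [hc]; exact SupportedIn.zero _)
  obtain ⟨τ, hτ, s, hs, hsK⟩ := L.exists_piece a hK
  refine hKc _ hsK ?_ _ (mem_of_mem_nhds hK)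
  obtain ⟨s', hs', h⟩ := hKσ hsK
  exact (L.trivialOn_surgeryChain a hζ y hτ hs).trans
    (TrivialOn.symm (hσ.2.2 τ hτ s' hs' s hs h))

end TubularLink

end SurgeryFormula

end

noncomputable section

namespace SurgeryFormula

open HasAffineSimplices

/-! ### The surgery formula -/

theorem inv_one_zero (b : Matrix.SpecialLinearGroup (Fin 2) ℤ) : b⁻¹ 1 0 = -b 1 0 := by
  rw [Matrix.SpecialLinearGroup.SL2_inv_expl]
  rfl

theorem inv_one_one (b : Matrix.SpecialLinearGroup (Fin 2) ℤ) : b⁻¹ 1 1 = b 0 0 := by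
  rw [Matrix.SpecialLinearGroup.SL2_inv_expl]
  rfl

theorem det_two (b : Matrix.SpecialLinearGroup (Fin 2) ℤ) :
    b 0 0 * b 1 1 - b 0 1 * b 1 0 = 1 := by
  rw [← Matrix.det_fin_two]
  exact b.2

/-! ### Well-definedness of F from independence of the chain -/

section WellDefined

variable {X : Type*} [TopologicalSpace X] {Γ : Type*} [Group Γ] {A : Type*} [AddCommGroup A]
variable {α : Γ → Γ → Γ → A} {T : Set (Chain 3 X)} {ρ : GroupoidRep X Γ} {ξ : Chain 2 X}

theorem F_eq (h : ∀ ζ ∈ T, ∀ ζ' ∈ T, boundary ζ = ξ → boundary ζ' = ξ →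
    evalHom ρ α ζ = evalHom ρ α ζ') {ζ : Chain 3 X} (hζ : ζ ∈ T) (hb : boundary ζ = ξ) :
    F α T ρ ξ = evalHom ρ α ζ := by
  have hex : ∃ ζ ∈ T, boundary ζ = ξ := ⟨ζ, hζ, hb⟩
  rw [F, dif_pos hex, evalChain_eq]
  exact h _ hex.choose_spec.1 _ hζ hex.choose_spec.2 hb

theorem fWellDefined_of_forall (h : ∀ ζ ∈ T, ∀ ζ' ∈ T, boundary ζ = ξ → boundary ζ' = ξ →
    evalHom ρ α ζ = evalHom ρ α ζ') (hex : ∃ ζ ∈ T, boundary ζ = ξ) : FWellDefined α T ρ ξ :=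
  ⟨hex, fun _ hζ hb => (F_eq h hζ hb).symm⟩

end WellDefined

namespace TubularLink

variable {n : ℕ} {L : TubularLink n} {a : Fin n → Matrix.SpecialLinearGroup (Fin 2) ℤ}
variable {Γ : Type*} [Group Γ] {A : Type*} [AddCommGroup A] {α : Γ → Γ → Γ → A}
variable (ρ : GroupoidRep (L.Surgery a) Γ)

/-- Seen from the solid torus, T²_i is parametrized through the inverse of a_i. The representation
there reads off the second coordinate, so the exponents are the second row (-q, p) of this inverse.
-/
theorem hasExponents_torus (i : Fin n) : HasExponents ((restrictExterior ρ).pull (L.torus i))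
    (coreVal one_pos (ρ.pull (L.inSolid a i))) (-a i 1 0) (a i 0 0) := by
  have h := (hasExponents_torusInSolid le_rfl (ρ.pull (L.inSolid a i))).pull (a i)⁻¹
  simp only [zero_mul, zero_add, one_mul, inv_one_zero, inv_one_one] at h
  intro v
  rw [← h v]
  have hc : ((L.inSolid a i).comp (torusInSolid 1 le_rfl)).comp (torusMap (a i)⁻¹) =
      (L.inExterior a).comp (L.torus i) := by
    ext1 t
    rw [inSolid_comp_torusInSolid]
    exact congrArg (fun t => L.inExterior a (L.torus i t)) (torusMap_apply_inv (a i) t)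
  change ρ.along (((L.inExterior a).comp (L.torus i)).comp torusCover) _ _ =
    ρ.along ((((L.inSolid a i).comp (torusInSolid 1 le_rfl)).comp (torusMap (a i)⁻¹)).comp
      torusCover) _ _
  rw [hc]

theorem rhoMeridian_eq (i : Fin n) :
    rhoMeridian ρ i = coreVal one_pos (ρ.pull (L.inSolid a i)) ^ (-a i 1 0) := by
  rw [rhoMeridian, ← GroupoidRep.val_pull, val_meridian, hasExponents_torus, mul_one, mul_zero,
    add_zero]

theorem rhoLongitude_eq (i : Fin n) :
    rhoLongitude ρ i = coreVal one_pos (ρ.pull (L.inSolid a i)) ^ a i 0 0 := by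
  rw [rhoLongitude, ← GroupoidRep.val_pull, val_longitude, hasExponents_torus, mul_one, mul_zero,
    zero_add]

theorem eq_coreVal {i : Fin n} {z : Γ} (hl : z ^ a i 0 0 = rhoLongitude ρ i)
    (hm : z ^ (-a i 1 0) = rhoMeridian ρ i) : z = coreVal one_pos (ρ.pull (L.inSolid a i)) :=
  eq_of_zpow_eq (det_two (a i)) (hl.trans (rhoLongitude_eq ρ i)) (hm.trans (rhoMeridian_eq ρ i))

/-- The fundamental chains of the solid tori contribute nothing. The correction chains, for the
exponents (0, 1) and the inverse of a_i, contribute ε(-q, p) - ε(0, 1), whose last term is zero. -/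
theorem evalHom_surgeryChain (hα' : IsStronglyNormalized α) (ζ : Chain 3 L.exterior)
    {y : Fin n → Chain 3 Torus} (hy : ∀ i, IsTransfer α (a i)⁻¹ (y i)) {f : Fin n → ℤ → ℤ → A}
    (hf : ∀ i, Trivializes α (coreVal one_pos (ρ.pull (L.inSolid a i))) (f i)) :
    evalHom ρ α (L.surgeryChain a ζ y) = evalHom (restrictExterior ρ) α ζ +
      ∑ i, antisymmetrize (f i) (-a i 1 0) (a i 0 0) := by
  rw [surgeryChain, map_add, map_sum, evalHom_push]
  refine congrArg _ (Finset.sum_congr rfl fun i _ => ?_)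
  rw [evalHom_push, map_add, evalHom_solidChain _ _ hα', evalHom_push,
    (hy i).2 _ _ _ _ (hasExponents_torusInSolid le_rfl _) _ (hf i),
    antisymmetrize_zero_one hα' (hf i)]
  simp only [zero_mul, zero_add, one_mul, inv_one_zero, inv_one_one, sub_zero]

end TubularLink

end SurgeryFormula

end

open SurgeryFormula SurgeryFormula.TubularLink
theorem mainTheorem1 {Γ : Type*} [Group Γ] {A : Type*} [AddCommGroup A]
    (α : Γ → Γ → Γ → A) (hα : IsThreeCocycle α) (hα' : IsStronglyNormalized α)
    {n : ℕ} (L : TubularLink n) (p q : Fin n → ℤ)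
    (a : Fin n → Matrix.SpecialLinearGroup (Fin 2) ℤ)
    (hp : ∀ i, a i 0 0 = p i) (hq : ∀ i, a i 1 0 = q i)
    (ρ : GroupoidRep (L.Surgery a) Γ) :
    FWellDefined α (L.surgeryTri a) ρ 0 ∧
    FWellDefined α L.exteriorTri (restrictExterior ρ) L.xiBoundary ∧
    (∀ z : Γ, ∃ f : ℤ → ℤ → A, Trivializes α z f) ∧
    (∀ i, ∃! z : Γ, z ^ p i = rhoLongitude ρ i ∧ z ^ (-q i) = rhoMeridian ρ i) ∧
    ∀ z : Fin n → Γ,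
      (∀ i, z i ^ p i = rhoLongitude ρ i ∧ z i ^ (-q i) = rhoMeridian ρ i) →
      ∀ f : Fin n → ℤ → ℤ → A, (∀ i, Trivializes α (z i) (f i)) →
        F α (L.surgeryTri a) ρ 0 =
          F α L.exteriorTri (restrictExterior ρ) L.xiBoundary +
            ∑ i, antisymmetrize (f i) (-q i) (p i) := by
  obtain rfl : (fun i => a i 0 0) = p := funext hp
  obtain rfl : (fun i => a i 1 0) = q := funext hq
  obtain ⟨ζ, hζ, hb⟩ := L.exists_exteriorTri
  choose y hy using fun i => exists_isTransfer (α := α) (a i)⁻¹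
  have hM := L.surgeryChain_mem a hζ hb fun i => (hy i).1
  have hb' := L.boundary_surgeryChain a hb fun i => (hy i).1
  have hu : ∀ ζ ∈ L.surgeryTri a, ∀ ζ' ∈ L.surgeryTri a, boundary ζ = 0 → boundary ζ' = 0 →
      evalHom ρ α ζ = evalHom ρ α ζ' := fun _ h _ h' _ _ => evalHom_eq_of_mem_surgeryTri ρ hα h h'
  have hu' : ∀ ζ ∈ L.exteriorTri, ∀ ζ' ∈ L.exteriorTri, boundary ζ = L.xiBoundary →
      boundary ζ' = L.xiBoundary →
      evalHom (restrictExterior ρ) α ζ = evalHom (restrictExterior ρ) α ζ' :=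
    fun _ h _ h' e e' => evalHom_eq_of_mem_exteriorTri ρ hα h h' (e.trans e'.symm)
  refine ⟨fWellDefined_of_forall hu ⟨_, hM, hb'⟩, fWellDefined_of_forall hu' ⟨ζ, hζ, hb⟩,
    exists_trivializes hα hα', fun i => ?_, fun z hz f hf => ?_⟩
  · exact ⟨_, ⟨(rhoLongitude_eq ρ i).symm, (rhoMeridian_eq ρ i).symm⟩,
      fun z hz => eq_coreVal ρ hz.1 hz.2⟩
  · rw [F_eq hu hM hb', F_eq hu' hζ hb]
    refine evalHom_surgeryChain ρ hα' ζ hy fun i => ?_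
    -- By uniqueness the prescribed `z i` is the core value, so any function trivializing the
    -- cocycle at `z i` may be used.
    rw [← eq_coreVal ρ (hz i).1 (hz i).2]
    exact hf i
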